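/- Let $b^+,b^-\ge 1$ be integers with $b^+b^->1$, and let $V=\mathbb{R}^{b^+,b^-}=V^+\oplus V^-$ with $Q(x)=\frac12\bigl(\sum_{j\le b^+}x_j^2-\sum_{j>b^+}x_j^2\bigr)$, $(x,y)=Q(x+y)-Q(x)-Q(y)$, and $\|w\|=|(w,w)|^{1/2}$ for $w\in V^\pm$. Let $L$ be an even lattice of signature $(b^+,b^-)$ with quadratic form $q$, dual lattice $L'$ and discriminant group $D_L=L'/L$; fix an isometry $v_0:(L_\mathbb{R},q)\to(V,Q)$ and write $v_0=v_0^++v_0^-$ according to $V=V^+\oplus V^-$. Put $\mathbf e(z)=e^{2\pi i z}$, let $\mathfrak e_\gamma$ $(\gamma\in D_L)$ be the standard basis of $\mathbb{C}[D_L]$, and let $\langle\sum a_\gamma\mathfrak e_\gamma,\sum b_\gamma\mathfrak e_\gamma\rangle_L=\sum_\gamma a_\gamma\overline{b_\gamma}$. Let $\mathrm{Mp}_2(\mathbb{Z})$ be the group of pairs $(M,\phi)$ with $M=\begin{pmatrix}a&b\\c&d\end{pmatrix}\in\mathrm{SL}_2(\mathbb{Z})$ and $\phi$ holomorphic on the upper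 half-plane $\mathbb{H}$ with $\phi(\tau)^2=c\tau+d$, with product $(A,\phi_1)(B,\phi_2)=(AB,\phi_1(B\tau)\phi_2(\tau))$, and let $\rho_L$ be its Weil representation on $\mathbb{C}[D_L]$, given on the generators $T=(\begin{pmatrix}1&1\\0&1\end{pmatrix},1)$ and $S=(\begin{pmatrix}0&-1\\1&0\end{pmatrix},\sqrt\tau)$ by $\rho_L(T)\mathfrak e_\gamma=\mathbf e(q(\gamma))\mathfrak e_\gamma$ and $\rho_L(S)\mathfrak e_\gamma=\frac{\mathbf e(-(b^+-b^-)/8)}{\sqrt{|D_L|}}\sum_\delta\mathbf e(-(\gamma,\delta))\mathfrak e_\delta$. Let $k\ge 0$ be an integer such that $\nu=k+\frac{b^+-b^-}{2}>2$. For $\beta\in D_L$ and $0<m\in q(\beta)+\mathbb{Z}$ let $$P_{m,\beta}(\tau)=\frac12\sum_{(M,\phi)\in\langle T\rangle\backslash\mathrm{Mp}_2(\mathbb{Z})}\phi(\tau)^{-2\nu}\,\mathbf e(mM\tau)\,\rho_L(M,\phi)^{-1}\mathfrak e_\beta .$$ Let $p$ be a complex polynomial on $V$ that is homogeneous of degree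 $k$ in the coordinates of $V^+$ and of degree $0$ in those of $V^-$. For $g\in\mathrm{O}(L_\mathbb{R})$ and $\tau=x+iy\in\mathbb{H}$ let $\Theta_L(\tau,g;p)=\sum_{\gamma\in D_L}\theta_{L+\gamma}(\tau,g;p)\,\mathfrak e_\gamma$ with $$\theta_{L+\gamma}(\tau,g;p)=y^{b^- /2}\sum_{\lambda\in L+\gamma}\Bigl[\exp\Bigl(-\frac{\Delta}{8\pi y}\Bigr)p\Bigr](v_0(g^{-1}\lambda))\;\mathbf e\bigl(\tau Q(v_0^+(g^{-1}\lambda))+\bar\tau Q(v_0^-(g^{-1}\lambda))\bigr),\qquad \Delta=\sum_{j=1}^{b^++b^-}\frac{\partial^2}{\partial x_j^2},$$ and let $$\vartheta_L(P_{m,\beta};p)(g)=\int_{\mathrm{SL}_2(\mathbb{Z})\backslash\mathbb{H}}\langle P_{m,\beta}(\tau),\Theta_L(\tau,g;p)\rangle_L\,y^{\nu}\,\frac{dx\,dy}{y^2}.$$ Finally let $Hp$ be the harmonic projection of $p$, $$Hp(x)=\sum_{j=0}^{[k/2]}\frac{(-1)^j\,\Gamma(\frac{b^+}{2}+k-j-1)}{4^j\,j!\,\Gamma(\frac{b^+}{2}+k-1)}\,\|x^+\|^{2j}\,\Delta_{b^+}^{j}p(x),\qquad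 \Delta_{b^+}=\sum_{j=1}^{b^+}\frac{\partial^2}{\partial x_j^2}.$$ Then the Poincaré series and the integral defining $\vartheta_L(P_{m,\beta};p)(g)$ converge absolutely, and $$\vartheta_L(P_{m,\beta};p)(g)=\frac{2\,\Gamma\bigl(k+\frac{b^+}{2}-1\bigr)}{(2\pi)^{k+\frac{b^+}{2}-1}}\sum_{\substack{\lambda\in L+\beta\\ q(\lambda)=m}}\frac{\overline{Hp\bigl(v_0^+(g^{-1}\lambda)\bigr)}}{\|v_0^+(g^{-1}\lambda)\|^{2k+b^+-2}}$$ whenever the sum on the right converges absolutely, which is always the case if $k>b^-$. (If $p$ has real coefficients, the complex conjugation can be omitted.) Moreover, without any convergence assumption on this sum, $$\vartheta_L(P_{m,\beta};p)(g)=\vartheta_L(P_{m,\beta};Hp)(g).$$ -/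

import Mathlib

open UpperHalfPlane MeasureTheory
open scoped MatrixGroups ComplexConjugate Manifold Modular

noncomputable section

namespace ThetaLift

/-- `e(z) = exp(2πiz)`. -/
def e (z : ℂ) : ℂ := Complex.exp (2 * Real.pi * Complex.I * z)

/-! ## The quadratic space of signature `(bp, bm)` and polynomials on it -/

/-- The real vector space `V = ℝ^{bp,bm}`; the first `bp` coordinates span `V⁺` and the last `bm`
coordinates span `V⁻`. -/
abbrev V (bp bm : ℕ) : Type := Fin bp ⊕ Fin bm → ℝ

/-- The quadratic form `Q(x) = (x, x) / 2` of signature `(bp, bm)` on `V`. -/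
def stdForm (bp bm : ℕ) : QuadraticForm ℝ (V bp bm) :=
  QuadraticMap.weightedSumSquares ℝ (Sum.elim (fun _ => (1 / 2 : ℝ)) (fun _ => (-1 / 2 : ℝ)))

variable {bp bm : ℕ}

/-- The component of `x` in `V⁺`. -/
def plusPart (x : V bp bm) : V bp bm := Sum.elim (fun i => x (Sum.inl i)) (fun _ => 0)

/-- The component of `x` in `V⁻`. -/
def minusPart (x : V bp bm) : V bp bm := Sum.elim (fun _ => 0) (fun j => x (Sum.inr j))

/-- `‖w‖ = |(w, w)|^{1/2}` for `w` in `V⁺` or in `V⁻`. -/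
def vnorm (w : V bp bm) : ℝ := Real.sqrt |2 * stdForm bp bm w|

/-- Complex polynomials on `V`. -/
abbrev Poly (bp bm : ℕ) : Type := MvPolynomial (Fin bp ⊕ Fin bm) ℂ

/-- The value of a polynomial at a point of `V`. -/
def evalAt (p : Poly bp bm) (x : V bp bm) : ℂ := MvPolynomial.eval (fun i => (x i : ℂ)) p

/-- The space `P^{r,s}(V)` of polynomials that are homogeneous of degree `r` in the first `bp`
variables and homogeneous of degree `s` in the last `bm` variables. -/
def bihomogeneous (bp bm r s : ℕ) : Submodule ℂ (Poly bp bm) :=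
  MvPolynomial.weightedHomogeneousSubmodule ℂ
    (Sum.elim (fun _ => ((1, 0) : ℕ × ℕ)) (fun _ => ((0, 1) : ℕ × ℕ))) (r, s)

/-- The Laplacian `∑_j ∂²/∂x_j²` over all `bp + bm` coordinates. -/
def laplacian (p : Poly bp bm) : Poly bp bm :=
  ∑ i, MvPolynomial.pderiv i (MvPolynomial.pderiv i p)

/-- The Laplacian over the first `bp` coordinates. -/
def laplacianPlus (p : Poly bp bm) : Poly bp bm :=
  ∑ i : Fin bp, MvPolynomial.pderiv (Sum.inl i) (MvPolynomial.pderiv (Sum.inl i) p)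

/-- `exp(t Δ) p = ∑_j t^j Δ^j p / j!`, a finite sum since `Δ` lowers the degree. -/
def expLaplacian (t : ℝ) (p : Poly bp bm) : Poly bp bm :=
  ∑ j ∈ Finset.range (p.totalDegree + 1),
    MvPolynomial.C ((t ^ j / j.factorial : ℝ) : ℂ) * laplacian^[j] p

/-- The polynomial `‖x⁺‖²`. -/
def normSqPlus (bp bm : ℕ) : Poly bp bm := ∑ i : Fin bp, MvPolynomial.X (Sum.inl i) ^ 2

/-- The harmonic projection in degree `k` with respect to the variables of `V⁺`:
`Hp = ∑_{0 ≤ j ≤ k/2} (-1)^j Γ(bp/2+k-j-1) / (4^j j! Γ(bp/2+k-1)) ‖x⁺‖^{2j} Δ⁺^j p`. -/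
def harmonicProj (k : ℕ) (p : Poly bp bm) : Poly bp bm :=
  ∑ j ∈ Finset.range (k / 2 + 1),
    MvPolynomial.C (((-1) ^ j * Real.Gamma (bp / 2 + k - j - 1) /
      (4 ^ j * j.factorial * Real.Gamma (bp / 2 + k - 1)) : ℝ) : ℂ) *
      normSqPlus bp bm ^ j * laplacianPlus^[j] p

/-! ## Even lattices and discriminant groups -/

section Lattice

variable {W : Type*} [AddCommGroup W] [Module ℝ W]

/-- `L` is an even lattice in the quadratic space `(W, q)`: the ℤ-span of an ℝ-basis of `W` on which
`q` takes integral values. Then `W = L ⊗ ℝ`. -/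
structure IsEvenLattice (q : QuadraticForm ℝ W) (L : AddSubgroup W) : Prop where
  exists_basis : ∃ (n : ℕ) (b : Module.Basis (Fin n) ℝ W), L = AddSubgroup.closure (Set.range b)
  even : ∀ x ∈ L, ∃ n : ℤ, q x = n

/-- The dual lattice `L'`, with respect to the bilinear form `(x, y) = q(x+y) - q(x) - q(y)`. -/
def dual (q : QuadraticForm ℝ W) (L : AddSubgroup W) : AddSubgroup W where
  carrier := {x | ∀ y ∈ L, ∃ n : ℤ, QuadraticMap.polar q x y = n}
  zero_mem' := fun y _ => ⟨0, by simp⟩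
  add_mem' := by
    intro a b ha hb y hy
    obtain ⟨m, hm⟩ := ha y hy
    obtain ⟨n, hn⟩ := hb y hy
    exact ⟨m + n, by rw [QuadraticMap.polar_add_left, hm, hn]; push_cast; rfl⟩
  neg_mem' := by
    intro a ha y hy
    obtain ⟨m, hm⟩ := ha y hy
    exact ⟨-m, by rw [QuadraticMap.polar_neg_left, hm]; push_cast; rfl⟩

/-- The discriminant group `D_L = L' / L`. -/
abbrev Discr (q : QuadraticForm ℝ W) (L : AddSubgroup W) : Type _ :=
  dual q L ⧸ L.addSubgroupOf (dual q L)

/-- The coset `L + γ` as a set of vectors of the dual lattice. -/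
abbrev Coset (q : QuadraticForm ℝ W) (L : AddSubgroup W) (γ : Discr q L) : Type _ :=
  {x : dual q L // (QuotientAddGroup.mk x : Discr q L) = γ}

/-- The vectors `x ∈ L + γ` with `q(x) = m`. -/
abbrev CosetOfNorm (q : QuadraticForm ℝ W) (L : AddSubgroup W) (γ : Discr q L) (m : ℝ) : Type _ :=
  {x : dual q L // (QuotientAddGroup.mk x : Discr q L) = γ ∧ q (x : W) = m}

/-- A representative of `γ ∈ L' / L` in `L'`. -/
def rep {q : QuadraticForm ℝ W} {L : AddSubgroup W} (γ : Discr q L) : W :=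
  ((Quotient.out γ : dual q L) : W)

/-- The group ring `ℂ[D_L]` as a vector space. -/
abbrev GroupRing (q : QuadraticForm ℝ W) (L : AddSubgroup W) : Type _ := Discr q L → ℂ

open Classical in
/-- The basis vector `𝔢_γ` of `ℂ[D_L]`. -/
def basisVec {q : QuadraticForm ℝ W} {L : AddSubgroup W} (γ : Discr q L) : GroupRing q L :=
  Pi.single γ 1

/-- The inner product `⟨a, b⟩_L = ∑_γ a_γ conj(b_γ)` (a sum over the finite group `D_L`). -/
def innerL {q : QuadraticForm ℝ W} {L : AddSubgroup W} (a b : GroupRing q L) : ℂ :=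
  ∑ᶠ γ : Discr q L, a γ * conj (b γ)

end Lattice

/-! ## The metaplectic group `Mp₂(ℤ)` -/

/-- `Mp₂(ℤ)`: pairs `(A, φ)` with `A = (a, b; c, d) ∈ SL₂(ℤ)` and `φ` holomorphic on the upper
half-plane with `φ(τ)² = cτ + d`. -/
@[ext]
structure Mp2Z where
  /-- the matrix -/
  mat : SL(2, ℤ)
  /-- the square root of the factor of automorphy -/
  phi : ℍ → ℂ
  holo : MDifferentiable 𝓘(ℂ) 𝓘(ℂ) phi
  sq : ∀ τ : ℍ, phi τ ^ 2 = (mat 1 0 : ℂ) * τ + (mat 1 1 : ℂ)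

namespace Mp2Z

lemma sq' (x : Mp2Z) (τ : ℍ) : x.phi τ ^ 2 = denom (x.mat : GL (Fin 2) ℝ) τ := by
  rw [x.sq]; simp [ModularGroup.denom_apply]

lemma phi_ne_zero (x : Mp2Z) (τ : ℍ) : x.phi τ ≠ 0 := by
  intro h
  have := x.sq' τ
  rw [h] at this
  exact denom_ne_zero (x.mat : GL (Fin 2) ℝ) τ (by rw [← this]; simp)

lemma cocycle (A B : SL(2, ℤ)) (τ : ℍ) :
    denom ((A * B : SL(2, ℤ)) : GL (Fin 2) ℝ) τ =
      denom (A : GL (Fin 2) ℝ) ((B • τ : ℍ) : ℂ) * denom (B : GL (Fin 2) ℝ) τ := by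
  have := denom_cocycle_σ (A : GL (Fin 2) ℝ) (B : GL (Fin 2) ℝ) τ
  simpa [σ] using this

lemma smul_holo (A : SL(2, ℤ)) : MDifferentiable 𝓘(ℂ) 𝓘(ℂ) (fun τ : ℍ => A • τ) :=
  mdifferentiable_smul (g := (A : GL (Fin 2) ℝ)) (by simp)

instance : One Mp2Z := ⟨⟨1, fun _ => 1, mdifferentiable_const, by intro τ; simp⟩⟩

/-- `(A, φ₁)(B, φ₂) = (AB, φ₁(Bτ) φ₂(τ))`. -/
instance : Mul Mp2Z := ⟨fun x y =>
  ⟨x.mat * y.mat, fun τ => x.phi (y.mat • τ) * y.phi τ,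
    (x.holo.comp (smul_holo y.mat)).mul y.holo, by
      intro τ
      rw [mul_pow, x.sq', y.sq', ← cocycle, ModularGroup.denom_apply]⟩⟩

instance : Inv Mp2Z := ⟨fun x =>
  ⟨x.mat⁻¹, fun τ => (x.phi (x.mat⁻¹ • τ))⁻¹, by
      have h : MDifferentiable 𝓘(ℂ) 𝓘(ℂ) (fun τ : ℍ => x.phi (x.mat⁻¹ • τ)) :=
        x.holo.comp (smul_holo _)
      rw [UpperHalfPlane.mdifferentiable_iff] at h ⊢
      exact h.inv (fun z _ => x.phi_ne_zero _), by
      intro τ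
      have h := cocycle x.mat x.mat⁻¹ τ
      rw [inv_pow, x.sq', inv_eq_of_mul_eq_one_right (b := denom ((x.mat⁻¹ : SL(2, ℤ)) :
        GL (Fin 2) ℝ) τ), ModularGroup.denom_apply]
      rw [← h]; simp [denom]⟩⟩

lemma mul_mat (x y : Mp2Z) : (x * y).mat = x.mat * y.mat := rfl

lemma mul_phi (x y : Mp2Z) (τ : ℍ) : (x * y).phi τ = x.phi (y.mat • τ) * y.phi τ := rfl

instance : Group Mp2Z where
  mul_assoc x y z := by
    ext1
    · exact mul_assoc _ _ _
    · funext τ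
      simp only [mul_phi, mul_mat, mul_smul, mul_assoc]
  one_mul x := by
    ext1
    · exact one_mul _
    · funext τ
      exact one_mul _
  mul_one x := by
    ext1
    · exact mul_one _
    · funext τ
      change x.phi ((1 : SL(2, ℤ)) • τ) * 1 = _
      rw [one_smul, mul_one]
  inv_mul_cancel x := by
    ext1
    · exact inv_mul_cancel _
    · funext τ
      change (x.phi (x.mat⁻¹ • x.mat • τ))⁻¹ * x.phi τ = 1
      rw [inv_smul_smul]
      exact inv_mul_cancel₀ (x.phi_ne_zero τ)

/-- `T = ((1, 1; 0, 1), 1)`. -/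
def T : Mp2Z := ⟨ModularGroup.T, fun _ => 1, mdifferentiable_const, by
  intro τ; simp [ModularGroup.T]⟩

/-- `S = ((0, -1; 1, 0), √τ)`, with the principal branch of the square root. -/
def S : Mp2Z := ⟨ModularGroup.S, fun τ => (τ : ℂ) ^ (1 / 2 : ℂ), by
    rw [UpperHalfPlane.mdifferentiable_iff]
    have h : DifferentiableOn ℂ (fun z : ℂ => z ^ (1 / 2 : ℂ)) {z | 0 < z.im} := fun z hz =>
      (DifferentiableAt.cpow_const differentiableAt_id
        (Or.inr (ne_of_gt hz))).differentiableWithinAt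
    refine h.congr fun z hz => ?_
    simp only [Function.comp_apply, ofComplex_apply_of_im_pos hz], by
    intro τ
    have h : ((τ : ℂ) ^ (1 / 2 : ℂ)) ^ 2 = (τ : ℂ) := by
      rw [← Complex.cpow_nat_mul]; norm_num
    rw [h]; simp [ModularGroup.S]⟩

end Mp2Z

/-! ## Weil representation, theta functions, Poincaré series and theta lifts -/

section Lift

variable {W : Type*} [AddCommGroup W] [Module ℝ W]

/-- `ρ` is the Weil representation of `Mp₂(ℤ)` on `ℂ[D_L]`, where `sig` is the signature of `L`: it
is given on the generators by
`ρ(T) 𝔢_γ = e(q(γ)) 𝔢_γ` and `ρ(S) 𝔢_γ = e(-sig/8) |D_L|^{-1/2} ∑_δ e(-(γ,δ)) 𝔢_δ`. -/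
def IsWeilRep (q : QuadraticForm ℝ W) (L : AddSubgroup W) (sig : ℤ)
    (ρ : Mp2Z →* (GroupRing q L ≃ₗ[ℂ] GroupRing q L)) : Prop :=
  (∀ γ : Discr q L, ρ Mp2Z.T (basisVec γ) = e (q (rep γ) : ℝ) • basisVec γ) ∧
  (∀ γ : Discr q L, ρ Mp2Z.S (basisVec γ) =
    (e (-(sig : ℂ) / 8) / (Real.sqrt (Nat.card (Discr q L)) : ℂ)) •
      fun δ : Discr q L => e (-(QuadraticMap.polar q (rep γ) (rep δ) : ℝ)))

open Classical in
/-- The Weil representation `ρ_L`: the homomorphism `Mp₂(ℤ) → Aut ℂ[D_L]` with the prescribed values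
on the generators `S` and `T`. (It exists for every even lattice of signature `sig`; it is unique
because `S` and `T` generate `Mp₂(ℤ)`.) -/
def weilRep (q : QuadraticForm ℝ W) (L : AddSubgroup W) (sig : ℤ) :
    Mp2Z →* (GroupRing q L ≃ₗ[ℂ] GroupRing q L) :=
  if h : ∃ ρ, IsWeilRep q L sig ρ then h.choose else 1

/-- The slash action of weight `w / 2`:
`(f | (M, φ))(τ) = φ(τ)^{-w} ρ_L(M, φ)⁻¹ f(Mτ)`. -/
def slash (q : QuadraticForm ℝ W) (L : AddSubgroup W) (sig w : ℤ) (f : ℍ → GroupRing q L)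
    (M : Mp2Z) (τ : ℍ) : GroupRing q L :=
  (M.phi τ) ^ (-w) • (weilRep q L sig M)⁻¹ (f (M.mat • τ))

/-- The coset space `⟨T⟩ \ Mp₂(ℤ)`. -/
abbrev CuspCosets : Type := Quotient (QuotientGroup.rightRel (Subgroup.zpowers Mp2Z.T))

/-- The summand of the Poincaré series at a coset: the function `𝔢_β(mτ) = e(mτ) 𝔢_β`, slashed with a
representative of the coset. -/
def poincareTerm (q : QuadraticForm ℝ W) (L : AddSubgroup W) (sig w : ℤ) (m : ℝ) (β : Discr q L)
    (τ : ℍ) (c : CuspCosets) : GroupRing q L :=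
  slash q L sig w (fun τ' => e (m * τ') • basisVec β) (Quotient.out c) τ

/-- The Poincaré series `P_{m,β}` of weight `w / 2`:
`P_{m,β} = (1/2) ∑_{(M, φ) ∈ ⟨T⟩ \ Mp₂(ℤ)} 𝔢_β(mτ) | (M, φ)`. -/
def poincare (q : QuadraticForm ℝ W) (L : AddSubgroup W) (sig w : ℤ) (m : ℝ) (β : Discr q L)
    (τ : ℍ) : GroupRing q L :=
  (1 / 2 : ℂ) • ∑' c : CuspCosets, poincareTerm q L sig w m β τ c

/-- The theta function `Θ_L(τ, g; p)`, whose component at `γ ∈ D_L` is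
`y^{bm/2} ∑_{λ ∈ L+γ} [exp(-Δ/(8πy)) p](v₀(g⁻¹λ)) e(τ Q(v₀⁺(g⁻¹λ)) + conj(τ) Q(v₀⁻(g⁻¹λ)))`. -/
def theta (q : QuadraticForm ℝ W) (v₀ : q.IsometryEquiv (stdForm bp bm)) (L : AddSubgroup W)
    (g : q.IsometryEquiv q) (p : Poly bp bm) (τ : ℍ) : GroupRing q L := fun γ =>
  ((τ.im ^ ((bm : ℝ) / 2) : ℝ) : ℂ) * ∑' x : Coset q L γ,
    evalAt (expLaplacian (-1 / (8 * Real.pi * τ.im)) p) (v₀ (g.symm (x.1 : W))) *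
      e ((τ : ℂ) * (stdForm bp bm (plusPart (v₀ (g.symm (x.1 : W)))) : ℝ) +
        conj (τ : ℂ) * (stdForm bp bm (minusPart (v₀ (g.symm (x.1 : W)))) : ℝ))

/-- The integrand `⟨f(τ), h(τ)⟩_L y^{w/2}` of the Petersson product in weight `w / 2`. -/
def peterssonIntegrand {q : QuadraticForm ℝ W} {L : AddSubgroup W} (w : ℤ)
    (f h : ℍ → GroupRing q L) (τ : ℍ) : ℂ :=
  innerL (f τ) (h τ) * ((τ.im ^ ((w : ℝ) / 2) : ℝ) : ℂ)

/-- The Petersson product `∫_{SL₂(ℤ)\ℍ} ⟨f, h⟩_L y^{w/2} dx dy / y²`, computed on the standard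
fundamental domain; the measure on `ℍ` is `dx dy / y²`. -/
def petersson {q : QuadraticForm ℝ W} {L : AddSubgroup W} (w : ℤ)
    (f h : ℍ → GroupRing q L) : ℂ :=
  ∫ τ in 𝒟, peterssonIntegrand w f h τ

/-- Twice the weight `ν = k + sig / 2`, an integer. -/
def twoWeight (bp bm k : ℕ) : ℤ := 2 * k + ((bp : ℤ) - bm)

/-- The theta lift `ϑ_L(f; p)(g) = (f, Θ_L(·, g; p))` of `f` of weight `k + (bp - bm) / 2`. -/
def thetaLift (k : ℕ) (q : QuadraticForm ℝ W) (v₀ : q.IsometryEquiv (stdForm bp bm))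
    (L : AddSubgroup W) (f : ℍ → GroupRing q L) (p : Poly bp bm) (g : q.IsometryEquiv q) : ℂ :=
  petersson (twoWeight bp bm k) f (theta q v₀ L g p)

/-- The summand `conj(P(v₀⁺(g⁻¹λ))) / ‖v₀⁺(g⁻¹λ)‖^{2k+bp-2}` at a vector `λ`. -/
def liftTerm (k : ℕ) (q : QuadraticForm ℝ W) (v₀ : q.IsometryEquiv (stdForm bp bm))
    (P : Poly bp bm) (g : q.IsometryEquiv q) (x : W) : ℂ :=
  conj (evalAt P (plusPart (v₀ (g.symm x)))) /
    (vnorm (plusPart (v₀ (g.symm x))) : ℂ) ^ (2 * (k : ℤ) + bp - 2)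

end Lift

end ThetaLift

end

/-!
The proof unfolds the integral against the Poincaré series. All theta functions are expressed through
an isometry `u` of `L ⊗ ℝ` with `ℝ^{bp,bm}`; for the lift this is `v₀ ∘ g⁻¹`.

*Modularity.* Poisson summation (`poisson_coset`) and the Fourier transforms of Hermite functions
(`fourier_hermite`, `fourierPi_thetaKernel`) give the inversion formula `thetaSeries_inversion`. The
Weil representation is constructed along with the transformation law of theta functions: the pairs
`(M, A)`, where `A` is a unitary operator that describes how theta functions transform under `M` and
how Heisenberg operators are conjugated, form a subgroup `weilGraph`. It contains a pair over each of
the generators `S` and `T`, and only one pair over the identity, so it is the graph of a representation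
(`exists_isWeilRep`), and theta functions transform under all of `Mp₂(ℤ)` (`thetaVec_smul`).

*Unfolding.* The Poincaré series converges because its terms are dominated by
`(1 + |c|)^{-2a} (1 + |d|)^{-2b}` with `a, b > 1 / 2` and `a + b = ν / 2` (`exists_majorant_bound`).
Almost every point of `ℍ` lies in the translates of `𝒟` by exactly four elements of `Mp₂(ℤ)`, whence
`integral_unfold`. The integral over a horizontal segment picks the vectors of norm `m` from the theta
series, and the remaining integrals over `y` are Gamma integrals. If the theta function has no constant
term it decays at the cusp and this argument is absolutely convergent (`petersson_poincare_eq`), which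
proves the formula for harmonic polynomials of positive degree (`petersson_of_harmonic`).

*Harmonic projection.* A polynomial differs from its harmonic projection by a multiple `‖x⁺‖² r`. The
theta function of `‖x⁺‖² r` is a multiple of the image of the theta function of `r` under the raising
operator (`raiseKernel_thetaK`), and such images are orthogonal to the Poincaré series, which is a
holomorphic cusp form, by Stokes' theorem on `𝒟` (`integral_fd_eq_zero`, `petersson_raise_eq_zero`).
Hence `petersson_harmonicProj`.

*Degree zero.* For `k = 0` the theta function has a constant term, and the unfolded double integral need
not converge absolutely. The image of `y² Θ(‖x⁻‖²)` under the raising operator has a constant term as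
well, and a multiple of it cancels that of `Θ(1)` without changing the Petersson product, so that the
general unfolding applies (`petersson_of_degree_zero`).

*Convergence for `k > bm`.* Since `|Hp(v)| ≤ C ‖v⁺‖^k`, it suffices to sum `‖v⁺‖^{-(k+bp-2)}`. This is a
sum of Gamma integrals, that is, the integral over the strip of `e(mτ) conj(Θ_β(τ; 1)) y^{(k+bp-bm)/2}`.
Folding the strip up to `𝒟` produces the majorant above times `y^s` with `s = (bm - k) / 2 + 2b`. For
`k > bm` the exponent `b > 1 / 2` can be chosen such that `s < 1`, and then `y^s` is integrable on `𝒟`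
(`integrableOn_strip_unfolded_one`).
-/

noncomputable section

namespace ThetaLift

/-! ### Poisson summation for rapidly decaying functions -/

/-- `f` decays faster than any power of the norm. -/
def RapidDecay {E : Type*} [NormedAddCommGroup E] (f : E → ℂ) : Prop :=
  ∀ N : ℕ, ∃ C : ℝ, ∀ x, ‖f x‖ ≤ C / (1 + ‖x‖) ^ N

lemma summable_int_vectors (ι : Type*) [Fintype ι] :
    ∃ N : ℕ, Summable fun m : ι → ℤ => 1 / (1 + ‖(fun i => (m i : ℝ))‖) ^ N := by
  classical
  let b := Pi.basisFun ℝ ι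
  let Λ : Submodule ℤ (ι → ℝ) := Submodule.span ℤ (Set.range b)
  refine ⟨Module.finrank ℤ Λ + 1, ?_⟩
  have h := ZLattice.summable_norm_pow_inv Λ (Module.finrank ℤ Λ + 1) (Nat.lt_succ_self _)
  let φ : (ι → ℤ) → Λ := fun m => ⟨fun i => (m i : ℝ), by
    have : (fun i => (m i : ℝ)) = ∑ i, m i • b i := by
      ext j
      simp [b, Finset.sum_apply, Pi.single_apply]
    rw [this]
    exact Submodule.sum_mem _ fun i _ => Submodule.smul_mem _ _ (Submodule.subset_span ⟨i, rfl⟩)⟩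
  have hφ : Function.Injective φ := by
    intro m m' hmm
    have := congrArg Subtype.val hmm
    funext i
    have := congrFun this i
    simpa [φ] using this
  refine Summable.of_norm_bounded_eventually (h.comp_injective hφ) ?_
  rw [Filter.eventually_cofinite]
  refine Set.Finite.subset (Set.finite_singleton 0) ?_
  intro m hm
  by_contra h0
  apply hm
  have h0 : m ≠ 0 := h0
  have hx : 0 < ‖(fun i => (m i : ℝ))‖ := by
    rw [norm_pos_iff]
    intro h
    apply h0
    funext i
    have := congrFun h i
    simpa using this
  have : ((fun z : Λ => ‖z‖⁻¹ ^ (Module.finrank ℤ Λ + 1)) ∘ φ) m =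
      1 / ‖(fun i => (m i : ℝ))‖ ^ (Module.finrank ℤ Λ + 1) := by
    simp [φ]
  rw [this, Real.norm_of_nonneg (by positivity)]
  gcongr
  linarith

lemma one_add_norm_le {E : Type*} [NormedAddCommGroup E] (x y : E) :
    1 + ‖y‖ ≤ (1 + ‖x‖) * (1 + ‖x + y‖) := by
  have : ‖y‖ ≤ ‖x + y‖ + ‖x‖ := by
    have := norm_sub_le (x + y) x
    simpa using this
  nlinarith [norm_nonneg x, norm_nonneg (x + y)]

section Poisson

variable {ι : Type*} [Fintype ι]

/-- The Fourier transform on `ℝ^ι` for the standard pairing. -/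
def fourierPi (f : (ι → ℝ) → ℂ) (ξ : ι → ℝ) : ℂ :=
  ∫ x, f x * e (-(∑ i, x i * ξ i : ℝ))

lemma norm_e_real (x : ℝ) : ‖e (x : ℂ)‖ = 1 := by
  rw [e, show (2 * Real.pi * Complex.I * x : ℂ) = ((2 * Real.pi * x : ℝ) : ℂ) * Complex.I by
    push_cast; ring, Complex.norm_exp_ofReal_mul_I]

lemma e_add (x y : ℂ) : e (x + y) = e x * e y := by
  rw [e, e, e, ← Complex.exp_add]; ring_nf

lemma e_zero : e 0 = 1 := by simp [e]

lemma e_int (n : ℤ) : e n = 1 := by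
  rw [e, Complex.exp_eq_one_iff]
  exact ⟨n, by ring⟩

lemma e_ne_zero (x : ℂ) : e x ≠ 0 := Complex.exp_ne_zero _

lemma continuous_e : Continuous e := by unfold e; fun_prop

lemma mFourier_coe (k : ι → ℤ) (x : ι → ℝ) :
    UnitAddTorus.mFourier k (fun i => (x i : UnitAddCircle)) = e (∑ i, x i * k i : ℝ) := by
  simp only [UnitAddTorus.mFourier, ContinuousMap.coe_mk, fourier_coe_apply]
  rw [← Complex.exp_sum, e]
  congr 1
  push_cast
  rw [Finset.mul_sum]
  refine Finset.sum_congr rfl fun i _ => ?_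
  simp
  ring

lemma RapidDecay.integrable {f : (ι → ℝ) → ℂ} (hf : RapidDecay f) (hc : Continuous f) :
    Integrable f := by
  obtain ⟨C, hC⟩ := hf (Fintype.card ι + 1)
  have h := integrable_one_add_norm (E := ι → ℝ) (μ := volume) (r := (Fintype.card ι + 1 : ℝ))
    (by simp)
  refine (h.const_mul C).mono' hc.aestronglyMeasurable (Filter.Eventually.of_forall fun x => ?_)
  refine (hC x).trans (le_of_eq ?_)
  rw [Real.rpow_neg (by positivity), div_eq_mul_inv]
  norm_cast

lemma rapidDecay_translates {f : (ι → ℝ) → ℂ} (hf : RapidDecay f) (R : ℝ) :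
    ∃ v : (ι → ℤ) → ℝ, Summable v ∧ ∀ m (x : ι → ℝ), ‖x‖ ≤ R →
      ‖f (x + fun i => (m i : ℝ))‖ ≤ v m := by
  obtain ⟨N, hN⟩ := summable_int_vectors ι
  obtain ⟨C, hC⟩ := hf N
  have hC0 : 0 ≤ C := by
    have := (norm_nonneg _).trans (hC 0)
    simpa using this
  refine ⟨_, hN.mul_left (C * (1 + R) ^ N), fun m x hx => (hC _).trans ?_⟩
  have h := one_add_norm_le x (fun i => (m i : ℝ))
  have hx0 := norm_nonneg x
  rw [mul_one_div, div_le_div_iff₀ (by positivity) (by positivity), mul_assoc]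
  refine mul_le_mul_of_nonneg_left ?_ hC0
  rw [← mul_pow]
  refine pow_le_pow_left₀ (by positivity) (h.trans ?_) N
  gcongr

/-- The Fourier coefficients of a periodization are values of the Fourier transform. -/
lemma integral_cube_tsum {f : (ι → ℝ) → ℂ} (hc : Continuous f) (hf : RapidDecay f) :
    ∫ x in {x : ι → ℝ | ∀ i, x i ∈ Set.Ioc (0 : ℝ) (0 + 1)},
      ∑' m : ι → ℤ, f (x + fun i => (m i : ℝ)) = ∫ x, f x := by
  set Q : Set (ι → ℝ) := {x : ι → ℝ | ∀ i, x i ∈ Set.Ioc (0 : ℝ) (0 + 1)} with hQ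
  have hQpi : Q = Set.univ.pi fun _ => Set.Ioc (0 : ℝ) (0 + 1) := by ext; simp [hQ]
  have hQm : MeasurableSet Q := by
    rw [hQpi]; exact MeasurableSet.univ_pi fun _ => measurableSet_Ioc
  have hQv : volume Q ≠ ⊤ := by
    rw [hQpi, Real.volume_pi_Ioc]; simp
  have hQb : ∀ x ∈ Q, ‖x‖ ≤ 1 := by
    intro x hx
    rw [pi_norm_le_iff_of_nonneg zero_le_one]
    intro i
    have := hx i
    rw [Real.norm_eq_abs, abs_le]
    constructor <;> linarith [this.1, this.2]
  obtain ⟨v, hv, hbd⟩ := rapidDecay_translates hf 1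
  let t : (ι → ℤ) → (ι → ℝ) := fun m i => (m i : ℝ)
  have hint : Integrable f := hf.integrable hc
  have h1 : HasSum (fun m : ι → ℤ => ∫ x in Q, f (x + t m))
      (∫ x in Q, ∑' m : ι → ℤ, f (x + t m)) := by
    refine hasSum_integral_of_summable_integral_norm (fun m => ?_) ?_
    · exact (hint.comp_add_right (t m)).integrableOn
    · refine Summable.of_nonneg_of_le (fun m => integral_nonneg fun x => norm_nonneg _)
        (fun m => ?_) (hv.mul_left (volume.real Q))
      have : ∫ x in Q, ‖f (x + t m)‖ ≤ ∫ x in Q, v m := by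
        refine setIntegral_mono_on (hint.comp_add_right (t m)).norm.integrableOn
          (integrableOn_const hQv) hQm fun x hx => hbd m x (hQb x hx)
      simpa using this
  have h2 : HasSum (fun m : ι → ℤ => ∫ x in ((fun x => x + (-t m)) ⁻¹' Q), f x)
      (∫ x in ⋃ m : ι → ℤ, (fun x => x + (-t m)) ⁻¹' Q, f x) := by
    refine hasSum_integral_iUnion (fun m => ?_) ?_ hint.integrableOn
    · exact (measurable_id.add_const _) hQm
    · intro m m' hmm
      rw [Function.onFun, Set.disjoint_left]
      intro x hx hx'
      apply hmm
      funext i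
      have a := hx i
      have b := hx' i
      simp only [Pi.add_apply, Pi.neg_apply, t, Set.mem_Ioc, zero_add] at a b
      have c1 : (m i : ℝ) < m' i + 1 := by linarith
      have c2 : (m' i : ℝ) < m i + 1 := by linarith
      have c1 : m i < m' i + 1 := by exact_mod_cast c1
      have c2 : m' i < m i + 1 := by exact_mod_cast c2
      omega
  have hU : (⋃ m : ι → ℤ, (fun x => x + (-t m)) ⁻¹' Q) = Set.univ := by
    rw [Set.eq_univ_iff_forall]
    intro x
    rw [Set.mem_iUnion]
    refine ⟨fun i => ⌈x i⌉ - 1, fun i => ?_⟩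
    simp only [Pi.add_apply, Pi.neg_apply, t, Set.mem_Ioc]
    push_cast
    constructor <;> linarith [Int.ceil_lt_add_one (x i), Int.le_ceil (x i)]
  rw [hU, Measure.restrict_univ] at h2
  have h3 : ∀ m : ι → ℤ, ∫ x in ((fun x => x + (-t m)) ⁻¹' Q), f x = ∫ x in Q, f (x + t m) := by
    intro m
    have := (measurePreserving_add_right (volume : Measure (ι → ℝ)) (-t m)).setIntegral_preimage_emb
      (measurableEmbedding_addRight _) (fun x => f (x + t m)) Q
    simpa using this
  simp_rw [h3] at h2
  exact h1.unique h2

/-- **Poisson summation** on `ℤ^ι`: the Fourier series of the periodization of `f`, evaluated at zero.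
-/
theorem poisson_summation {f : (ι → ℝ) → ℂ} (hc : Continuous f) (hf : RapidDecay f)
    (hs : Summable fun k : ι → ℤ => fourierPi f fun i => (k i : ℝ)) :
    ∑' m : ι → ℤ, f (fun i => (m i : ℝ)) = ∑' k : ι → ℤ, fourierPi f fun i => (k i : ℝ) := by
  classical
  let t : (ι → ℤ) → (ι → ℝ) := fun m i => (m i : ℝ)
  let P : (ι → ℝ) → ℂ := fun x => ∑' m : ι → ℤ, f (x + t m)
  have hPc : Continuous P := by
    rw [continuous_iff_continuousAt]
    intro x₀
    obtain ⟨v, hv, hbd⟩ := rapidDecay_translates hf (‖x₀‖ + 1)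
    have : ContinuousOn P (Metric.ball x₀ 1) := by
      refine continuousOn_tsum (fun m => ?_) hv fun m x hx => hbd m x ?_
      · fun_prop
      · have := norm_le_norm_add_norm_sub' x x₀
        rw [mem_ball_iff_norm] at hx
        linarith
    exact this.continuousAt (Metric.ball_mem_nhds _ one_pos)
  have hPper : ∀ (x : ι → ℝ) (m : ι → ℤ), P (x + t m) = P x := by
    intro x m
    simp only [P]
    rw [← (Equiv.addLeft m).tsum_eq (fun m' : ι → ℤ => f (x + t m'))]
    refine tsum_congr fun m' => ?_
    congr 1
    funext i
    simp [t]
    ring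
  -- the periodization descends to a continuous function on the torus
  let π : (ι → ℝ) → UnitAddTorus ι := fun x i => (x i : UnitAddCircle)
  have hπ : IsOpenQuotientMap π :=
    IsOpenQuotientMap.piMap fun _ => QuotientAddGroup.isOpenQuotientMap_mk
  let F₀ : UnitAddTorus ι → ℂ := fun y => P (Function.surjInv hπ.surjective y)
  have hF₀ : ∀ x, F₀ (π x) = P x := by
    intro x
    have h := Function.surjInv_eq hπ.surjective (π x)
    have h' : ∀ i, ∃ n : ℤ, Function.surjInv hπ.surjective (π x) i = x i + n := by
      intro i
      have hi : ((Function.surjInv hπ.surjective (π x) i : ℝ) : UnitAddCircle) = (x i : ℝ) :=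
        congrFun h i
      have hi := (QuotientAddGroup.eq_iff_sub_mem).1 hi
      obtain ⟨n, hn⟩ := AddSubgroup.mem_zmultiples_iff.1 hi
      refine ⟨n, ?_⟩
      have hn' : (n : ℝ) = Function.surjInv hπ.surjective (π x) i - x i := by simpa using hn
      linarith
    choose n hn using h'
    change P _ = _
    rw [← hPper x n]
    congr 1
    funext i
    exact hn i
  let F : C(UnitAddTorus ι, ℂ) := ⟨F₀, by
    rw [hπ.isQuotientMap.continuous_iff]
    have : F₀ ∘ π = P := funext hF₀
    rw [this]; exact hPc⟩
  have hcoef : ∀ k : ι → ℤ, UnitAddTorus.mFourierCoeff F k = fourierPi f (t k) := by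
    intro k
    rw [UnitAddTorus.mFourierCoeff_eq_integral F k 0]
    let g : (ι → ℝ) → ℂ := fun x => f x * e (-(∑ i, x i * (k i : ℝ) : ℝ))
    have hgc : Continuous g := hc.mul (continuous_e.comp (by fun_prop))
    have hg : RapidDecay g := by
      intro N
      obtain ⟨C, hC⟩ := hf N
      refine ⟨C, fun x => ?_⟩
      rw [norm_mul, ← Complex.ofReal_neg, norm_e_real, mul_one]
      exact hC x
    rw [fourierPi, ← integral_cube_tsum hgc hg]
    refine setIntegral_congr_fun ?_ fun x _ => ?_
    · have : {x : ι → ℝ | ∀ i, x i ∈ Set.Ioc ((0 : ι → ℝ) i) ((0 : ι → ℝ) i + 1)} =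
          Set.univ.pi fun i => Set.Ioc ((0 : ι → ℝ) i) ((0 : ι → ℝ) i + 1) := by ext; simp
      rw [this]; exact MeasurableSet.univ_pi fun _ => measurableSet_Ioc
    · change UnitAddTorus.mFourier (-k) (π x) • F₀ (π x) = _
      rw [hF₀, mFourier_coe, smul_eq_mul, ← tsum_mul_left]
      refine tsum_congr fun m => ?_
      rw [mul_comm]
      simp only [g]
      congr 1
      have : (-(∑ i, (x + fun i => (m i : ℝ)) i * (k i : ℝ) : ℝ) : ℂ) =
          (∑ i, x i * ((-k) i : ℝ) : ℝ) + ((-∑ i, m i * k i : ℤ) : ℂ) := by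
        push_cast
        simp only [Pi.add_apply, Pi.neg_apply]
        push_cast
        simp only [add_mul, Finset.sum_add_distrib, mul_neg, Finset.sum_neg_distrib]
        ring
      rw [this, e_add, e_int, mul_one]
  have hsF : Summable (UnitAddTorus.mFourierCoeff F) := by
    rw [show UnitAddTorus.mFourierCoeff F = fun k => fourierPi f (t k) from funext hcoef]
    exact hs
  have := (UnitAddTorus.hasSum_mFourier_series_apply_of_summable hsF (π 0)).tsum_eq
  have h0 : F (π 0) = ∑' m : ι → ℤ, f (t m) := by
    change F₀ (π 0) = _
    rw [hF₀]
    simp [P]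
  rw [h0] at this
  rw [← this]
  refine tsum_congr fun k => ?_
  rw [hcoef, mFourier_coe]
  simp [e_zero, t]

end Poisson

/-! ### Hermite functions in one variable -/

section Hermite

open Polynomial
open scoped FourierTransform

/-- The polynomial `exp(-t D²) X^k`, defined by its recursion. -/
def hermiteHeat (t : ℂ) : ℕ → Polynomial ℂ
  | 0 => 1
  | k + 1 => X * hermiteHeat t k - C (2 * t) * derivative (hermiteHeat t k)

/-- The function `P(x) e(τ x² / 2)` on the real line. -/
def polyGauss (τ : ℂ) (P : Polynomial ℂ) (x : ℝ) : ℂ :=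
  P.eval (x : ℂ) * Complex.exp (Real.pi * Complex.I * τ * (x : ℂ) ^ 2)

lemma norm_exp_gauss (τ : ℂ) (x : ℝ) :
    ‖Complex.exp (Real.pi * Complex.I * τ * (x : ℂ) ^ 2)‖ =
      Real.exp (-(Real.pi * τ.im) * x ^ 2) := by
  rw [Complex.norm_exp]
  congr 1
  have : (Real.pi * Complex.I * τ * (x : ℂ) ^ 2) = ((Real.pi * x ^ 2 : ℝ) : ℂ) * (Complex.I * τ) := by
    push_cast; ring
  rw [this, Complex.re_ofReal_mul]
  simp
  ring

lemma continuous_polyGauss (τ : ℂ) (P : Polynomial ℂ) : Continuous (polyGauss τ P) := by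
  unfold polyGauss
  exact (P.continuous.comp Complex.continuous_ofReal).mul (by fun_prop)

lemma integrable_polyGauss {τ : ℂ} (hτ : 0 < τ.im) (P : Polynomial ℂ) :
    Integrable (polyGauss τ P) := by
  induction P using Polynomial.induction_on' with
  | add P Q hP hQ =>
    refine (hP.add hQ).congr (Filter.Eventually.of_forall fun x => ?_)
    simp [polyGauss, add_mul]
  | monomial n a =>
    have h := integrable_rpow_mul_exp_neg_mul_sq (b := Real.pi * τ.im) (by positivity)
      (s := (n : ℝ)) (by have : (0 : ℝ) ≤ n := n.cast_nonneg
                         linarith)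
    refine (h.norm.const_mul ‖a‖).mono' (continuous_polyGauss _ _).aestronglyMeasurable
      (Filter.Eventually.of_forall fun x => le_of_eq ?_)
    rw [polyGauss, norm_mul, norm_exp_gauss]
    simp [Real.rpow_natCast, mul_assoc]

lemma hasDerivAt_polyGauss (τ : ℂ) (P : Polynomial ℂ) (x : ℝ) :
    HasDerivAt (polyGauss τ P)
      (polyGauss τ (derivative P + C (2 * Real.pi * Complex.I * τ) * (X * P)) x) x := by
  have h1 : HasDerivAt (fun x : ℝ => P.eval (x : ℂ)) ((derivative P).eval (x : ℂ)) x :=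
    (P.hasDerivAt (x : ℂ)).comp_ofReal
  have h2 : HasDerivAt (fun x : ℝ => Complex.exp (Real.pi * Complex.I * τ * (x : ℂ) ^ 2))
      (Complex.exp (Real.pi * Complex.I * τ * (x : ℂ) ^ 2) *
        (Real.pi * Complex.I * τ * (2 * x))) x := by
    have : HasDerivAt (fun z : ℂ => Complex.exp (Real.pi * Complex.I * τ * z ^ 2))
      (Complex.exp (Real.pi * Complex.I * τ * (x : ℂ) ^ 2) *
        (Real.pi * Complex.I * τ * (2 * x))) (x : ℂ) := by
      have := ((hasDerivAt_pow 2 (x : ℂ)).const_mul (Real.pi * Complex.I * τ)).cexp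
      simpa using this
    exact this.comp_ofReal
  refine (h1.mul h2).congr_deriv ?_
  simp [polyGauss]
  ring

lemma fourier_polyGauss_X_mul {τ : ℂ} (hτ : 0 < τ.im) (P : Polynomial ℂ) {d : ℂ} {ξ : ℝ}
    (h : HasDerivAt (𝓕 (polyGauss τ P)) d ξ) :
    𝓕 (polyGauss τ (X * P)) ξ = -1 / (2 * Real.pi * Complex.I) * d := by
  have hx : (fun x : ℝ => x • polyGauss τ P x) = polyGauss τ (X * P) := by
    funext x; simp [polyGauss, mul_assoc]
  have h1 := Real.hasDerivAt_fourier (integrable_polyGauss hτ P)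
    (by rw [hx]; exact integrable_polyGauss hτ _) ξ
  rw [h.unique h1]
  have h2 : (fun x : ℝ => (-2 * Real.pi * Complex.I * x : ℂ) • polyGauss τ P x) =
      (-2 * Real.pi * Complex.I : ℂ) • polyGauss τ (X * P) := by
    rw [← hx]; funext x; simp; ring
  rw [h2, Real.fourier_real_eq_integral_exp_smul, Real.fourier_real_eq_integral_exp_smul]
  simp only [Pi.smul_apply, smul_comm _ (-2 * Real.pi * Complex.I : ℂ)]
  rw [integral_smul, smul_eq_mul, ← mul_assoc]
  have hpi : (Real.pi : ℂ) ≠ 0 := by exact_mod_cast Real.pi_ne_zero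
  have : (-1 / (2 * Real.pi * Complex.I) * (-2 * Real.pi * Complex.I) : ℂ) = 1 := by
    have := Complex.I_ne_zero
    field_simp
  rw [this, one_mul]

/-- The square root of `τ / i` with positive real part, inverted. -/
def gaussFactor (τ : ℂ) : ℂ := 1 / (-Complex.I * τ) ^ (1 / 2 : ℂ)

/-- The Fourier transform of a Hermite function, by induction on the degree: multiplication by `x` and
the derivative are interchanged by the Fourier transform, and the recursion of `hermiteHeat` is
compatible with this exchange exactly when the heat parameter is `1 / (8π Im τ)`. -/
theorem fourier_hermite {τ : ℂ} (hτ : 0 < τ.im) (k : ℕ) :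
    𝓕 (polyGauss τ (hermiteHeat (1 / (8 * Real.pi * τ.im)) k)) =
      fun ξ => gaussFactor τ * (τ⁻¹) ^ k *
        polyGauss (-1 / τ) (hermiteHeat (1 / (8 * Real.pi * (-1 / τ).im)) k) ξ := by
  have hτ0 : τ ≠ 0 := by rintro rfl; simp at hτ
  have hpi : (Real.pi : ℂ) ≠ 0 := by exact_mod_cast Real.pi_ne_zero
  have hy : (τ.im : ℂ) ≠ 0 := by exact_mod_cast hτ.ne'
  have hc0 : conj τ ≠ 0 := by simpa using hτ0
  have him : ((-1 / τ).im : ℂ) = τ.im / (τ * conj τ) := by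
    rw [Complex.mul_conj, ← Complex.ofReal_div]
    congr 1
    rw [Complex.div_im]; simp [neg_div]
  have hyc : (τ.im : ℂ) = (τ - conj τ) / (2 * Complex.I) := by
    rw [Complex.sub_conj]; field_simp [Complex.I_ne_zero]
    push_cast; ring
  induction k with
  | zero =>
    have hb : 0 < (-Complex.I * τ).re := by simpa using hτ
    have h := fourier_gaussian_pi hb
    have e1 : (fun x : ℝ => Complex.exp (-Real.pi * (-Complex.I * τ) * (x : ℂ) ^ 2)) =
        polyGauss τ (hermiteHeat (1 / (8 * Real.pi * τ.im)) 0) := by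
      funext x; simp only [polyGauss, hermiteHeat, eval_one, one_mul]; ring_nf
    rw [e1] at h
    rw [h]
    funext ξ
    simp only [polyGauss, hermiteHeat, eval_one, one_mul, gaussFactor, pow_zero, mul_one]
    congr 2
    have : (-Real.pi / (-Complex.I * τ) : ℂ) = Real.pi * Complex.I * (-1 / τ) := by
      field_simp
      rw [Complex.I_sq]; ring
    rw [this]
  | succ k ih =>
    set t : ℂ := 1 / (8 * Real.pi * τ.im) with ht
    set t' : ℂ := 1 / (8 * Real.pi * (-1 / τ).im) with ht'
    set H := hermiteHeat t k with hH
    set H' := hermiteHeat t' k with hH'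
    funext ξ
    have hd : HasDerivAt (𝓕 (polyGauss τ H)) (gaussFactor τ * (τ⁻¹) ^ k *
        polyGauss (-1 / τ) (derivative H' + C (2 * Real.pi * Complex.I * (-1 / τ)) * (X * H')) ξ)
        ξ := by
      rw [ih]
      exact (hasDerivAt_polyGauss _ _ _).const_mul _
    have hX := fourier_polyGauss_X_mul hτ H hd
    have hderiv : deriv (polyGauss τ H) =
        polyGauss τ (derivative H + C (2 * Real.pi * Complex.I * τ) * (X * H)) :=
      funext fun x => (hasDerivAt_polyGauss τ H x).deriv
    have hF := Real.fourier_deriv (integrable_polyGauss hτ H)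
      (fun x => (hasDerivAt_polyGauss τ H x).differentiableAt)
      (by rw [hderiv]; exact integrable_polyGauss hτ _)
    have hF := congrFun hF ξ
    -- the recursion of `hermiteHeat`, in terms of operations with known Fourier transforms
    have hrec : polyGauss τ (hermiteHeat t (k + 1)) =
        (1 + 4 * Real.pi * Complex.I * τ * t) • polyGauss τ (X * H) +
          (-(2 * t)) • deriv (polyGauss τ H) := by
      rw [hderiv]
      funext x
      simp only [hermiteHeat, polyGauss, Pi.add_apply, Pi.smul_apply, eval_add, eval_sub, eval_mul,
        eval_C, eval_X, smul_eq_mul, hH]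
      ring
    have hlin : 𝓕 (polyGauss τ (hermiteHeat t (k + 1))) ξ =
        (1 + 4 * Real.pi * Complex.I * τ * t) * 𝓕 (polyGauss τ (X * H)) ξ +
          (-(2 * t)) * 𝓕 (deriv (polyGauss τ H)) ξ := by
      have i1 : Integrable (polyGauss τ (X * H)) := integrable_polyGauss hτ _
      have i2 : Integrable (deriv (polyGauss τ H)) := by
        rw [hderiv]; exact integrable_polyGauss hτ _
      rw [hrec, Real.fourier_real_eq_integral_exp_smul, Real.fourier_real_eq_integral_exp_smul,
        Real.fourier_real_eq_integral_exp_smul, ← integral_const_mul, ← integral_const_mul,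
        ← integral_add]
      · refine integral_congr_ae (Filter.Eventually.of_forall fun x => ?_)
        simp only [Pi.add_apply, Pi.smul_apply, smul_eq_mul]
        ring
      · refine Integrable.const_mul ?_ _
        refine (i1.norm.mono' (by
          have := continuous_polyGauss τ (X * H)
          exact Continuous.aestronglyMeasurable (by fun_prop)) ?_)
        refine Filter.Eventually.of_forall fun x => ?_
        rw [norm_smul, Complex.norm_exp_ofReal_mul_I, one_mul]
      · refine Integrable.const_mul ?_ _
        refine (i2.norm.mono' (by
          have := continuous_polyGauss τ (derivative H + C (2 * Real.pi * Complex.I * τ) * (X * H))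
          rw [hderiv]
          exact Continuous.aestronglyMeasurable (by fun_prop)) ?_)
        refine Filter.Eventually.of_forall fun x => ?_
        rw [norm_smul, Complex.norm_exp_ofReal_mul_I, one_mul]
    rw [hlin, hX, hF, ih]
    simp only [hermiteHeat, polyGauss, eval_add, eval_sub, eval_mul, eval_C, eval_X, smul_eq_mul,
      pow_succ τ⁻¹ k, ← hH']
    have k1 : -1 / (2 * Real.pi * Complex.I) * (1 + 4 * Real.pi * Complex.I * τ * t) =
        -(2 * t') * τ⁻¹ := by
      rw [ht, ht', him, hyc]
      have := Complex.I_ne_zero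
      have h2 : τ - conj τ ≠ 0 := by
        intro h; rw [h] at hyc; simp at hyc; exact hτ.ne' hyc
      field_simp
      ring_nf
      rw [Complex.I_sq]; ring
    have k2 : -1 / (2 * Real.pi * Complex.I) * (1 + 4 * Real.pi * Complex.I * τ * t) *
        (2 * Real.pi * Complex.I * (-1 / τ)) - 2 * t * (2 * Real.pi * Complex.I) = τ⁻¹ := by
      rw [ht, hyc]
      have := Complex.I_ne_zero
      have h2 : τ - conj τ ≠ 0 := by
        intro h; rw [h] at hyc; simp at hyc; exact hτ.ne' hyc
      field_simp
      ring_nf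
    generalize Complex.exp (Real.pi * Complex.I * (-1 / τ) * (ξ : ℂ) ^ 2) = G
    linear_combination (gaussFactor τ * τ⁻¹ ^ k * eval (ξ : ℂ) (derivative H') * G) * k1 +
      (gaussFactor τ * τ⁻¹ ^ k * eval (ξ : ℂ) H' * ξ * G) * k2

end Hermite

/-! ### The heat operator on polynomials -/

section Heat

open MvPolynomial

variable {bp bm : ℕ}

/-- The Laplacian as a linear map. -/
def laplacianLin (bp bm : ℕ) : Poly bp bm →ₗ[ℂ] Poly bp bm :=
  ∑ i, (pderiv i).toLinearMap ∘ₗ (pderiv i).toLinearMap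

lemma laplacianLin_apply (p : Poly bp bm) : laplacianLin bp bm p = laplacian p := by
  simp [laplacianLin, laplacian, LinearMap.sum_apply]

lemma laplacian_iterate (j : ℕ) (p : Poly bp bm) :
    laplacian^[j] p = ((laplacianLin bp bm) ^ j) p := by
  induction j with
  | zero => rfl
  | succ j ih =>
    rw [Function.iterate_succ_apply', ih, pow_succ', Module.End.mul_apply, laplacianLin_apply]

lemma pderiv_comm (i j : Fin bp ⊕ Fin bm) (p : Poly bp bm) :
    pderiv i (pderiv j p) = pderiv j (pderiv i p) := by
  have : ⁅(pderiv i : Derivation ℂ (Poly bp bm) (Poly bp bm)),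
      (pderiv j : Derivation ℂ (Poly bp bm) (Poly bp bm))⁆ = 0 := by
    apply MvPolynomial.derivation_ext
    intro k
    rw [Derivation.commutator_apply]
    simp only [pderiv_X, Pi.single_apply]
    split_ifs <;> simp
  have h := congrArg (fun D => D p) this
  simp only [Derivation.commutator_apply, Derivation.coe_zero, Pi.zero_apply] at h
  exact sub_eq_zero.mp h

lemma pderiv_laplacianLin (i : Fin bp ⊕ Fin bm) (p : Poly bp bm) :
    pderiv i (laplacianLin bp bm p) = laplacianLin bp bm (pderiv i p) := by
  simp only [laplacianLin_apply, laplacian, map_sum]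
  refine Finset.sum_congr rfl fun j _ => ?_
  rw [pderiv_comm i j, pderiv_comm i j]

lemma laplacianLin_X_mul (i : Fin bp ⊕ Fin bm) (p : Poly bp bm) :
    laplacianLin bp bm (X i * p) = X i * laplacianLin bp bm p + 2 * pderiv i p := by
  simp only [laplacianLin_apply, laplacian, Finset.mul_sum]
  have : ∀ j, pderiv j (pderiv j (X i * p)) =
      X i * pderiv j (pderiv j p) + (if j = i then 2 * pderiv i p else 0) := by
    intro j
    rw [pderiv_mul, map_add, pderiv_mul, pderiv_mul, pderiv_X]
    by_cases h : j = i
    · subst h; simp; ring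
    · simp [h]
  rw [Finset.sum_congr rfl fun j _ => this j, Finset.sum_add_distrib]
  simp

lemma laplacianLin_pow_X_mul (i : Fin bp ⊕ Fin bm) (j : ℕ) (p : Poly bp bm) :
    (laplacianLin bp bm ^ (j + 1)) (X i * p) = X i * (laplacianLin bp bm ^ (j + 1)) p +
      C (2 * (j + 1) : ℂ) * pderiv i ((laplacianLin bp bm ^ j) p) := by
  induction j with
  | zero =>
    have : (C 2 : Poly bp bm) = 2 := map_ofNat C 2
    simp [laplacianLin_X_mul, this]
  | succ j ih =>
    rw [pow_succ' _ (j + 1), Module.End.mul_apply, ih, map_add, laplacianLin_X_mul]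
    rw [show C (2 * (j + 1) : ℂ) * pderiv i ((laplacianLin bp bm ^ j) p) =
      (2 * (j + 1) : ℂ) • pderiv i ((laplacianLin bp bm ^ j) p) by rw [MvPolynomial.C_mul'],
      map_smul, ← pderiv_laplacianLin, ← Module.End.mul_apply, ← Module.End.mul_apply, ← pow_succ',
      ← pow_succ', MvPolynomial.smul_eq_C_mul]
    push_cast
    simp only [map_add, map_mul, map_one, map_ofNat]
    ring

lemma totalDegree_pderiv_lt {i : Fin bp ⊕ Fin bm} {p : Poly bp bm} {d : ℕ}
    (h : p.totalDegree ≤ d + 1) : (pderiv i p).totalDegree ≤ d := by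
  rw [p.as_sum, map_sum]
  refine totalDegree_finsetSum_le fun s hs => ?_
  rw [pderiv_monomial]
  by_cases hsi : s i = 0
  · simp [hsi]
  refine (totalDegree_monomial_le _ _).trans ?_
  have h1 := (le_totalDegree hs).trans h
  have h2 : (s - Finsupp.single i 1).sum (fun _ e => e) + 1 = s.sum fun _ e => e := by
    have : s = (s - Finsupp.single i 1) + Finsupp.single i 1 := by
      ext j; by_cases hj : i = j
      · subst hj; simp; omega
      · simp [hj]
    conv_rhs => rw [this, Finsupp.sum_add_index' (fun _ => rfl) (fun _ _ _ => rfl)]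
    simp
  have h3 : ((s - Finsupp.single i 1).sum fun _ => id) =
      (s - Finsupp.single i 1).sum (fun _ e => e) := rfl
  omega

lemma pderiv_eq_zero_of_totalDegree {i : Fin bp ⊕ Fin bm} {p : Poly bp bm}
    (h : p.totalDegree = 0) : pderiv i p = 0 := by
  rw [totalDegree_eq_zero_iff_eq_C.mp h, pderiv_C]

lemma laplacianLin_pow_eq_zero {j : ℕ} : ∀ {p : Poly bp bm}, p.totalDegree < j →
    (laplacianLin bp bm ^ j) p = 0 := by
  induction j with
  | zero => intro p h; omega
  | succ j ih =>
    intro p h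
    rw [pow_succ, Module.End.mul_apply]
    by_cases h0 : p.totalDegree = 0
    · rw [laplacianLin_apply, laplacian]
      simp [pderiv_eq_zero_of_totalDegree h0]
    · refine ih ?_
      rw [laplacianLin_apply, laplacian]
      have h1 : ∀ i, (pderiv i (pderiv i p)).totalDegree ≤ p.totalDegree - 1 := by
        intro i
        have h2 : (pderiv i p).totalDegree ≤ p.totalDegree - 1 :=
          totalDegree_pderiv_lt (by omega)
        exact totalDegree_pderiv_lt (by omega)
      have := totalDegree_finsetSum_le (s := Finset.univ)
        (f := fun i => pderiv i (pderiv i p)) (fun i _ => h1 i)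
      omega

/-- The truncated exponential series of `t Δ`. -/
def heatTrunc (t : ℂ) (N : ℕ) (p : Poly bp bm) : Poly bp bm :=
  ∑ j ∈ Finset.range N, (t ^ j / j.factorial : ℂ) • (laplacianLin bp bm ^ j) p

lemma heatTrunc_eq {t : ℂ} {N M : ℕ} {p : Poly bp bm} (hN : p.totalDegree < N)
    (hNM : N ≤ M) : heatTrunc t M p = heatTrunc t N p := by
  refine (Finset.sum_subset (by simpa using hNM) fun j _ hj => ?_).symm
  rw [laplacianLin_pow_eq_zero, smul_zero]
  simp at hj
  omega

lemma expLaplacian_eq {t : ℝ} {N : ℕ} {p : Poly bp bm} (hN : p.totalDegree < N) :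
    expLaplacian t p = heatTrunc t N p := by
  rw [heatTrunc_eq (Nat.lt_succ_self _) hN, expLaplacian, heatTrunc]
  refine Finset.sum_congr rfl fun j _ => ?_
  rw [laplacian_iterate, MvPolynomial.smul_eq_C_mul]
  push_cast
  rfl

lemma expLaplacian_add (t : ℝ) (p r : Poly bp bm) :
    expLaplacian t (p + r) = expLaplacian t p + expLaplacian t r := by
  set N := p.totalDegree + r.totalDegree + (p + r).totalDegree + 1 with hN
  rw [expLaplacian_eq (N := N) (by omega), expLaplacian_eq (N := N) (by omega),
    expLaplacian_eq (N := N) (by omega)]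
  simp [heatTrunc, smul_add, Finset.sum_add_distrib]

lemma expLaplacian_smul (t : ℝ) (a : ℂ) (p : Poly bp bm) :
    expLaplacian t (a • p) = a • expLaplacian t p := by
  set N := p.totalDegree + (a • p).totalDegree + 1 with hN
  rw [expLaplacian_eq (N := N) (by omega), expLaplacian_eq (N := N) (by omega)]
  simp [heatTrunc, Finset.smul_sum, smul_comm a]

lemma expLaplacian_zero (t : ℝ) : expLaplacian t (0 : Poly bp bm) = 0 := by
  simpa using expLaplacian_smul t 0 (0 : Poly bp bm)

lemma expLaplacian_sum (t : ℝ) {κ : Type*} (s : Finset κ) (f : κ → Poly bp bm) :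
    expLaplacian t (∑ i ∈ s, f i) = ∑ i ∈ s, expLaplacian t (f i) := by
  classical
  induction s using Finset.induction_on with
  | empty => simp [expLaplacian_zero]
  | insert a s ha ih => rw [Finset.sum_insert ha, Finset.sum_insert ha, expLaplacian_add, ih]

/-- Conjugating multiplication by a coordinate with the heat operator adds a derivative. -/
lemma expLaplacian_X_mul (t : ℝ) (i : Fin bp ⊕ Fin bm) (p : Poly bp bm) :
    expLaplacian t (X i * p) =
      X i * expLaplacian t p + (2 * t : ℂ) • pderiv i (expLaplacian t p) := by
  set N := p.totalDegree + (X i * p).totalDegree + 1 with hN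
  rw [expLaplacian_eq (p := X i * p) (N := N + 1) (by omega)]
  have e1 : expLaplacian t p = heatTrunc t (N + 1) p := expLaplacian_eq (by omega)
  have e2 : pderiv i (expLaplacian t p) = pderiv i (heatTrunc t N p) := by
    rw [expLaplacian_eq (N := N) (by omega)]
  rw [e2, e1]
  clear_value N
  rw [heatTrunc, heatTrunc, Finset.sum_range_succ', Finset.sum_range_succ', heatTrunc, mul_add,
    Finset.mul_sum, map_sum, Finset.smul_sum, add_right_comm, ← Finset.sum_add_distrib]
  congr 1
  · refine Finset.sum_congr rfl fun j _ => ?_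
    rw [laplacianLin_pow_X_mul, smul_add, mul_smul_comm, Derivation.map_smul, smul_smul,
      ← MvPolynomial.smul_eq_C_mul, smul_smul]
    congr 2
    rw [Nat.factorial_succ, pow_succ]
    push_cast
    have h1 : (j.factorial : ℂ) ≠ 0 := by exact_mod_cast j.factorial_ne_zero
    have h2 : (j + 1 : ℂ) ≠ 0 := by exact_mod_cast j.succ_ne_zero
    field_simp
  · simp

/-- On a monomial the heat operator is a product of one-variable heat operators. -/
lemma expLaplacian_monomial (t : ℝ) (s : Fin bp ⊕ Fin bm →₀ ℕ) :
    expLaplacian t (monomial s (1 : ℂ)) =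
      ∏ i, Polynomial.aeval (X i : Poly bp bm) (hermiteHeat (-t) (s i)) := by
  classical
  induction' hn : s.degree with n ih generalizing s
  · have : s = 0 := (Finsupp.degree_eq_zero_iff s).mp hn
    subst this
    simp only [Finsupp.coe_zero, Pi.zero_apply, hermiteHeat, map_one, Finset.prod_const_one]
    change expLaplacian t (1 : Poly bp bm) = 1
    rw [expLaplacian_eq (N := 1) (by simp)]
    simp [heatTrunc]
  · obtain ⟨i, hi⟩ : ∃ i, s i ≠ 0 := by
      by_contra h
      push Not at h
      have : s = 0 := by ext j; simpa using h j
      subst this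
      simp at hn
    set s' := s - Finsupp.single i 1 with hs'
    have hss : s = s' + Finsupp.single i 1 := by
      ext j; by_cases hj : i = j
      · subst hj; simp [hs']; omega
      · simp [hs', hj]
    have hdeg : s'.degree = n := by
      rw [hss, map_add, Finsupp.degree_single] at hn
      omega
    have hX : (monomial s (1 : ℂ) : Poly bp bm) = X i * monomial s' 1 := by
      rw [hss, X, monomial_mul, add_comm, mul_one]
    rw [hX, expLaplacian_X_mul, ih s' hdeg]
    set h := fun j => Polynomial.aeval (X j : Poly bp bm) (hermiteHeat (-t) (s' j)) with hh
    rw [← Finset.mul_prod_erase Finset.univ h (Finset.mem_univ i),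
      ← Finset.mul_prod_erase Finset.univ _ (Finset.mem_univ i)]
    have hR : ∏ j ∈ Finset.univ.erase i, Polynomial.aeval (X j : Poly bp bm)
        (hermiteHeat (-t) (s j)) = ∏ j ∈ Finset.univ.erase i, h j := by
      refine Finset.prod_congr rfl fun j hj => ?_
      have : j ≠ i := (Finset.mem_erase.mp hj).1
      have : s j = s' j := by rw [hss]; simp [this.symm]
      rw [this]
    have hsi : s i = s' i + 1 := by rw [hss]; simp
    have hd : pderiv i (∏ j ∈ Finset.univ.erase i, h j) = 0 := by
      refine Finset.prod_induction _ (fun q => pderiv i q = 0) (fun a b ha hb => ?_) ?_ ?_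
      · rw [pderiv_mul, ha, hb]; simp
      · simp
      · intro j hj
        have : j ≠ i := (Finset.mem_erase.mp hj).1
        rw [hh, Derivation.map_aeval, pderiv_X_of_ne this, smul_zero]
    rw [hR, pderiv_mul, hd, hsi, hermiteHeat]
    have hdi : pderiv i (h i) =
        Polynomial.aeval (X i : Poly bp bm) (Polynomial.derivative (hermiteHeat (-t) (s' i))) := by
      rw [hh, Derivation.map_aeval, pderiv_X_self, smul_eq_mul, mul_one]
    rw [hdi]
    simp only [hh, map_sub, map_mul, Polynomial.aeval_X, Polynomial.aeval_C,
      MvPolynomial.smul_eq_C_mul, MvPolynomial.algebraMap_eq, map_neg, mul_neg]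
    ring

end Heat

/-! ### Polynomial times Gaussian on the quadratic space -/

section Kernel

variable {bp bm : ℕ}

/-- The sum of the squares of the coordinates of `V⁺`. -/
def sqPlus (x : V bp bm) : ℝ := ∑ i, x (Sum.inl i) ^ 2

/-- The sum of the squares of the coordinates of `V⁻`. -/
def sqMinus (x : V bp bm) : ℝ := ∑ j, x (Sum.inr j) ^ 2

lemma sqPlus_nonneg (x : V bp bm) : 0 ≤ sqPlus x := Finset.sum_nonneg fun _ _ => sq_nonneg _

lemma sqMinus_nonneg (x : V bp bm) : 0 ≤ sqMinus x := Finset.sum_nonneg fun _ _ => sq_nonneg _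

lemma stdForm_eq (x : V bp bm) : stdForm bp bm x = (sqPlus x - sqMinus x) / 2 := by
  rw [stdForm, QuadraticMap.weightedSumSquares_apply, Fintype.sum_sum_type]
  simp only [Sum.elim_inl, Sum.elim_inr, smul_eq_mul, ← Finset.mul_sum, sqPlus, sqMinus, ← sq]
  ring

lemma stdForm_plusPart (x : V bp bm) : stdForm bp bm (plusPart x) = sqPlus x / 2 := by
  rw [stdForm_eq]; simp [sqPlus, sqMinus, plusPart]

lemma stdForm_minusPart (x : V bp bm) : stdForm bp bm (minusPart x) = -sqMinus x / 2 := by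
  rw [stdForm_eq]; simp [sqPlus, sqMinus, minusPart]

lemma vnorm_plusPart (x : V bp bm) : vnorm (plusPart x) = Real.sqrt (sqPlus x) := by
  rw [vnorm, stdForm_plusPart, mul_div_cancel₀ _ two_ne_zero, abs_of_nonneg (sqPlus_nonneg x)]

lemma norm_sq_le (x : V bp bm) : ‖x‖ ^ 2 ≤ sqPlus x + sqMinus x := by
  have h : ∀ i, x i ^ 2 ≤ sqPlus x + sqMinus x := by
    rintro (i | j)
    · have := Finset.single_le_sum (f := fun i => x (Sum.inl i) ^ 2) (fun _ _ => sq_nonneg _)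
        (Finset.mem_univ i)
      have h2 := sqMinus_nonneg x
      simp only [sqPlus] at *
      linarith
    · have := Finset.single_le_sum (f := fun i => x (Sum.inr i) ^ 2) (fun _ _ => sq_nonneg _)
        (Finset.mem_univ j)
      have h2 := sqPlus_nonneg x
      simp only [sqMinus] at *
      linarith
  have h0 : 0 ≤ sqPlus x + sqMinus x := add_nonneg (sqPlus_nonneg x) (sqMinus_nonneg x)
  have : ‖x‖ ≤ Real.sqrt (sqPlus x + sqMinus x) := by
    rw [pi_norm_le_iff_of_nonneg (Real.sqrt_nonneg _)]
    intro i
    rw [Real.norm_eq_abs]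
    exact Real.abs_le_sqrt (h i)
  calc ‖x‖ ^ 2 ≤ Real.sqrt (sqPlus x + sqMinus x) ^ 2 := by gcongr
    _ = _ := Real.sq_sqrt h0

/-- The Gaussian `e(τ Q(x⁺) + conj(τ) Q(x⁻))`. -/
def gaussV (z : ℂ) (x : V bp bm) : ℂ :=
  e (z * (stdForm bp bm (plusPart x) : ℝ) + conj z * (stdForm bp bm (minusPart x) : ℝ))

lemma norm_gaussV (z : ℂ) (x : V bp bm) :
    ‖gaussV z x‖ = Real.exp (-(Real.pi * z.im) * (sqPlus x + sqMinus x)) := by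
  rw [gaussV, e, Complex.norm_exp, stdForm_plusPart, stdForm_minusPart]
  congr 1
  have : (2 * Real.pi * Complex.I * (z * ((sqPlus x / 2 : ℝ) : ℂ) +
      conj z * ((-sqMinus x / 2 : ℝ) : ℂ)) : ℂ) =
      ((2 * Real.pi * (sqPlus x / 2) : ℝ) : ℂ) * (Complex.I * z) +
        ((2 * Real.pi * (-sqMinus x / 2) : ℝ) : ℂ) * (Complex.I * conj z) := by
    push_cast; ring
  rw [this, Complex.add_re, Complex.re_ofReal_mul, Complex.re_ofReal_mul]
  simp
  ring

lemma continuous_gaussV (z : ℂ) : Continuous (gaussV z : V bp bm → ℂ) := by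
  unfold gaussV
  refine continuous_e.comp ?_
  simp only [stdForm_plusPart, stdForm_minusPart, sqPlus, sqMinus]
  fun_prop

/-- Functions bounded by a power of `1 + ‖x‖`. -/
def PolyGrowth {E : Type*} [NormedAddCommGroup E] (f : E → ℂ) : Prop :=
  ∃ (C : ℝ) (N : ℕ), 0 ≤ C ∧ ∀ x, ‖f x‖ ≤ C * (1 + ‖x‖) ^ N

lemma PolyGrowth.const {E : Type*} [NormedAddCommGroup E] (a : ℂ) :
    PolyGrowth (fun _ : E => a) := ⟨‖a‖, 0, norm_nonneg _, fun x => by simp⟩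

lemma PolyGrowth.mul {E : Type*} [NormedAddCommGroup E] {f h : E → ℂ} (hf : PolyGrowth f)
    (hh : PolyGrowth h) : PolyGrowth fun x => f x * h x := by
  obtain ⟨C, N, hC, h1⟩ := hf
  obtain ⟨D, M, hD, h2⟩ := hh
  refine ⟨C * D, N + M, mul_nonneg hC hD, fun x => ?_⟩
  rw [norm_mul, pow_add]
  calc ‖f x‖ * ‖h x‖ ≤ (C * (1 + ‖x‖) ^ N) * (D * (1 + ‖x‖) ^ M) :=
        mul_le_mul (h1 x) (h2 x) (norm_nonneg _) (by positivity)
    _ = _ := by ring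

lemma PolyGrowth.add {E : Type*} [NormedAddCommGroup E] {f h : E → ℂ} (hf : PolyGrowth f)
    (hh : PolyGrowth h) : PolyGrowth fun x => f x + h x := by
  obtain ⟨C, N, hC, h1⟩ := hf
  obtain ⟨D, M, hD, h2⟩ := hh
  refine ⟨C + D, N + M, add_nonneg hC hD, fun x => ?_⟩
  have hx : 1 ≤ 1 + ‖x‖ := by linarith [norm_nonneg x]
  calc ‖f x + h x‖ ≤ ‖f x‖ + ‖h x‖ := norm_add_le _ _
    _ ≤ C * (1 + ‖x‖) ^ N + D * (1 + ‖x‖) ^ M := add_le_add (h1 x) (h2 x)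
    _ ≤ C * (1 + ‖x‖) ^ (N + M) + D * (1 + ‖x‖) ^ (N + M) := by
        gcongr <;> first | exact hx | omega
    _ = _ := by ring

lemma PolyGrowth.sum {E : Type*} [NormedAddCommGroup E] {κ : Type*} {s : Finset κ}
    {f : κ → E → ℂ} (hf : ∀ i ∈ s, PolyGrowth (f i)) : PolyGrowth fun x => ∑ i ∈ s, f i x := by
  classical
  induction s using Finset.induction_on with
  | empty => simpa using PolyGrowth.const 0
  | insert a s ha ih =>
    simp only [Finset.sum_insert ha]
    exact (hf a (Finset.mem_insert_self _ _)).add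
      (ih fun i hi => hf i (Finset.mem_insert_of_mem hi))

lemma PolyGrowth.coord (i : Fin bp ⊕ Fin bm) : PolyGrowth fun x : V bp bm => (x i : ℂ) :=
  ⟨1, 1, zero_le_one, fun x => by
    have := norm_le_pi_norm x i
    rw [Complex.norm_real]
    linarith⟩

lemma PolyGrowth.evalAt (p : Poly bp bm) : PolyGrowth (evalAt p) := by
  change PolyGrowth fun x : V bp bm => MvPolynomial.eval (fun i => (x i : ℂ)) p
  induction p using MvPolynomial.induction_on with
  | C a => simpa using PolyGrowth.const (E := V bp bm) a
  | add p q hp hq => simpa using hp.add hq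
  | mul_X p i hp => simpa using hp.mul (PolyGrowth.coord i)

lemma PolyGrowth.sqPlus : PolyGrowth fun x : V bp bm => (sqPlus x : ℂ) := by
  have : (fun x : V bp bm => (ThetaLift.sqPlus x : ℂ)) =
      fun x => ∑ i : Fin bp, (x (Sum.inl i) : ℂ) * (x (Sum.inl i) : ℂ) := by
    funext x; simp [ThetaLift.sqPlus, sq]
  rw [this]
  exact PolyGrowth.sum fun i _ => (PolyGrowth.coord _).mul (PolyGrowth.coord _)

lemma PolyGrowth.sqMinus : PolyGrowth fun x : V bp bm => (sqMinus x : ℂ) := by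
  have : (fun x : V bp bm => (ThetaLift.sqMinus x : ℂ)) =
      fun x => ∑ i : Fin bm, (x (Sum.inr i) : ℂ) * (x (Sum.inr i) : ℂ) := by
    funext x; simp [ThetaLift.sqMinus, sq]
  rw [this]
  exact PolyGrowth.sum fun i _ => (PolyGrowth.coord _).mul (PolyGrowth.coord _)

lemma continuous_evalAt (p : Poly bp bm) : Continuous (evalAt p) := by
  unfold evalAt
  exact (MvPolynomial.continuous_eval p).comp (by fun_prop)

/-- A Gaussian beats every power, with an explicit constant. -/
lemma exp_neg_sq_le {c : ℝ} (hc : 0 < c) (N : ℕ) {r : ℝ} (hr : 0 ≤ r) :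
    Real.exp (-c * r ^ 2) ≤ Real.exp (N ^ 2 / (4 * c)) / (1 + r) ^ N := by
  rw [le_div_iff₀ (by positivity)]
  have h1 : (1 + r) ^ N ≤ Real.exp (N * r) := by
    rw [Real.exp_nat_mul]
    gcongr
    linarith [Real.add_one_le_exp r]
  calc Real.exp (-c * r ^ 2) * (1 + r) ^ N ≤ Real.exp (-c * r ^ 2) * Real.exp (N * r) := by gcongr
    _ = Real.exp (-c * r ^ 2 + N * r) := by rw [Real.exp_add]
    _ ≤ _ := by
      rw [Real.exp_le_exp, le_div_iff₀ (by positivity)]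
      nlinarith [sq_nonneg ((N : ℝ) - 2 * c * r)]

/-- A uniform version of the rapid decay of a polynomially bounded function times a Gaussian, with
some room left in the exponent. -/
lemma PolyGrowth.mul_gauss_le {f : V bp bm → ℂ} (hf : PolyGrowth f) {c : ℝ} (hc : 0 < c) (M : ℕ) :
    ∃ C : ℝ, 0 ≤ C ∧ ∀ x, ‖f x‖ * Real.exp (-c * (ThetaLift.sqPlus x + ThetaLift.sqMinus x)) ≤
      C / (1 + ‖x‖) ^ M := by
  obtain ⟨C, N, hC, h1⟩ := hf
  refine ⟨C * Real.exp ((N + M : ℕ) ^ 2 / (4 * c)), by positivity, fun x => ?_⟩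
  have h2 : Real.exp (-c * (ThetaLift.sqPlus x + ThetaLift.sqMinus x)) ≤
      Real.exp ((N + M : ℕ) ^ 2 / (4 * c)) / (1 + ‖x‖) ^ (N + M) := by
    refine le_trans ?_ (exp_neg_sq_le hc (N + M) (norm_nonneg x))
    rw [Real.exp_le_exp]
    have := norm_sq_le x
    nlinarith
  calc ‖f x‖ * Real.exp (-c * (ThetaLift.sqPlus x + ThetaLift.sqMinus x))
      ≤ (C * (1 + ‖x‖) ^ N) * (Real.exp ((N + M : ℕ) ^ 2 / (4 * c)) / (1 + ‖x‖) ^ (N + M)) :=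
        mul_le_mul (h1 x) h2 (Real.exp_pos _).le (by positivity)
    _ = _ := by
      rw [pow_add]
      have : (1 + ‖x‖) ≠ 0 := by positivity
      field_simp

lemma PolyGrowth.rapidDecay {f : V bp bm → ℂ} (hf : PolyGrowth f) {z : ℂ} (hz : 0 < z.im) :
    RapidDecay fun x => f x * gaussV z x := by
  intro M
  obtain ⟨C, -, hC⟩ := hf.mul_gauss_le (c := Real.pi * z.im) (by positivity) M
  exact ⟨C, fun x => by rw [norm_mul, norm_gaussV]; exact hC x⟩

/-- The summand `[exp(-Δ/(8πy)) p](x) e(τ Q(x⁺) + conj(τ) Q(x⁻))` of the theta function. -/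
def thetaKernel (p : Poly bp bm) (z : ℂ) (x : V bp bm) : ℂ :=
  evalAt (expLaplacian (-1 / (8 * Real.pi * z.im)) p) x * gaussV z x

lemma gaussFactor_neg_conj {τ : ℂ} (hτ : 0 < τ.im) :
    gaussFactor (-conj τ) = conj (gaussFactor τ) := by
  have h : (-Complex.I * -conj τ) = conj (-Complex.I * τ) := by simp
  rw [gaussFactor, gaussFactor, h]
  have harg : (-Complex.I * τ).arg ≠ Real.pi := by
    rw [Ne, Complex.arg_eq_pi_iff]
    rintro ⟨h1, -⟩
    simp at h1
    linarith
  have := Complex.cpow_conj (-Complex.I * τ) (1 / 2) harg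
  simp only [map_div₀, map_one, map_ofNat] at this ⊢
  rw [this, Complex.conj_conj]

/-- The modulus of each coordinate: `τ` on `V⁺` and `-conj(τ)` on `V⁻`. -/
def coordTau (τ : ℂ) : Fin bp ⊕ Fin bm → ℂ := Sum.elim (fun _ => τ) fun _ => -conj τ

lemma coordTau_im (τ : ℂ) (i : Fin bp ⊕ Fin bm) : (coordTau τ i).im = τ.im := by
  rcases i with i | i <;> simp [coordTau]

lemma coordTau_inv (τ : ℂ) (i : Fin bp ⊕ Fin bm) : -1 / coordTau τ i = coordTau (-1 / τ) i := by
  rcases i with i | i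
  · rfl
  · simp [coordTau, neg_div]

lemma gaussV_eq_prod (z : ℂ) (x : V bp bm) :
    gaussV z x = ∏ i, Complex.exp (Real.pi * Complex.I * coordTau z i * (x i : ℂ) ^ 2) := by
  rw [gaussV, e, ← Complex.exp_sum, stdForm_plusPart, stdForm_minusPart, sqPlus, sqMinus]
  congr 1
  rw [Fintype.sum_sum_type]
  simp only [coordTau, Sum.elim_inl, Sum.elim_inr, ← Finset.mul_sum]
  push_cast
  ring

lemma thetaKernel_monomial (s : Fin bp ⊕ Fin bm →₀ ℕ) (z : ℂ) (x : V bp bm) :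
    thetaKernel (MvPolynomial.monomial s 1) z x =
      ∏ i, polyGauss (coordTau z i) (hermiteHeat (1 / (8 * Real.pi * (coordTau z i).im)) (s i))
        (x i) := by
  rw [thetaKernel, gaussV_eq_prod, expLaplacian_monomial, evalAt, map_prod,
    ← Finset.prod_mul_distrib]
  refine Finset.prod_congr rfl fun i _ => ?_
  rw [polyGauss, coordTau_im]
  congr 1
  rw [Polynomial.aeval_def, Polynomial.hom_eval₂, MvPolynomial.eval_X]
  have : (MvPolynomial.eval fun i => (x i : ℂ)).comp (algebraMap ℂ (Poly bp bm)) =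
      RingHom.id ℂ := by
    ext a; simp
  rw [this, Polynomial.eval₂_id]
  push_cast
  rw [neg_div, neg_neg]

lemma fourierPi_thetaKernel_monomial (s : Fin bp ⊕ Fin bm →₀ ℕ) {z : ℂ} (hz : 0 < z.im)
    (ξ : V bp bm) :
    fourierPi (thetaKernel (MvPolynomial.monomial s 1) z) ξ =
      (∏ i, gaussFactor (coordTau z i) * ((coordTau z i)⁻¹) ^ s i) *
        thetaKernel (MvPolynomial.monomial s 1) (-1 / z) ξ := by
  rw [fourierPi]
  have h1 : ∀ x : V bp bm, thetaKernel (MvPolynomial.monomial s 1) z x *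
      e (-(∑ i, x i * ξ i : ℝ)) = ∏ i, (polyGauss (coordTau z i)
        (hermiteHeat (1 / (8 * Real.pi * (coordTau z i).im)) (s i)) (x i) *
          e (-(x i * ξ i : ℝ))) := by
    intro x
    rw [thetaKernel_monomial, Finset.prod_mul_distrib]
    congr 1
    simp only [e]
    rw [← Complex.exp_sum]
    congr 1
    push_cast
    rw [← Finset.mul_sum, ← Finset.sum_neg_distrib]
  rw [integral_congr_ae (Filter.Eventually.of_forall h1),
    integral_fintype_prod_volume_eq_prod (fun i (v : ℝ) => polyGauss (coordTau z i)
        (hermiteHeat (1 / (8 * Real.pi * (coordTau z i).im)) (s i)) v *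
          e (-(v * ξ i : ℝ))), thetaKernel_monomial, ← Finset.prod_mul_distrib]
  refine Finset.prod_congr rfl fun i _ => ?_
  have h2 := congrFun (fourier_hermite (τ := coordTau z i) (by rw [coordTau_im]; exact hz) (s i))
    (ξ i)
  rw [coordTau_inv] at h2
  rw [← h2, Real.fourier_real_eq_integral_exp_smul]
  refine integral_congr_ae (Filter.Eventually.of_forall fun v => ?_)
  simp only [smul_eq_mul, e]
  rw [mul_comm]
  congr 2
  push_cast
  ring

lemma continuous_thetaKernel (p : Poly bp bm) (z : ℂ) : Continuous (thetaKernel p z) :=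
  (continuous_evalAt _).mul (continuous_gaussV z)

lemma rapidDecay_thetaKernel (p : Poly bp bm) {z : ℂ} (hz : 0 < z.im) :
    RapidDecay (thetaKernel p z) := (PolyGrowth.evalAt _).rapidDecay hz

lemma thetaKernel_sum {κ : Type*} (s : Finset κ) (a : κ → ℂ) (f : κ → Poly bp bm) (z : ℂ)
    (x : V bp bm) :
    thetaKernel (∑ i ∈ s, a i • f i) z x = ∑ i ∈ s, a i * thetaKernel (f i) z x := by
  simp only [thetaKernel, expLaplacian_sum, expLaplacian_smul, evalAt, map_sum,
    MvPolynomial.smul_eval, Finset.sum_mul, mul_assoc]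

lemma weight_bihomogeneous (s : Fin bp ⊕ Fin bm →₀ ℕ) :
    Finsupp.weight (Sum.elim (fun _ : Fin bp => ((1, 0) : ℕ × ℕ)) (fun _ : Fin bm => ((0, 1) : ℕ × ℕ))) s =
      (∑ i, s (Sum.inl i), ∑ j, s (Sum.inr j)) := by
  rw [Finsupp.weight_apply, Finsupp.sum_fintype _ _ (by simp), Fintype.sum_sum_type]
  simp [Prod.ext_iff, Prod.fst_sum, Prod.snd_sum]

lemma mem_bihomogeneous_iff {r s : ℕ} {p : Poly bp bm} : p ∈ bihomogeneous bp bm r s ↔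
    ∀ d ∈ p.support, ∑ i, d (Sum.inl i) = r ∧ ∑ j, d (Sum.inr j) = s := by
  rw [bihomogeneous, MvPolynomial.mem_weightedHomogeneousSubmodule,
    MvPolynomial.IsWeightedHomogeneous]
  simp only [MvPolynomial.mem_support_iff, weight_bihomogeneous, Prod.mk.injEq]

/-- The Fourier transform of the theta kernel. -/
theorem fourierPi_thetaKernel {k l : ℕ} {p : Poly bp bm} (hp : p ∈ bihomogeneous bp bm k l) {z : ℂ}
    (hz : 0 < z.im) (ξ : V bp bm) :
    fourierPi (thetaKernel p z) ξ =
      gaussFactor z ^ bp * conj (gaussFactor z) ^ bm * ((z⁻¹) ^ k * ((-conj z)⁻¹) ^ l) *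
        thetaKernel p (-1 / z) ξ := by
  rw [mem_bihomogeneous_iff] at hp
  have hsum : p = ∑ s ∈ p.support, p.coeff s • MvPolynomial.monomial s (1 : ℂ) := by
    conv_lhs => rw [p.as_sum]
    refine Finset.sum_congr rfl fun s _ => ?_
    rw [MvPolynomial.smul_monomial, smul_eq_mul, mul_one]
  have h1 : ∀ (z : ℂ) (x : V bp bm), thetaKernel p z x =
      ∑ s ∈ p.support, p.coeff s * thetaKernel (MvPolynomial.monomial s 1) z x := by
    intro z x
    conv_lhs => rw [hsum]
    rw [thetaKernel_sum]
  rw [fourierPi]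
  simp_rw [h1, Finset.sum_mul]
  rw [integral_finsetSum, Finset.mul_sum]
  · refine Finset.sum_congr rfl fun s hs => ?_
    simp_rw [mul_assoc]
    rw [integral_const_mul]
    have := fourierPi_thetaKernel_monomial s hz ξ
    rw [fourierPi] at this
    rw [this, Fintype.prod_sum_type]
    simp only [coordTau, Sum.elim_inl, Sum.elim_inr, gaussFactor_neg_conj hz]
    simp only [Finset.prod_mul_distrib, Finset.prod_const,
      Finset.card_univ, Fintype.card_fin, Finset.prod_pow_eq_pow_sum, (hp s hs).1,
      (hp s hs).2]
    ring
  · intro s _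
    have h2 := ((rapidDecay_thetaKernel (MvPolynomial.monomial s (1 : ℂ)) hz).integrable
      (continuous_thetaKernel _ _)).const_mul (p.coeff s)
    refine h2.norm.mono' ?_ (Filter.Eventually.of_forall fun x => ?_)
    · refine Continuous.aestronglyMeasurable ?_
      refine ((continuous_thetaKernel _ _).const_mul _).mul (continuous_e.comp (by fun_prop))
    · rw [norm_mul, ← Complex.ofReal_neg, norm_e_real, mul_one]

end Kernel

/-! ### The dual lattice and the discriminant group -/

section DualLattice

variable {bp bm : ℕ} {W : Type*} [AddCommGroup W] [Module ℝ W] {q : QuadraticForm ℝ W}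

/-- The bilinear form of signature `(bp, bm)`. -/
def stdPolar (x y : V bp bm) : ℝ :=
  ∑ i, x (Sum.inl i) * y (Sum.inl i) - ∑ j, x (Sum.inr j) * y (Sum.inr j)

lemma polar_stdForm (x y : V bp bm) : QuadraticMap.polar (stdForm bp bm) x y = stdPolar x y := by
  rw [QuadraticMap.polar, stdForm_eq, stdForm_eq, stdForm_eq, stdPolar]
  simp only [sqPlus, sqMinus, Pi.add_apply, add_sq, Finset.sum_add_distrib, mul_assoc,
    ← Finset.mul_sum]
  ring

lemma polar_eq (u : q.IsometryEquiv (stdForm bp bm)) (x y : W) :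
    QuadraticMap.polar q x y = stdPolar (u x) (u y) := by
  rw [← polar_stdForm, QuadraticMap.polar, QuadraticMap.polar, ← map_add, u.map_app, u.map_app,
    u.map_app]

lemma polar_nondegenerate (u : q.IsometryEquiv (stdForm bp bm)) {x : W}
    (h : ∀ y, QuadraticMap.polar q x y = 0) : x = 0 := by
  classical
  have h2 : u x = 0 := by
    funext i
    have := h (u.symm (Pi.single i 1))
    have h3 : u (u.symm (Pi.single i 1)) = Pi.single i 1 := u.toLinearEquiv.apply_symm_apply _
    rw [polar_eq u, h3, stdPolar] at this
    rcases i with i | i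
    · simpa [Pi.single_apply] using this
    · simpa [Pi.single_apply] using this
  exact u.toLinearEquiv.map_eq_zero_iff.mp h2

variable {L : AddSubgroup W}

lemma polar_sum_smul {n : ℕ} (c : Fin n → ℝ) (b : Fin n → W) (y : W) :
    QuadraticMap.polar q (∑ j, c j • b j) y = ∑ j, c j * QuadraticMap.polar q (b j) y := by
  change QuadraticMap.polarBilin q (∑ j, c j • b j) y =
    ∑ j, c j * QuadraticMap.polarBilin q (b j) y
  rw [map_sum, LinearMap.sum_apply]
  simp only [map_smul, LinearMap.smul_apply, smul_eq_mul]

lemma le_dual (hL : IsEvenLattice q L) : L ≤ dual q L := by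
  intro x hx y hy
  obtain ⟨a, ha⟩ := hL.even x hx
  obtain ⟨b, hb⟩ := hL.even y hy
  obtain ⟨c, hc⟩ := hL.even (x + y) (L.add_mem hx hy)
  exact ⟨c - a - b, by rw [QuadraticMap.polar, ha, hb, hc]; push_cast; rfl⟩

/-- Coordinates on the dual lattice: pairing with a basis of `L` identifies `L'` with `ℤ^n`. -/
lemma exists_dual_coords (u : q.IsometryEquiv (stdForm bp bm)) (hL : IsEvenLattice q L) :
    ∃ (n : ℕ) (b : Module.Basis (Fin n) ℝ W), L = AddSubgroup.closure (Set.range b) ∧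
      ∃ φ : dual q L ≃ (Fin n → ℤ), ∀ (x : dual q L) i, QuadraticMap.polar q (x : W) (b i) = φ x i := by
  obtain ⟨n, b, hb⟩ := hL.exists_basis
  refine ⟨n, b, hb, ?_⟩
  have hbL : ∀ i, b i ∈ L := fun i => by rw [hb]; exact AddSubgroup.subset_closure ⟨i, rfl⟩
  have hex : ∀ (x : dual q L) (i : Fin n), ∃ m : ℤ, QuadraticMap.polar q (x : W) (b i) = m :=
    fun x i => x.2 (b i) (hbL i)
  choose φ hφ using hex
  let T : W →ₗ[ℝ] (Fin n → ℝ) := LinearMap.pi fun i => (QuadraticMap.polarBilin q).flip (b i)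
  have hT : ∀ x i, T x i = QuadraticMap.polar q x (b i) := fun x i => rfl
  have hTinj : Function.Injective T := by
    rw [← LinearMap.ker_eq_bot, LinearMap.ker_eq_bot']
    intro x hx
    apply polar_nondegenerate u
    intro y
    have : (QuadraticMap.polarBilin q x) = 0 := by
      apply b.ext
      intro i
      exact congrFun hx i
    exact congrArg (fun l => l y) this
  have : FiniteDimensional ℝ W := Module.Finite.of_basis b
  have hTsurj : Function.Surjective T := by
    rw [← LinearMap.injective_iff_surjective_of_finrank_eq_finrank]
    · exact hTinj
    · rw [Module.finrank_eq_card_basis b]; simp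
  have hbij : Function.Bijective φ := by
    constructor
    · intro x y hxy
      apply Subtype.ext
      apply hTinj
      funext i
      rw [hT, hT, hφ, hφ, hxy]
    · intro m
      obtain ⟨x, hx⟩ := hTsurj fun i => (m i : ℝ)
      have hxd : x ∈ dual q L := by
        intro y hy
        rw [hb] at hy
        induction hy using AddSubgroup.closure_induction with
        | mem y hy =>
          obtain ⟨i, rfl⟩ := hy
          exact ⟨m i, by rw [← hT, hx]⟩
        | zero => exact ⟨0, by simp⟩
        | add y z _ _ h1 h2 =>
          obtain ⟨a, ha⟩ := h1
          obtain ⟨c, hc⟩ := h2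
          exact ⟨a + c, by rw [QuadraticMap.polar_add_right, ha, hc]; push_cast; rfl⟩
        | neg y _ h1 =>
          obtain ⟨a, ha⟩ := h1
          exact ⟨-a, by rw [QuadraticMap.polar_neg_right, ha]; push_cast; rfl⟩
      refine ⟨⟨x, hxd⟩, ?_⟩
      funext i
      have h1 : T x i = φ ⟨x, hxd⟩ i := hφ ⟨x, hxd⟩ i
      have h2 : T x i = m i := by rw [hx]
      exact_mod_cast h1.symm.trans h2
  exact ⟨Equiv.ofBijective φ hbij, fun x i => hφ x i⟩

/-- Every element of `L` is an integral combination of the basis vectors, uniquely. -/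
lemma mem_lattice_iff {n : ℕ} {b : Module.Basis (Fin n) ℝ W}
    (hb : L = AddSubgroup.closure (Set.range b)) (x : W) :
    x ∈ L ↔ ∃ m : Fin n → ℤ, x = ∑ i, (m i : ℝ) • b i := by
  constructor
  · intro hx
    rw [hb] at hx
    induction hx using AddSubgroup.closure_induction with
    | mem y hy =>
      classical
      obtain ⟨i, rfl⟩ := hy
      refine ⟨Pi.single i 1, ?_⟩
      rw [Finset.sum_eq_single i]
      · simp
      · intro j _ hj; simp [hj]
      · simp
    | zero => exact ⟨0, by simp⟩
    | add y z _ _ h1 h2 =>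
      obtain ⟨a, ha⟩ := h1
      obtain ⟨c, hc⟩ := h2
      exact ⟨a + c, by rw [ha, hc, ← Finset.sum_add_distrib]; simp [add_smul]⟩
    | neg y _ h1 =>
      obtain ⟨a, ha⟩ := h1
      exact ⟨-a, by rw [ha, ← Finset.sum_neg_distrib]; simp⟩
  · rintro ⟨m, rfl⟩
    refine AddSubgroup.sum_mem _ fun i _ => ?_
    have : (m i : ℝ) • b i = m i • b i := Int.cast_smul_eq_zsmul ℝ (m i) (b i)
    rw [this]
    refine AddSubgroup.zsmul_mem _ ?_ _
    rw [hb]; exact AddSubgroup.subset_closure ⟨i, rfl⟩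

lemma mk_eq_mk_iff {x y : dual q L} :
    (QuotientAddGroup.mk x : Discr q L) = QuotientAddGroup.mk y ↔ (y : W) - x ∈ L := by
  rw [QuotientAddGroup.eq, AddSubgroup.mem_addSubgroupOf]
  simp [neg_add_eq_sub]

/-- The discriminant group is finite. -/
lemma finite_discr (u : q.IsometryEquiv (stdForm bp bm)) (hL : IsEvenLattice q L) :
    Finite (Discr q L) := by
  obtain ⟨n, b, hb, φ, hφ⟩ := exists_dual_coords u hL
  obtain ⟨B, hB⟩ : ∃ B : ℤ, ∀ i, ∑ j, |QuadraticMap.polar q (b j) (b i)| ≤ B := by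
    refine ⟨⌈∑ i, ∑ j, |QuadraticMap.polar q (b j) (b i)|⌉, fun i => ?_⟩
    refine le_trans ?_ (Int.le_ceil _)
    exact Finset.single_le_sum (f := fun i => ∑ j, |QuadraticMap.polar q (b j) (b i)|)
      (fun i _ => Finset.sum_nonneg fun j _ => abs_nonneg _) (Finset.mem_univ i)
  let f : (Set.Icc (fun _ : Fin n => -B) fun _ => B) → Discr q L :=
    fun m => QuotientAddGroup.mk (φ.symm m.1)
  have : Function.Surjective f := by
    intro γ
    obtain ⟨x, rfl⟩ := QuotientAddGroup.mk_surjective γ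
    let l : W := ∑ j, ((⌊b.repr x j⌋ : ℤ) : ℝ) • b j
    have hl : l ∈ L := (mem_lattice_iff hb l).2 ⟨fun j => ⌊b.repr x j⌋, rfl⟩
    let y : dual q L := x - ⟨l, le_dual hL hl⟩
    have hy : (y : W) = ∑ j, Int.fract (b.repr x j) • b j := by
      change (x : W) - l = _
      conv_lhs => rw [← b.sum_repr x]
      simp only [l]
      rw [← Finset.sum_sub_distrib]
      refine Finset.sum_congr rfl fun j _ => ?_
      rw [← sub_smul, Int.self_sub_floor]
    have hφy : ∀ i, |(φ y i : ℝ)| ≤ B := by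
      intro i
      rw [← hφ, hy]
      refine le_trans ?_ (hB i)
      rw [polar_sum_smul]
      refine (Finset.abs_sum_le_sum_abs _ _).trans (Finset.sum_le_sum fun j _ => ?_)
      rw [abs_mul, abs_of_nonneg (Int.fract_nonneg _)]
      exact mul_le_of_le_one_left (abs_nonneg _) (Int.fract_lt_one _).le
    refine ⟨⟨φ y, ⟨fun i => ?_, fun i => ?_⟩⟩, ?_⟩
    · have := (abs_le.mp (hφy i)).1
      exact_mod_cast this
    · have := (abs_le.mp (hφy i)).2
      exact_mod_cast this
    · simp only [f, Equiv.symm_apply_apply]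
      rw [mk_eq_mk_iff]
      simpa [y] using hl
  exact Finite.of_surjective f this

/-- The double dual of `L` is `L`. -/
lemma mem_of_polar_dual (u : q.IsometryEquiv (stdForm bp bm)) (hL : IsEvenLattice q L) {x : W}
    (h : ∀ y ∈ dual q L, ∃ n : ℤ, QuadraticMap.polar q x y = n) : x ∈ L := by
  classical
  obtain ⟨n, b, hb, φ, hφ⟩ := exists_dual_coords u hL
  rw [mem_lattice_iff hb]
  choose m hm using fun i => h _ (φ.symm (Pi.single i 1)).2
  refine ⟨m, ?_⟩
  conv_lhs => rw [← b.sum_repr x]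
  refine Finset.sum_congr rfl fun i _ => ?_
  congr 1
  rw [← hm]
  conv_rhs => rw [← b.sum_repr x]
  rw [polar_sum_smul, Finset.sum_eq_single i]
  · rw [QuadraticMap.polar_comm, hφ, Equiv.apply_symm_apply]; simp
  · intro j _ hj
    rw [QuadraticMap.polar_comm, hφ, Equiv.apply_symm_apply]; simp [hj]
  · simp

lemma e_eq_one_iff (r : ℝ) : e r = 1 ↔ ∃ n : ℤ, r = n := by
  constructor
  · intro h
    rw [e, Complex.exp_eq_one_iff] at h
    obtain ⟨n, hn⟩ := h
    refine ⟨n, ?_⟩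
    have h2 : (2 * Real.pi * Complex.I : ℂ) ≠ 0 := Complex.two_pi_I_ne_zero
    have : (r : ℂ) = n := by
      apply mul_left_cancel₀ h2
      rw [hn]; ring
    exact_mod_cast this
  · rintro ⟨n, rfl⟩
    exact_mod_cast e_int n

lemma e_congr {r s : ℝ} (h : ∃ n : ℤ, r - s = n) : e r = e s := by
  obtain ⟨n, hn⟩ := h
  have : (r : ℂ) = s + (n : ℤ) := by
    have : r = s + n := by linarith
    rw [this]; push_cast; rfl
  rw [this, e_add, e_int, mul_one]

/-- The value `e((γ, δ))` of the discriminant bilinear form. -/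
def discrPair (γ δ : Discr q L) : ℂ := e (QuadraticMap.polar q (rep γ) (rep δ) : ℝ)

lemma rep_mem (γ : Discr q L) : (rep γ : W) ∈ dual q L := (Quotient.out γ).2

lemma mk_rep (γ : Discr q L) : (QuotientAddGroup.mk ⟨rep γ, rep_mem γ⟩ : Discr q L) = γ :=
  Quotient.out_eq γ

lemma sub_rep_mem (x : dual q L) : (x : W) - rep (QuotientAddGroup.mk x : Discr q L) ∈ L :=
  mk_eq_mk_iff.1 (mk_rep (QuotientAddGroup.mk x : Discr q L))

lemma discrPair_mk (x y : dual q L) :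
    discrPair (QuotientAddGroup.mk x : Discr q L) (QuotientAddGroup.mk y) =
      e (QuadraticMap.polar q (x : W) (y : W) : ℝ) := by
  refine (e_congr ?_).symm
  set x' : W := rep (QuotientAddGroup.mk x : Discr q L)
  set y' : W := rep (QuotientAddGroup.mk y : Discr q L)
  obtain ⟨a, ha⟩ := y.2 _ (sub_rep_mem x)
  obtain ⟨c, hc⟩ := rep_mem (QuotientAddGroup.mk x : Discr q L) _ (sub_rep_mem y)
  refine ⟨a + c, ?_⟩
  push_cast
  rw [← ha, ← hc, QuadraticMap.polar_comm q (y : W), QuadraticMap.polar_sub_left,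
    QuadraticMap.polar_sub_right]
  ring

lemma e_q_mk (hL : IsEvenLattice q L) (x : dual q L) :
    e (q (rep (QuotientAddGroup.mk x : Discr q L)) : ℝ) = e (q (x : W) : ℝ) := by
  refine (e_congr ?_).symm
  set x' : W := rep (QuotientAddGroup.mk x : Discr q L)
  obtain ⟨a, ha⟩ := hL.even _ (sub_rep_mem x)
  obtain ⟨c, hc⟩ := rep_mem (QuotientAddGroup.mk x : Discr q L) _ (sub_rep_mem x)
  refine ⟨a + c, ?_⟩
  push_cast
  rw [← ha, ← hc]
  have : q (x : W) = q (((x : W) - x') + x') := by simp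
  rw [this, QuadraticMap.map_add q, QuadraticMap.polar_comm]
  ring

lemma exists_mk (γ : Discr q L) : ∃ x : dual q L, QuotientAddGroup.mk x = γ :=
  ⟨_, mk_rep γ⟩

lemma discrPair_add_left (γ γ' δ : Discr q L) :
    discrPair (γ + γ') δ = discrPair γ δ * discrPair γ' δ := by
  obtain ⟨x, rfl⟩ := exists_mk γ
  obtain ⟨x', rfl⟩ := exists_mk γ'
  obtain ⟨y, rfl⟩ := exists_mk δ
  rw [← QuotientAddGroup.mk_add, discrPair_mk, discrPair_mk, discrPair_mk, ← e_add,
    ← Complex.ofReal_add, ← QuadraticMap.polar_add_left]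
  rfl

lemma discrPair_comm (γ δ : Discr q L) : discrPair γ δ = discrPair δ γ := by
  rw [discrPair, discrPair, QuadraticMap.polar_comm]

lemma discrPair_add_right (γ δ δ' : Discr q L) :
    discrPair γ (δ + δ') = discrPair γ δ * discrPair γ δ' := by
  rw [discrPair_comm, discrPair_add_left, discrPair_comm, discrPair_comm δ']

lemma norm_discrPair (γ δ : Discr q L) : ‖discrPair γ δ‖ = 1 := norm_e_real _

lemma conj_e (z : ℂ) : conj (e z) = e (-conj z) := by
  rw [e, e, ← Complex.exp_conj]; congr 1; simp [map_ofNat]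

lemma conj_e_real (r : ℝ) : conj (e (r : ℂ)) = e (-(r : ℂ)) := by
  rw [conj_e, Complex.conj_ofReal]

lemma discrPair_neg_left (γ δ : Discr q L) : discrPair (-γ) δ = conj (discrPair γ δ) := by
  obtain ⟨x, rfl⟩ := exists_mk γ
  obtain ⟨y, rfl⟩ := exists_mk δ
  rw [← QuotientAddGroup.mk_neg, discrPair_mk, discrPair_mk, conj_e_real, ← Complex.ofReal_neg,
    ← QuadraticMap.polar_neg_left]
  rfl

lemma discrPair_zero_left (δ : Discr q L) : discrPair 0 δ = 1 := by
  have := discrPair_add_left 0 0 δ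
  rw [add_zero] at this
  have h0 : discrPair (0 : Discr q L) δ ≠ 0 := e_ne_zero _
  exact (mul_right_cancel₀ h0 (by rw [one_mul, ← this])).symm

/-- The discriminant form is nondegenerate. -/
lemma exists_discrPair_ne_one (u : q.IsometryEquiv (stdForm bp bm)) (hL : IsEvenLattice q L)
    {γ : Discr q L} (h : γ ≠ 0) : ∃ δ, discrPair γ δ ≠ 1 := by
  by_contra hall
  push Not at hall
  obtain ⟨x, rfl⟩ := exists_mk γ
  apply h
  have : (x : W) ∈ L := by
    apply mem_of_polar_dual u hL
    intro y hy
    have := hall (QuotientAddGroup.mk ⟨y, hy⟩)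
    rw [discrPair_mk, e_eq_one_iff] at this
    exact this
  rw [← QuotientAddGroup.mk_zero, mk_eq_mk_iff]
  simpa using L.neg_mem this

open Classical in
lemma sum_discrPair [Fintype (Discr q L)] (u : q.IsometryEquiv (stdForm bp bm))
    (hL : IsEvenLattice q L) (γ : Discr q L) :
    ∑ δ, discrPair γ δ = if γ = 0 then (Nat.card (Discr q L) : ℂ) else 0 := by
  split_ifs with h
  · subst h
    simp [discrPair_zero_left]
  · obtain ⟨δ₀, hδ⟩ := exists_discrPair_ne_one u hL h
    have h1 : ∑ δ, discrPair γ δ = discrPair γ δ₀ * ∑ δ, discrPair γ δ := by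
      rw [Finset.mul_sum, ← Equiv.sum_comp (Equiv.addLeft δ₀) fun δ => discrPair γ δ]
      simp [discrPair_add_right]
    have h2 : (1 - discrPair γ δ₀) * ∑ δ, discrPair γ δ = 0 := by
      rw [sub_mul, ← h1]; ring
    rcases mul_eq_zero.mp h2 with h3 | h3
    · exact absurd (sub_eq_zero.mp h3).symm hδ
    · exact h3

open Classical in
lemma sum_discrPair_conj [Fintype (Discr q L)] (u : q.IsometryEquiv (stdForm bp bm))
    (hL : IsEvenLattice q L) (γ γ' : Discr q L) :
    ∑ δ, discrPair γ δ * conj (discrPair γ' δ) =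
      if γ = γ' then (Nat.card (Discr q L) : ℂ) else 0 := by
  have := sum_discrPair u hL (γ + -γ')
  simp only [discrPair_add_left, discrPair_neg_left, add_neg_eq_zero] at this
  exact this

/-- The values of the norm on the dual lattice are sparse enough for negative powers to sum. -/
lemma summable_dual (u : q.IsometryEquiv (stdForm bp bm)) (hL : IsEvenLattice q L) :
    ∃ N : ℕ, Summable fun x : dual q L => 1 / (1 + ‖u (x : W)‖) ^ N := by
  obtain ⟨n, b, hb, φ, hφ⟩ := exists_dual_coords u hL
  obtain ⟨N, hN⟩ := summable_int_vectors (Fin n)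
  let T : V bp bm →ₗ[ℝ] (Fin n → ℝ) :=
    LinearMap.pi fun i => (QuadraticMap.polarBilin (stdForm bp bm)).flip (u (b i))
  let T' := LinearMap.toContinuousLinearMap T
  have hT : ∀ x : dual q L, T' (u (x : W)) = fun i => (φ x i : ℝ) := by
    intro x
    funext i
    rw [← hφ, polar_eq u, ← polar_stdForm]
    rfl
  refine ⟨N, Summable.of_nonneg_of_le (fun x => by positivity) (fun x => ?_)
    ((hN.comp_injective φ.injective).mul_left ((1 + ‖T'‖) ^ N))⟩
  have h1 : 1 + ‖(fun i => (φ x i : ℝ))‖ ≤ (1 + ‖T'‖) * (1 + ‖u (x : W)‖) := by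
    rw [← hT]
    have := T'.le_opNorm (u (x : W))
    nlinarith [norm_nonneg T', norm_nonneg (u (x : W))]
  simp only [Function.comp]
  rw [mul_one_div, div_le_div_iff₀ (by positivity) (by positivity), one_mul, ← mul_pow]
  exact pow_le_pow_left₀ (by positivity) h1 N

lemma RapidDecay.summable_dual (u : q.IsometryEquiv (stdForm bp bm)) (hL : IsEvenLattice q L)
    {f : V bp bm → ℂ} (hf : RapidDecay f) : Summable fun x : dual q L => f (u (x : W)) := by
  obtain ⟨N, hN⟩ := ThetaLift.summable_dual u hL
  obtain ⟨C, hC⟩ := hf N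
  refine Summable.of_norm_bounded (hN.mul_left C) fun x => ?_
  rw [mul_one_div]
  exact hC _

end DualLattice

/-! ### Poisson summation on cosets and the inversion of theta series -/

section CosetPoisson

variable {bp bm : ℕ} {W : Type*} [AddCommGroup W] [Module ℝ W] {q : QuadraticForm ℝ W}
  {L : AddSubgroup W}

/-- The reflection that changes the sign of the coordinates of `V⁻`. -/
def flipMinus (x : V bp bm) : V bp bm := Sum.elim (fun i => x (Sum.inl i)) fun j => -x (Sum.inr j)

lemma sum_mul_flipMinus (x y : V bp bm) : ∑ i, x i * flipMinus y i = stdPolar x y := by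
  rw [Fintype.sum_sum_type, stdPolar, sub_eq_add_neg, ← Finset.sum_neg_distrib]
  simp [flipMinus]

lemma norm_flipMinus (x : V bp bm) : ‖flipMinus x‖ = ‖x‖ := by
  have h : ∀ x : V bp bm, ‖flipMinus x‖ ≤ ‖x‖ := by
    intro x
    rw [pi_norm_le_iff_of_nonneg (norm_nonneg _)]
    rintro (i | j)
    · exact norm_le_pi_norm x (Sum.inl i)
    · simpa [flipMinus] using norm_le_pi_norm x (Sum.inr j)
  refine le_antisymm (h x) ?_
  have : flipMinus (flipMinus x) = x := by
    funext i; rcases i with i | i <;> simp [flipMinus]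
  conv_lhs => rw [← this]
  exact h _

/-- The coset `L + γ` is parametrized by `ℤ^n`. -/
lemma exists_coset_coords (hL : IsEvenLattice q L) {n : ℕ} {b : Module.Basis (Fin n) ℝ W}
    (hb : L = AddSubgroup.closure (Set.range b)) (γ : Discr q L) :
    ∃ ψ : (Fin n → ℤ) ≃ Coset q L γ, ∀ m, ((ψ m).1 : W) = rep γ + ∑ i, (m i : ℝ) • b i := by
  have hl : ∀ m : Fin n → ℤ, ∑ i, (m i : ℝ) • b i ∈ L := fun m => (mem_lattice_iff hb _).2 ⟨m, rfl⟩
  let ψ : (Fin n → ℤ) → Coset q L γ := fun m =>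
    ⟨⟨rep γ + ∑ i, (m i : ℝ) • b i, (dual q L).add_mem (rep_mem γ) (le_dual hL (hl m))⟩, by
      conv_rhs => rw [← mk_rep γ]
      rw [mk_eq_mk_iff]
      simpa using L.neg_mem (hl m)⟩
  have hψ : Function.Bijective ψ := by
    constructor
    · intro m m' h
      have h1 : rep γ + ∑ i, (m i : ℝ) • b i = rep γ + ∑ i, (m' i : ℝ) • b i :=
        congrArg (fun x : Coset q L γ => (x.1 : W)) h
      have h2 := add_left_cancel h1
      funext i
      have := congrArg (fun w => b.repr w i) h2
      simp only [b.repr_sum_self] at this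
      exact_mod_cast this
    · rintro ⟨x, hx⟩
      have h1 : (x : W) - rep γ ∈ L := by rw [← hx]; exact sub_rep_mem x
      obtain ⟨m, hm⟩ := (mem_lattice_iff hb _).1 h1
      refine ⟨m, Subtype.ext (Subtype.ext ?_)⟩
      change rep γ + ∑ i, (m i : ℝ) • b i = x
      rw [← hm]; simp
  exact ⟨Equiv.ofBijective ψ hψ, fun m => rfl⟩

/-- **Poisson summation** for the cosets of `L` in `L'`. The constant `c` is the inverse covolume,
which is left unspecified here. -/
theorem poisson_coset (u : q.IsometryEquiv (stdForm bp bm)) (hL : IsEvenLattice q L) :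
    ∃ c : ℝ, 0 < c ∧ ∀ (f : V bp bm → ℂ), Continuous f → RapidDecay f →
      RapidDecay (fourierPi f) → ∀ γ : Discr q L,
        ∑' x : Coset q L γ, f (u (x.1 : W)) = c * ∑' y : dual q L,
          e (QuadraticMap.polar q (rep γ) (y : W) : ℝ) * fourierPi f (flipMinus (u (y : W))) := by
  obtain ⟨n, b, hb, φ, hφ⟩ := exists_dual_coords u hL
  let A : (Fin n → ℝ) ≃ₗ[ℝ] V bp bm := b.equivFun.symm.trans u.toLinearEquiv
  have hA : ∀ t, A t = u (∑ i, t i • b i) := by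
    intro t
    change u (b.equivFun.symm t) = _
    rw [b.equivFun_symm_apply]
  let A' : (Fin n → ℝ) ≃L[ℝ] V bp bm := A.toContinuousLinearEquiv
  have hA' : ∀ t, A' t = A t := fun t => rfl
  have : (Measure.map A' (volume : Measure (Fin n → ℝ))).IsAddHaarMeasure :=
    A'.isAddHaarMeasure_map _
  -- the coordinates of `L` transport Lebesgue measure to a multiple of Lebesgue measure on `V`
  set c := Measure.addHaarScalarFactor (Measure.map A' (volume : Measure (Fin n → ℝ)))
    (volume : Measure (V bp bm)) with hc
  have hmap : Measure.map A' (volume : Measure (Fin n → ℝ)) = c • (volume : Measure (V bp bm)) :=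
    Measure.isAddLeftInvariant_eq_smul _ _
  have hc0 : 0 < c := Measure.addHaarScalarFactor_pos_of_isAddHaarMeasure _ _
  have hint : ∀ G : V bp bm → ℂ, ∫ t, G (A t) = (c : ℝ) • ∫ x, G x := by
    intro G
    have h1 := A'.toHomeomorph.measurableEmbedding.integral_map (μ := volume) G
    have h2 : Measure.map (⇑A'.toHomeomorph) (volume : Measure (Fin n → ℝ)) =
      c • (volume : Measure (V bp bm)) := hmap
    rw [h2, integral_smul_nnreal_measure] at h1
    exact h1.symm
  refine ⟨c, by exact_mod_cast hc0, fun f hfc hf hff γ => ?_⟩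
  obtain ⟨ψ, hψ⟩ := exists_coset_coords hL hb γ
  let F : (Fin n → ℝ) → ℂ := fun t => f (u (rep γ) + A t)
  have hFc : Continuous F := hfc.comp (continuous_const.add A'.continuous)
  have hFd : RapidDecay F := by
    intro N
    obtain ⟨C, hC⟩ := hf N
    have hC0 : 0 ≤ C := by simpa using (norm_nonneg _).trans (hC 0)
    let S := (A'.symm : V bp bm →L[ℝ] (Fin n → ℝ))
    refine ⟨C * ((1 + ‖S‖) * (1 + ‖u (rep γ)‖)) ^ N, fun t => (hC _).trans ?_⟩
    have h1 : ‖t‖ ≤ ‖S‖ * ‖A t‖ := by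
      have := S.le_opNorm (A t)
      have h2 : S (A t) = t := A'.symm_apply_apply t
      rwa [h2] at this
    have h2 := one_add_norm_le (u (rep γ)) (A t)
    have h3 : 1 + ‖t‖ ≤ ((1 + ‖S‖) * (1 + ‖u (rep γ)‖)) * (1 + ‖u (rep γ) + A t‖) := by
      have : 1 + ‖t‖ ≤ (1 + ‖S‖) * (1 + ‖A t‖) := by
        nlinarith [norm_nonneg S, norm_nonneg (A t)]
      refine this.trans ?_
      rw [mul_assoc]
      exact mul_le_mul_of_nonneg_left h2 (by positivity)
    rw [div_le_div_iff₀ (by positivity) (by positivity), mul_assoc, ← mul_pow]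
    exact mul_le_mul_of_nonneg_left (pow_le_pow_left₀ (by positivity) h3 N) hC0
  have hFF : ∀ y : dual q L, fourierPi F (fun i => (φ y i : ℝ)) =
      c * (e (QuadraticMap.polar q (rep γ) (y : W) : ℝ) * fourierPi f (flipMinus (u (y : W)))) := by
    intro y
    have h1 : ∀ t, F t * e (-(∑ i, t i * (φ y i : ℝ) : ℝ)) =
        (fun x => f (u (rep γ) + x) * e (-(stdPolar x (u (y : W)) : ℝ))) (A t) := by
      intro t
      have : ∑ i, t i * (φ y i : ℝ) = stdPolar (A t) (u (y : W)) := by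
        rw [hA, ← polar_eq u, polar_sum_smul]
        refine Finset.sum_congr rfl fun i _ => ?_
        rw [← hφ, QuadraticMap.polar_comm]
      rw [this]
    rw [fourierPi, integral_congr_ae (Filter.Eventually.of_forall h1),
      hint fun x => f (u (rep γ) + x) * e (-(stdPolar x (u (y : W)) : ℝ)), fourierPi,
      ← integral_const_mul, Complex.real_smul]
    congr 1
    refine Eq.trans ?_ (integral_add_left_eq_self (μ := volume) (fun x : V bp bm =>
      e (QuadraticMap.polar q (rep γ) (y : W) : ℝ) *
        (f x * e (-(∑ i, x i * flipMinus (u (y : W)) i : ℝ)))) (u (rep γ)))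
    refine integral_congr_ae (Filter.Eventually.of_forall fun x => ?_)
    simp only
    rw [sum_mul_flipMinus, mul_left_comm, ← e_add]
    congr 2
    have : stdPolar (u (rep γ) + x) (u (y : W)) =
        QuadraticMap.polar q (rep γ) (y : W) + stdPolar x (u (y : W)) := by
      rw [polar_eq u, ← polar_stdForm, ← polar_stdForm, ← polar_stdForm,
        QuadraticMap.polar_add_left]
    rw [this]
    push_cast
    ring
  have hsumF : Summable fun k : Fin n → ℤ => fourierPi F fun i => (k i : ℝ) := by
    rw [← φ.summable_iff]
    have h1 : (fun k : Fin n → ℤ => fourierPi F fun i => (k i : ℝ)) ∘ φ = fun y : dual q L =>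
        c * (e (QuadraticMap.polar q (rep γ) (y : W) : ℝ) *
          fourierPi f (flipMinus (u (y : W)))) := funext hFF
    rw [h1]
    refine Summable.mul_left _ ?_
    have hfl : RapidDecay fun x : V bp bm => fourierPi f (flipMinus x) := by
      intro N
      obtain ⟨C, hC⟩ := hff N
      exact ⟨C, fun x => by rw [← norm_flipMinus x]; exact hC _⟩
    refine Summable.of_norm_bounded (hfl.summable_dual u hL).norm fun y => ?_
    rw [norm_mul, norm_e_real, one_mul]
  have key := poisson_summation hFc hFd hsumF
  rw [← ψ.tsum_eq, ← tsum_mul_left]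
  have h1 : ∀ m : Fin n → ℤ, f (u ((ψ m).1 : W)) = F fun i => (m i : ℝ) := by
    intro m
    rw [hψ]
    simp only [F]
    rw [hA, map_add]
  rw [tsum_congr h1, key, ← φ.tsum_eq]
  exact tsum_congr hFF

/-- The theta series without the power of the imaginary part. -/
def thetaSeries (u : q.IsometryEquiv (stdForm bp bm)) (L : AddSubgroup W) (p : Poly bp bm) (z : ℂ)
    (γ : Discr q L) : ℂ := ∑' x : Coset q L γ, thetaKernel p z (u (x.1 : W))

lemma hermiteHeat_eval_neg (t x : ℂ) (n : ℕ) :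
    (hermiteHeat t n).eval (-x) = (-1) ^ n * (hermiteHeat t n).eval x := by
  have h : ∀ n, (hermiteHeat t n).comp (-Polynomial.X) =
      Polynomial.C ((-1) ^ n) * hermiteHeat t n := by
    intro n
    induction n with
    | zero => simp [hermiteHeat]
    | succ n ih =>
      have hd := congrArg Polynomial.derivative ih
      rw [Polynomial.derivative_comp, Polynomial.derivative_C_mul, Polynomial.derivative_neg,
        Polynomial.derivative_X] at hd
      rw [hermiteHeat, Polynomial.sub_comp, Polynomial.mul_comp, Polynomial.mul_comp,
        Polynomial.X_comp, Polynomial.C_comp, ih, pow_succ, map_mul _ _ (-1 : ℂ), map_neg,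
        map_one]
      linear_combination (Polynomial.C (2 * t)) * hd
  have := congrArg (Polynomial.eval x) (h n)
  simpa [Polynomial.eval_comp] using this

lemma thetaKernel_flipMinus {k l : ℕ} {p : Poly bp bm} (hp : p ∈ bihomogeneous bp bm k l) (z : ℂ)
    (x : V bp bm) : thetaKernel p z (flipMinus x) = (-1) ^ l * thetaKernel p z x := by
  rw [mem_bihomogeneous_iff] at hp
  have hsum : p = ∑ s ∈ p.support, p.coeff s • MvPolynomial.monomial s (1 : ℂ) := by
    conv_lhs => rw [p.as_sum]
    refine Finset.sum_congr rfl fun s _ => ?_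
    rw [MvPolynomial.smul_monomial, smul_eq_mul, mul_one]
  rw [hsum, thetaKernel_sum, thetaKernel_sum, Finset.mul_sum]
  refine Finset.sum_congr rfl fun s hs => ?_
  rw [thetaKernel_monomial, thetaKernel_monomial, Fintype.prod_sum_type, Fintype.prod_sum_type,
    ← (hp s hs).2, ← Finset.prod_pow_eq_pow_sum]
  rw [mul_left_comm (∏ j, (-1 : ℂ) ^ s (Sum.inr j)), mul_left_comm (∏ j, (-1 : ℂ) ^ s (Sum.inr j)),
    ← Finset.prod_mul_distrib]
  congr 2
  refine Finset.prod_congr rfl fun j _ => ?_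
  simp only [flipMinus, Sum.elim_inr, polyGauss, Complex.ofReal_neg, hermiteHeat_eval_neg, neg_sq]
  ring

/-- A sum over the dual lattice, split into the cosets of `L`. -/
lemma tsum_dual_eq [Fintype (Discr q L)] {f : dual q L → ℂ} (hf : Summable f) :
    ∑' y, f y = ∑ δ : Discr q L, ∑' x : Coset q L δ, f x.1 := by
  rw [← (Equiv.sigmaFiberEquiv (fun x : dual q L => (QuotientAddGroup.mk x : Discr q L))).tsum_eq,
    Summable.tsum_sigma', tsum_fintype]
  · rfl
  · intro δ
    exact hf.comp_injective Subtype.val_injective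
  · exact ((Equiv.sigmaFiberEquiv _).summable_iff).2 hf

lemma RapidDecay.const_mul {f : V bp bm → ℂ} (hf : RapidDecay f) (a : ℂ) :
    RapidDecay fun x => a * f x := by
  intro N
  obtain ⟨C, hC⟩ := hf N
  refine ⟨‖a‖ * C, fun x => ?_⟩
  rw [norm_mul, mul_div_assoc]
  exact mul_le_mul_of_nonneg_left (hC x) (norm_nonneg _)

lemma im_neg_inv_pos {z : ℂ} (hz : 0 < z.im) : 0 < (-1 / z).im := by
  rw [neg_div, Complex.neg_im, one_div, Complex.inv_im]
  have : z ≠ 0 := by rintro rfl; simp at hz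
  have := Complex.normSq_pos.mpr this
  rw [neg_div, neg_neg]
  positivity

/-- The inversion formula, with an unspecified positive constant and the theta series at `-1/z` on
the right hand side. -/
lemma thetaSeries_inversion_aux [Fintype (Discr q L)] (u : q.IsometryEquiv (stdForm bp bm))
    (hL : IsEvenLattice q L) :
    ∃ c : ℝ, 0 < c ∧ ∀ (k l : ℕ) (p : Poly bp bm), p ∈ bihomogeneous bp bm k l → ∀ z : ℂ, 0 < z.im →
      ∀ γ : Discr q L, thetaSeries u L p z γ =
        c * (gaussFactor z ^ bp * conj (gaussFactor z) ^ bm * ((z⁻¹) ^ k * ((conj z)⁻¹) ^ l)) *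
          ∑ δ, discrPair γ δ * thetaSeries u L p (-1 / z) δ := by
  obtain ⟨c, hc, h⟩ := poisson_coset u hL
  refine ⟨c, hc, fun k l p hp z hz γ => ?_⟩
  have hF : fourierPi (thetaKernel p z) = fun ξ =>
      gaussFactor z ^ bp * conj (gaussFactor z) ^ bm * ((z⁻¹) ^ k * ((-conj z)⁻¹) ^ l) *
        thetaKernel p (-1 / z) ξ :=
    funext fun ξ => fourierPi_thetaKernel hp hz ξ
  have hr : RapidDecay (thetaKernel p (-1 / z)) := rapidDecay_thetaKernel p (im_neg_inv_pos hz)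
  rw [thetaSeries, h _ (continuous_thetaKernel p z) (rapidDecay_thetaKernel p hz)
    (by rw [hF]; exact hr.const_mul _), mul_assoc, hF]
  congr 1
  simp only [thetaKernel_flipMinus hp]
  rw [tsum_dual_eq, Finset.mul_sum]
  · refine Finset.sum_congr rfl fun δ _ => ?_
    rw [thetaSeries, ← tsum_mul_left, ← tsum_mul_left]
    refine tsum_congr fun x => ?_
    have : e (QuadraticMap.polar q (rep γ) (x.1 : W) : ℝ) = discrPair γ δ := by
      have := discrPair_mk ⟨rep γ, rep_mem γ⟩ x.1
      rw [mk_rep, x.2] at this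
      exact this.symm
    have hl : ((-conj z)⁻¹) ^ l * (-1) ^ l = ((conj z)⁻¹) ^ l := by
      rw [← mul_pow, inv_neg, neg_mul_neg, mul_one]
    rw [this, ← hl]
    ring
  · refine Summable.of_norm_bounded (((hr.const_mul
      (gaussFactor z ^ bp * conj (gaussFactor z) ^ bm *
        ((z⁻¹) ^ k * ((-conj z)⁻¹) ^ l) * (-1) ^ l)).summable_dual u hL).norm)
      fun y => ?_
    rw [norm_mul, norm_e_real, one_mul, mul_assoc _ ((-1 : ℂ) ^ l)]

lemma one_mem_bihomogeneous : (1 : Poly bp bm) ∈ bihomogeneous bp bm 0 0 := by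
  rw [mem_bihomogeneous_iff]
  intro d hd
  have : d = 0 := by
    by_contra h
    rw [MvPolynomial.mem_support_iff, MvPolynomial.coeff_one, if_neg (Ne.symm h)] at hd
    exact hd rfl
  subst this
  simp

lemma expLaplacian_one (t : ℝ) : expLaplacian t (1 : Poly bp bm) = 1 := by
  rw [expLaplacian_eq (N := 1) (by simp)]
  simp [heatTrunc]

lemma thetaKernel_one (z : ℂ) (x : V bp bm) : thetaKernel 1 z x = gaussV z x := by
  rw [thetaKernel, expLaplacian_one]; simp [evalAt]

/-- At `τ = i` the theta series of the constant polynomial is a sum of positive numbers. -/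
lemma thetaSeries_one_I (u : q.IsometryEquiv (stdForm bp bm)) (hL : IsEvenLattice q L)
    (γ : Discr q L) : ∃ r : ℝ, 0 < r ∧ thetaSeries u L 1 Complex.I γ = r := by
  have h1 : ∀ x : V bp bm, thetaKernel 1 Complex.I x =
      (Real.exp (-Real.pi * (sqPlus x + sqMinus x)) : ℝ) := by
    intro x
    rw [thetaKernel_one, gaussV, e, stdForm_plusPart, stdForm_minusPart, Complex.conj_I]
    push_cast
    congr 1
    linear_combination (Real.pi * (sqPlus x + sqMinus x) : ℂ) * Complex.I_sq
  have hs : Summable fun x : Coset q L γ =>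
      Real.exp (-Real.pi * (sqPlus (u (x.1 : W)) + sqMinus (u (x.1 : W)))) := by
    have h2 := ((rapidDecay_thetaKernel (1 : Poly bp bm) (z := Complex.I)
      (by simp)).summable_dual u hL).comp_injective
      (Subtype.val_injective : Function.Injective fun x : Coset q L γ => x.1)
    simp only [Function.comp_def, h1] at h2
    exact_mod_cast h2
  refine ⟨_, hs.tsum_pos (fun x => (Real.exp_pos _).le)
    ⟨⟨rep γ, rep_mem γ⟩, mk_rep γ⟩ (Real.exp_pos _), ?_⟩
  rw [thetaSeries, Complex.ofReal_tsum]
  exact tsum_congr fun x => h1 _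

/-- The **inversion formula** for theta series. Applying the preliminary formula twice at `τ = i`
identifies the constant. -/
theorem thetaSeries_inversion [Fintype (Discr q L)] (u : q.IsometryEquiv (stdForm bp bm))
    (hL : IsEvenLattice q L) {k l : ℕ} {p : Poly bp bm} (hp : p ∈ bihomogeneous bp bm k l) {z : ℂ}
    (hz : 0 < z.im) (γ : Discr q L) :
    thetaSeries u L p (-1 / z) γ =
      (z ^ k * conj z ^ l / (gaussFactor z ^ bp * conj (gaussFactor z) ^ bm)) *
        ((1 / Real.sqrt (Nat.card (Discr q L)) : ℝ) *
          ∑ δ, conj (discrPair γ δ) * thetaSeries u L p z δ) := by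
  classical
  obtain ⟨c, hc, h⟩ := thetaSeries_inversion_aux (L := L) u hL
  have horth : ∀ (F : Discr q L → ℂ) (γ : Discr q L),
      ∑ δ, conj (discrPair γ δ) * ∑ ε, discrPair δ ε * F ε = Nat.card (Discr q L) * F γ := by
    intro F γ
    simp_rw [Finset.mul_sum]
    rw [Finset.sum_comm]
    have h1 : ∀ ε, ∑ δ, conj (discrPair γ δ) * (discrPair δ ε * F ε) =
        if ε = γ then (Nat.card (Discr q L) : ℂ) * F γ else 0 := by
      intro ε
      have h2 := sum_discrPair_conj u hL ε γ
      have : ∑ δ, conj (discrPair γ δ) * (discrPair δ ε * F ε) =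
          (∑ δ, discrPair ε δ * conj (discrPair γ δ)) * F ε := by
        rw [Finset.sum_mul]
        refine Finset.sum_congr rfl fun δ _ => ?_
        rw [discrPair_comm δ ε]; ring
      rw [this, h2]
      split_ifs with h3
      · rw [h3]
      · simp
    simp [h1]
  have hcard : (Nat.card (Discr q L) : ℝ) ≠ 0 := by
    have : Nonempty (Discr q L) := ⟨0⟩
    exact_mod_cast Nat.card_pos.ne'
  have hcardpos : 0 < (Nat.card (Discr q L) : ℝ) := lt_of_le_of_ne (Nat.cast_nonneg _) hcard.symm
  -- two applications of the preliminary formula at `τ = i` give `c² |D_L| = 1`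
  have hcc : c * Nat.card (Discr q L) = Real.sqrt (Nat.card (Discr q L)) := by
    have hI : -1 / Complex.I = Complex.I := by
      rw [div_eq_iff Complex.I_ne_zero]; simp
    have hg : gaussFactor Complex.I = 1 := by simp [gaussFactor]
    choose r hr0 hr using thetaSeries_one_I u hL (L := L)
    have h1 : ∀ γ, (r γ : ℂ) = c * ∑ δ, discrPair γ δ * r δ := by
      intro γ
      have := h 0 0 1 one_mem_bihomogeneous Complex.I (by simp) γ
      simp only [hI, hg, hr] at this
      simpa using this
    have h2 : ∀ γ, (r γ : ℂ) = c * ∑ δ, conj (discrPair γ δ) * r δ := by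
      intro γ
      have := congrArg conj (h1 γ)
      simpa using this
    have h3 := h2 0
    have h4 : (r 0 : ℂ) = c * (c * ∑ δ, conj (discrPair 0 δ) * ∑ ε, discrPair δ ε * r ε) := by
      rw [h3]
      congr 1
      rw [Finset.mul_sum]
      refine Finset.sum_congr rfl fun δ _ => ?_
      conv_lhs => rw [h1 δ]
      ring
    rw [horth (fun ε => (r ε : ℂ))] at h4
    have h5 : r 0 * 1 = r 0 * (c * c * Nat.card (Discr q L)) := by
      have : (r 0 : ℂ) = ((r 0 * (c * c * Nat.card (Discr q L)) : ℝ) : ℂ) := by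
        rw [h4]; push_cast; ring
      rw [mul_one]
      exact_mod_cast this
    have h6 := mul_left_cancel₀ (hr0 0).ne' h5
    rw [eq_comm, Real.sqrt_eq_iff_mul_self_eq hcardpos.le (by positivity)]
    linear_combination (Nat.card (Discr q L) : ℝ) * h6
  have hz0 : z ≠ 0 := by rintro rfl; simp at hz
  have hcz0 : conj z ≠ 0 := by simpa using hz0
  have hg0 : gaussFactor z ≠ 0 := by
    rw [gaussFactor]
    refine one_div_ne_zero ?_
    rw [Ne, Complex.cpow_eq_zero_iff]
    rintro ⟨h1, -⟩
    simp [hz0] at h1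
  have hg0' : conj (gaussFactor z) ≠ 0 := by simpa using hg0
  simp_rw [h k l p hp z hz]
  set N := gaussFactor z ^ bp * conj (gaussFactor z) ^ bm with hN
  have hN0 : N ≠ 0 := mul_ne_zero (pow_ne_zero _ hg0) (pow_ne_zero _ hg0')
  have : ∑ δ, conj (discrPair γ δ) * (c * (N * (z⁻¹ ^ k * (conj z)⁻¹ ^ l)) *
      ∑ ε, discrPair δ ε * thetaSeries u L p (-1 / z) ε) =
      c * (N * (z⁻¹ ^ k * (conj z)⁻¹ ^ l)) * (Nat.card (Discr q L) * thetaSeries u L p (-1 / z) γ) := by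
    rw [← horth, Finset.mul_sum]
    refine Finset.sum_congr rfl fun δ _ => ?_
    ring
  rw [this]
  have hc' : (c : ℂ) * Nat.card (Discr q L) = Real.sqrt (Nat.card (Discr q L)) := by
    exact_mod_cast congrArg (fun x : ℝ => (x : ℂ)) hcc
  have hsq : (Real.sqrt (Nat.card (Discr q L)) : ℂ) ≠ 0 := by
    have := Real.sqrt_pos.mpr hcardpos
    exact_mod_cast this.ne'
  push_cast
  rw [inv_pow, inv_pow]
  generalize thetaSeries u L p (-1 / z) γ = t
  field_simp
  linear_combination (-t) * hc'

end CosetPoisson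

/-! ### The metaplectic group is generated by `S` and `T` -/

namespace Mp2Z

lemma one_phi (τ : ℍ) : (1 : Mp2Z).phi τ = 1 := rfl

lemma inv_mat (x : Mp2Z) : (x⁻¹).mat = x.mat⁻¹ := rfl

lemma inv_phi (x : Mp2Z) (τ : ℍ) : (x⁻¹).phi τ = (x.phi (x.mat⁻¹ • τ))⁻¹ := rfl

lemma continuous_phi (x : Mp2Z) : Continuous x.phi := x.holo.continuous

/-- The projection to `SL₂(ℤ)`. -/
def matHom : Mp2Z →* SL(2, ℤ) where
  toFun := mat
  map_one' := rfl
  map_mul' _ _ := rfl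

/-- Two elements over the same matrix differ by a sign. -/
lemma phi_eq_or_neg {x y : Mp2Z} (h : x.mat = y.mat) :
    (∀ τ, x.phi τ = y.phi τ) ∨ ∀ τ, x.phi τ = -y.phi τ := by
  have hp : IsPreconnected (Set.univ : Set ℍ) := isPreconnected_univ
  have := hp.eq_or_eq_neg_of_sq_eq x.continuous_phi.continuousOn y.continuous_phi.continuousOn
    (fun τ _ => by simp only [Pi.pow_apply]; rw [x.sq, y.sq, h]) (fun {τ} _ => y.phi_ne_zero τ)
  rcases this with h1 | h1
  · exact Or.inl fun τ => h1 (Set.mem_univ τ)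
  · exact Or.inr fun τ => h1 (Set.mem_univ τ)

lemma S_mul_S_mat : (S * S).mat = -1 := by
  rw [mul_mat]
  change ModularGroup.S * ModularGroup.S = -1
  ext i j
  fin_cases i <;> fin_cases j <;> decide

lemma S_pow_four_phi (τ : ℍ) : ((S * S) * (S * S)).phi τ = -1 := by
  rw [mul_phi, S_mul_S_mat, ModularGroup.SL_neg_smul, one_smul, ← pow_two, (S * S).sq, S_mul_S_mat]
  simp

lemma S_pow_four_mat : ((S * S) * (S * S)).mat = 1 := by
  rw [mul_mat, S_mul_S_mat]; simp

lemma closure_S_T : Subgroup.closure ({S, T} : Set Mp2Z) = ⊤ := by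
  rw [eq_top_iff]
  intro x _
  have hS : S ∈ Subgroup.closure ({S, T} : Set Mp2Z) := Subgroup.subset_closure (by simp)
  have hmap : (Subgroup.closure ({S, T} : Set Mp2Z)).map matHom = ⊤ := by
    rw [MonoidHom.map_closure, Set.image_pair]
    exact SpecialLinearGroup.SL2Z_generators
  obtain ⟨y, hy, hyx⟩ : x.mat ∈ (Subgroup.closure ({S, T} : Set Mp2Z)).map matHom := by
    rw [hmap]; trivial
  have hyx : y.mat = x.mat := hyx
  rcases phi_eq_or_neg hyx.symm with h | h
  · have : x = y := Mp2Z.ext hyx.symm (funext h)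
    rw [this]; exact hy
  · have : x = ((S * S) * (S * S)) * y := by
      ext1
      · rw [mul_mat, S_pow_four_mat, one_mul, hyx]
      · funext τ
        rw [mul_phi, S_pow_four_phi, h]; ring
    rw [this]
    exact Subgroup.mul_mem _ (Subgroup.mul_mem _ (Subgroup.mul_mem _ hS hS)
      (Subgroup.mul_mem _ hS hS)) hy

end Mp2Z

/-! ### The Weil representation -/

section Weil

variable {bp bm : ℕ} {W : Type*} [AddCommGroup W] [Module ℝ W] {q : QuadraticForm ℝ W}
  {L : AddSubgroup W}

/-- The theta function of an isometry `u`. -/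
def thetaVec (u : q.IsometryEquiv (stdForm bp bm)) (L : AddSubgroup W) (p : Poly bp bm) (τ : ℍ) :
    GroupRing q L :=
  fun γ => ((τ.im ^ ((bm : ℝ) / 2) : ℝ) : ℂ) * thetaSeries u L p τ γ

lemma theta_eq (v₀ : q.IsometryEquiv (stdForm bp bm)) (g : q.IsometryEquiv q) (p : Poly bp bm)
    (τ : ℍ) : theta q v₀ L g p τ = thetaVec (g.symm.trans v₀) L p τ := rfl

/-- The operator of the Weil representation at `T`. -/
def weilT (q : QuadraticForm ℝ W) (L : AddSubgroup W) : GroupRing q L ≃ₗ[ℂ] GroupRing q L :=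
  LinearEquiv.piCongrRight fun γ => LinearEquiv.smulOfNeZero ℂ ℂ (e (q (rep γ) : ℝ)) (e_ne_zero _)

lemma weilT_apply (a : GroupRing q L) (γ : Discr q L) :
    weilT q L a γ = e (q (rep γ) : ℝ) * a γ := rfl

/-- The constant in the operator of the Weil representation at `S`. -/
def weilConst (q : QuadraticForm ℝ W) (L : AddSubgroup W) (sig : ℤ) : ℂ :=
  e (-(sig : ℂ) / 8) / (Real.sqrt (Nat.card (Discr q L)) : ℂ)

lemma weilConst_mul_conj [Finite (Discr q L)] (sig : ℤ) :
    weilConst q L sig * conj (weilConst q L sig) * Nat.card (Discr q L) = 1 := by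
  have hcard : (0 : ℝ) < Nat.card (Discr q L) := by exact_mod_cast Nat.card_pos
  rw [weilConst, map_div₀, Complex.conj_ofReal, conj_e]
  have h1 : e (-(sig : ℂ) / 8) * e (-conj (-(sig : ℂ) / 8)) = 1 := by
    rw [← e_add]
    have : (-(sig : ℂ) / 8) + -conj (-(sig : ℂ) / 8) = 0 := by simp [map_ofNat]
    rw [this, e_zero]
  have h2 : (Real.sqrt (Nat.card (Discr q L)) : ℂ) * Real.sqrt (Nat.card (Discr q L)) =
      Nat.card (Discr q L) := by
    rw [← Complex.ofReal_mul, Real.mul_self_sqrt hcard.le]; simp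
  have h3 : (Nat.card (Discr q L) : ℂ) ≠ 0 := by exact_mod_cast hcard.ne'
  rw [div_mul_div_comm, h1, h2]
  field_simp

lemma thetaSeries_add_one (u : q.IsometryEquiv (stdForm bp bm)) (hL : IsEvenLattice q L)
    (p : Poly bp bm) (z : ℂ) (γ : Discr q L) :
    thetaSeries u L p (z + 1) γ = e (q (rep γ) : ℝ) * thetaSeries u L p z γ := by
  rw [thetaSeries, thetaSeries, ← tsum_mul_left]
  refine tsum_congr fun x => ?_
  have h1 : e (q (rep γ) : ℝ) = e (q (x.1 : W) : ℝ) := by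
    have := e_q_mk hL x.1
    rwa [x.2] at this
  have h2 : gaussV (z + 1) (u (x.1 : W)) = e (q (x.1 : W) : ℝ) * gaussV z (u (x.1 : W)) := by
    rw [gaussV, gaussV, ← e_add, ← u.map_app, stdForm_plusPart, stdForm_minusPart, stdForm_eq]
    congr 1
    simp only [map_add, map_one]
    push_cast
    ring
  rw [thetaKernel, thetaKernel, h1, h2]
  simp only [Complex.add_im, Complex.one_im, add_zero]
  ring

/-- The action of `SL₂(ℤ)` on pairs of dual vectors, twisted such that it describes conjugation of
Heisenberg operators by the Weil representation. -/
def pairAct (M : SL(2, ℤ)) (h : dual q L × dual q L) : dual q L × dual q L :=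
  (M 1 1 • h.1 + M 1 0 • h.2, M 0 1 • h.1 + M 0 0 • h.2)

lemma pairAct_mul (M N : SL(2, ℤ)) (h : dual q L × dual q L) :
    pairAct (M * N) h = pairAct M (pairAct N h) := by
  simp only [pairAct, Matrix.SpecialLinearGroup.coe_mul, Matrix.mul_apply, Fin.sum_univ_two]
  ext1
  · simp only; module
  · simp only; module

lemma pairAct_one (h : dual q L × dual q L) : pairAct 1 h = h := by
  simp [pairAct]

section

variable [Fintype (Discr q L)]

/-- The operator of the Weil representation at `S`, as a linear map. -/
def weilSLin (q : QuadraticForm ℝ W) (L : AddSubgroup W) [Fintype (Discr q L)] (sig : ℤ) :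
    GroupRing q L →ₗ[ℂ] GroupRing q L where
  toFun a := fun δ => weilConst q L sig * ∑ γ, conj (discrPair γ δ) * a γ
  map_add' a b := by
    funext δ
    simp only [Pi.add_apply, mul_add, Finset.sum_add_distrib]
  map_smul' c a := by
    funext δ
    simp only [Pi.smul_apply, smul_eq_mul, RingHom.id_apply, Finset.mul_sum]
    refine Finset.sum_congr rfl fun γ _ => ?_
    ring

lemma innerL_eq (a b : GroupRing q L) : innerL a b = ∑ γ, a γ * conj (b γ) :=
  finsum_eq_sum_of_fintype _

lemma innerL_weilSLin (u : q.IsometryEquiv (stdForm bp bm)) (hL : IsEvenLattice q L) (sig : ℤ)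
    (a b : GroupRing q L) : innerL (weilSLin q L sig a) (weilSLin q L sig b) = innerL a b := by
  classical
  rw [innerL_eq, innerL_eq]
  have h1 : ∀ δ, weilSLin q L sig a δ * conj (weilSLin q L sig b δ) =
      weilConst q L sig * conj (weilConst q L sig) *
        ∑ γ, ∑ γ', (a γ * conj (b γ')) * (discrPair γ' δ * conj (discrPair γ δ)) := by
    intro δ
    change (weilConst q L sig * ∑ γ, conj (discrPair γ δ) * a γ) *
      conj (weilConst q L sig * ∑ γ, conj (discrPair γ δ) * b γ) = _
    rw [map_mul, map_sum, mul_mul_mul_comm, Finset.sum_mul_sum]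
    congr 1
    refine Finset.sum_congr rfl fun γ _ => Finset.sum_congr rfl fun γ' _ => ?_
    rw [map_mul, Complex.conj_conj]
    ring
  rw [Finset.sum_congr rfl fun δ _ => h1 δ, ← Finset.mul_sum, Finset.sum_comm]
  have h2 : ∀ γ, ∑ δ, ∑ γ', (a γ * conj (b γ')) * (discrPair γ' δ * conj (discrPair γ δ)) =
      Nat.card (Discr q L) * (a γ * conj (b γ)) := by
    intro γ
    rw [Finset.sum_comm]
    simp_rw [← Finset.mul_sum, sum_discrPair_conj u hL]
    simp [mul_comm]
  rw [Finset.sum_congr rfl fun γ _ => h2 γ, ← Finset.mul_sum, ← mul_assoc, weilConst_mul_conj,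
    one_mul]

lemma innerL_self_eq_zero {a : GroupRing q L} (h : innerL a a = 0) : a = 0 := by
  rw [innerL_eq] at h
  have h1 : ∑ γ, ‖a γ‖ ^ 2 = 0 := by
    have : ((∑ γ, ‖a γ‖ ^ 2 : ℝ) : ℂ) = 0 := by
      rw [← h]
      push_cast
      refine Finset.sum_congr rfl fun γ _ => ?_
      rw [Complex.mul_conj, Complex.normSq_eq_norm_sq]
      push_cast; rfl
    exact_mod_cast this
  rw [Finset.sum_eq_zero_iff_of_nonneg fun _ _ => sq_nonneg _] at h1
  funext γ
  simpa using h1 γ (Finset.mem_univ γ)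

/-- The operator of the Weil representation at `S`. -/
def weilS (u : q.IsometryEquiv (stdForm bp bm)) (hL : IsEvenLattice q L) (sig : ℤ) :
    GroupRing q L ≃ₗ[ℂ] GroupRing q L :=
  LinearEquiv.ofInjectiveEndo (weilSLin q L sig) (by
    rw [← LinearMap.ker_eq_bot, LinearMap.ker_eq_bot']
    intro a ha
    apply innerL_self_eq_zero
    rw [← innerL_weilSLin u hL sig, ha]
    simp [innerL_eq])

lemma weilS_apply (u : q.IsometryEquiv (stdForm bp bm)) (hL : IsEvenLattice q L) (sig : ℤ)
    (a : GroupRing q L) (δ : Discr q L) :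
    weilS u hL sig a δ = weilConst q L sig * ∑ γ, conj (discrPair γ δ) * a γ := rfl

/-- The Heisenberg operator of a pair of dual vectors. -/
def heisenberg (h : dual q L × dual q L) (a : GroupRing q L) : GroupRing q L := fun δ =>
  discrPair δ (QuotientAddGroup.mk h.2) *
    e (-(QuadraticMap.polar q (h.1 : W) (h.2 : W) / 2 : ℝ)) * a (δ - QuotientAddGroup.mk h.1)

/-- The pairs `(M, A)` for which `A` has the properties of the Weil representation at `M`: it is
unitary, it describes the transformation of all theta functions under `M`, and conjugation by `A`
acts on Heisenberg operators through `M`. These conditions make it a subgroup, so it suffices to check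
them for generators; by the last two it is the graph of a homomorphism. -/
def weilGraph (u : q.IsometryEquiv (stdForm bp bm)) (L : AddSubgroup W) [Fintype (Discr q L)] :
    Subgroup (Mp2Z × (GroupRing q L ≃ₗ[ℂ] GroupRing q L)) where
  carrier := {x | (∀ a b, innerL (x.2 a) (x.2 b) = innerL a b) ∧
    (∀ (k l : ℕ) (p : Poly bp bm), p ∈ bihomogeneous bp bm k l → ∀ τ : ℍ,
      ((x.1.mat • τ).im : ℂ) ^ l • thetaVec u L p (x.1.mat • τ) =
        (x.1.phi τ) ^ (twoWeight bp bm k - 2 * l) •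
          x.2 ((τ.im : ℂ) ^ l • thetaVec u L p τ)) ∧
    ∀ h a, x.2 (heisenberg h a) = heisenberg (pairAct x.1.mat h) (x.2 a)}
  one_mem' := by
    refine ⟨fun a b => rfl, fun k l p hp τ => ?_, fun h a => ?_⟩
    · change ((((1 : SL(2, ℤ)) • τ).im : ℝ) : ℂ) ^ l • thetaVec u L p ((1 : SL(2, ℤ)) • τ) =
        (1 : ℂ) ^ (twoWeight bp bm k - 2 * l) • _
      rw [one_smul, one_zpow, one_smul]
      rfl
    · change _ = heisenberg (pairAct 1 h) _
      rw [pairAct_one]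
      rfl
  mul_mem' := by
    rintro ⟨M, A⟩ ⟨N, B⟩ ⟨h1, h2, h3⟩ ⟨k1, k2, k3⟩
    refine ⟨fun a b => ?_, fun k l p hp τ => ?_, fun h a => ?_⟩
    · exact (h1 _ _).trans (k1 a b)
    · change ((((M.mat * N.mat) • τ).im : ℝ) : ℂ) ^ l • thetaVec u L p ((M.mat * N.mat) • τ) =
        (M.phi (N.mat • τ) * N.phi τ) ^ _ • A (B ((τ.im : ℂ) ^ l • thetaVec u L p τ))
      have e1 := h2 k l p hp (N.mat • τ)
      have e2 := k2 k l p hp τ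
      simp only at e1 e2
      rw [mul_smul, e1, e2, map_smul, smul_smul, mul_zpow]
    · change A (B (heisenberg h a)) = heisenberg (pairAct (M.mat * N.mat) h) (A (B a))
      have e1 := k3 h a
      have e2 := h3 (pairAct N.mat h) (B a)
      simp only at e1 e2
      rw [e1, e2, pairAct_mul]
  inv_mem' := by
    rintro ⟨M, A⟩ ⟨h1, h2, h3⟩
    simp only at h1 h2 h3
    refine ⟨fun a b => ?_, fun k l p hp τ => ?_, fun h a => ?_⟩
    · change innerL (A.symm a) (A.symm b) = _
      rw [← h1, A.apply_symm_apply, A.apply_symm_apply]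
    · change (((M.mat⁻¹ • τ).im : ℝ) : ℂ) ^ l • thetaVec u L p (M.mat⁻¹ • τ) =
        ((M.phi (M.mat⁻¹ • τ))⁻¹) ^ _ • A.symm ((τ.im : ℂ) ^ l • thetaVec u L p τ)
      have e1 := h2 k l p hp (M.mat⁻¹ • τ)
      rw [smul_inv_smul] at e1
      rw [e1, map_smul A.symm (_ ^ _), A.symm_apply_apply, smul_smul, inv_zpow, inv_mul_cancel₀, one_smul]
      exact zpow_ne_zero _ (M.phi_ne_zero _)
    · change A.symm (heisenberg h a) = heisenberg (pairAct M.mat⁻¹ h) (A.symm a)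
      apply A.injective
      rw [A.apply_symm_apply, h3, ← pairAct_mul, mul_inv_cancel, pairAct_one, A.apply_symm_apply]

lemma T_mem_weilGraph (u : q.IsometryEquiv (stdForm bp bm)) (hL : IsEvenLattice q L) :
    ((Mp2Z.T, weilT q L) : Mp2Z × (GroupRing q L ≃ₗ[ℂ] GroupRing q L)) ∈ weilGraph u L := by
  refine ⟨fun a b => ?_, fun k l p hp τ => ?_, fun h a => ?_⟩
  · rw [innerL_eq, innerL_eq]
    refine Finset.sum_congr rfl fun γ _ => ?_
    simp only [weilT_apply, map_mul, conj_e_real]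
    have : e (q (rep γ) : ℝ) * e (-(q (rep γ) : ℝ)) = 1 := by rw [← e_add, add_neg_cancel, e_zero]
    linear_combination (a γ * conj (b γ)) * this
  · change (((ModularGroup.T • τ).im : ℝ) : ℂ) ^ l • thetaVec u L p (ModularGroup.T • τ) =
      (1 : ℂ) ^ _ • weilT q L _
    rw [one_zpow, one_smul, map_smul]
    funext γ
    rw [Pi.smul_apply, Pi.smul_apply, weilT_apply, thetaVec, thetaVec, ModularGroup.im_T_smul]
    have : ((ModularGroup.T • τ : ℍ) : ℂ) = τ + 1 := by
      have := ModularGroup.coe_T_zpow_smul_eq (z := τ) (n := 1)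
      simpa using this
    rw [this, thetaSeries_add_one u hL]
    ring
  · funext δ
    obtain ⟨d, rfl⟩ := exists_mk δ
    have hact : pairAct ModularGroup.T h = (h.1, h.1 + h.2) := by
      simp [pairAct, ModularGroup.T]
    change weilT q L (heisenberg h a) _ = heisenberg (pairAct ModularGroup.T h) (weilT q L a) _
    rw [hact, weilT_apply, heisenberg, heisenberg, weilT_apply, e_q_mk hL]
    simp only
    rw [← QuotientAddGroup.mk_sub, e_q_mk hL, discrPair_mk, discrPair_mk]
    have hq : q ((d - h.1 : dual q L) : W) = q (d : W) -
        QuadraticMap.polar q (d : W) (h.1 : W) + q (h.1 : W) := by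
      have : ((d - h.1 : dual q L) : W) = (d : W) + -(h.1 : W) := by
        rw [← sub_eq_add_neg]; rfl
      rw [this, QuadraticMap.map_add q, QuadraticMap.polar_neg_right, QuadraticMap.map_neg]
      ring
    have h11 : QuadraticMap.polar q (h.1 : W) (h.1 : W) = 2 * q (h.1 : W) := by
      rw [QuadraticMap.polar_self, nsmul_eq_mul, Nat.cast_ofNat]
    have h1 : QuadraticMap.polar q (h.1 : W) ((h.1 + h.2 : dual q L) : W) =
        2 * q (h.1 : W) + QuadraticMap.polar q (h.1 : W) (h.2 : W) := by
      rw [← h11, ← QuadraticMap.polar_add_right]; rfl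
    have h2 : QuadraticMap.polar q (d : W) ((h.1 + h.2 : dual q L) : W) =
        QuadraticMap.polar q (d : W) (h.1 : W) + QuadraticMap.polar q (d : W) (h.2 : W) := by
      rw [← QuadraticMap.polar_add_right]; rfl
    rw [hq, h1, h2, ← mul_assoc, ← mul_assoc, ← mul_assoc, ← e_add, ← e_add, ← e_add, ← e_add]
    congr 2
    push_cast
    ring

lemma gaussFactor_inv {τ : ℂ} (hτ : 0 < τ.im) :
    (-Complex.I * τ) ^ (1 / 2 : ℂ) = e (-1 / 8) * τ ^ (1 / 2 : ℂ) := by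
  have hτ0 : τ ≠ 0 := by rintro rfl; simp at hτ
  have hI : -Complex.I * τ ≠ 0 := mul_ne_zero (neg_ne_zero.mpr Complex.I_ne_zero) hτ0
  rw [Complex.cpow_def_of_ne_zero hI, Complex.cpow_def_of_ne_zero hτ0, e, ← Complex.exp_add]
  have harg := Complex.arg_nonneg_iff.mpr hτ.le
  have hlog : Complex.log (-Complex.I * τ) = Complex.log (-Complex.I) + Complex.log τ := by
    apply Complex.log_mul (neg_ne_zero.mpr Complex.I_ne_zero) hτ0
    rw [Complex.arg_neg_I]
    have h1 := Complex.arg_le_pi τ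
    constructor <;> linarith [Real.pi_pos]
  rw [hlog, Complex.log_neg_I]
  congr 1
  ring

lemma S_mem_weilGraph (u : q.IsometryEquiv (stdForm bp bm)) (hL : IsEvenLattice q L) :
    ((Mp2Z.S, weilS u hL ((bp : ℤ) - bm)) : Mp2Z × (GroupRing q L ≃ₗ[ℂ] GroupRing q L)) ∈
      weilGraph u L := by
  refine ⟨fun a b => innerL_weilSLin u hL _ a b, fun k l p hp τ => ?_, fun h a => ?_⟩
  · change (((ModularGroup.S • τ).im : ℝ) : ℂ) ^ l • thetaVec u L p (ModularGroup.S • τ) =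
      ((τ : ℂ) ^ (1 / 2 : ℂ)) ^ _ • weilS u hL _ ((τ.im : ℂ) ^ l • thetaVec u L p τ)
    funext γ
    rw [map_smul]
    have hτ0 : (τ : ℂ) ≠ 0 := τ.ne_zero
    set s := (τ : ℂ) ^ (1 / 2 : ℂ) with hs
    have hs2 : s ^ 2 = τ := by
      rw [hs, ← Complex.cpow_nat_mul]; norm_num
    have hs0 : s ≠ 0 := by
      intro h
      rw [h] at hs2
      exact hτ0 (by rw [← hs2]; simp)
    have hcs0 : conj s ≠ 0 := by simpa using hs0
    set ε := e (-1 / 8) with hε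
    have hε0 : ε ≠ 0 := e_ne_zero _
    have hεc : conj ε = ε⁻¹ := by
      apply eq_inv_of_mul_eq_one_left
      rw [hε, conj_e, ← e_add]
      simp [map_ofNat, e_zero]
    have hg : gaussFactor τ = 1 / (ε * s) := by rw [gaussFactor, gaussFactor_inv τ.im_pos]
    have hSτ : ((ModularGroup.S • τ : ℍ) : ℂ) = -1 / τ := by
      rw [UpperHalfPlane.modular_S_smul, neg_div, one_div, ← inv_neg]
    have him : (((ModularGroup.S • τ : ℍ).im ^ ((bm : ℝ) / 2) : ℝ) : ℂ) =
        ((τ.im ^ ((bm : ℝ) / 2) : ℝ) : ℂ) / (s * conj s) ^ bm := by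
      have h1 : (ModularGroup.S • τ : ℍ).im = τ.im / ‖s‖ ^ 4 := by
        have : ‖s‖ ^ 4 = Complex.normSq τ := by
          rw [Complex.normSq_eq_norm_sq, ← hs2, norm_pow]; ring
        rw [this, ← UpperHalfPlane.coe_im, hSτ, neg_div, Complex.neg_im, one_div, Complex.inv_im]
        simp [neg_div]
      have h2 : (‖s‖ ^ 4 : ℝ) ^ ((bm : ℝ) / 2) = (‖s‖ ^ 2) ^ bm := by
        rw [show (‖s‖ ^ 4 : ℝ) = (‖s‖ ^ 2) ^ (2 : ℝ) by norm_cast; ring, ← Real.rpow_mul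
          (by positivity), mul_div_cancel₀ _ two_ne_zero, Real.rpow_natCast]
      rw [h1, Real.div_rpow τ.im_pos.le (by positivity), h2, Complex.mul_conj,
        Complex.normSq_eq_norm_sq]
      push_cast
      rfl
    have himl : ((ModularGroup.S • τ : ℍ).im : ℂ) = τ.im / (s * conj s) ^ 2 := by
      have h1 : (ModularGroup.S • τ : ℍ).im = τ.im / (‖s‖ ^ 2) ^ 2 := by
        have : (‖s‖ ^ 2) ^ 2 = Complex.normSq τ := by
          rw [Complex.normSq_eq_norm_sq, ← hs2, norm_pow]
        rw [this, ← UpperHalfPlane.coe_im, hSτ, neg_div, Complex.neg_im, one_div, Complex.inv_im]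
        simp [neg_div]
      rw [h1, Complex.mul_conj, Complex.normSq_eq_norm_sq]
      push_cast
      rfl
    have hsig : e (-((bp : ℤ) - bm : ℤ) / 8) = ε ^ bp / ε ^ bm := by
      have hpow : ∀ n : ℕ, ε ^ n = e (-n / 8) := by
        intro n
        rw [hε, e, e, ← Complex.exp_nat_mul]
        congr 1; ring
      rw [hpow, hpow, eq_div_iff (e_ne_zero _), ← e_add]
      congr 1; push_cast; ring
    have hw : s ^ (twoWeight bp bm k - 2 * l) = s ^ (2 * k) * s ^ bp / s ^ bm / s ^ (2 * l) := by
      rw [twoWeight, zpow_sub₀ hs0, zpow_add₀ hs0, zpow_sub₀ hs0]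
      norm_cast
      rw [mul_div_assoc, mul_div_assoc, mul_div_assoc]
    rw [Pi.smul_apply, Pi.smul_apply, Pi.smul_apply, weilS_apply, thetaVec, himl, hSτ, thetaSeries_inversion u hL hp τ.im_pos, him, hg,
      weilConst, hsig, smul_eq_mul, smul_eq_mul, smul_eq_mul, hw]
    simp only [thetaVec, map_div₀, map_one, map_mul, hεc]
    have hsum : ∑ δ, conj (discrPair δ γ) *
        (((τ.im ^ ((bm : ℝ) / 2) : ℝ) : ℂ) * thetaSeries u L p τ δ) =
        ((τ.im ^ ((bm : ℝ) / 2) : ℝ) : ℂ) * ∑ δ, conj (discrPair γ δ) * thetaSeries u L p τ δ := by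
      rw [Finset.mul_sum]
      refine Finset.sum_congr rfl fun δ _ => ?_
      rw [discrPair_comm]; ring
    rw [hsum, show (τ : ℂ) ^ k = s ^ (2 * k) by rw [pow_mul, hs2],
      show conj (τ : ℂ) ^ l = conj s ^ (2 * l) by rw [pow_mul, ← map_pow conj s, hs2]]
    push_cast
    generalize ∑ δ, conj (discrPair γ δ) * thetaSeries u L p τ δ = X
    generalize ((τ.im ^ ((bm : ℝ) / 2) : ℝ) : ℂ) = Y
    have hcard : (0 : ℝ) < Nat.card (Discr q L) := by exact_mod_cast Nat.card_pos
    have hq : (Real.sqrt (Nat.card (Discr q L)) : ℂ) ≠ 0 := by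
      have := Real.sqrt_pos.mpr hcard
      exact_mod_cast this.ne'
    simp only [mul_pow, div_pow, one_pow, inv_pow, ← pow_mul]
    field_simp
  · funext δ
    have hact : pairAct ModularGroup.S h = (h.2, -h.1) := by
      simp [pairAct, ModularGroup.S]
    change weilS u hL _ (heisenberg h a) _ = heisenberg (pairAct ModularGroup.S h) (weilS u hL _ a) _
    rw [hact, weilS_apply, heisenberg, weilS_apply]
    rw [mul_left_comm (_ * _) (weilConst q L _)]
    congr 1
    rw [Finset.mul_sum]
    rw [← Equiv.sum_comp (Equiv.addRight (QuotientAddGroup.mk h.1 : Discr q L))]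
    refine Finset.sum_congr rfl fun γ _ => ?_
    simp only [heisenberg, Equiv.coe_addRight, add_sub_cancel_right]
    have h1 : discrPair (QuotientAddGroup.mk h.1 : Discr q L) (QuotientAddGroup.mk h.2) *
        e (-(QuadraticMap.polar q (h.1 : W) (h.2 : W) / 2 : ℝ)) =
        e (-(QuadraticMap.polar q (h.2 : W) ((-h.1 : dual q L) : W) / 2 : ℝ)) := by
      have : QuadraticMap.polar q (h.2 : W) ((-h.1 : dual q L) : W) =
          -QuadraticMap.polar q (h.1 : W) (h.2 : W) := by
        rw [QuadraticMap.polar_comm, ← QuadraticMap.polar_neg_left]; rfl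
      rw [discrPair_mk, this, ← e_add]
      congr 1; push_cast; ring
    rw [← h1, QuotientAddGroup.mk_neg, discrPair_comm δ, discrPair_neg_left, discrPair_add_left,
      discrPair_add_left, sub_eq_add_neg, discrPair_add_right, discrPair_comm γ (-_),
      discrPair_neg_left, map_mul, map_mul, Complex.conj_conj,
      discrPair_comm γ (QuotientAddGroup.mk h.2)]
    ring

end

end Weil

/-! ### Existence of the Weil representation -/

section WeilExistence

variable {bp bm : ℕ} {W : Type*} [AddCommGroup W] [Module ℝ W] {q : QuadraticForm ℝ W}
  {L : AddSubgroup W}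

/-- An operator over the identity commutes with the diagonal Heisenberg operators, hence is diagonal,
and it fixes a vector none of whose components vanishes. -/
lemma eq_one_of_mem_weilGraph [Fintype (Discr q L)] (u : q.IsometryEquiv (stdForm bp bm))
    (hL : IsEvenLattice q L) {A : GroupRing q L ≃ₗ[ℂ] GroupRing q L}
    (h : ((1, A) : Mp2Z × (GroupRing q L ≃ₗ[ℂ] GroupRing q L)) ∈ weilGraph u L) : A = 1 := by
  classical
  obtain ⟨-, h2, h3⟩ := h
  have hdiag : ∀ γ δ, δ ≠ γ → A (basisVec γ) δ = 0 := by
    intro γ δ hne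
    obtain ⟨v, hv⟩ := exists_discrPair_ne_one u hL (sub_ne_zero.mpr hne)
    obtain ⟨v, rfl⟩ := exists_mk v
    have e1 := congrFun (h3 (0, v) (basisVec γ)) δ
    have e2 : ∀ a : GroupRing q L, heisenberg (0, v) a =
        fun δ => discrPair δ (QuotientAddGroup.mk v) * a δ := by
      intro a
      funext δ
      simp [heisenberg, e_zero]
    have e3 : heisenberg (0, v) (basisVec γ) =
        discrPair γ (QuotientAddGroup.mk v) • (basisVec γ : GroupRing q L) := by
      rw [e2]
      funext δ'
      by_cases hδ : δ' = γ
      · subst hδ; simp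
      · simp [basisVec, hδ]
    have e4 : pairAct (1 : SL(2, ℤ)) ((0, v) : dual q L × dual q L) = (0, v) := pairAct_one _
    change A (heisenberg (0, v) (basisVec γ)) δ =
      heisenberg (pairAct (1 : SL(2, ℤ)) (0, v)) (A (basisVec γ)) δ at e1
    rw [e4, e3, map_smul, e2, Pi.smul_apply, smul_eq_mul] at e1
    by_contra h0
    apply hv
    have e5 := mul_right_cancel₀ h0 e1
    rw [sub_eq_add_neg, discrPair_add_left, discrPair_neg_left, ← e5, Complex.mul_conj,
      Complex.normSq_eq_norm_sq, norm_discrPair]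
    simp
  have hA : ∀ a γ, A a γ = a γ * A (basisVec γ) γ := by
    intro a γ
    have : a = ∑ δ, a δ • (basisVec δ : GroupRing q L) := by
      simp only [basisVec]
      exact pi_eq_sum_univ' a
    conv_lhs => rw [this, map_sum, Finset.sum_apply]
    rw [Finset.sum_eq_single γ]
    · rw [map_smul, Pi.smul_apply, smul_eq_mul]
    · intro δ _ hδ
      rw [map_smul, Pi.smul_apply, hdiag δ γ hδ.symm, smul_zero]
    · simp
  have hc : ∀ γ, A (basisVec γ) γ = 1 := by
    intro γ
    have e1 := congrFun (h2 0 0 1 one_mem_bihomogeneous I) γ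
    change (1 • thetaVec u L 1 ((1 : SL(2, ℤ)) • I)) γ =
      ((1 : ℂ) ^ _ • A (1 • thetaVec u L 1 I)) γ at e1
    rw [one_smul, one_smul, one_smul, one_zpow, one_smul, hA] at e1
    have hne : thetaVec u L 1 I γ ≠ 0 := by
      obtain ⟨r, hr, hr'⟩ := thetaSeries_one_I u hL γ
      rw [thetaVec, show ((I : ℍ) : ℂ) = Complex.I from rfl, hr']
      simp [hr.ne']
    exact (mul_right_eq_self₀.mp e1.symm).resolve_right hne
  refine LinearEquiv.ext fun a => funext fun γ => ?_
  rw [hA, hc, mul_one]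
  rfl

lemma weilT_basisVec (γ : Discr q L) :
    weilT q L (basisVec γ) = e (q (rep γ) : ℝ) • (basisVec γ : GroupRing q L) := by
  classical
  funext δ
  rw [weilT_apply, Pi.smul_apply, smul_eq_mul]
  by_cases hδ : δ = γ
  · rw [hδ]
  · simp [basisVec, hδ]

lemma weilS_basisVec [Fintype (Discr q L)] (u : q.IsometryEquiv (stdForm bp bm))
    (hL : IsEvenLattice q L) (sig : ℤ) (γ : Discr q L) :
    weilS u hL sig (basisVec γ) =
      (e (-(sig : ℂ) / 8) / (Real.sqrt (Nat.card (Discr q L)) : ℂ)) •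
      (fun δ : Discr q L => e (-(QuadraticMap.polar q (rep γ) (rep δ) : ℝ)) :
        GroupRing q L) := by
  classical
  funext δ
  rw [weilS_apply, Pi.smul_apply, smul_eq_mul, weilConst, Finset.sum_eq_single γ]
  · rw [discrPair, conj_e_real]
    simp [basisVec]
  · intro δ' _ hδ'
    simp [basisVec, hδ'.symm]
  · simp

lemma exists_isWeilRep (u : q.IsometryEquiv (stdForm bp bm)) (hL : IsEvenLattice q L) :
    ∃ ρ, IsWeilRep q L ((bp : ℤ) - bm) ρ := by
  have := finite_discr u hL
  have := Fintype.ofFinite (Discr q L)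
  let f : weilGraph u L →* Mp2Z := (MonoidHom.fst _ _).comp (weilGraph u L).subtype
  have hinj : Function.Injective f := by
    rw [injective_iff_map_eq_one]
    rintro ⟨⟨M, A⟩, hx⟩ (rfl : M = 1)
    have := eq_one_of_mem_weilGraph u hL hx
    subst this
    rfl
  have hsurj : Function.Surjective f := by
    rw [← MonoidHom.range_eq_top, eq_top_iff, ← Mp2Z.closure_S_T, Subgroup.closure_le]
    rintro x (rfl | rfl)
    · exact ⟨⟨_, S_mem_weilGraph u hL⟩, rfl⟩
    · exact ⟨⟨_, T_mem_weilGraph u hL⟩, rfl⟩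
  let φ := MulEquiv.ofBijective f ⟨hinj, hsurj⟩
  refine ⟨((MonoidHom.snd _ _).comp (weilGraph u L).subtype).comp φ.symm.toMonoidHom,
    fun γ => ?_, fun γ => ?_⟩
  · have h1 : φ.symm Mp2Z.T = ⟨_, T_mem_weilGraph u hL⟩ := by
      rw [MulEquiv.symm_apply_eq]; rfl
    change (φ.symm Mp2Z.T).1.2 (basisVec γ) = _
    rw [h1]
    exact weilT_basisVec γ
  · have h1 : φ.symm Mp2Z.S = ⟨_, S_mem_weilGraph u hL⟩ := by
      rw [MulEquiv.symm_apply_eq]; rfl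
    change (φ.symm Mp2Z.S).1.2 (basisVec γ) = _
    rw [h1]
    exact weilS_basisVec u hL _ γ

lemma isWeilRep_weilRep (u : q.IsometryEquiv (stdForm bp bm)) (hL : IsEvenLattice q L) :
    IsWeilRep q L ((bp : ℤ) - bm) (weilRep q L ((bp : ℤ) - bm)) := by
  rw [weilRep, dif_pos (exists_isWeilRep u hL)]
  exact (exists_isWeilRep u hL).choose_spec

lemma groupRing_equiv_ext [Finite (Discr q L)] {A B : GroupRing q L ≃ₗ[ℂ] GroupRing q L}
    (h : ∀ γ, A (basisVec γ) = B (basisVec γ)) : A = B := by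
  classical
  have : A.toLinearMap = B.toLinearMap := (Pi.basisFun ℂ (Discr q L)).ext fun γ => by
    rw [Pi.basisFun_apply]
    have := h γ
    simp only [basisVec] at this
    convert this <;> rfl
  exact LinearEquiv.toLinearMap_injective this

lemma weilRep_T (u : q.IsometryEquiv (stdForm bp bm)) (hL : IsEvenLattice q L) :
     weilRep q L ((bp : ℤ) - bm) Mp2Z.T = weilT q L := by
  have := finite_discr u hL
  refine groupRing_equiv_ext fun γ => ?_
  rw [(isWeilRep_weilRep u hL).1 γ, weilT_basisVec]

lemma weilRep_S [Fintype (Discr q L)] (u : q.IsometryEquiv (stdForm bp bm)) (hL : IsEvenLattice q L) :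
    weilRep q L ((bp : ℤ) - bm) Mp2Z.S = weilS u hL ((bp : ℤ) - bm) := by
  refine groupRing_equiv_ext fun γ => ?_
  rw [(isWeilRep_weilRep u hL).2 γ, weilS_basisVec]

lemma weilRep_mem_weilGraph [Fintype (Discr q L)] (u : q.IsometryEquiv (stdForm bp bm)) (hL : IsEvenLattice q L)
    (M : Mp2Z) :
    ((M, weilRep q L ((bp : ℤ) - bm) M) : Mp2Z × (GroupRing q L ≃ₗ[ℂ] GroupRing q L)) ∈
      weilGraph u L := by
  let F : Mp2Z →* Mp2Z × (GroupRing q L ≃ₗ[ℂ] GroupRing q L) :=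
    (MonoidHom.id _).prod (weilRep q L ((bp : ℤ) - bm))
  have h : (⊤ : Subgroup Mp2Z) ≤ (weilGraph u L).comap F := by
    rw [← Mp2Z.closure_S_T, Subgroup.closure_le]
    rintro x (rfl | rfl)
    · change (Mp2Z.S, weilRep q L ((bp : ℤ) - bm) Mp2Z.S) ∈ weilGraph u L
      rw [weilRep_S u hL]
      exact S_mem_weilGraph u hL
    · change (Mp2Z.T, weilRep q L ((bp : ℤ) - bm) Mp2Z.T) ∈ weilGraph u L
      rw [weilRep_T u hL]
      exact T_mem_weilGraph u hL
  exact h (Subgroup.mem_top M)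

lemma innerL_weilRep (u : q.IsometryEquiv (stdForm bp bm)) (hL : IsEvenLattice q L)
    (M : Mp2Z) (a b : GroupRing q L) :
    innerL (weilRep q L ((bp : ℤ) - bm) M a) (weilRep q L ((bp : ℤ) - bm) M b) = innerL a b := by
  have := finite_discr u hL
  have := Fintype.ofFinite (Discr q L)
  exact (weilRep_mem_weilGraph u hL M).1 a b

lemma innerL_weilRep_inv (u : q.IsometryEquiv (stdForm bp bm)) (hL : IsEvenLattice q L)
    (M : Mp2Z) (a b : GroupRing q L) :
    innerL ((weilRep q L ((bp : ℤ) - bm) M)⁻¹ a) b =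
      innerL a (weilRep q L ((bp : ℤ) - bm) M b) := by
  rw [← innerL_weilRep u hL M]
  congr 1
  exact LinearEquiv.apply_symm_apply _ a

lemma thetaVec_smul (u : q.IsometryEquiv (stdForm bp bm)) (hL : IsEvenLattice q L)
    {k l : ℕ} {p : Poly bp bm} (hp : p ∈ bihomogeneous bp bm k l) (M : Mp2Z)
    (τ : ℍ) : ((M.mat • τ).im : ℂ) ^ l • thetaVec u L p (M.mat • τ) =
      (M.phi τ) ^ (twoWeight bp bm k - 2 * l) •
        weilRep q L ((bp : ℤ) - bm) M ((τ.im : ℂ) ^ l • thetaVec u L p τ) := by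
  have := finite_discr u hL
  have := Fintype.ofFinite (Discr q L)
  exact (weilRep_mem_weilGraph u hL M).2.1 k l p hp τ

end WeilExistence

/-! ### Cosets of the stabilizer of the cusp -/

namespace Mp2Z

lemma T_zpow_mat (n : ℤ) : (T ^ n).mat = ModularGroup.T ^ n :=
  map_zpow matHom T n

lemma T_zpow_phi (n : ℤ) (τ : ℍ) : (T ^ n).phi τ = 1 := by
  have hT : ∀ τ, T.phi τ = 1 := fun _ => rfl
  induction n using Int.induction_on generalizing τ with
  | zero => rfl
  | succ n ih => rw [zpow_add_one, mul_phi, ih, hT, one_mul]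
  | pred n ih => rw [zpow_sub_one, mul_phi, ih, inv_phi, hT, inv_one, one_mul]

lemma norm_phi_pow_four (x : Mp2Z) (τ : ℍ) : ‖x.phi τ‖ ^ 4 =
    ((x.mat 1 0 : ℝ) * τ.re + x.mat 1 1) ^ 2 + ((x.mat 1 0 : ℝ) * τ.im) ^ 2 := by
  rw [show ‖x.phi τ‖ ^ 4 = ‖x.phi τ ^ 2‖ ^ 2 by rw [norm_pow]; ring, x.sq,
    ← Complex.normSq_eq_norm_sq, Complex.normSq_apply]
  simp
  ring

lemma norm_phi_pos (x : Mp2Z) (τ : ℍ) : 0 < ‖x.phi τ‖ := norm_pos_iff.mpr (x.phi_ne_zero τ)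

lemma im_smul_eq (x : Mp2Z) (τ : ℍ) : (x.mat • τ).im = τ.im / ‖x.phi τ‖ ^ 4 := by
  rw [ModularGroup.im_smul_eq_div_normSq, Complex.normSq_eq_norm_sq, ← x.sq' τ, norm_pow]
  ring

open Classical in
/-- The bottom row of the matrix together with the choice of the square root: a complete invariant
of an element of `Mp₂(ℤ)` modulo `⟨T⟩` from the left. -/
def cuspInvariant (x : Mp2Z) : ℤ × ℤ × Bool :=
  (x.mat 1 0, x.mat 1 1, decide (x.phi I = (denom (x.mat : GL (Fin 2) ℝ) I) ^ (1 / 2 : ℂ)))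

lemma exists_T_zpow_of_cuspInvariant {x y : Mp2Z} (h : cuspInvariant x = cuspInvariant y) :
    ∃ n : ℤ, y = T ^ n * x := by
  classical
  simp only [cuspInvariant, Prod.mk.injEq, decide_eq_decide] at h
  obtain ⟨h0, h1, h2⟩ := h
  have hdx := Matrix.det_fin_two x.mat.1
  have hdy := Matrix.det_fin_two y.mat.1
  rw [x.mat.2] at hdx
  rw [y.mat.2] at hdy
  set n : ℤ := y.mat 0 1 * x.mat 0 0 - y.mat 0 0 * x.mat 0 1 with hn
  have hmat : y.mat = ModularGroup.T ^ n * x.mat := by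
    apply Subtype.ext
    rw [Matrix.SpecialLinearGroup.coe_mul, ModularGroup.coe_T_zpow]
    ext i j
    fin_cases i <;> fin_cases j
    · simp [Matrix.mul_apply, Fin.sum_univ_two]
      rw [← h0, ← h1] at hdy
      rw [hn]
      linear_combination (y.mat.1 0 0) * hdx - (x.mat.1 0 0) * hdy
    · simp [Matrix.mul_apply, Fin.sum_univ_two]
      rw [← h0, ← h1] at hdy
      rw [hn]
      linear_combination (y.mat.1 0 1) * hdx - (x.mat.1 0 1) * hdy
    · simp [Matrix.mul_apply, Fin.sum_univ_two]
      exact h0.symm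
    · simp [Matrix.mul_apply, Fin.sum_univ_two]
      exact h1.symm
  have hmat' : y.mat = (T ^ n * x).mat := by rw [mul_mat, T_zpow_mat, hmat]
  refine ⟨n, Mp2Z.ext hmat' (funext fun τ => ?_)⟩
  have hphi : ∀ τ, (T ^ n * x).phi τ = x.phi τ := fun τ => by rw [mul_phi, T_zpow_phi, one_mul]
  rcases phi_eq_or_neg hmat' with h | h
  · exact h τ
  · exfalso
    simp only [hphi] at h
    have hD : denom (y.mat : GL (Fin 2) ℝ) I = denom (x.mat : GL (Fin 2) ℝ) I := by
      rw [ModularGroup.denom_apply, ModularGroup.denom_apply, h0, h1]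
    rw [hD] at h2
    set r := (denom (x.mat : GL (Fin 2) ℝ) I) ^ (1 / 2 : ℂ)
    have hr2 : r ^ 2 = denom (x.mat : GL (Fin 2) ℝ) I := by
      rw [← Complex.cpow_nat_mul]; norm_num
    have hx : x.phi I = r ∨ x.phi I = -r := by
      rw [← sq_eq_sq_iff_eq_or_eq_neg, hr2, x.sq']
    have hx0 := x.phi_ne_zero I
    have hI := h I
    rcases hx with hx | hx
    · have := h2.mp hx
      rw [hI, hx, neg_eq_iff_add_eq_zero, ← two_mul] at this
      rw [hx] at hx0
      simp [hx0] at this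
    · have := h2.mpr (by rw [hI, hx, neg_neg])
      rw [hx, neg_eq_iff_add_eq_zero, ← two_mul] at this
      simp at this
      rw [hx, this] at hx0
      simp at hx0

lemma cuspInvariant_out_injective :
    Function.Injective fun c : CuspCosets => cuspInvariant (Quotient.out c) := by
  intro c d h
  obtain ⟨n, hn⟩ := exists_T_zpow_of_cuspInvariant h
  rw [← Quotient.out_eq c, ← Quotient.out_eq d]
  refine Quotient.sound (s := QuotientGroup.rightRel (Subgroup.zpowers Mp2Z.T)) ?_
  rw [← Quotient.eq_iff_equiv, Quotient.eq, QuotientGroup.rightRel_apply, hn, mul_inv_cancel_right]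
  exact ⟨n, rfl⟩

end Mp2Z

/-! ### A majorant for sums over the cosets -/

/-- The majorant `(1 + |c|)^{-2a} (1 + |d|)^{-2b}`. -/
def majorant (a b : ℝ) (x : Mp2Z) : ℝ :=
  (1 + |(x.mat 1 0 : ℝ)|) ^ (-(2 * a)) * (1 + |(x.mat 1 1 : ℝ)|) ^ (-(2 * b))

lemma majorant_pos (a b : ℝ) (x : Mp2Z) : 0 < majorant a b x := by
  rw [majorant]; positivity

lemma summable_int_rpow {s : ℝ} (hs : 1 < s) : Summable fun n : ℤ => (1 + |(n : ℝ)|) ^ (-s) := by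
  have h : Summable fun n : ℕ => (1 + |((n : ℤ) : ℝ)|) ^ (-s) := by
    have h1 := (Real.summable_nat_rpow.mpr (neg_lt_neg hs)).comp_injective Nat.succ_injective
    refine h1.congr fun n => ?_
    simp [add_comm]
  refine Summable.of_nat_of_neg h ?_
  simpa using h

lemma summable_majorant {a b : ℝ} (ha : 1 < 2 * a) (hb : 1 < 2 * b) :
    Summable fun c : CuspCosets => majorant a b (Quotient.out c) := by
  have h1 : Summable fun x : ℤ × ℤ × Bool =>
      (1 + |(x.1 : ℝ)|) ^ (-(2 * a)) * (1 + |(x.2.1 : ℝ)|) ^ (-(2 * b)) := by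
    refine (summable_int_rpow ha).mul_of_nonneg
      (g := fun x : ℤ × Bool => (1 + |(x.1 : ℝ)|) ^ (-(2 * b))) ?_ (fun _ => by positivity)
      (fun _ => by positivity)
    have := (summable_int_rpow hb).mul_of_nonneg (g := fun _ : Bool => (1 : ℝ))
      (hasSum_fintype _).summable (fun _ => by positivity)
      (fun _ => zero_le_one)
    simpa using this
  have h2 : ∀ x : Mp2Z, majorant a b x = (1 + |((Mp2Z.cuspInvariant x).1 : ℝ)|) ^ (-(2 * a)) *
      (1 + |((Mp2Z.cuspInvariant x).2.1 : ℝ)|) ^ (-(2 * b)) := fun x => by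
    simp only [majorant, Mp2Z.cuspInvariant]
  simp only [h2]
  exact h1.comp_injective Mp2Z.cuspInvariant_out_injective

lemma rpow_mul_exp_neg_le {s c y : ℝ} (hs : 0 < s) (hc : 0 < c) (hy : 0 < y) :
    y ^ s * Real.exp (-(c * y)) ≤ (s / c) ^ s := by
  have h1 : (c * y / s) ^ s ≤ Real.exp (c * y) := by
    have h2 : c * y / s ≤ Real.exp (c * y / s) := by
      linarith [Real.add_one_le_exp (c * y / s)]
    calc (c * y / s) ^ s ≤ (Real.exp (c * y / s)) ^ s :=
          Real.rpow_le_rpow (by positivity) h2 hs.le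
      _ = Real.exp (c * y) := by
          rw [← Real.exp_mul]; congr 1; field_simp
  have h3 : y ^ s = (s / c) ^ s * (c * y / s) ^ s := by
    rw [← Real.mul_rpow (by positivity) (by positivity)]
    congr 1; field_simp
  rw [h3, mul_assoc, Real.exp_neg]
  refine mul_le_of_le_one_right (by positivity) ?_
  rw [← div_eq_mul_inv, div_le_one (Real.exp_pos _)]
  exact h1

/-- The terms of a Poincaré series are dominated, uniformly for `|x| ≤ A` and `y ≥ B`, by the
majorant times a power of `y`. -/
lemma exists_majorant_bound {a b A B m : ℝ} (ha : 0 < a) (hb : 0 < b) (hB : 0 < B) (hm : 0 < m) :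
    ∃ K : ℝ, 0 ≤ K ∧ ∀ (x : Mp2Z) (τ : ℍ), |τ.re| ≤ A → B ≤ τ.im →
      (‖x.phi τ‖ ^ 4) ^ (-(a + b)) * Real.exp (-(2 * Real.pi * m * (x.mat • τ).im)) ≤
        K * majorant a b x * τ.im ^ (-(2 * a)) := by
  set κ : ℝ := 2 / B ^ 2 + 4 + 4 * A ^ 2 / B ^ 2 with hκ
  have hκ0 : 0 < κ := by positivity
  set K1 : ℝ := 2 ^ (2 * a) * κ ^ b
  set K2 : ℝ := 2 ^ (2 * b) * (2 * a / (2 * Real.pi * m)) ^ (2 * a)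
  refine ⟨K1 + K2, by positivity, fun x τ hA hBτ => ?_⟩
  have hy := τ.im_pos
  set N := ‖x.phi τ‖ ^ 4 with hN
  have hN0 : 0 < N := pow_pos (x.norm_phi_pos τ) 4
  have hNeq := x.norm_phi_pow_four τ
  rw [← hN] at hNeq
  have hu : 0 < majorant a b x := majorant_pos a b x
  have hyp : 0 < τ.im ^ (-(2 * a)) := by positivity
  have hK1 : 0 ≤ K1 := by positivity
  have hK2 : 0 ≤ K2 := by positivity
  rw [mul_assoc (K1 + K2), add_mul]
  -- for `c = 0` the exponential supplies the decay in `y`, for `c ≠ 0` the automorphy factor does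
  by_cases hc : x.mat 1 0 = 0
  · have hd : |(x.mat 1 1 : ℝ)| = 1 := by
      have := Matrix.det_fin_two x.mat.1
      rw [x.mat.2, hc, mul_zero, sub_zero] at this
      have h1 : IsUnit (x.mat 1 1) := IsUnit.of_mul_eq_one_right _ this.symm
      rcases Int.isUnit_iff.mp h1 with h | h <;> rw [h] <;> simp
    have hN1 : N = 1 := by
      rw [hNeq, hc, Int.cast_zero, zero_mul, zero_mul, zero_add, ← sq_abs, hd]; simp
    have h1 : K2 * (majorant a b x * τ.im ^ (-(2 * a))) =
        (2 * a / (2 * Real.pi * m)) ^ (2 * a) * τ.im ^ (-(2 * a)) := by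
      rw [majorant, hc, hd, Int.cast_zero, abs_zero, add_zero, Real.one_rpow, one_mul, one_add_one_eq_two,
        ← mul_assoc]
      congr 1
      rw [mul_right_comm, ← Real.rpow_add two_pos, add_neg_cancel, Real.rpow_zero, one_mul]
    have h2 := rpow_mul_exp_neg_le (s := 2 * a) (c := 2 * Real.pi * m) (by positivity)
      (by positivity) hy
    have h3 : Real.exp (-(2 * Real.pi * m * τ.im)) ≤
        (2 * a / (2 * Real.pi * m)) ^ (2 * a) * τ.im ^ (-(2 * a)) := by
      rw [Real.rpow_neg hy.le, ← div_eq_mul_inv, le_div_iff₀ (by positivity), mul_comm]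
      exact h2
    rw [hN1, Real.one_rpow, one_mul, x.im_smul_eq, ← hN, hN1, div_one]
    have : 0 ≤ K1 * (majorant a b x * τ.im ^ (-(2 * a))) := by positivity
    rw [h1]
    linarith
  · have hc1 : (1 : ℝ) ≤ |(x.mat 1 0 : ℝ)| := by
      exact_mod_cast Int.one_le_abs hc
    have hc2 : (1 : ℝ) ≤ (x.mat 1 0 : ℝ) ^ 2 := by
      rw [← sq_abs]; nlinarith
    set c : ℝ := (x.mat 1 0 : ℝ)
    set d : ℝ := (x.mat 1 1 : ℝ)
    have h1 : (|c| * τ.im) ^ 2 ≤ N := by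
      rw [hNeq, mul_pow, sq_abs, mul_pow]; nlinarith [sq_nonneg (c * τ.re + d)]
    have hcB : c ^ 2 * B ^ 2 ≤ N := by
      refine le_trans ?_ h1
      rw [mul_pow, sq_abs]
      gcongr
    have h2 : (1 + |d|) ^ 2 ≤ κ * N := by
      have e1 : (1 + |d|) ^ 2 ≤ 2 + 2 * d ^ 2 := by
        nlinarith [sq_nonneg (1 - |d|), sq_abs d]
      have e2 : d ^ 2 ≤ 2 * (c * τ.re + d) ^ 2 + 2 * (c ^ 2 * A ^ 2) := by
        have : τ.re ^ 2 ≤ A ^ 2 := by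
          rw [← sq_abs]; exact pow_le_pow_left₀ (abs_nonneg _) hA 2
        nlinarith [sq_nonneg (2 * (c * τ.re) + d), mul_le_mul_of_nonneg_left this (sq_nonneg c)]
      have e3 : (c * τ.re + d) ^ 2 ≤ N := by rw [hNeq]; nlinarith [sq_nonneg (c * τ.im)]
      have e4 : c ^ 2 ≤ N / B ^ 2 := by rw [le_div_iff₀ (by positivity)]; exact hcB
      have e5 : 1 ≤ N / B ^ 2 := hc2.trans e4
      have e6 : c ^ 2 * A ^ 2 ≤ N / B ^ 2 * A ^ 2 := mul_le_mul_of_nonneg_right e4 (sq_nonneg _)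
      have e7 : κ * N = 2 * (N / B ^ 2) + 4 * N + 4 * (N / B ^ 2 * A ^ 2) := by
        rw [hκ]; field_simp
      rw [e7]
      linarith
    have hd0 : 0 < 1 + |d| := by positivity
    have hN1 : N ^ (-a) ≤ (|c| * τ.im) ^ (-(2 * a)) := by
      rw [show -(2 * a) = 2 * (-a) by ring, Real.rpow_mul (by positivity), Real.rpow_two]
      exact Real.rpow_le_rpow_of_nonpos (by positivity) h1 (by linarith)
    have hN2 : N ^ (-b) ≤ κ ^ b * (1 + |d|) ^ (-(2 * b)) := by
      rw [show -(2 * b) = 2 * (-b) by ring, Real.rpow_mul (by positivity), Real.rpow_two,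
        ← neg_neg b, Real.rpow_neg hκ0.le, neg_neg, ← div_eq_inv_mul, le_div_iff₀ (by positivity),
        ← Real.mul_rpow hN0.le hκ0.le, mul_comm N]
      exact Real.rpow_le_rpow_of_nonpos (by positivity) h2 (by linarith)
    have hcc : |c| ^ (-(2 * a)) ≤ 2 ^ (2 * a) * (1 + |c|) ^ (-(2 * a)) := by
      have : ((1 + |c|) / 2) ^ (2 * a) ≤ |c| ^ (2 * a) :=
        Real.rpow_le_rpow (by positivity) (by linarith) (by positivity)
      rw [Real.div_rpow (by positivity) two_pos.le] at this
      rw [Real.rpow_neg (by positivity), Real.rpow_neg (by positivity), ← div_eq_mul_inv,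
        inv_eq_one_div, div_le_div_iff₀ (by positivity) (by positivity), one_mul]
      rwa [div_le_iff₀' (by positivity)] at this
    have hexp : Real.exp (-(2 * Real.pi * m * (x.mat • τ).im)) ≤ 1 := by
      rw [Real.exp_le_one_iff, neg_nonpos]
      have := (x.mat • τ).im_pos
      positivity
    have hle : 0 ≤ K2 * (majorant a b x * τ.im ^ (-(2 * a))) := by positivity
    calc N ^ (-(a + b)) * Real.exp (-(2 * Real.pi * m * (x.mat • τ).im))
        ≤ N ^ (-(a + b)) := mul_le_of_le_one_right (by positivity) hexp
      _ = N ^ (-a) * N ^ (-b) := by rw [← Real.rpow_add hN0]; congr 1; ring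
      _ ≤ (|c| * τ.im) ^ (-(2 * a)) * (κ ^ b * (1 + |d|) ^ (-(2 * b))) := by gcongr
      _ = |c| ^ (-(2 * a)) * τ.im ^ (-(2 * a)) * (κ ^ b * (1 + |d|) ^ (-(2 * b))) := by
          rw [Real.mul_rpow (by positivity) hy.le]
      _ ≤ 2 ^ (2 * a) * (1 + |c|) ^ (-(2 * a)) * τ.im ^ (-(2 * a)) *
          (κ ^ b * (1 + |d|) ^ (-(2 * b))) := by gcongr
      _ = K1 * (majorant a b x * τ.im ^ (-(2 * a))) := by
          simp only [majorant, K1]; ring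
      _ ≤ _ := by linarith

/-! ### The Poincaré series -/

section Poincare

variable {bp bm : ℕ} {W : Type*} [AddCommGroup W] [Module ℝ W] {q : QuadraticForm ℝ W}
  {L : AddSubgroup W}

lemma weilRep_inv_apply (sig : ℤ) (M : Mp2Z) (a : GroupRing q L) :
    weilRep q L sig M ((weilRep q L sig M)⁻¹ a) = a :=
  LinearEquiv.apply_symm_apply _ a

lemma weilRep_apply_inv (sig : ℤ) (M : Mp2Z) (a : GroupRing q L) :
    (weilRep q L sig M)⁻¹ (weilRep q L sig M a) = a :=
  LinearEquiv.symm_apply_apply _ a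

lemma innerL_basisVec [Fintype (Discr q L)] (β : Discr q L) (a : GroupRing q L) :
    innerL (basisVec β) a = conj (a β) := by
  classical
  rw [innerL_eq, Finset.sum_eq_single β]
  · simp [basisVec]
  · intro γ _ h; simp [basisVec, h]
  · simp

lemma norm_sq_apply_le [Fintype (Discr q L)] (a : GroupRing q L) (γ : Discr q L) :
    ‖a γ‖ ^ 2 ≤ (innerL a a).re := by
  rw [innerL_eq, Complex.re_sum]
  have h : ∀ δ, (a δ * conj (a δ)).re = ‖a δ‖ ^ 2 := fun δ => by
    rw [Complex.mul_conj, Complex.normSq_eq_norm_sq, Complex.ofReal_re]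
  simp only [h]
  exact Finset.single_le_sum (f := fun δ => ‖a δ‖ ^ 2) (fun _ _ => sq_nonneg _)
    (Finset.mem_univ γ)

/-- Matrix coefficients of the Weil representation are bounded by one. -/
lemma norm_weilRep_inv_basisVec_le (u : q.IsometryEquiv (stdForm bp bm)) (hL : IsEvenLattice q L)
    (M : Mp2Z) (β γ : Discr q L) :
    ‖(weilRep q L ((bp : ℤ) - bm) M)⁻¹ (basisVec β) γ‖ ≤ 1 := by
  classical
  have := finite_discr u hL
  have := Fintype.ofFinite (Discr q L)
  have h := norm_sq_apply_le ((weilRep q L ((bp : ℤ) - bm) M)⁻¹ (basisVec β)) γ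
  rw [innerL_weilRep_inv u hL, weilRep_inv_apply, innerL_basisVec] at h
  have h1 : (conj ((basisVec β : GroupRing q L) β)).re = 1 := by simp [basisVec]
  rw [h1] at h
  nlinarith [norm_nonneg ((weilRep q L ((bp : ℤ) - bm) M)⁻¹ (basisVec β) γ)]

lemma slash_slash (sig w : ℤ) (f : ℍ → GroupRing q L) (M N : Mp2Z) (τ : ℍ) :
    slash q L sig w (slash q L sig w f M) N τ = slash q L sig w f (M * N) τ := by
  simp only [slash, Mp2Z.mul_phi, Mp2Z.mul_mat, map_smul, map_mul, mul_inv_rev, mul_smul,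
    mul_zpow, LinearEquiv.mul_apply]
  rw [smul_comm]

/-- The function `e(mτ) 𝔢_β`. -/
def cuspExp (m : ℝ) (β : Discr q L) (τ : ℍ) : GroupRing q L := e (m * τ) • basisVec β

lemma poincareTerm_eq (sig w : ℤ) (m : ℝ) (β : Discr q L) (τ : ℍ) (c : CuspCosets) :
    poincareTerm q L sig w m β τ c = slash q L sig w (cuspExp m β) (Quotient.out c) τ := rfl

lemma e_m_eq (hL : IsEvenLattice q L) {m : ℝ} {β : Discr q L}
    (hmβ : ∃ x : dual q L, (QuotientAddGroup.mk x : Discr q L) = β ∧ ∃ n : ℤ, m = q (x : W) + n) :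
    e (m : ℂ) = e (q (rep β) : ℝ) := by
  obtain ⟨x, rfl, n, rfl⟩ := hmβ
  rw [e_q_mk hL, Complex.ofReal_add, e_add, Complex.ofReal_intCast, e_int, mul_one]

lemma coe_T_smul (τ : ℍ) : ((ModularGroup.T • τ : ℍ) : ℂ) = τ + 1 := by
  have := ModularGroup.coe_T_zpow_smul_eq (z := τ) (n := 1)
  simpa using this

lemma slash_T (u : q.IsometryEquiv (stdForm bp bm)) (hL : IsEvenLattice q L) {m : ℝ}
    {β : Discr q L} (w : ℤ) (hmβ : e (m : ℂ) = e (q (rep β) : ℝ)) :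
    slash q L ((bp : ℤ) - bm) w (cuspExp m β) Mp2Z.T = cuspExp m β := by
  funext τ
  have hphi : Mp2Z.T.phi τ = 1 := rfl
  have h1 : e (m * (τ + 1)) = e (m * τ) * e (m : ℂ) := by
    rw [← e_add]; congr 1; ring
  have h2 : cuspExp m β (Mp2Z.T.mat • τ) =
      weilRep q L ((bp : ℤ) - bm) Mp2Z.T (cuspExp m β τ) := by
    rw [weilRep_T u hL, cuspExp, cuspExp, map_smul, weilT_basisVec, smul_smul,
      ← hmβ, ← h1, ← coe_T_smul]
    rfl
  rw [slash, hphi, one_zpow, one_smul, h2, weilRep_apply_inv]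

lemma slash_eq_of_rel (u : q.IsometryEquiv (stdForm bp bm)) (hL : IsEvenLattice q L) {m : ℝ}
    {β : Discr q L} (w : ℤ) (hmβ : e (m : ℂ) = e (q (rep β) : ℝ)) {M N : Mp2Z}
    (h : N * M⁻¹ ∈ Subgroup.zpowers Mp2Z.T) :
    slash q L ((bp : ℤ) - bm) w (cuspExp m β) M =
      slash q L ((bp : ℤ) - bm) w (cuspExp m β) N := by
  let H : Subgroup Mp2Z :=
    { carrier := {x | slash q L ((bp : ℤ) - bm) w (cuspExp m β) x = cuspExp m β}
      one_mem' := by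
        funext τ
        have h1 : (1 : Mp2Z).mat • τ = τ := one_smul _ τ
        simp only [slash, Mp2Z.one_phi, one_zpow, one_smul, map_one, h1]
        rfl
      mul_mem' := by
        intro x y hx hy
        funext τ
        rw [← slash_slash, hx, hy]
      inv_mem' := by
        intro x hx
        funext τ
        have h1 : (1 : Mp2Z).mat • τ = τ := one_smul _ τ
        conv_lhs => rw [← (show _ = _ from hx)]
        rw [slash_slash, mul_inv_cancel]
        simp only [slash, Mp2Z.one_phi, one_zpow, one_smul, map_one, h1]
        rfl }
  have hT : Subgroup.zpowers Mp2Z.T ≤ H := by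
    rw [Subgroup.zpowers_le]
    exact slash_T u hL w hmβ
  funext τ
  have h2 : slash q L ((bp : ℤ) - bm) w (cuspExp m β) (N * M⁻¹) = cuspExp m β := hT h
  rw [show N = (N * M⁻¹) * M by group, ← slash_slash, h2]

/-- Right multiplication on `⟨T⟩ \ Mp₂(ℤ)`. -/
def cosetMulRight (N : Mp2Z) : CuspCosets ≃ CuspCosets :=
  Quotient.congr (Equiv.mulRight N) fun a b => by
    rw [QuotientGroup.rightRel_apply, QuotientGroup.rightRel_apply]
    simp [mul_assoc]

lemma out_rel (M : Mp2Z) :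
    M * (Quotient.out (Quotient.mk (QuotientGroup.rightRel (Subgroup.zpowers Mp2Z.T)) M))⁻¹ ∈
      Subgroup.zpowers Mp2Z.T := by
  rw [← QuotientGroup.rightRel_apply]
  exact Quotient.mk_out (s := QuotientGroup.rightRel (Subgroup.zpowers Mp2Z.T)) M

lemma norm_poincareTerm_le (u : q.IsometryEquiv (stdForm bp bm)) (hL : IsEvenLattice q L) (m : ℝ)
    (β γ : Discr q L) (w : ℤ) (τ : ℍ) (c : CuspCosets) :
    ‖poincareTerm q L ((bp : ℤ) - bm) w m β τ c γ‖ ≤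
      (‖(Quotient.out c).phi τ‖ ^ 4) ^ (-((w : ℝ) / 4)) *
        Real.exp (-(2 * Real.pi * m * ((Quotient.out c).mat • τ).im)) := by
  set x := Quotient.out c
  have h1 : poincareTerm q L ((bp : ℤ) - bm) w m β τ c γ = (x.phi τ) ^ (-w) *
      (e (m * ((x.mat • τ : ℍ) : ℂ)) * (weilRep q L ((bp : ℤ) - bm) x)⁻¹ (basisVec β) γ) := by
    rw [poincareTerm_eq, slash, cuspExp, map_smul]; rfl
  have h2 : ‖e (m * ((x.mat • τ : ℍ) : ℂ))‖ =
      Real.exp (-(2 * Real.pi * m * (x.mat • τ).im)) := by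
    rw [e, Complex.norm_exp]
    congr 1
    simp [mul_assoc]
  have h3 : ‖(x.phi τ) ^ (-w)‖ = (‖x.phi τ‖ ^ 4) ^ (-((w : ℝ) / 4)) := by
    rw [norm_zpow, ← Real.rpow_natCast, ← Real.rpow_mul (norm_nonneg _), ← Real.rpow_intCast]
    congr 1
    push_cast
    ring
  rw [h1, norm_mul, norm_mul, h2, h3]
  gcongr
  exact mul_le_of_le_one_right (Real.exp_pos _).le (norm_weilRep_inv_basisVec_le u hL x β γ)

/-- A bound for the terms of the Poincaré series on vertical strips. -/
lemma exists_poincareTerm_bound (u : q.IsometryEquiv (stdForm bp bm)) (hL : IsEvenLattice q L)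
    {m : ℝ} (hm : 0 < m) (β : Discr q L) {w : ℤ} (hw : 4 < w) (A : ℝ) {B : ℝ} (hB : 0 < B) :
    ∃ (s : ℝ) (U : CuspCosets → ℝ), 0 < s ∧ Summable U ∧ ∀ (τ : ℍ) c γ, |τ.re| ≤ A → B ≤ τ.im →
      ‖poincareTerm q L ((bp : ℤ) - bm) w m β τ c γ‖ ≤ U c * τ.im ^ (-s) := by
  have hw' : (4 : ℝ) < w := by exact_mod_cast hw
  obtain ⟨K, hK, h⟩ := exists_majorant_bound (a := w / 8) (b := w / 8) (A := A) (m := m)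
    (by positivity) (by positivity) hB hm
  refine ⟨2 * (w / 8), fun c => K * majorant (w / 8) (w / 8) (Quotient.out c), by positivity,
    (summable_majorant (by linarith) (by linarith)).mul_left K, fun τ c γ hA hτ => ?_⟩
  refine (norm_poincareTerm_le u hL m β γ w τ c).trans ?_
  have := h (Quotient.out c) τ hA hτ
  rwa [show (w / 8 + w / 8 : ℝ) = w / 4 by ring] at this

lemma summable_poincareTerm (u : q.IsometryEquiv (stdForm bp bm)) (hL : IsEvenLattice q L)
    {m : ℝ} (hm : 0 < m) (β : Discr q L) {w : ℤ} (hw : 4 < w) (τ : ℍ) :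
    Summable (poincareTerm q L ((bp : ℤ) - bm) w m β τ) := by
  obtain ⟨s, U, hs, hU, h⟩ := exists_poincareTerm_bound u hL hm β hw |τ.re| τ.im_pos
  rw [Pi.summable]
  intro γ
  exact Summable.of_norm_bounded (hU.mul_right _) fun c => h τ c γ le_rfl le_rfl

lemma poincare_apply (u : q.IsometryEquiv (stdForm bp bm)) (hL : IsEvenLattice q L)
    {m : ℝ} (hm : 0 < m) (β : Discr q L) {w : ℤ} (hw : 4 < w) (τ : ℍ) (γ : Discr q L) :
    poincare q L ((bp : ℤ) - bm) w m β τ γ =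
      1 / 2 * ∑' c, poincareTerm q L ((bp : ℤ) - bm) w m β τ c γ := by
  rw [poincare, Pi.smul_apply, tsum_apply (summable_poincareTerm u hL hm β hw τ), smul_eq_mul]

/-- The Poincaré series is a modular form for the Weil representation. -/
lemma poincare_smul (u : q.IsometryEquiv (stdForm bp bm)) (hL : IsEvenLattice q L)
    {m : ℝ} (hm : 0 < m) {β : Discr q L} (hmβ : e (m : ℂ) = e (q (rep β) : ℝ)) {w : ℤ}
    (hw : 4 < w) (N : Mp2Z) (τ : ℍ) :
    poincare q L ((bp : ℤ) - bm) w m β (N.mat • τ) =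
      (N.phi τ) ^ w • weilRep q L ((bp : ℤ) - bm) N (poincare q L ((bp : ℤ) - bm) w m β τ) := by
  have := finite_discr u hL
  have := Fintype.ofFinite (Discr q L)
  set ρ := weilRep q L ((bp : ℤ) - bm)
  have hs := summable_poincareTerm u hL hm β hw
  have h1 : ∀ c, poincareTerm q L ((bp : ℤ) - bm) w m β (N.mat • τ) c =
      (N.phi τ) ^ w • ρ N (poincareTerm q L ((bp : ℤ) - bm) w m β τ (cosetMulRight N c)) := by
    intro c
    have h2 : slash q L ((bp : ℤ) - bm) w (cuspExp m β)
        (Quotient.out (cosetMulRight N c)) =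
        slash q L ((bp : ℤ) - bm) w (cuspExp m β) (Quotient.out c * N) := by
      apply slash_eq_of_rel u hL w hmβ
      have : cosetMulRight N c = Quotient.mk _ (Quotient.out c * N) := by
        conv_lhs => rw [← Quotient.out_eq c]
        rfl
      rw [this]
      exact out_rel _
    rw [poincareTerm_eq, poincareTerm_eq, h2, ← slash_slash]
    conv_rhs => rw [slash]
    rw [map_smul, weilRep_inv_apply, smul_smul, ← zpow_add₀ (N.phi_ne_zero τ), add_neg_cancel,
      zpow_zero, one_smul]
  let E : GroupRing q L ≃L[ℂ] GroupRing q L := (ρ N).toContinuousLinearEquiv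
  have h3 : ∀ a, ρ N a = E a := fun _ => rfl
  rw [poincare, poincare, tsum_congr h1, tsum_const_smul'', map_smul,
    Equiv.tsum_eq (cosetMulRight N) fun c => ρ N (poincareTerm q L ((bp : ℤ) - bm) w m β τ c)]
  simp only [h3]
  rw [E.map_tsum, smul_comm]

lemma poincare_add_one (u : q.IsometryEquiv (stdForm bp bm)) (hL : IsEvenLattice q L)
    {m : ℝ} (hm : 0 < m) {β : Discr q L} (hmβ : e (m : ℂ) = e (q (rep β) : ℝ)) {w : ℤ}
    (hw : 4 < w) (τ : ℍ) (γ : Discr q L) :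
    poincare q L ((bp : ℤ) - bm) w m β (ModularGroup.T • τ) γ =
      e (q (rep γ) : ℝ) * poincare q L ((bp : ℤ) - bm) w m β τ γ := by
  have h := poincare_smul u hL hm hmβ hw Mp2Z.T τ
  have hphi : Mp2Z.T.phi τ = 1 := rfl
  rw [hphi, one_zpow, one_smul, weilRep_T u hL] at h
  exact (congrFun h γ).trans (weilT_apply _ _)

/-- The Poincaré series is holomorphic. -/
lemma differentiableOn_poincare (u : q.IsometryEquiv (stdForm bp bm)) (hL : IsEvenLattice q L)
    {m : ℝ} (hm : 0 < m) (β : Discr q L) {w : ℤ} (hw : 4 < w) (γ : Discr q L) :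
    DifferentiableOn ℂ (fun z : ℂ => poincare q L ((bp : ℤ) - bm) w m β (ofComplex z) γ)
      {z | 0 < z.im} := by
  intro z₀ hz₀
  have hz₀ : 0 < z₀.im := hz₀
  obtain ⟨s, U, hs, hU, h⟩ := exists_poincareTerm_bound u hL hm β hw (|z₀.re| + 1) (half_pos hz₀)
  set Ω : Set ℂ := {z | |z.re| < |z₀.re| + 1 ∧ z₀.im / 2 < z.im} with hΩ
  have hΩo : IsOpen Ω := (isOpen_lt (continuous_abs.comp Complex.continuous_re) continuous_const).inter
    (isOpen_lt continuous_const Complex.continuous_im)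
  have hΩ0 : ∀ z ∈ Ω, 0 < z.im := fun z hz => (half_pos hz₀).trans hz.2
  have hmem : z₀ ∈ Ω := ⟨lt_add_one _, half_lt_self hz₀⟩
  have hterm : ∀ c, DifferentiableOn ℂ (fun z : ℂ =>
      poincareTerm q L ((bp : ℤ) - bm) w m β (ofComplex z) c γ) Ω := by
    intro c
    set x := Quotient.out c
    have h1 : ∀ z : ℂ, poincareTerm q L ((bp : ℤ) - bm) w m β (ofComplex z) c γ =
        (x.phi (ofComplex z)) ^ (-w) * (e (m * ((x.mat • ofComplex z : ℍ) : ℂ)) *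
          (weilRep q L ((bp : ℤ) - bm) x)⁻¹ (basisVec β) γ) := by
      intro z
      rw [poincareTerm_eq, slash, cuspExp, map_smul]; rfl
    simp only [h1]
    have hphi := (UpperHalfPlane.mdifferentiable_iff.mp x.holo).mono (fun z hz => hΩ0 z hz)
    have hmob : DifferentiableOn ℂ (fun z => ((x.mat • ofComplex z : ℍ) : ℂ)) Ω :=
      (UpperHalfPlane.mdifferentiable_iff.mp (mdifferentiable_coe.comp (Mp2Z.smul_holo x.mat))).mono
        (fun z hz => hΩ0 z hz)
    refine DifferentiableOn.mul ?_ (DifferentiableOn.mul_const ?_ _)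
    · exact hphi.zpow (Or.inl fun z _ => x.phi_ne_zero _)
    · simp only [e]
      exact ((hmob.const_mul _).const_mul _).cexp
  have hsum := Complex.differentiableOn_tsum_of_summable_norm
    (u := fun c => U c * (z₀.im / 2) ^ (-s)) (hU.mul_right _) hterm hΩo (fun c z hz => by
      have hz0 := hΩ0 z hz
      have h1 := h (ofComplex z) c γ (by
        rw [ofComplex_apply_of_im_pos hz0]; exact hz.1.le) (by
        rw [ofComplex_apply_of_im_pos hz0]; exact hz.2.le)
      have him : (ofComplex z).im = z.im := by rw [ofComplex_apply_of_im_pos hz0]; rfl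
      have hpos : 0 < z.im ^ (-s) := by positivity
      rw [him] at h1
      have hUc : 0 ≤ U c := by
        by_contra hneg
        push Not at hneg
        linarith [norm_nonneg (poincareTerm q L ((bp : ℤ) - bm) w m β (ofComplex z) c γ),
          mul_neg_of_neg_of_pos hneg hpos]
      refine h1.trans (mul_le_mul_of_nonneg_left ?_ hUc)
      exact Real.rpow_le_rpow_of_nonpos (half_pos hz₀) hz.2.le (by linarith))
  have hfin : DifferentiableAt ℂ (fun z : ℂ =>
      poincare q L ((bp : ℤ) - bm) w m β (ofComplex z) γ) z₀ := by
    simp only [poincare_apply u hL hm β hw]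
    exact (hsum.differentiableAt (hΩo.mem_nhds hmem)).const_mul _
  exact hfin.differentiableWithinAt

/-- The Poincaré series is a cusp form: it decays exponentially at the cusp. -/
lemma exists_poincare_decay (u : q.IsometryEquiv (stdForm bp bm)) (hL : IsEvenLattice q L)
    {m : ℝ} (hm : 0 < m) {β : Discr q L} (hmβ : e (m : ℂ) = e (q (rep β) : ℝ)) {w : ℤ}
    (hw : 4 < w) (γ : Discr q L) :
    ∃ C c : ℝ, 0 < c ∧ ∀ τ : ℍ, |τ.re| ≤ 1 → 1 / 2 ≤ τ.im →
      ‖poincare q L ((bp : ℤ) - bm) w m β τ γ‖ ≤ C * Real.exp (-(c * τ.im)) := by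
  obtain ⟨s, U, hs, hU, h⟩ := exists_poincareTerm_bound u hL hm β hw 1 (one_half_pos (α := ℝ))
  set K : ℝ := 1 / 2 * ∑' c, U c with hKdef
  have hbound : ∀ τ : ℍ, |τ.re| ≤ 1 → 1 / 2 ≤ τ.im →
      ‖poincare q L ((bp : ℤ) - bm) w m β τ γ‖ ≤ K * τ.im ^ (-s) := by
    intro τ h1 h2
    rw [poincare_apply u hL hm β hw, norm_mul, hKdef, mul_assoc, ← tsum_mul_right]
    refine mul_le_mul (by norm_num) ?_ (norm_nonneg _) (by norm_num)
    exact tsum_of_norm_bounded (hU.mul_right _).hasSum fun c => h τ c γ h1 h2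
  -- `r` is the representative of `q(γ)` modulo one in the interval `(-1, 0]`
  set r : ℝ := -Int.fract (-(q (rep γ))) with hr
  have hr0 : r ≤ 0 := neg_nonpos.mpr (Int.fract_nonneg _)
  have hr1 : -1 < r := neg_lt_neg (Int.fract_lt_one _)
  have her : e (-(r : ℂ)) * e (q (rep γ) : ℝ) = 1 := by
    rw [← e_add, show (-(r : ℂ) + (q (rep γ) : ℝ)) = ((-⌊-(q (rep γ))⌋ : ℤ) : ℂ) by
      rw [hr, ← Int.self_sub_floor]; push_cast; ring, e_int]
  set g : ℂ → ℂ := fun z => e (-(r : ℂ) * z) *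
    poincare q L ((bp : ℤ) - bm) w m β (ofComplex z) γ with hg
  have hper : ∀ z : ℂ, 0 < z.im → g (z + 1) = g z := by
    intro z hz
    have h1 : ofComplex (z + 1) = ModularGroup.T • ofComplex z := by
      ext1
      rw [coe_T_smul, ofComplex_apply_of_im_pos hz, ofComplex_apply_of_im_pos (by simpa using hz)]
    rw [hg]
    simp only
    rw [h1, poincare_add_one u hL hm hmβ hw, mul_add, e_add, mul_one]
    linear_combination (e (-(r : ℂ) * z) * poincare q L ((bp : ℤ) - bm) w m β (ofComplex z) γ) * her
  have hgnorm : ∀ z : ℂ, ‖g z‖ = Real.exp (2 * Real.pi * r * z.im) *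
      ‖poincare q L ((bp : ℤ) - bm) w m β (ofComplex z) γ‖ := by
    intro z
    rw [hg, norm_mul, e, Complex.norm_exp]
    congr 2
    simp
    ring
  -- below the real line the function is cut off in order to make it periodic on all of `ℂ`
  set G : ℂ → ℂ := fun z => if 0 < z.im then g z else 0 with hG
  have hGper : Function.Periodic G ((1 : ℝ) : ℂ) := by
    intro z
    simp only [hG, Complex.add_im, Complex.ofReal_im, add_zero]
    split_ifs with hz
    · simpa using hper z hz
    · rfl
  have hI : ∀ B : ℝ, ∀ᶠ z in Filter.comap Complex.im Filter.atTop, B < z.im := fun B =>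
    (Filter.eventually_gt_atTop B).comap _
  have hdiff : ∀ᶠ z in Filter.comap Complex.im Filter.atTop, DifferentiableAt ℂ G z := by
    filter_upwards [hI 0] with z hz
    have hopen : IsOpen {z : ℂ | 0 < z.im} := isOpen_lt continuous_const Complex.continuous_im
    have hd : DifferentiableOn ℂ g {z : ℂ | 0 < z.im} := by
      refine DifferentiableOn.mul ?_ (differentiableOn_poincare u hL hm β hw γ)
      simp only [e]
      fun_prop
    refine (hd.differentiableAt (hopen.mem_nhds hz)).congr_of_eventuallyEq ?_
    filter_upwards [hopen.mem_nhds hz] with x hx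
    simp only [hG]
    rw [if_pos hx]
  have hnormbound : ∀ z : ℂ, 1 / 2 ≤ z.im → ‖G z‖ ≤ K * z.im ^ (-s) := by
    have h0 : ∀ z : ℂ, |z.re| ≤ 1 → 1 / 2 ≤ z.im → ‖G z‖ ≤ K * z.im ^ (-s) := by
      intro z h1 h2
      have hz : 0 < z.im := by linarith
      simp only [hG]
      rw [if_pos hz, hgnorm]
      have h3 := hbound (ofComplex z) (by rw [ofComplex_apply_of_im_pos hz]; exact h1)
        (by rw [ofComplex_apply_of_im_pos hz]; exact h2)
      rw [show (ofComplex z).im = z.im by rw [ofComplex_apply_of_im_pos hz]; rfl] at h3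
      refine le_trans (mul_le_of_le_one_left (norm_nonneg _) ?_) h3
      rw [Real.exp_le_one_iff]
      exact mul_nonpos_of_nonpos_of_nonneg
        (mul_nonpos_of_nonneg_of_nonpos (by positivity) hr0) hz.le
    intro z hz
    have h1 : G (z - (⌊z.re⌋ : ℤ) * ((1 : ℝ) : ℂ)) = G z := hGper.sub_int_mul_eq _
    have h2 := h0 (z - (⌊z.re⌋ : ℤ) * ((1 : ℝ) : ℂ)) (by
      simp only [Complex.sub_re, Complex.mul_re, Complex.intCast_re, Complex.ofReal_re,
        Complex.intCast_im, Complex.ofReal_im, mul_one, mul_zero, sub_zero]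
      rw [abs_of_nonneg (Int.fract_nonneg _)]
      exact (Int.fract_lt_one _).le) (by simpa using hz)
    rw [h1] at h2
    simpa using h2
  have hzero : Filter.ZeroAtFilter (Filter.comap Complex.im Filter.atTop) G := by
    have h1 : Filter.Tendsto (fun z : ℂ => K * z.im ^ (-s))
        (Filter.comap Complex.im Filter.atTop) (nhds 0) := by
      have h2 := ((tendsto_rpow_neg_atTop hs).const_mul K).comp
        (Filter.tendsto_comap (f := Complex.im) (x := Filter.atTop))
      simpa [Function.comp_def] using h2
    refine squeeze_zero_norm' ?_ h1
    filter_upwards [hI (1 / 2)] with z hz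
    exact hnormbound z hz.le
  have hO := Function.Periodic.exp_decay_of_zero_at_inf one_pos hGper hdiff hzero
  obtain ⟨C, hC⟩ := hO.bound
  rw [Filter.eventually_comap] at hC
  obtain ⟨Y, hY⟩ := Filter.eventually_atTop.mp hC
  have hK0 : 0 ≤ K := by
    have h1 := (norm_nonneg _).trans (hnormbound Complex.I (by norm_num))
    simpa using h1
  refine ⟨|C| + K * (1 / 2) ^ (-s) * Real.exp (2 * Real.pi * (1 + r) * |Y|), 2 * Real.pi * (1 + r),
    by have : 0 < 1 + r := by linarith
       positivity, fun τ h1 h2 => ?_⟩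
  have hc0 : 0 < 1 + r := by linarith
  rw [add_mul]
  rcases le_or_gt Y τ.im with h3 | h3
  · have h4 := hY τ.im h3 τ rfl
    have hGτ : G τ = g τ := if_pos τ.im_pos
    rw [hGτ, hgnorm, ofComplex_apply, Real.norm_of_nonneg (Real.exp_pos _).le] at h4
    have h5 : ‖poincare q L ((bp : ℤ) - bm) w m β τ γ‖ ≤
        |C| * Real.exp (-(2 * Real.pi * (1 + r) * τ.im)) := by
      have e1 : Real.exp (-(2 * Real.pi * (1 + r) * τ.im)) =
          Real.exp (-2 * Real.pi * (τ : ℂ).im / 1) / Real.exp (2 * Real.pi * r * (τ : ℂ).im) := by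
        rw [← Real.exp_sub]
        congr 1
        rw [coe_im]
        ring
      rw [e1, ← mul_div_assoc, le_div_iff₀ (Real.exp_pos _), mul_comm]
      exact h4.trans (mul_le_mul_of_nonneg_right (le_abs_self C) (Real.exp_pos _).le)
    have : 0 ≤ K * (1 / 2) ^ (-s) * Real.exp (2 * Real.pi * (1 + r) * |Y|) *
        Real.exp (-(2 * Real.pi * (1 + r) * τ.im)) := by positivity
    linarith
  · have h4 := hbound τ h1 h2
    have h5 : τ.im ^ (-s) ≤ (1 / 2) ^ (-s) :=
      Real.rpow_le_rpow_of_nonpos (by norm_num) h2 (by linarith)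
    have h6 : 1 ≤ Real.exp (2 * Real.pi * (1 + r) * |Y|) *
        Real.exp (-(2 * Real.pi * (1 + r) * τ.im)) := by
      rw [← Real.exp_add]
      apply Real.one_le_exp
      have : τ.im ≤ |Y| := h3.le.trans (le_abs_self Y)
      have : 0 ≤ 2 * Real.pi * (1 + r) * (|Y| - τ.im) :=
        mul_nonneg (by positivity) (by linarith)
      linarith
    have h7 : K * τ.im ^ (-s) ≤ K * (1 / 2) ^ (-s) := mul_le_mul_of_nonneg_left h5 hK0
    have h8 : K * (1 / 2) ^ (-s) ≤ K * (1 / 2) ^ (-s) * (Real.exp (2 * Real.pi * (1 + r) * |Y|) *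
        Real.exp (-(2 * Real.pi * (1 + r) * τ.im))) := le_mul_of_one_le_right (by positivity) h6
    have : 0 ≤ |C| * Real.exp (-(2 * Real.pi * (1 + r) * τ.im)) := by positivity
    rw [mul_assoc (K * (1 / 2) ^ (-s))]
    linarith

end Poincare

/-! ### Real coordinates on the upper half-plane -/

/-- The point `x + iy` of the upper half-plane (a constant if `y ≤ 0`). -/
def pt (p : ℝ × ℝ) : ℍ := ofComplex ⟨p.1, p.2⟩

lemma coe_pt {p : ℝ × ℝ} (hp : 0 < p.2) : (pt p : ℂ) = ⟨p.1, p.2⟩ := by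
  rw [pt, ofComplex_apply_of_im_pos (by exact hp)]

lemma pt_re {p : ℝ × ℝ} (hp : 0 < p.2) : (pt p).re = p.1 := by
  rw [← coe_re, coe_pt hp]

lemma pt_im {p : ℝ × ℝ} (hp : 0 < p.2) : (pt p).im = p.2 := by
  rw [← coe_im, coe_pt hp]

lemma pt_re_im (τ : ℍ) : pt (τ.re, τ.im) = τ := by
  rw [pt]
  exact ofComplex_apply τ

lemma measurable_pt : Measurable pt := by
  have h : ∀ p : ℝ × ℝ, ((pt p : ℍ) : ℂ) = if 0 < p.2 then (⟨p.1, p.2⟩ : ℂ) else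
      ((Classical.choice inferInstance : ℍ) : ℂ) := by
    intro p
    split_ifs with hp
    · exact coe_pt hp
    · rw [pt, ofComplex_apply_of_im_nonpos (by exact not_lt.mp hp)]
  rw [← measurableEmbedding_coe.measurable_comp_iff]
  simp only [Function.comp_def, h]
  refine Measurable.ite (measurableSet_lt measurable_const measurable_snd) ?_ measurable_const
  exact Complex.measurableEquivRealProd.symm.measurable

/-- The density `1 / y²` of the invariant measure. -/
def density (p : ℝ × ℝ) : NNReal := ⟨1 / p.2 ^ 2, by positivity⟩

lemma measurable_density : Measurable density := by
  refine Measurable.subtype_mk ?_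
  fun_prop

/-- The upper half-plane in real coordinates. -/
def halfPlane : Set (ℝ × ℝ) := {p | 0 < p.2}

lemma measurableSet_halfPlane : MeasurableSet halfPlane :=
  measurableSet_lt measurable_const measurable_snd

lemma volume_eq_map : (volume : Measure ℍ) =
    ((volume.restrict halfPlane).withDensity fun p => (density p : ENNReal)).map pt := by
  ext s hs
  rw [Measure.map_apply measurable_pt hs, withDensity_apply _ (measurable_pt hs),
    Measure.restrict_restrict (measurable_pt hs), volume_eq_lintegral]
  have h1 : UpperHalfPlane.coe '' s =
      Complex.measurableEquivRealProd ⁻¹' (pt ⁻¹' s ∩ halfPlane) := by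
    ext z
    simp only [Set.mem_image, Set.mem_preimage, Set.mem_inter_iff, Complex.measurableEquivRealProd_apply]
    constructor
    · rintro ⟨τ, hτ, rfl⟩
      exact ⟨by rw [show ((τ : ℂ).re, (τ : ℂ).im) = (τ.re, τ.im) from rfl, pt_re_im]; exact hτ,
        τ.im_pos⟩
    · rintro ⟨h1, h2⟩
      exact ⟨_, h1, coe_pt h2⟩
  rw [h1, ← Complex.volume_preserving_equiv_real_prod.setLIntegral_comp_preimage_emb
    Complex.measurableEquivRealProd.measurableEmbedding]
  refine lintegral_congr fun z => ?_
  rw [ENNReal.coe_inj]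
  refine NNReal.eq ?_
  simp only [density, Complex.measurableEquivRealProd_apply, NNReal.coe_pow, NNReal.coe_div,
    NNReal.coe_one, coe_nnnorm, Real.norm_eq_abs, div_pow, one_pow, sq_abs]
  rfl

lemma setLIntegral_eq_real {f : ℍ → ENNReal} (hf : Measurable f) {s : Set ℍ}
    (hs : MeasurableSet s) : ∫⁻ τ in s, f τ =
      ∫⁻ p in pt ⁻¹' s ∩ halfPlane, (density p : ENNReal) * f (pt p) := by
  rw [volume_eq_map, setLIntegral_map hs hf measurable_pt,
    restrict_withDensity (measurable_pt hs), Measure.restrict_restrict (measurable_pt hs)]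
  exact lintegral_withDensity_eq_lintegral_mul _ measurable_density.coe_nnreal_ennreal
    (hf.comp measurable_pt)

lemma setIntegral_eq_real {f : ℍ → ℂ} (hf : StronglyMeasurable f) {s : Set ℍ}
    (hs : MeasurableSet s) : ∫ τ in s, f τ =
      ∫ p in pt ⁻¹' s ∩ halfPlane, ((1 / p.2 ^ 2 : ℝ) : ℂ) * f (pt p) := by
  rw [volume_eq_map, setIntegral_map hs hf.aestronglyMeasurable measurable_pt.aemeasurable,
    restrict_withDensity (measurable_pt hs),
    integral_withDensity_eq_integral_smul measurable_density,
    Measure.restrict_restrict (measurable_pt hs)]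
  rfl

lemma integrableOn_iff_real {f : ℍ → ℂ} (hf : StronglyMeasurable f) {s : Set ℍ}
    (hs : MeasurableSet s) : IntegrableOn f s ↔
      IntegrableOn (fun p : ℝ × ℝ => ((1 / p.2 ^ 2 : ℝ) : ℂ) * f (pt p))
        (pt ⁻¹' s ∩ halfPlane) := by
  rw [volume_eq_map, IntegrableOn, Measure.restrict_map measurable_pt hs,
    integrable_map_measure hf.aestronglyMeasurable measurable_pt.aemeasurable,
    restrict_withDensity (measurable_pt hs),
    integrable_withDensity_iff_integrable_smul measurable_density,
    Measure.restrict_restrict (measurable_pt hs), IntegrableOn]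
  rfl

lemma measure_eq_zero_of_pt {s : Set ℍ} {B : Set (ℝ × ℝ)} (hs : MeasurableSet s)
    (hB : volume B = 0) (h : pt ⁻¹' s ∩ halfPlane ⊆ B) : volume s = 0 := by
  have h1 := setLIntegral_eq_real (f := fun _ => 1) measurable_const hs
  rw [setLIntegral_one] at h1
  rw [h1, Measure.restrict_zero_set (measure_mono_null h hB)]
  simp

/-! ### Counting translates of the fundamental domain -/

lemma measurableSet_fd : MeasurableSet 𝒟 := by
  rw [ModularGroup.fd_eq_closure_fdo]
  exact isClosed_closure.measurableSet

lemma volume_fd_diff_fdo : volume (𝒟 \ 𝒟ᵒ) = 0 := by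
  have hm : MeasurableSet {p : ℝ × ℝ | p.1 ^ 2 + p.2 ^ 2 = 1 ∨ |p.1| = 1 / 2} := by
    have h1 : MeasurableSet {p : ℝ × ℝ | p.1 ^ 2 + p.2 ^ 2 = 1} :=
      measurableSet_eq_fun (by fun_prop) measurable_const
    have h2 : MeasurableSet {p : ℝ × ℝ | |p.1| = 1 / 2} :=
      measurableSet_eq_fun (by fun_prop) measurable_const
    exact h1.union h2
  refine measure_eq_zero_of_pt (measurableSet_fd.diff ModularGroup.isOpen_fdo.measurableSet)
    (B := {p | p.1 ^ 2 + p.2 ^ 2 = 1 ∨ |p.1| = 1 / 2}) ?_ ?_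
  · rw [Measure.volume_eq_prod, Measure.measure_prod_null hm]
    have h1 : ∀ᵐ x : ℝ, x ≠ 1 / 2 ∧ x ≠ -(1 / 2) := by
      refine Filter.Eventually.and ?_ ?_ <;>
      exact compl_mem_ae_iff.mpr (measure_singleton _)
    filter_upwards [h1] with x hx
    have : Prod.mk x ⁻¹' {p : ℝ × ℝ | p.1 ^ 2 + p.2 ^ 2 = 1 ∨ |p.1| = 1 / 2} ⊆
        {Real.sqrt (1 - x ^ 2), -Real.sqrt (1 - x ^ 2)} := by
      rintro y (hy | hy)
      · simp only at hy
        have h2 : 1 - x ^ 2 = y ^ 2 := by linarith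
        rw [h2, Real.sqrt_sq_eq_abs]
        rcases abs_choice y with h3 | h3 <;> rw [h3] <;> simp
      · rcases abs_eq (by norm_num) |>.mp hy with h3 | h3
        · exact absurd h3 hx.1
        · exact absurd h3 hx.2
    exact measure_mono_null this ((Set.toFinite _).measure_zero _)
  · rintro p ⟨⟨h1, h2⟩, h3⟩
    have h3 : 0 < p.2 := h3
    have e1 : Complex.normSq (pt p) = p.1 ^ 2 + p.2 ^ 2 := by
      rw [coe_pt h3, Complex.normSq_mk]; ring
    simp only [ModularGroup.fd, ModularGroup.fdo, Set.mem_ofPred_eq, e1, pt_re h3] at h1 h2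
    by_contra hcon
    simp only [Set.mem_ofPred_eq, not_or] at hcon
    exact h2 ⟨lt_of_le_of_ne h1.1 (Ne.symm hcon.1), lt_of_le_of_ne h1.2 hcon.2⟩

namespace Mp2Z

lemma matHom_surjective : Function.Surjective matHom := by
  rw [← MonoidHom.range_eq_top, eq_top_iff, ← SpecialLinearGroup.SL2Z_generators,
    Subgroup.closure_le]
  rintro x (rfl | rfl)
  · exact ⟨S, rfl⟩
  · exact ⟨T, rfl⟩

instance : Countable Mp2Z := by
  have h : Function.Injective fun x : Mp2Z => (x.mat, (cuspInvariant x).2.2) := by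
    intro x y h
    simp only [Prod.mk.injEq] at h
    obtain ⟨n, hn⟩ := exists_T_zpow_of_cuspInvariant (x := x) (y := y)
      (Prod.ext (by simp [cuspInvariant, h.1]) (Prod.ext (by simp [cuspInvariant, h.1]) h.2))
    refine Mp2Z.ext h.1 (funext fun τ => ?_)
    rw [hn, mul_phi, T_zpow_phi, one_mul]
  have : Countable (Matrix (Fin 2) (Fin 2) ℤ) :=
    inferInstanceAs (Countable (Fin 2 → Fin 2 → ℤ))
  have : Countable SL(2, ℤ) := Subtype.countable
  exact h.countable

/-- The element `S²` generates the center, a cyclic group of order four. -/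
lemma mat_eq_one_or_neg_one_iff (x : Mp2Z) : x.mat = 1 ∨ x.mat = -1 ↔
    x = 1 ∨ x = S * S ∨ x = (S * S) * (S * S) ∨ x = (S * S) * (S * S) * (S * S) := by
  constructor
  · rintro (h | h)
    · rcases phi_eq_or_neg (x := x) (y := 1) h with h1 | h1
      · exact Or.inl (Mp2Z.ext h (funext h1))
      · refine Or.inr (Or.inr (Or.inl (Mp2Z.ext (h.trans S_pow_four_mat.symm)
          (funext fun τ => ?_))))
        rw [h1, S_pow_four_phi, one_phi]
    · rcases phi_eq_or_neg (x := x) (y := S * S) (h.trans S_mul_S_mat.symm) with h1 | h1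
      · exact Or.inr (Or.inl (Mp2Z.ext (h.trans S_mul_S_mat.symm) (funext h1)))
      · refine Or.inr (Or.inr (Or.inr (Mp2Z.ext ?_ (funext fun τ => ?_))))
        · rw [mul_mat _ (S * S), S_pow_four_mat, one_mul, S_mul_S_mat, h]
        · rw [mul_phi _ (S * S), S_pow_four_phi, h1]; ring
  · rintro (rfl | rfl | rfl | rfl)
    · exact Or.inl rfl
    · exact Or.inr S_mul_S_mat
    · exact Or.inl S_pow_four_mat
    · refine Or.inr ?_
      rw [mul_mat _ (S * S), S_pow_four_mat, one_mul, S_mul_S_mat]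

lemma tsum_kernel_eq_four :
    ∑' x : Mp2Z, Set.indicator {x : Mp2Z | x.mat = 1 ∨ x.mat = -1} (fun _ => (1 : ENNReal)) x =
      4 := by
  classical
  have hne : (S * S) * (S * S) ≠ (1 : Mp2Z) := by
    intro h
    have h1 := congrArg (fun x : Mp2Z => x.phi I) h
    simp only [S_pow_four_phi, one_phi] at h1
    norm_num at h1
  have hm : (-1 : SL(2, ℤ)) ≠ 1 := by decide
  have hZ : S * S ≠ (1 : Mp2Z) := fun h => hm (by rw [← S_mul_S_mat, h]; rfl)
  have hset : {x : Mp2Z | x.mat = 1 ∨ x.mat = -1} =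
      (({1, S * S, (S * S) * (S * S), (S * S) * (S * S) * (S * S)} : Finset Mp2Z) : Set Mp2Z) := by
    ext x
    rw [Set.mem_ofPred_eq, mat_eq_one_or_neg_one_iff]
    simp
  have hcard : ({1, S * S, (S * S) * (S * S), (S * S) * (S * S) * (S * S)} : Finset Mp2Z).card =
      4 := by
    have h1 : (S * S) * (S * S) * (S * S) ≠ (1 : Mp2Z) := by
      intro h
      refine hm ?_
      have := congrArg mat h
      rwa [mul_mat _ (S * S), S_pow_four_mat, one_mul, S_mul_S_mat] at this
    rw [Finset.card_insert_of_notMem, Finset.card_insert_of_notMem, Finset.card_insert_of_notMem,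
      Finset.card_singleton]
    · simp only [Finset.mem_singleton]
      intro h
      exact hZ (mul_eq_left.mp h.symm)
    · simp only [Finset.mem_insert, Finset.mem_singleton, not_or]
      refine ⟨fun h => hZ (mul_eq_left.mp h.symm), fun h => hne ?_⟩
      exact mul_eq_right.mp h.symm
    · simp only [Finset.mem_insert, Finset.mem_singleton, not_or]
      exact ⟨hZ.symm, hne.symm, h1.symm⟩
  rw [← tsum_subtype, hset, ENNReal.tsum_const, ENat.card_eq_coe_fintype_card]
  simp [hcard]

end Mp2Z

lemma measurePreserving_mat_smul (g : SL(2, ℤ)) :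
    MeasurePreserving (fun τ : ℍ => g • τ) volume volume :=
  measurePreserving_smul (g : GL (Fin 2) ℝ) (volume : Measure ℍ)

/-- Almost every point lies in the translates of the fundamental domain by precisely four elements of
the metaplectic group. -/
lemma ae_tsum_indicator_fd : ∀ᵐ τ : ℍ, ∑' x : Mp2Z,
    Set.indicator 𝒟 (fun _ => (1 : ENNReal)) (x.mat • τ) = 4 := by
  have h1 : ∀ᵐ τ : ℍ, ∀ x : Mp2Z, x.mat • τ ∉ 𝒟 \ 𝒟ᵒ := by
    rw [ae_all_iff]
    intro x
    have := (measurePreserving_mat_smul x.mat).quasiMeasurePreserving.preimage_null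
      volume_fd_diff_fdo
    exact compl_mem_ae_iff.mpr this
  -- away from the boundary, two elements moving `τ` into `𝒟` differ by an element over `± 1`
  filter_upwards [h1] with τ hτ
  have hD : ∀ x : Mp2Z, x.mat • τ ∈ 𝒟 → x.mat • τ ∈ 𝒟ᵒ := fun x hx => by
    by_contra h
    exact hτ x ⟨hx, h⟩
  obtain ⟨g, hg⟩ := ModularGroup.exists_smul_mem_fd τ
  obtain ⟨y, rfl⟩ := Mp2Z.matHom_surjective g
  change y.mat • τ ∈ 𝒟 at hg
  rw [← Mp2Z.tsum_kernel_eq_four, ← Equiv.tsum_eq (Equiv.mulRight y)]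
  refine tsum_congr fun x => ?_
  rw [Equiv.coe_mulRight, Mp2Z.mul_mat, mul_smul]
  have hiff : x.mat • y.mat • τ ∈ 𝒟 ↔ x.mat = 1 ∨ x.mat = -1 := by
    constructor
    · intro h
      refine ModularGroup.eq_one_or_neg_one_of_mem_fdo_mem_fdo (hD y hg) ?_
      have := hD (x * y)
      rw [Mp2Z.mul_mat, mul_smul] at this
      exact this h
    · rintro (h | h)
      · rw [h, one_smul]; exact hg
      · rw [h, ModularGroup.SL_neg_smul, one_smul]; exact hg
  classical
  rw [Set.indicator_apply, Set.indicator_apply]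
  simp only [hiff, Set.mem_ofPred_eq]

lemma sum_map_restrict_fd :
    Measure.sum (fun x : Mp2Z => (volume.restrict 𝒟).map fun τ : ℍ => x.mat • τ) =
      (4 : ENNReal) • (volume : Measure ℍ) := by
  ext A hA
  rw [Measure.sum_apply _ hA, Measure.smul_apply, smul_eq_mul]
  have h1 : ∀ x : Mp2Z, ((volume.restrict 𝒟).map fun τ : ℍ => x.mat • τ) A =
      ∫⁻ τ in A, Set.indicator 𝒟 (fun _ => (1 : ENNReal)) (x⁻¹.mat • τ) := by
    intro x
    have hx := (measurePreserving_mat_smul x.mat).measurable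
    rw [Measure.map_apply hx hA, Measure.restrict_apply (hx hA),
      ← (measurePreserving_mat_smul x⁻¹.mat).measure_preimage
        ((hx hA).inter measurableSet_fd).nullMeasurableSet]
    have h2 : (fun τ : ℍ => Set.indicator 𝒟 (fun _ => (1 : ENNReal)) (x⁻¹.mat • τ)) =
        Set.indicator ((fun τ : ℍ => x⁻¹.mat • τ) ⁻¹' 𝒟) 1 := rfl
    rw [h2, lintegral_indicator_one ((measurePreserving_mat_smul x⁻¹.mat).measurable
      measurableSet_fd), Measure.restrict_apply ((measurePreserving_mat_smul x⁻¹.mat).measurable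
      measurableSet_fd)]
    congr 1
    ext τ
    simp only [Set.mem_preimage, Set.mem_inter_iff, Mp2Z.inv_mat, smul_inv_smul]
    exact and_comm
  rw [tsum_congr h1, ← lintegral_tsum]
  · have h2 : ∀ᵐ τ ∂(volume.restrict A), ∑' x : Mp2Z,
        Set.indicator 𝒟 (fun _ => (1 : ENNReal)) (x⁻¹.mat • τ) = 4 := by
      filter_upwards [ae_restrict_of_ae ae_tsum_indicator_fd] with τ hτ
      rw [← hτ]
      exact Equiv.tsum_eq (Equiv.inv Mp2Z) fun x =>
        Set.indicator 𝒟 (fun _ => (1 : ENNReal)) (x.mat • τ)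
    rw [lintegral_congr_ae h2, setLIntegral_const]
  · intro x
    exact ((measurable_const.indicator measurableSet_fd).comp
      (measurePreserving_mat_smul x⁻¹.mat).measurable).aemeasurable

/-! ### Unfolding -/

/-- A fundamental domain for the translations `τ ↦ τ + 1`. -/
def strip : Set ℍ := {τ | 0 ≤ τ.re ∧ τ.re < 1}

lemma measurableSet_strip : MeasurableSet strip :=
  (measurableSet_le measurable_const UpperHalfPlane.continuous_re.measurable).inter
    (measurableSet_lt UpperHalfPlane.continuous_re.measurable measurable_const)

lemma apply_T_zpow_smul {E : Type*} {h : ℍ → E} (hT : ∀ τ, h (ModularGroup.T • τ) = h τ) (n : ℤ)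
    (τ : ℍ) : h (ModularGroup.T ^ n • τ) = h τ := by
  induction n using Int.induction_on generalizing τ with
  | zero => rw [zpow_zero, one_smul]
  | succ n ih => rw [zpow_add_one, mul_smul, ih, hT]
  | pred n ih =>
    rw [zpow_sub_one, mul_smul, ih, ← hT, smul_inv_smul]

lemma hasSum_indicator_strip {E : Type*} [AddCommMonoid E] [TopologicalSpace E] {h : ℍ → E}
    (hT : ∀ τ, h (ModularGroup.T • τ) = h τ) (τ : ℍ) :
    HasSum (fun n : ℤ => strip.indicator h (ModularGroup.T ^ n • τ)) (h τ) := by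
  have h1 : h τ = strip.indicator h (ModularGroup.T ^ (-⌊τ.re⌋) • τ) := by
    rw [Set.indicator_of_mem, apply_T_zpow_smul hT]
    rw [strip, Set.mem_ofPred_eq, ModularGroup.re_T_zpow_smul]
    push_cast
    exact ⟨by linarith [Int.floor_le τ.re], by linarith [Int.lt_floor_add_one τ.re]⟩
  rw [h1]
  refine hasSum_single _ fun n hn => Set.indicator_of_notMem (fun hmem => hn ?_) _
  rw [strip, Set.mem_ofPred_eq, ModularGroup.re_T_zpow_smul] at hmem
  have : ⌊τ.re⌋ = -n := by
    rw [Int.floor_eq_iff]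
    push_cast
    exact ⟨by linarith, by linarith⟩
  omega

/-- Every element of `Mp₂(ℤ)` is uniquely a power of `T` times the representative of a coset. -/
def cosetEquiv : CuspCosets × ℤ ≃ Mp2Z :=
  Equiv.ofBijective (fun x => Mp2Z.T ^ x.2 * Quotient.out x.1) <| by
    constructor
    · rintro ⟨c, n⟩ ⟨d, k⟩ h
      simp only at h
      have hcd : c = d := by
        rw [← Quotient.out_eq c, ← Quotient.out_eq d]
        refine Quotient.sound (s := QuotientGroup.rightRel (Subgroup.zpowers Mp2Z.T)) ?_
        change QuotientGroup.rightRel _ _ _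
        rw [QuotientGroup.rightRel_apply]
        refine ⟨-k + n, ?_⟩
        simp only
        rw [zpow_add, eq_mul_inv_iff_mul_eq, mul_assoc, h, ← mul_assoc, ← zpow_add,
          neg_add_cancel, zpow_zero, one_mul]
      subst hcd
      have h1 := congrArg Mp2Z.mat (mul_right_cancel h)
      rw [Mp2Z.T_zpow_mat, Mp2Z.T_zpow_mat] at h1
      have h2 := congrArg (fun g : SL(2, ℤ) => g.1 0 1) h1
      simp only [ModularGroup.coe_T_zpow] at h2
      simp at h2
      rw [h2]
    · intro x
      obtain ⟨n, hn⟩ := out_rel x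
      refine ⟨(Quotient.mk _ x, n), ?_⟩
      simp only at hn ⊢
      rw [hn, inv_mul_cancel_right]

lemma cosetEquiv_smul (c : CuspCosets) (n : ℤ) (τ : ℍ) :
    (cosetEquiv (c, n)).mat • τ = ModularGroup.T ^ n • (Quotient.out c).mat • τ := by
  change (Mp2Z.T ^ n * Quotient.out c).mat • τ = _
  rw [Mp2Z.mul_mat, mul_smul, Mp2Z.T_zpow_mat]

lemma tsum_coset_eq_tsum {h : ℍ → ENNReal} (hT : ∀ τ, h (ModularGroup.T • τ) = h τ) (τ : ℍ) :
    ∑' c : CuspCosets, h ((Quotient.out c).mat • τ) =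
      ∑' x : Mp2Z, strip.indicator h (x.mat • τ) := by
  rw [← cosetEquiv.tsum_eq, ENNReal.tsum_prod (f := fun c n =>
    strip.indicator h ((cosetEquiv (c, n)).mat • τ))]
  refine tsum_congr fun c => ?_
  simp only [cosetEquiv_smul]
  exact (hasSum_indicator_strip hT _).tsum_eq.symm

/-- **Unfolding** for nonnegative functions. The factor four is the order of the center of
`Mp₂(ℤ)`. -/
theorem lintegral_unfold {h : ℍ → ENNReal} (hm : Measurable h)
    (hT : ∀ τ, h (ModularGroup.T • τ) = h τ) :
    ∫⁻ τ in 𝒟, ∑' c : CuspCosets, h ((Quotient.out c).mat • τ) = 4 * ∫⁻ τ in strip, h τ := by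
  have hg : Measurable (strip.indicator h) := hm.indicator measurableSet_strip
  have hx : ∀ x : Mp2Z, Measurable fun τ : ℍ => x.mat • τ := fun x =>
    (measurePreserving_mat_smul x.mat).measurable
  have h1 : ∫⁻ τ, strip.indicator h τ ∂((4 : ENNReal) • (volume : Measure ℍ)) =
      4 * ∫⁻ τ in strip, h τ := by
    rw [lintegral_smul_measure, lintegral_indicator measurableSet_strip, smul_eq_mul]
  rw [← h1, ← sum_map_restrict_fd, lintegral_sum_measure,
    lintegral_congr fun τ => tsum_coset_eq_tsum hT τ,
    lintegral_tsum (f := fun (x : Mp2Z) τ => strip.indicator h (x.mat • τ))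
      fun x => (hg.comp (hx x)).aemeasurable]
  exact tsum_congr fun x => (lintegral_map hg (hx x)).symm

/-- **Unfolding** for absolutely convergent integrals. -/
theorem integral_unfold {h : ℍ → ℂ} (hm : StronglyMeasurable h)
    (hT : ∀ τ, h (ModularGroup.T • τ) = h τ)
    (hfin : ∫⁻ τ in 𝒟, ∑' c : CuspCosets, ‖h ((Quotient.out c).mat • τ)‖ₑ ≠ ⊤) :
    IntegrableOn h strip ∧
      ∫ τ in 𝒟, ∑' c : CuspCosets, h ((Quotient.out c).mat • τ) = 4 * ∫ τ in strip, h τ := by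
  have hTe : ∀ τ, ‖h (ModularGroup.T • τ)‖ₑ = ‖h τ‖ₑ := fun τ => by rw [hT]
  have hl := lintegral_unfold hm.enorm hTe
  have hint : IntegrableOn h strip := by
    refine ⟨hm.aestronglyMeasurable, ?_⟩
    rw [HasFiniteIntegral, lt_top_iff_ne_top]
    intro h1
    rw [hl, h1] at hfin
    exact hfin (by simp)
  refine ⟨hint, ?_⟩
  set g := strip.indicator h with hg
  have hgm : StronglyMeasurable g := hm.indicator measurableSet_strip
  have hgi : Integrable g := (integrable_indicator_iff measurableSet_strip).mpr hint
  have hgx : ∀ x : Mp2Z, StronglyMeasurable fun τ : ℍ => g (x.mat • τ) := fun x =>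
    hgm.comp_measurable (measurePreserving_mat_smul x.mat).measurable
  have hge : ∀ τ, ‖g τ‖ₑ = strip.indicator (fun τ => ‖h τ‖ₑ) τ := fun τ => by
    rw [hg, enorm_indicator_eq_indicator_enorm]
  have hpt : ∀ᵐ τ ∂(volume.restrict 𝒟), ∑' c : CuspCosets, h ((Quotient.out c).mat • τ) =
      ∑' x : Mp2Z, g (x.mat • τ) := by
    have hmeas : AEMeasurable (fun τ : ℍ => ∑' c : CuspCosets, ‖h ((Quotient.out c).mat • τ)‖ₑ)
        (volume.restrict 𝒟) := by
      have : Measurable fun τ : ℍ => ∑' c : CuspCosets, ‖h ((Quotient.out c).mat • τ)‖ₑ :=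
        Measurable.tsum fun c =>
          hm.enorm.comp (measurePreserving_mat_smul (Quotient.out c).mat).measurable
      exact this.aemeasurable
    filter_upwards [ae_lt_top' hmeas hfin] with τ hτ
    have hs : Summable fun x : Mp2Z => g (x.mat • τ) := by
      refine Summable.of_enorm ?_
      simp only [hge]
      rw [← tsum_coset_eq_tsum hTe]
      exact hτ.ne
    rw [← cosetEquiv.tsum_eq, Summable.tsum_prod (f := fun p => g ((cosetEquiv p).mat • τ))
      (cosetEquiv.summable_iff.mpr hs)]
    refine tsum_congr fun c => ?_
    simp only [cosetEquiv_smul]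
    exact (hasSum_indicator_strip hT _).tsum_eq.symm
  rw [integral_congr_ae hpt, integral_tsum (fun x => (hgx x).aestronglyMeasurable)]
  · have h4 : ∫ τ in strip, h τ = ∫ τ, g τ := (integral_indicator measurableSet_strip).symm
    have hsum : Integrable g (Measure.sum fun x : Mp2Z =>
        (volume.restrict 𝒟).map fun τ : ℍ => x.mat • τ) := by
      rw [sum_map_restrict_fd]
      exact hgi.smul_measure (by simp)
    have h5 := integral_sum_measure hsum
    rw [sum_map_restrict_fd, integral_smul_measure] at h5
    rw [h4]
    have h6 : (4 : ENNReal).toReal • ∫ τ, g τ = 4 * ∫ τ, g τ := by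
      rw [show (4 : ENNReal).toReal = 4 by norm_num, Complex.real_smul]; norm_num
    rw [← h6, h5]
    refine tsum_congr fun x => ?_
    rw [integral_map (measurePreserving_mat_smul x.mat).measurable.aemeasurable
      hgm.aestronglyMeasurable]
  · rw [← lintegral_tsum fun x => (hgx x).enorm.aemeasurable]
    simp only [hge]
    rw [lintegral_congr fun τ => (tsum_coset_eq_tsum hTe τ).symm]
    exact hfin

/-! ### Gaussian series attached to kernels -/

section Series

variable {bp bm : ℕ}

/-- Moderate growth of a function of `y > 0` and a vector: polynomial in `y`, `1/y` and the
vector. -/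
def ModerateGrowth (κ : ℝ → V bp bm → ℂ) : Prop :=
  ∃ (C : ℝ) (s N : ℕ), 0 ≤ C ∧ ∀ y, 0 < y → ∀ x, ‖κ y x‖ ≤ C * (y + y⁻¹) ^ s * (1 + ‖x‖) ^ N

lemma one_le_add_inv {y : ℝ} (hy : 0 < y) : 1 ≤ y + y⁻¹ := by
  rcases le_or_gt 1 y with h | h
  · have : 0 < y⁻¹ := inv_pos.mpr hy
    linarith
  · have : 1 ≤ y⁻¹ := (one_le_inv₀ hy).mpr h.le
    linarith

namespace ModerateGrowth

lemma of_polyGrowth {f : V bp bm → ℂ} (hf : PolyGrowth f) : ModerateGrowth fun _ x => f x := by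
  obtain ⟨C, N, hC, h⟩ := hf
  exact ⟨C, 0, N, hC, fun y _ x => by simpa using h x⟩

lemma const (a : ℂ) : ModerateGrowth fun (_ : ℝ) (_ : V bp bm) => a :=
  of_polyGrowth (PolyGrowth.const a)

lemma rpow (a : ℝ) : ModerateGrowth fun (y : ℝ) (_ : V bp bm) => ((y ^ a : ℝ) : ℂ) := by
  refine ⟨1, ⌈|a|⌉₊, 0, zero_le_one, fun y hy x => ?_⟩
  rw [pow_zero, mul_one, one_mul, Complex.norm_real, Real.norm_of_nonneg (by positivity),
    ← Real.rpow_natCast]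
  have h1 : |a| ≤ (⌈|a|⌉₊ : ℝ) := Nat.le_ceil _
  refine le_trans ?_ (Real.rpow_le_rpow_of_exponent_le (one_le_add_inv hy) h1)
  have hinv : 0 < y⁻¹ := inv_pos.mpr hy
  rcases le_or_gt 0 a with h | h
  · rw [abs_of_nonneg h]
    exact Real.rpow_le_rpow hy.le (by linarith) h
  · rw [abs_of_neg h, show y ^ a = (y⁻¹) ^ (-a) by rw [Real.inv_rpow hy.le, Real.rpow_neg hy.le,
      inv_inv]]
    exact Real.rpow_le_rpow hinv.le (by linarith) (by linarith)

lemma mul {κ κ' : ℝ → V bp bm → ℂ} (h : ModerateGrowth κ) (h' : ModerateGrowth κ') :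
    ModerateGrowth fun y x => κ y x * κ' y x := by
  obtain ⟨C, s, N, hC, h⟩ := h
  obtain ⟨C', s', N', hC', h'⟩ := h'
  refine ⟨C * C', s + s', N + N', mul_nonneg hC hC', fun y hy x => ?_⟩
  have hinv : 0 < y⁻¹ := inv_pos.mpr hy
  rw [norm_mul]
  refine (mul_le_mul (h y hy x) (h' y hy x) (norm_nonneg _) (by positivity)).trans (le_of_eq ?_)
  ring

lemma add {κ κ' : ℝ → V bp bm → ℂ} (h : ModerateGrowth κ) (h' : ModerateGrowth κ') :
    ModerateGrowth fun y x => κ y x + κ' y x := by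
  obtain ⟨C, s, N, hC, h⟩ := h
  obtain ⟨C', s', N', hC', h'⟩ := h'
  refine ⟨C + C', s + s', N + N', add_nonneg hC hC', fun y hy x => ?_⟩
  have h1 := one_le_add_inv hy
  have h2 : 1 ≤ 1 + ‖x‖ := by linarith [norm_nonneg x]
  refine (norm_add_le _ _).trans ?_
  rw [add_mul, add_mul]
  refine add_le_add ((h y hy x).trans ?_) ((h' y hy x).trans ?_)
  · gcongr
    · exact Nat.le_add_right _ _
    · exact Nat.le_add_right _ _
  · gcongr
    · exact Nat.le_add_left _ _
    · exact Nat.le_add_left _ _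

lemma sum {ι : Type*} {s : Finset ι} {κ : ι → ℝ → V bp bm → ℂ}
    (h : ∀ i ∈ s, ModerateGrowth (κ i)) : ModerateGrowth fun y x => ∑ i ∈ s, κ i y x := by
  classical
  induction s using Finset.induction_on with
  | empty => simpa using const 0
  | insert a s ha ih =>
    simp only [Finset.sum_insert ha]
    exact (h a (Finset.mem_insert_self _ _)).add
      (ih fun i hi => h i (Finset.mem_insert_of_mem hi))

lemma congr {κ κ' : ℝ → V bp bm → ℂ} (h : ModerateGrowth κ)
    (hκ : ∀ y, 0 < y → ∀ x, κ' y x = κ y x) : ModerateGrowth κ' := by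
  obtain ⟨C, s, N, hC, h⟩ := h
  exact ⟨C, s, N, hC, fun y hy x => by rw [hκ y hy]; exact h y hy x⟩

lemma polyGrowth {κ : ℝ → V bp bm → ℂ} (h : ModerateGrowth κ) {y : ℝ} (hy : 0 < y) :
    PolyGrowth (κ y) := by
  obtain ⟨C, s, N, hC, h⟩ := h
  have hinv : 0 < y⁻¹ := inv_pos.mpr hy
  exact ⟨C * (y + y⁻¹) ^ s, N, by positivity, h y hy⟩

end ModerateGrowth

/-- `x ↦ sqPlus x + sqMinus x` is the majorant of the quadratic form. -/
lemma sqPlus_add_sqMinus_nonneg (x : V bp bm) : 0 ≤ sqPlus x + sqMinus x :=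
  (sq_nonneg _).trans (norm_sq_le x)

variable {W : Type*} [AddCommGroup W] [Module ℝ W] {q : QuadraticForm ℝ W} {L : AddSubgroup W}

/-- The series `∑_{λ ∈ L+γ} κ(y, λ) e(τ Q(λ⁺) + conj(τ) Q(λ⁻))`. -/
def kernelSeries (u : q.IsometryEquiv (stdForm bp bm)) (L : AddSubgroup W)
    (κ : ℝ → V bp bm → ℂ) (γ : Discr q L) (z : ℂ) : ℂ :=
  ∑' x : Coset q L γ, κ z.im (u (x.1 : W)) * gaussV z (u (x.1 : W))

lemma ModerateGrowth.summable (u : q.IsometryEquiv (stdForm bp bm)) (hL : IsEvenLattice q L)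
    {κ : ℝ → V bp bm → ℂ} (hκ : ModerateGrowth κ) {z : ℂ} (hz : 0 < z.im) :
    Summable fun x : dual q L => κ z.im (u (x : W)) * gaussV z (u (x : W)) :=
  ((hκ.polyGrowth hz).rapidDecay hz).summable_dual u hL

lemma ModerateGrowth.summable_coset (u : q.IsometryEquiv (stdForm bp bm))
    (hL : IsEvenLattice q L) {κ : ℝ → V bp bm → ℂ} (hκ : ModerateGrowth κ) {z : ℂ}
    (hz : 0 < z.im) (γ : Discr q L) :
    Summable fun x : Coset q L γ => κ z.im (u (x.1 : W)) * gaussV z (u (x.1 : W)) :=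
  (hκ.summable u hL hz).comp_injective Subtype.val_injective

/-- On a horizontal strip the terms of the series have a summable majorant. -/
lemma ModerateGrowth.exists_majorant (u : q.IsometryEquiv (stdForm bp bm))
    (hL : IsEvenLattice q L) {κ : ℝ → V bp bm → ℂ} (hκ : ModerateGrowth κ) {a b : ℝ}
    (ha : 0 < a) : ∃ U : dual q L → ℝ, Summable U ∧ (∀ x, 0 ≤ U x) ∧ ∀ (z : ℂ) (x : dual q L), a ≤ z.im →
      z.im ≤ b → ‖κ z.im (u (x : W)) * gaussV z (u (x : W))‖ ≤ U x := by
  obtain ⟨C, s, N, hC, h⟩ := hκ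
  obtain ⟨M, hM⟩ := ThetaLift.summable_dual u hL
  have hf : PolyGrowth fun x : V bp bm => ((C * (|b| + a⁻¹) ^ s * (1 + ‖x‖) ^ N : ℝ) : ℂ) := by
    refine ⟨C * (|b| + a⁻¹) ^ s, N, by positivity, fun x => ?_⟩
    rw [Complex.norm_real, Real.norm_of_nonneg (by positivity)]
  obtain ⟨D, hD, hD'⟩ := hf.mul_gauss_le (c := Real.pi * a) (by positivity) M
  refine ⟨fun x => D * (1 / (1 + ‖u (x : W)‖) ^ M), hM.mul_left D,
    fun x => by positivity, fun z x h1 h2 => ?_⟩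
  have hz : 0 < z.im := ha.trans_le h1
  refine le_trans ?_ ((hD' (u (x : W))).trans (le_of_eq (by ring)))
  rw [norm_mul, norm_gaussV, Complex.norm_real, Real.norm_of_nonneg (by positivity)]
  have hR := sqPlus_add_sqMinus_nonneg (u (x : W))
  refine mul_le_mul ((h _ hz _).trans ?_) ?_ (Real.exp_pos _).le (by positivity)
  · have hinv : z.im⁻¹ ≤ a⁻¹ := inv_anti₀ ha h1
    have hb : z.im ≤ |b| := h2.trans (le_abs_self b)
    have : 0 < z.im⁻¹ := inv_pos.mpr hz
    gcongr
  · rw [Real.exp_le_exp]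
    have : Real.pi * a ≤ Real.pi * z.im := mul_le_mul_of_nonneg_left h1 Real.pi_pos.le
    nlinarith

/-- A complex valued real-linear form on the plane, given by its two coefficients. -/
def planeForm (a b : ℂ) : ℝ × ℝ →L[ℝ] ℂ :=
  (ContinuousLinearMap.fst ℝ ℝ ℝ).smulRight a + (ContinuousLinearMap.snd ℝ ℝ ℝ).smulRight b

lemma planeForm_apply (a b : ℂ) (p : ℝ × ℝ) : planeForm a b p = p.1 * a + p.2 * b := by
  simp [planeForm]

lemma norm_planeForm_le (a b : ℂ) : ‖planeForm a b‖ ≤ ‖a‖ + ‖b‖ := by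
  refine (norm_add_le _ _).trans (add_le_add ?_ ?_)
  · rw [ContinuousLinearMap.norm_smulRight_apply]
    exact mul_le_of_le_one_left (norm_nonneg _) (ContinuousLinearMap.norm_fst_le ..)
  · rw [ContinuousLinearMap.norm_smulRight_apply]
    exact mul_le_of_le_one_left (norm_nonneg _) (ContinuousLinearMap.norm_snd_le ..)

lemma hasSum_planeForm {ι : Type*} {a b : ι → ℂ} {A B : ℂ} (ha : HasSum a A) (hb : HasSum b B) :
    HasSum (fun i => planeForm (a i) (b i)) (planeForm A B) := by
  have h1 := ha.mapL (ContinuousLinearMap.smulRightL ℝ (ℝ × ℝ) ℂ (ContinuousLinearMap.fst ℝ ℝ ℝ))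
  have h2 := hb.mapL (ContinuousLinearMap.smulRightL ℝ (ℝ × ℝ) ℂ (ContinuousLinearMap.snd ℝ ℝ ℝ))
  exact h1.add h2

lemma gaussV_mk (x y : ℝ) (v : V bp bm) : gaussV ⟨x, y⟩ v =
    Complex.exp (2 * Real.pi * Complex.I * stdForm bp bm v * x -
      Real.pi * (sqPlus v + sqMinus v) * y) := by
  rw [gaussV, e, stdForm_plusPart, stdForm_minusPart, stdForm_eq]
  congr 1
  have h1 : (⟨x, y⟩ : ℂ) = x + y * Complex.I := Complex.mk_eq_add_mul_I x y
  rw [h1]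
  simp only [map_add, map_mul, Complex.conj_ofReal, Complex.conj_I]
  push_cast
  linear_combination (Real.pi * y * (sqPlus v + sqMinus v) : ℂ) * Complex.I_sq

/-- The kernel of the `x`-derivative. -/
def kernelDX (κ : ℝ → V bp bm → ℂ) (y : ℝ) (v : V bp bm) : ℂ :=
  2 * Real.pi * Complex.I * stdForm bp bm v * κ y v

/-- The kernel of the `y`-derivative; `κ'` is the derivative of `κ` with respect to `y`. -/
def kernelDY (κ κ' : ℝ → V bp bm → ℂ) (y : ℝ) (v : V bp bm) : ℂ :=
  κ' y v - Real.pi * (sqPlus v + sqMinus v) * κ y v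

lemma ModerateGrowth.kernelDX {κ : ℝ → V bp bm → ℂ} (h : ModerateGrowth κ) :
    ModerateGrowth (kernelDX κ) := by
  have h1 : PolyGrowth fun v : V bp bm => 2 * Real.pi * Complex.I * (stdForm bp bm v : ℂ) := by
    have h2 : (fun v : V bp bm => 2 * Real.pi * Complex.I * (stdForm bp bm v : ℂ)) =
        fun v => Real.pi * Complex.I * ((ThetaLift.sqPlus v : ℂ) + (-1) * ThetaLift.sqMinus v) := by
      funext v
      rw [stdForm_eq]
      push_cast
      ring
    rw [h2]
    exact (PolyGrowth.const _).mul (PolyGrowth.sqPlus.add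
      ((PolyGrowth.const _).mul PolyGrowth.sqMinus))
  exact (ModerateGrowth.of_polyGrowth h1).mul h

lemma ModerateGrowth.kernelDY {κ κ' : ℝ → V bp bm → ℂ} (h : ModerateGrowth κ)
    (h' : ModerateGrowth κ') : ModerateGrowth (kernelDY κ κ') := by
  have h1 : PolyGrowth fun v : V bp bm =>
      (-Real.pi : ℂ) * ((ThetaLift.sqPlus v : ℂ) + ThetaLift.sqMinus v) :=
    (PolyGrowth.const _).mul (PolyGrowth.sqPlus.add PolyGrowth.sqMinus)
  refine (h'.add ((ModerateGrowth.of_polyGrowth h1).mul h)).congr fun y _ x => ?_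
  rw [ThetaLift.kernelDY]
  ring

/-- A Gaussian series is differentiable termwise. -/
theorem hasFDerivAt_kernelSeries (u : q.IsometryEquiv (stdForm bp bm)) (hL : IsEvenLattice q L)
    {κ κ' : ℝ → V bp bm → ℂ} (hκ : ModerateGrowth κ) (hκ' : ModerateGrowth κ')
    (hd : ∀ y, 0 < y → ∀ v, HasDerivAt (fun y => κ y v) (κ' y v) y) (γ : Discr q L) {p : ℝ × ℝ}
    (hp : 0 < p.2) :
    HasFDerivAt (fun p : ℝ × ℝ => kernelSeries u L κ γ ⟨p.1, p.2⟩)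
      (planeForm (kernelSeries u L (kernelDX κ) γ ⟨p.1, p.2⟩)
        (kernelSeries u L (kernelDY κ κ') γ ⟨p.1, p.2⟩)) p := by
  set Ω : Set (ℝ × ℝ) := {p' | p.2 / 2 < p'.2 ∧ p'.2 < 2 * p.2} with hΩ
  have hΩo : IsOpen Ω := (isOpen_lt continuous_const continuous_snd).inter
    (isOpen_lt continuous_snd continuous_const)
  have hconv : Convex ℝ Ω := by
    have h1 : Ω = Prod.snd ⁻¹' Set.Ioo (p.2 / 2) (2 * p.2) := rfl
    rw [h1]
    exact (convex_Ioo _ _).linear_preimage (LinearMap.snd ℝ ℝ ℝ)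
  have hmem : p ∈ Ω := ⟨by linarith, by linarith⟩
  obtain ⟨U, hU, hU0, hUle⟩ := (hκ.kernelDX).exists_majorant u hL (a := p.2 / 2) (b := 2 * p.2)
    (half_pos hp)
  obtain ⟨U', hU', hU0', hUle'⟩ := (hκ.kernelDY hκ').exists_majorant u hL (a := p.2 / 2)
    (b := 2 * p.2) (half_pos hp)
  have hinj : Function.Injective fun x : Coset q L γ => x.1 := Subtype.val_injective
  have key := hasFDerivAt_tsum_of_isPreconnected
    (f := fun (x : Coset q L γ) (p : ℝ × ℝ) =>
      κ p.2 (u (x.1 : W)) * gaussV ⟨p.1, p.2⟩ (u (x.1 : W)))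
    (f' := fun (x : Coset q L γ) (p : ℝ × ℝ) =>
      planeForm (kernelDX κ p.2 (u (x.1 : W)) * gaussV ⟨p.1, p.2⟩ (u (x.1 : W)))
        (kernelDY κ κ' p.2 (u (x.1 : W)) * gaussV ⟨p.1, p.2⟩ (u (x.1 : W))))
    (u := fun x => U x.1 + U' x.1) (s := Ω) (x₀ := p) (x := p)
    ((hU.comp_injective hinj).add (hU'.comp_injective hinj)) hΩo hconv.isPreconnected
    (fun x p' hp' => ?_) (fun x p' hp' => ?_) hmem
    (hκ.summable_coset u hL (z := ⟨p.1, p.2⟩) hp γ) hmem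
  · have h1 := (hκ.kernelDX.summable_coset u hL (z := ⟨p.1, p.2⟩) hp γ).hasSum
    have h2 := ((hκ.kernelDY hκ').summable_coset u hL (z := ⟨p.1, p.2⟩) hp γ).hasSum
    rw [(hasSum_planeForm h1 h2).tsum_eq] at key
    exact key
  · have hp'0 : 0 < p'.2 := (half_pos hp).trans hp'.1
    have h1 := (hd p'.2 hp'0 (u (x.1 : W))).hasFDerivAt.comp p'
      (ContinuousLinearMap.snd ℝ ℝ ℝ).hasFDerivAt
    set v := u (x.1 : W)
    have h2 : HasFDerivAt (fun p : ℝ × ℝ => gaussV (bp := bp) (bm := bm) ⟨p.1, p.2⟩ v)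
        (planeForm (2 * Real.pi * Complex.I * stdForm bp bm v * gaussV ⟨p'.1, p'.2⟩ v)
          (-(Real.pi * (sqPlus v + sqMinus v)) * gaussV ⟨p'.1, p'.2⟩ v)) p' := by
      have e1 : HasFDerivAt (fun p : ℝ × ℝ => 2 * Real.pi * Complex.I * stdForm bp bm v * (p.1 : ℂ) -
          Real.pi * (sqPlus v + sqMinus v) * (p.2 : ℂ))
          (planeForm (2 * Real.pi * Complex.I * stdForm bp bm v)
            (-(Real.pi * (sqPlus v + sqMinus v)))) p' := by
        have e2 : (fun p : ℝ × ℝ => 2 * Real.pi * Complex.I * stdForm bp bm v * (p.1 : ℂ) -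
          Real.pi * (sqPlus v + sqMinus v) * (p.2 : ℂ)) =
          planeForm (2 * Real.pi * Complex.I * stdForm bp bm v)
            (-(Real.pi * (sqPlus v + sqMinus v))) := by
          funext p
          rw [planeForm_apply]
          ring
        rw [e2]
        exact ContinuousLinearMap.hasFDerivAt _
      have e3 := e1.cexp
      simp only [gaussV_mk]
      refine e3.congr_fderiv ?_
      ext <;> simp [planeForm_apply] <;> ring
    refine (h1.mul h2).congr_fderiv ?_
    ext <;> simp [planeForm_apply, kernelDX, kernelDY] <;> ring
  · refine (norm_planeForm_le _ _).trans (add_le_add ?_ ?_)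
    · exact hUle ⟨p'.1, p'.2⟩ x.1 hp'.1.le hp'.2.le
    · exact hUle' ⟨p'.1, p'.2⟩ x.1 hp'.1.le hp'.2.le

/-- Nonzero vectors of the dual lattice are bounded away from zero. -/
lemma exists_dual_gap (u : q.IsometryEquiv (stdForm bp bm)) (hL : IsEvenLattice q L) :
    ∃ δ : ℝ, 0 < δ ∧ ∀ x : dual q L, (x : W) ≠ 0 →
      δ ≤ sqPlus (u (x : W)) + sqMinus (u (x : W)) := by
  obtain ⟨N, hN⟩ := ThetaLift.summable_dual u hL
  have hfin : {x : dual q L | ¬ 1 / (1 + ‖u (x : W)‖) ^ N < 1 / 2 ^ N}.Finite := by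
    have := hN.tendsto_cofinite_zero.eventually (gt_mem_nhds (show (0 : ℝ) < 1 / 2 ^ N by positivity))
    exact Filter.eventually_cofinite.mp this
  have hpos : ∀ x : dual q L, (x : W) ≠ 0 → 0 < ‖u (x : W)‖ ^ 2 := fun x hx => by
    have : u (x : W) ≠ 0 := fun h => hx (u.toLinearEquiv.map_eq_zero_iff.mp h)
    positivity
  obtain ⟨δ, hδ, hδ'⟩ : ∃ δ : ℝ, 0 < δ ∧ ∀ x ∈ {x : dual q L |
      ¬ 1 / (1 + ‖u (x : W)‖) ^ N < 1 / 2 ^ N}, (x : W) ≠ 0 → δ ≤ ‖u (x : W)‖ ^ 2 := by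
    have hfin' : {x : dual q L | ¬ 1 / (1 + ‖u (x : W)‖) ^ N < 1 / 2 ^ N ∧
      (x : W) ≠ 0}.Finite := hfin.subset fun x hx => hx.1
    rcases Set.eq_empty_or_nonempty {x : dual q L | ¬ 1 / (1 + ‖u (x : W)‖) ^ N < 1 / 2 ^ N ∧
      (x : W) ≠ 0} with h | h
    · refine ⟨1, one_pos, fun x hx hx0 => ?_⟩
      have : x ∈ (∅ : Set (dual q L)) := h ▸ ⟨hx, hx0⟩
      exact this.elim
    · obtain ⟨x₀, hx₀, hmin⟩ := Set.exists_min_image _ (fun x : dual q L => ‖u (x : W)‖ ^ 2) hfin' h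
      exact ⟨_, hpos x₀ hx₀.2, fun x hx hx0 => hmin x ⟨hx, hx0⟩⟩
  refine ⟨min δ 1, lt_min hδ one_pos, fun x hx => le_trans ?_ (norm_sq_le _)⟩
  by_cases hm : 1 / (1 + ‖u (x : W)‖) ^ N < 1 / 2 ^ N
  · have h1 : (2 : ℝ) ^ N < (1 + ‖u (x : W)‖) ^ N := by
      rwa [div_lt_div_iff₀ (by positivity) (by positivity), one_mul, one_mul] at hm
    have h2 : 2 < 1 + ‖u (x : W)‖ := lt_of_pow_lt_pow_left₀ N (by positivity) h1
    exact (min_le_right _ _).trans (by nlinarith)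
  · exact (min_le_left _ _).trans (hδ' x hm hx)

/-- A Gaussian series grows at most polynomially at the cusp. -/
lemma ModerateGrowth.exists_bound (u : q.IsometryEquiv (stdForm bp bm)) (hL : IsEvenLattice q L)
    {κ : ℝ → V bp bm → ℂ} {C : ℝ} {s N : ℕ} (hC : 0 ≤ C)
    (h : ∀ y, 0 < y → ∀ x, ‖κ y x‖ ≤ C * (y + y⁻¹) ^ s * (1 + ‖x‖) ^ N) :
    ∃ D : ℝ, 0 ≤ D ∧ ∀ (z : ℂ) (γ : Discr q L), 1 / 2 ≤ z.im →
      ‖kernelSeries u L κ γ z‖ ≤ D * z.im ^ s := by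
  obtain ⟨M, hM⟩ := ThetaLift.summable_dual u hL
  have hf : PolyGrowth fun x : V bp bm => ((C * (1 + ‖x‖) ^ N : ℝ) : ℂ) := by
    refine ⟨C, N, hC, fun x => ?_⟩
    rw [Complex.norm_real, Real.norm_of_nonneg (by positivity)]
  obtain ⟨D, hD, hD'⟩ := hf.mul_gauss_le (c := Real.pi * (1 / 2)) (by positivity) M
  refine ⟨5 ^ s * ∑' x : dual q L, D * (1 / (1 + ‖u (x : W)‖) ^ M), by positivity, fun z γ hz => ?_⟩
  have hz0 : 0 < z.im := by linarith
  have hsum := (hM.mul_left (D * (5 * z.im) ^ s))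
  have hle : ∀ x : Coset q L γ, ‖κ z.im (u (x.1 : W)) * gaussV z (u (x.1 : W))‖ ≤
      D * (5 * z.im) ^ s * (1 / (1 + ‖u (x.1 : W)‖) ^ M) := by
    intro x
    have h1 := hD' (u (x.1 : W))
    rw [Complex.norm_real, Real.norm_of_nonneg (by positivity)] at h1
    have hR := sqPlus_add_sqMinus_nonneg (u (x.1 : W))
    have h2 : z.im + z.im⁻¹ ≤ 5 * z.im := by
      have : z.im⁻¹ ≤ 4 * z.im := by
        rw [inv_le_iff_one_le_mul₀ hz0]; nlinarith
      linarith
    have hinv : 0 < z.im⁻¹ := inv_pos.mpr hz0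
    rw [norm_mul, norm_gaussV]
    calc ‖κ z.im (u (x.1 : W))‖ *
          Real.exp (-(Real.pi * z.im) * (sqPlus (u (x.1 : W)) + sqMinus (u (x.1 : W))))
        ≤ (C * (5 * z.im) ^ s * (1 + ‖u (x.1 : W)‖) ^ N) *
          Real.exp (-(Real.pi * (1 / 2)) * (sqPlus (u (x.1 : W)) + sqMinus (u (x.1 : W)))) := by
          refine mul_le_mul ((h _ hz0 _).trans ?_) ?_ (Real.exp_pos _).le (by positivity)
          · gcongr
          · rw [Real.exp_le_exp]
            have : Real.pi * (1 / 2) ≤ Real.pi * z.im := mul_le_mul_of_nonneg_left hz Real.pi_pos.le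
            nlinarith
      _ = (5 * z.im) ^ s * (C * (1 + ‖u (x.1 : W)‖) ^ N *
          Real.exp (-(Real.pi * (1 / 2)) * (sqPlus (u (x.1 : W)) + sqMinus (u (x.1 : W))))) := by ring
      _ ≤ (5 * z.im) ^ s * (D / (1 + ‖u (x.1 : W)‖) ^ M) := by gcongr
      _ = _ := by ring
  have hcos := hsum.comp_injective (Subtype.val_injective : Function.Injective
    fun x : Coset q L γ => x.1)
  refine (tsum_of_norm_bounded hcos.hasSum hle).trans ?_
  refine (hcos.tsum_le_tsum_of_inj (fun x : Coset q L γ => x.1) Subtype.val_injective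
    (fun x _ => by positivity) (fun x => le_rfl) hsum).trans ?_
  rw [tsum_mul_left, tsum_mul_left, mul_pow]
  exact le_of_eq (by ring)

/-- If the term of the zero vector vanishes, a Gaussian series decays rapidly at the cusp. -/
lemma ModerateGrowth.exists_decay (u : q.IsometryEquiv (stdForm bp bm)) (hL : IsEvenLattice q L)
    {κ : ℝ → V bp bm → ℂ} (hκ : ModerateGrowth κ) (h0 : ∀ y, 0 < y → κ y 0 = 0) {r : ℝ}
    (hr : 0 < r) : ∃ D : ℝ, 0 ≤ D ∧ ∀ (z : ℂ) (γ : Discr q L), 1 / 2 ≤ z.im →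
      ‖kernelSeries u L κ γ z‖ ≤ D * z.im ^ (-r) := by
  obtain ⟨C, s, N, hC, h⟩ := hκ
  obtain ⟨δ, hδ, hgap⟩ := exists_dual_gap u hL
  obtain ⟨M, hM⟩ := ThetaLift.summable_dual u hL
  have hf : PolyGrowth fun x : V bp bm => ((C * (1 + ‖x‖) ^ N : ℝ) : ℂ) := by
    refine ⟨C, N, hC, fun x => ?_⟩
    rw [Complex.norm_real, Real.norm_of_nonneg (by positivity)]
  obtain ⟨D, hD, hD'⟩ := hf.mul_gauss_le (c := Real.pi * (1 / 4)) (by positivity) M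
  set E : ℝ := 5 ^ s * ((s + r) / (Real.pi * δ / 2)) ^ (s + r) with hE
  refine ⟨E * ∑' x : dual q L, D * (1 / (1 + ‖u (x : W)‖) ^ M), by positivity, fun z γ hz => ?_⟩
  have hz0 : 0 < z.im := by linarith
  have hsum := (hM.mul_left (D * (E * z.im ^ (-r))))
  have hle : ∀ x : Coset q L γ, ‖κ z.im (u (x.1 : W)) * gaussV z (u (x.1 : W))‖ ≤
      D * (E * z.im ^ (-r)) * (1 / (1 + ‖u (x.1 : W)‖) ^ M) := by
    intro x
    by_cases hx : (x.1 : W) = 0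
    · rw [hx, map_zero, h0 _ hz0, zero_mul, norm_zero]
      positivity
    have hg := hgap x.1 hx
    have h1 := hD' (u (x.1 : W))
    rw [Complex.norm_real, Real.norm_of_nonneg (by positivity)] at h1
    set R := sqPlus (u (x.1 : W)) + sqMinus (u (x.1 : W))
    have h2 : z.im + z.im⁻¹ ≤ 5 * z.im := by
      have : z.im⁻¹ ≤ 4 * z.im := by
        rw [inv_le_iff_one_le_mul₀ hz0]; nlinarith
      linarith
    have hinv : 0 < z.im⁻¹ := inv_pos.mpr hz0
    have h3 := rpow_mul_exp_neg_le (s := s + r) (c := Real.pi * δ / 2) (by positivity)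
      (by positivity) hz0
    have h4 : (5 * z.im) ^ s * Real.exp (-(Real.pi * δ / 2 * z.im)) ≤ E * z.im ^ (-r) := by
      rw [Real.rpow_neg hz0.le, ← div_eq_mul_inv, le_div_iff₀ (by positivity), mul_pow, hE]
      rw [Real.rpow_add hz0, Real.rpow_natCast] at h3
      calc 5 ^ s * z.im ^ s * Real.exp (-(Real.pi * δ / 2 * z.im)) * z.im ^ r
          = 5 ^ s * (z.im ^ s * z.im ^ r * Real.exp (-(Real.pi * δ / 2 * z.im))) := by ring
        _ ≤ _ := by gcongr
    rw [norm_mul, norm_gaussV]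
    calc ‖κ z.im (u (x.1 : W))‖ * Real.exp (-(Real.pi * z.im) * R)
        ≤ (C * (5 * z.im) ^ s * (1 + ‖u (x.1 : W)‖) ^ N) *
          (Real.exp (-(Real.pi * δ / 2 * z.im)) * Real.exp (-(Real.pi * (1 / 4)) * R)) := by
          refine mul_le_mul ((h _ hz0 _).trans ?_) ?_ (Real.exp_pos _).le (by positivity)
          · gcongr
          · rw [← Real.exp_add, Real.exp_le_exp]
            have e1 : Real.pi * (z.im - 1 / 4) * δ ≤ Real.pi * (z.im - 1 / 4) * R :=
              mul_le_mul_of_nonneg_left hg (mul_nonneg Real.pi_pos.le (by linarith))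
            have e2 : 0 ≤ Real.pi * δ * (z.im / 2 - 1 / 4) :=
              mul_nonneg (by positivity) (by linarith)
            linarith
      _ = (5 * z.im) ^ s * Real.exp (-(Real.pi * δ / 2 * z.im)) *
          (C * (1 + ‖u (x.1 : W)‖) ^ N * Real.exp (-(Real.pi * (1 / 4)) * R)) := by ring
      _ ≤ E * z.im ^ (-r) * (D / (1 + ‖u (x.1 : W)‖) ^ M) := by gcongr
      _ = _ := by ring
  have hcos := hsum.comp_injective (Subtype.val_injective : Function.Injective
    fun x : Coset q L γ => x.1)
  refine (tsum_of_norm_bounded hcos.hasSum hle).trans ?_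
  refine (hcos.tsum_le_tsum_of_inj (fun x : Coset q L γ => x.1) Subtype.val_injective
    (fun x _ => by positivity) (fun x => le_rfl) hsum).trans ?_
  rw [tsum_mul_left, tsum_mul_left]
  exact le_of_eq (by ring)

end Series

/-! ### Integrability on the fundamental domain -/

lemma abs_re_le_of_mem_fd {τ : ℍ} (h : τ ∈ 𝒟) : |τ.re| ≤ 1 / 2 := h.2

lemma half_le_im_of_mem_fd {τ : ℍ} (h : τ ∈ 𝒟) : 1 / 2 ≤ τ.im := by
  have h1 := ModularGroup.three_le_four_mul_im_sq_of_mem_fd h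
  nlinarith [τ.im_pos]

/-- `y^s` is integrable on the fundamental domain for `s < 1`. -/
lemma lintegral_fd_rpow_lt_top {s : ℝ} (hs : s < 1) :
    ∫⁻ τ in 𝒟, ENNReal.ofReal (τ.im ^ s) < ⊤ := by
  rw [setLIntegral_eq_real (f := fun τ => ENNReal.ofReal (τ.im ^ s))
    (ENNReal.measurable_ofReal.comp (UpperHalfPlane.continuous_im.measurable.pow_const s))
    measurableSet_fd]
  have h1 : ∀ p ∈ pt ⁻¹' 𝒟 ∩ halfPlane, (density p : ENNReal) * ENNReal.ofReal ((pt p).im ^ s) =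
      ENNReal.ofReal (p.2 ^ (s - 2)) := by
    rintro p ⟨-, hp⟩
    have hp : 0 < p.2 := hp
    have h2 : (density p : ENNReal) = ENNReal.ofReal (1 / p.2 ^ 2) := by
      rw [ENNReal.ofReal, Real.toNNReal_of_nonneg (by positivity)]
      rfl
    rw [pt_im hp, h2, ← ENNReal.ofReal_mul (by positivity)]
    congr 1
    rw [Real.rpow_sub hp, Real.rpow_two]
    ring
  rw [setLIntegral_congr_fun ((measurable_pt measurableSet_fd).inter measurableSet_halfPlane) h1]
  have hsub : pt ⁻¹' 𝒟 ∩ halfPlane ⊆ Set.Icc (-1 / 2 : ℝ) (1 / 2) ×ˢ Set.Ioi (1 / 4 : ℝ) := by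
    rintro p ⟨hp, hp0⟩
    have hp0 : 0 < p.2 := hp0
    have h3 := abs_le.mp (abs_re_le_of_mem_fd hp)
    have h4 := half_le_im_of_mem_fd hp
    rw [pt_re hp0] at h3
    rw [pt_im hp0] at h4
    exact ⟨⟨by linarith, h3.2⟩, show 1 / 4 < p.2 by linarith⟩
  refine (lintegral_mono_set hsub).trans_lt ?_
  have hI : IntegrableOn (fun y : ℝ => y ^ (s - 2)) (Set.Ioi (1 / 4)) :=
    integrableOn_Ioi_rpow_of_lt (by linarith) (by norm_num)
  have h5 : IntegrableOn (fun p : ℝ × ℝ => (1 : ℝ) * p.2 ^ (s - 2))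
      (Set.Icc (-1 / 2 : ℝ) (1 / 2) ×ˢ Set.Ioi (1 / 4 : ℝ)) := by
    rw [IntegrableOn, Measure.volume_eq_prod, ← Measure.prod_restrict]
    exact Integrable.mul_prod (μ := volume.restrict (Set.Icc (-1 / 2 : ℝ) (1 / 2)))
      (f := fun _ : ℝ => (1 : ℝ)) (integrable_const _) hI
  simp only [one_mul] at h5
  exact Integrable.lintegral_lt_top h5

lemma integrableOn_fd_of_le {f : ℍ → ℂ} (hf : Continuous f) {C s : ℝ} (hs : s < 1)
    (h : ∀ τ ∈ 𝒟, ‖f τ‖ ≤ C * τ.im ^ s) : IntegrableOn f 𝒟 := by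
  refine ⟨hf.aestronglyMeasurable, ?_⟩
  refine lt_of_le_of_lt (setLIntegral_mono (g := fun τ => ENNReal.ofReal |C| *
    ENNReal.ofReal (τ.im ^ s)) ?_ fun τ hτ => ?_) ?_
  · exact (ENNReal.measurable_ofReal.comp
      (UpperHalfPlane.continuous_im.measurable.pow_const s)).const_mul _
  · have := τ.im_pos
    rw [← ENNReal.ofReal_mul (abs_nonneg _), ← ofReal_norm]
    exact ENNReal.ofReal_le_ofReal ((h τ hτ).trans
      (mul_le_mul_of_nonneg_right (le_abs_self C) (by positivity)))
  · rw [lintegral_const_mul']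
    · exact ENNReal.mul_lt_top ENNReal.ofReal_lt_top (lintegral_fd_rpow_lt_top hs)
    · exact ENNReal.ofReal_ne_top

/-! ### Differentiable kernels -/

/-- `κ'` is the derivative of the kernel `κ` with respect to `y > 0`, and both grow moderately. -/
structure KernelHasDeriv (κ κ' : ℝ → V bp bm → ℂ) : Prop where
  moderate : ModerateGrowth κ
  moderate_deriv : ModerateGrowth κ'
  hasDerivAt : ∀ y, 0 < y → ∀ v, HasDerivAt (fun y => κ y v) (κ' y v) y

namespace KernelHasDeriv

variable {bp bm : ℕ}

lemma of_polyGrowth {f : V bp bm → ℂ} (hf : PolyGrowth f) :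
    KernelHasDeriv (fun _ x => f x) (fun _ _ => 0) :=
  ⟨.of_polyGrowth hf, .const 0, fun _ _ _ => hasDerivAt_const _ _⟩

lemma const (a : ℂ) : KernelHasDeriv (fun _ (_ : V bp bm) => a) (fun _ _ => 0) :=
  of_polyGrowth (PolyGrowth.const a)

lemma rpow (a : ℝ) : KernelHasDeriv (fun y (_ : V bp bm) => ((y ^ a : ℝ) : ℂ))
    (fun y _ => ((a * y ^ (a - 1) : ℝ) : ℂ)) := by
  refine ⟨.rpow a, ?_, fun y hy v => ?_⟩
  · refine ((ModerateGrowth.const (a : ℂ)).mul (.rpow (a - 1))).congr fun y _ x => ?_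
    push_cast
    rfl
  · exact (Real.hasDerivAt_rpow_const (Or.inl hy.ne')).ofReal_comp

lemma mul {κ κ' μ μ' : ℝ → V bp bm → ℂ} (h : KernelHasDeriv κ κ') (h' : KernelHasDeriv μ μ') :
    KernelHasDeriv (fun y x => κ y x * μ y x) (fun y x => κ' y x * μ y x + κ y x * μ' y x) :=
  ⟨h.1.mul h'.1, (h.2.mul h'.1).add (h.1.mul h'.2), fun y hy v => (h.3 y hy v).mul (h'.3 y hy v)⟩

lemma add {κ κ' μ μ' : ℝ → V bp bm → ℂ} (h : KernelHasDeriv κ κ') (h' : KernelHasDeriv μ μ') :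
    KernelHasDeriv (fun y x => κ y x + μ y x) (fun y x => κ' y x + μ' y x) :=
  ⟨h.1.add h'.1, h.2.add h'.2, fun y hy v => (h.3 y hy v).add (h'.3 y hy v)⟩

lemma congr {κ κ' μ μ' : ℝ → V bp bm → ℂ} (h : KernelHasDeriv κ κ')
    (h1 : ∀ y, 0 < y → ∀ x, μ y x = κ y x) (h2 : ∀ y, 0 < y → ∀ x, μ' y x = κ' y x) :
    KernelHasDeriv μ μ' := by
  refine ⟨h.1.congr h1, h.2.congr h2, fun y hy v => ?_⟩
  rw [h2 y hy]
  refine (h.3 y hy v).congr_of_eventuallyEq ?_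
  filter_upwards [lt_mem_nhds hy] with z hz
  exact h1 z hz v

end KernelHasDeriv

section Vec

variable {W : Type*} [AddCommGroup W] [Module ℝ W] {q : QuadraticForm ℝ W} {L : AddSubgroup W}

/-- The Gaussian series of a kernel as a function with values in the group ring. -/
def kernelVec (u : q.IsometryEquiv (stdForm bp bm)) (L : AddSubgroup W) (κ : ℝ → V bp bm → ℂ)
    (τ : ℍ) : GroupRing q L := fun γ => kernelSeries u L κ γ τ

/-- The real coordinates of a point of the upper half-plane. -/
def coords (τ : ℍ) : ℝ × ℝ := (τ.re, τ.im)

lemma continuous_coords : Continuous coords :=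
  UpperHalfPlane.continuous_re.prodMk UpperHalfPlane.continuous_im

lemma KernelHasDeriv.continuous_kernelVec (u : q.IsometryEquiv (stdForm bp bm))
    (hL : IsEvenLattice q L) {κ κ' : ℝ → V bp bm → ℂ} (h : KernelHasDeriv κ κ')
    (γ : Discr q L) : Continuous fun τ : ℍ => kernelVec u L κ τ γ := by
  rw [continuous_iff_continuousAt]
  intro τ
  have h1 := (hasFDerivAt_kernelSeries u hL h.1 h.2 h.3 γ (p := coords τ) τ.im_pos).continuousAt
  exact h1.comp (f := coords) continuous_coords.continuousAt

/-- The function `e(mτ) conj(K_β(τ)) y^t`, whose integral over the strip is the unfolded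
integral. -/
def unfolded (u : q.IsometryEquiv (stdForm bp bm)) (L : AddSubgroup W) (κ : ℝ → V bp bm → ℂ)
    (m : ℝ) (β : Discr q L) (t : ℝ) (τ : ℍ) : ℂ :=
  e (m * τ) * conj (kernelVec u L κ τ β) * ((τ.im ^ t : ℝ) : ℂ)

lemma continuous_unfolded (u : q.IsometryEquiv (stdForm bp bm)) (hL : IsEvenLattice q L)
    {κ κ' : ℝ → V bp bm → ℂ} (h : KernelHasDeriv κ κ') (m : ℝ) (β : Discr q L) (t : ℝ) :
    Continuous (unfolded u L κ m β t) := by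
  have h1 := h.continuous_kernelVec u hL β
  have h2 : Continuous fun τ : ℍ => ((τ.im ^ t : ℝ) : ℂ) :=
    Complex.continuous_ofReal.comp
      (UpperHalfPlane.continuous_im.rpow_const fun τ => Or.inl τ.im_pos.ne')
  have h3 : Continuous fun τ : ℍ => e (m * τ) := by
    unfold e
    have := UpperHalfPlane.continuous_coe
    fun_prop
  exact (h3.mul (Complex.continuous_conj.comp h1)).mul h2

/-! ### Fourier coefficients of Gaussian series -/

lemma integral_exp_int (n : ℤ) : ∫ x in Set.Ico (0 : ℝ) 1, Complex.exp (2 * Real.pi * Complex.I * n * x) =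
    if n = 0 then 1 else 0 := by
  rw [integral_Ico_eq_integral_Ioo, ← integral_Ioc_eq_integral_Ioo,
    ← intervalIntegral.integral_of_le zero_le_one]
  split_ifs with h
  · simp [h]
  · have hc : (2 * Real.pi * Complex.I * n : ℂ) ≠ 0 := by
      simp [Real.pi_ne_zero, h]
    rw [integral_exp_mul_complex hc]
    have h1 : Complex.exp (2 * Real.pi * Complex.I * n * (1 : ℝ)) = 1 := by
      rw [Complex.exp_eq_one_iff]
      exact ⟨n, by push_cast; ring⟩
    rw [h1]
    simp

lemma exists_int_of_mk_eq (hL : IsEvenLattice q L) {m : ℝ} {β : Discr q L}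
    (hmβ : e (m : ℂ) = e (q (rep β) : ℝ)) {x : dual q L}
    (hx : (QuotientAddGroup.mk x : Discr q L) = β) : ∃ n : ℤ, m - q (x : W) = n := by
  subst hx
  rw [e_q_mk hL] at hmβ
  have h1 : Complex.exp (2 * Real.pi * Complex.I * ((m - q (x : W) : ℝ) : ℂ)) = 1 := by
    rw [show (2 * Real.pi * Complex.I * ((m - q (x : W) : ℝ) : ℂ)) =
      2 * Real.pi * Complex.I * (m : ℂ) - 2 * Real.pi * Complex.I * (q (x : W) : ℂ) by
        push_cast; ring, Complex.exp_sub]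
    rw [e, e] at hmβ
    rw [hmβ, div_self (Complex.exp_ne_zero _)]
  obtain ⟨n, hn⟩ := Complex.exp_eq_one_iff.mp h1
  refine ⟨n, ?_⟩
  have h2 : (2 * Real.pi * Complex.I : ℂ) ≠ 0 := by simp [Real.pi_ne_zero]
  have h3 : ((m - q (x : W) : ℝ) : ℂ) = n := mul_left_cancel₀ h2 (by rw [hn]; ring)
  exact_mod_cast h3

lemma countable_dual (u : q.IsometryEquiv (stdForm bp bm)) (hL : IsEvenLattice q L) :
    Countable (dual q L) := by
  obtain ⟨N, hN⟩ := ThetaLift.summable_dual u hL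
  have h1 := hN.countable_support
  have h2 : (Function.support fun x : dual q L => 1 / (1 + ‖u (x : W)‖) ^ N) = Set.univ := by
    ext x
    simp only [Function.mem_support, Set.mem_univ, iff_true]
    positivity
  rw [h2] at h1
  exact Set.countable_univ_iff.mp h1

lemma norm_term_eq (m y x : ℝ) (c : ℂ) (v : V bp bm) :
    ‖e (m * (⟨x, y⟩ : ℂ)) * conj (c * gaussV ⟨x, y⟩ v)‖ =
      Real.exp (-(2 * Real.pi * m * y)) * ‖c * gaussV ⟨0, y⟩ v‖ := by
  rw [norm_mul, Complex.norm_conj, norm_mul, norm_mul, norm_gaussV, norm_gaussV, e, Complex.norm_exp]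
  congr 2
  simp [mul_assoc]

lemma term_eq {m y x : ℝ} (c : ℂ) {v : V bp bm} {n : ℤ} (hn : m - stdForm bp bm v = n) :
    e (m * (⟨x, y⟩ : ℂ)) * conj (c * gaussV ⟨x, y⟩ v) =
      conj c * (Real.exp (-(Real.pi * (2 * m + sqPlus v + sqMinus v) * y)) : ℂ) *
        Complex.exp (2 * Real.pi * Complex.I * n * x) := by
  rw [gaussV_mk, map_mul, ← Complex.exp_conj, e, Complex.ofReal_exp]
  have hn' : (n : ℂ) = m - stdForm bp bm v := by rw [← Complex.ofReal_sub, hn]; simp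
  have h1 : (⟨x, y⟩ : ℂ) = x + y * Complex.I := Complex.mk_eq_add_mul_I x y
  rw [mul_left_comm, ← Complex.exp_add, mul_assoc (conj c), ← Complex.exp_add, hn', h1]
  congr 2
  simp only [map_add, map_mul, map_sub, map_ofNat, Complex.conj_ofReal, Complex.conj_I]
  push_cast
  linear_combination (2 * Real.pi * m * y : ℂ) * Complex.I_sq

/-- The Fourier coefficients of a Gaussian series. -/
lemma integral_Ico_kernelSeries (u : q.IsometryEquiv (stdForm bp bm)) (hL : IsEvenLattice q L)
    {κ : ℝ → V bp bm → ℂ} (hκ : ModerateGrowth κ) {m : ℝ} {β : Discr q L}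
    (hmβ : e (m : ℂ) = e (q (rep β) : ℝ)) {y : ℝ} (hy : 0 < y) :
    ∫ x in Set.Ico (0 : ℝ) 1, e (m * (⟨x, y⟩ : ℂ)) * conj (kernelSeries u L κ β ⟨x, y⟩) =
      ∑' x : CosetOfNorm q L β m, conj (κ y (u (x.1 : W))) *
        (Real.exp (-(2 * Real.pi * sqPlus (u (x.1 : W)) * y)) : ℂ) := by
  have := countable_dual u hL
  choose n hn using fun x : Coset q L β => exists_int_of_mk_eq hL hmβ x.2
  have hn' : ∀ x : Coset q L β, m - stdForm bp bm (u (x.1 : W)) = n x := fun x => by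
    rw [u.map_app, hn]
  have hsum := (hκ.summable_coset u hL (z := ⟨0, y⟩) hy β).norm
  have hcont : ∀ x : Coset q L β, Continuous fun t : ℝ =>
      e (m * (⟨t, y⟩ : ℂ)) * conj (κ y (u (x.1 : W)) * gaussV ⟨t, y⟩ (u (x.1 : W))) := by
    intro x
    simp only [term_eq _ (hn' x)]
    fun_prop
  have key := hasSum_integral_of_summable_integral_norm (μ := volume.restrict (Set.Ico (0 : ℝ) 1))
    (F := fun (x : Coset q L β) (t : ℝ) =>
      e (m * (⟨t, y⟩ : ℂ)) * conj (κ y (u (x.1 : W)) * gaussV ⟨t, y⟩ (u (x.1 : W))))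
    (fun x => ((hcont x).integrableOn_Icc (a := 0) (b := 1)).mono_set Set.Ico_subset_Icc_self) (by
      simp only [norm_term_eq]
      simpa using hsum.mul_left (Real.exp (-(2 * Real.pi * m * y))))
  have h1 : ∀ t : ℝ, ∑' x : Coset q L β,
      e (m * (⟨t, y⟩ : ℂ)) * conj (κ y (u (x.1 : W)) * gaussV ⟨t, y⟩ (u (x.1 : W))) =
      e (m * (⟨t, y⟩ : ℂ)) * conj (kernelSeries u L κ β ⟨t, y⟩) := by
    intro t
    rw [tsum_mul_left, kernelSeries, ← Complex.conj_tsum]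
  simp only [h1] at key
  rw [← key.tsum_eq]
  have h2 : ∀ x : Coset q L β, ∫ t in Set.Ico (0 : ℝ) 1,
      e (m * (⟨t, y⟩ : ℂ)) * conj (κ y (u (x.1 : W)) * gaussV ⟨t, y⟩ (u (x.1 : W))) =
      if n x = 0 then conj (κ y (u (x.1 : W))) *
        (Real.exp (-(2 * Real.pi * sqPlus (u (x.1 : W)) * y)) : ℂ) else 0 := by
    intro x
    simp only [term_eq _ (hn' x)]
    rw [integral_const_mul, integral_exp_int]
    split_ifs with h
    · have h3 := hn' x
      rw [h, stdForm_eq] at h3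
      push_cast at h3
      rw [mul_one]
      congr 4
      linear_combination 2 * (Real.pi * y) * h3
    · rw [mul_zero]
  simp only [h2]
  let ι : CosetOfNorm q L β m → Coset q L β := fun x => ⟨x.1, x.2.1⟩
  have hι : Function.Injective ι := fun a b h => Subtype.ext (congrArg (fun x => x.1) h)
  have hz : ∀ x : CosetOfNorm q L β m, n (ι x) = 0 := fun x => by
    have := hn (ι x)
    have h4 : q ((ι x).1 : W) = m := x.2.2
    rw [h4, sub_self] at this
    exact_mod_cast this.symm
  rw [← hι.tsum_eq]
  · refine tsum_congr fun x => ?_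
    rw [if_pos (hz x)]
  · intro x hx
    rw [Function.mem_support] at hx
    have h5 : n x = 0 := by
      by_contra h
      exact hx (if_neg h)
    have h6 := hn x
    rw [h5] at h6
    exact ⟨⟨x.1, x.2, by push_cast at h6; linarith⟩, rfl⟩

lemma pt_preimage_strip : pt ⁻¹' strip ∩ halfPlane = Set.Ico (0 : ℝ) 1 ×ˢ Set.Ioi (0 : ℝ) := by
  ext p
  constructor
  · rintro ⟨h, hp⟩
    have hp : 0 < p.2 := hp
    have h : 0 ≤ (pt p).re ∧ (pt p).re < 1 := h
    rw [pt_re hp] at h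
    exact ⟨h, hp⟩
  · rintro ⟨h, hp⟩
    have hp : 0 < p.2 := hp
    refine ⟨?_, hp⟩
    change 0 ≤ (pt p).re ∧ (pt p).re < 1
    rw [pt_re hp]
    exact h

/-- The unfolded integral in terms of the Fourier coefficients of the Gaussian series. -/
theorem integral_strip_unfolded (u : q.IsometryEquiv (stdForm bp bm)) (hL : IsEvenLattice q L)
    {κ κ' : ℝ → V bp bm → ℂ} (hκ : KernelHasDeriv κ κ') {m : ℝ} {β : Discr q L}
    (hmβ : e (m : ℂ) = e (q (rep β) : ℝ)) {t : ℝ}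
    (hint : IntegrableOn (unfolded u L κ m β t) strip) :
    IntegrableOn (fun y : ℝ => ∑' x : CosetOfNorm q L β m, conj (κ y (u (x.1 : W))) *
        ((Real.exp (-(2 * Real.pi * sqPlus (u (x.1 : W)) * y)) * y ^ (t - 2) : ℝ) : ℂ))
        (Set.Ioi 0) ∧
      ∫ τ in strip, unfolded u L κ m β t τ =
        ∫ y in Set.Ioi (0 : ℝ), ∑' x : CosetOfNorm q L β m, conj (κ y (u (x.1 : W))) *
          ((Real.exp (-(2 * Real.pi * sqPlus (u (x.1 : W)) * y)) * y ^ (t - 2) : ℝ) : ℂ) := by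
  have hsm := (continuous_unfolded u hL hκ m β t).stronglyMeasurable
  rw [integrableOn_iff_real hsm measurableSet_strip, pt_preimage_strip, IntegrableOn,
    Measure.volume_eq_prod, ← Measure.prod_restrict] at hint
  have h1 : ∀ y ∈ Set.Ioi (0 : ℝ), ∫ x in Set.Ico (0 : ℝ) 1,
      ((1 / y ^ 2 : ℝ) : ℂ) * unfolded u L κ m β t (pt (x, y)) =
      ∑' x : CosetOfNorm q L β m, conj (κ y (u (x.1 : W))) *
        ((Real.exp (-(2 * Real.pi * sqPlus (u (x.1 : W)) * y)) * y ^ (t - 2) : ℝ) : ℂ) := by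
    intro y hy
    have hy : 0 < y := hy
    have h2 : ∀ x : ℝ, ((1 / y ^ 2 : ℝ) : ℂ) * unfolded u L κ m β t (pt (x, y)) =
        ((y ^ (t - 2) : ℝ) : ℂ) *
          (e (m * (⟨x, y⟩ : ℂ)) * conj (kernelSeries u L κ β ⟨x, y⟩)) := by
      intro x
      rw [unfolded, kernelVec, pt_im (p := (x, y)) hy, coe_pt (p := (x, y)) hy,
        Real.rpow_sub hy, Real.rpow_two]
      push_cast
      ring
    simp only [h2]
    rw [integral_const_mul, integral_Ico_kernelSeries u hL hκ.1 hmβ hy, ← tsum_mul_left]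
    refine tsum_congr fun x => ?_
    push_cast
    ring
  constructor
  · refine (hint.integral_prod_right).congr ?_
    filter_upwards [ae_restrict_mem measurableSet_Ioi] with y hy
    exact h1 y hy
  · rw [setIntegral_eq_real hsm measurableSet_strip, pt_preimage_strip,
      Measure.volume_eq_prod, ← Measure.prod_restrict, integral_prod_symm _ hint]
    exact setIntegral_congr_fun measurableSet_Ioi h1

end Vec

/-! ### Unfolding against the Poincaré series -/

section Unfold

variable {W : Type*} [AddCommGroup W] [Module ℝ W] {q : QuadraticForm ℝ W} {L : AddSubgroup W}

/-- The transformation law of a vector valued modular form of weight `w / 2` for the Weil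
representation. -/
def IsModular (q : QuadraticForm ℝ W) (L : AddSubgroup W) (sig w : ℤ) (f : ℍ → GroupRing q L) :
    Prop :=
  ∀ (M : Mp2Z) (τ : ℍ), f (M.mat • τ) = M.phi τ ^ w • weilRep q L sig M (f τ)

lemma innerL_smul_left (a : ℂ) (f g : GroupRing q L) : innerL (a • f) g = a * innerL f g := by
  rw [innerL, innerL, ← smul_eq_mul a, smul_finsum]
  simp only [Pi.smul_apply, smul_eq_mul, mul_assoc]

lemma IsModular.conj_apply_smul (u : q.IsometryEquiv (stdForm bp bm)) (hL : IsEvenLattice q L)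
    {w : ℤ} {f : ℍ → GroupRing q L} (hf : IsModular q L ((bp : ℤ) - bm) w f) (M : Mp2Z) (τ : ℍ)
    (β : Discr q L) : conj (f (M.mat • τ) β) = conj (M.phi τ) ^ w *
      innerL ((weilRep q L ((bp : ℤ) - bm) M)⁻¹ (basisVec β)) (f τ) := by
  have := finite_discr u hL
  have := Fintype.ofFinite (Discr q L)
  rw [innerL_weilRep_inv u hL, innerL_basisVec, hf M τ, Pi.smul_apply, smul_eq_mul, map_mul,
    map_zpow₀]

lemma IsModular.unfolded_smul (u : q.IsometryEquiv (stdForm bp bm)) (hL : IsEvenLattice q L)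
    {w : ℤ} {κ : ℝ → V bp bm → ℂ} (hf : IsModular q L ((bp : ℤ) - bm) w (kernelVec u L κ))
    (m : ℝ) (β : Discr q L) (t : ℝ) (M : Mp2Z) (τ : ℍ) :
    unfolded u L κ m β t (M.mat • τ) = e (m * ((M.mat • τ : ℍ) : ℂ)) * (conj (M.phi τ) ^ w *
      innerL ((weilRep q L ((bp : ℤ) - bm) M)⁻¹ (basisVec β)) (kernelVec u L κ τ)) *
      (((M.mat • τ).im ^ t : ℝ) : ℂ) := by
  rw [unfolded, hf.conj_apply_smul u hL]

lemma IsModular.unfolded_T_smul (u : q.IsometryEquiv (stdForm bp bm)) (hL : IsEvenLattice q L)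
    {w : ℤ} {κ : ℝ → V bp bm → ℂ} (hf : IsModular q L ((bp : ℤ) - bm) w (kernelVec u L κ))
    {m : ℝ} {β : Discr q L} (hmβ : e (m : ℂ) = e (q (rep β) : ℝ)) (t : ℝ) (τ : ℍ) :
    unfolded u L κ m β t (ModularGroup.T • τ) = unfolded u L κ m β t τ := by
  have h1 := congrFun (hf Mp2Z.T τ) β
  have hphi : Mp2Z.T.phi τ = 1 := rfl
  have hmat : Mp2Z.T.mat = ModularGroup.T := rfl
  rw [hphi, one_zpow, one_smul, weilRep_T u hL, weilT_apply, hmat] at h1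
  have him : (ModularGroup.T • τ).im = τ.im := by
    rw [← coe_im, coe_T_smul]
    simp
  have h2 : e (m * (τ + 1)) = e (m * τ) * e (m : ℂ) := by
    rw [← e_add]; congr 1; ring
  have h3 : e (m : ℂ) * conj (e (m : ℂ)) = 1 := by
    rw [e, Complex.mul_conj, Complex.normSq_eq_norm_sq, Complex.norm_exp]
    simp
  rw [unfolded, unfolded, h1, him, coe_T_smul, h2, ← hmβ, map_mul]
  linear_combination (e (m * τ) * conj (kernelVec u L κ τ β) * ((τ.im ^ t : ℝ) : ℂ)) * h3

lemma zpow_mul_rpow_im (M : Mp2Z) (τ : ℍ) (w : ℤ) :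
    conj (M.phi τ) ^ w * (((M.mat • τ).im ^ ((w : ℝ) / 2) : ℝ) : ℂ) =
      M.phi τ ^ (-w) * ((τ.im ^ ((w : ℝ) / 2) : ℝ) : ℂ) := by
  have h0 := M.norm_phi_pos τ
  have h1 : (‖M.phi τ‖ ^ 4) ^ ((w : ℝ) / 2) = (‖M.phi τ‖ ^ 2) ^ w := by
    rw [show ‖M.phi τ‖ ^ 4 = (‖M.phi τ‖ ^ 2) ^ (2 : ℝ) by rw [Real.rpow_two]; ring,
      ← Real.rpow_mul (by positivity), ← Real.rpow_intCast]
    congr 1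
    ring
  rw [M.im_smul_eq, Real.div_rpow τ.im_pos.le (by positivity), h1]
  push_cast
  rw [← Complex.mul_conj', mul_zpow, zpow_neg]
  have h2 : M.phi τ ^ w ≠ 0 := zpow_ne_zero _ (M.phi_ne_zero τ)
  have h3 : conj (M.phi τ) ^ w ≠ 0 :=
    zpow_ne_zero _ ((map_ne_zero _).mpr (M.phi_ne_zero τ))
  field_simp

/-- A term of the Poincaré series paired with a modular form is a translate of `unfolded`. -/
lemma innerL_poincareTerm (u : q.IsometryEquiv (stdForm bp bm)) (hL : IsEvenLattice q L)
    {w : ℤ} {κ : ℝ → V bp bm → ℂ} (hf : IsModular q L ((bp : ℤ) - bm) w (kernelVec u L κ))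
    (m : ℝ) (β : Discr q L) (τ : ℍ) (c : CuspCosets) :
    innerL (poincareTerm q L ((bp : ℤ) - bm) w m β τ c) (kernelVec u L κ τ) *
      ((τ.im ^ ((w : ℝ) / 2) : ℝ) : ℂ) =
      unfolded u L κ m β ((w : ℝ) / 2) ((Quotient.out c).mat • τ) := by
  rw [hf.unfolded_smul u hL, poincareTerm_eq, slash, cuspExp, map_smul, innerL_smul_left,
    innerL_smul_left]
  have h := zpow_mul_rpow_im (Quotient.out c) τ w
  linear_combination (-e (m * (((Quotient.out c).mat • τ : ℍ) : ℂ)) *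
    innerL ((weilRep q L ((bp : ℤ) - bm) (Quotient.out c))⁻¹ (basisVec β)) (kernelVec u L κ τ)) * h

lemma summable_innerL_poincareTerm (u : q.IsometryEquiv (stdForm bp bm)) (hL : IsEvenLattice q L)
    {m : ℝ} (hm : 0 < m) (β : Discr q L) {w : ℤ} (hw : 4 < w) (τ : ℍ) (b : GroupRing q L) :
    HasSum (fun c => innerL (poincareTerm q L ((bp : ℤ) - bm) w m β τ c) b)
      (2 * innerL (poincare q L ((bp : ℤ) - bm) w m β τ) b) := by
  have := finite_discr u hL
  have := Fintype.ofFinite (Discr q L)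
  simp only [innerL_eq]
  have hs := summable_poincareTerm u hL hm β hw τ
  have h1 : ∀ γ, HasSum (fun c => poincareTerm q L ((bp : ℤ) - bm) w m β τ c γ * conj (b γ))
      (2 * poincare q L ((bp : ℤ) - bm) w m β τ γ * conj (b γ)) := by
    intro γ
    refine HasSum.mul_right _ ?_
    rw [poincare_apply u hL hm β hw, ← mul_assoc]
    norm_num
    exact (Pi.summable.mp hs γ).hasSum
  have h2 := hasSum_sum (s := Finset.univ) fun γ _ => h1 γ
  simpa only [Finset.mul_sum, mul_assoc] using h2

/-- The Petersson integrand of the Poincaré series is half the sum over the cosets. -/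
lemma peterssonIntegrand_poincare (u : q.IsometryEquiv (stdForm bp bm)) (hL : IsEvenLattice q L)
    {m : ℝ} (hm : 0 < m) (β : Discr q L) {w : ℤ} (hw : 4 < w) {κ : ℝ → V bp bm → ℂ}
    (hf : IsModular q L ((bp : ℤ) - bm) w (kernelVec u L κ)) (τ : ℍ) :
    peterssonIntegrand w (poincare q L ((bp : ℤ) - bm) w m β) (kernelVec u L κ) τ =
      1 / 2 * ∑' c : CuspCosets, unfolded u L κ m β ((w : ℝ) / 2) ((Quotient.out c).mat • τ) := by
  have h := (summable_innerL_poincareTerm u hL hm β hw τ (kernelVec u L κ τ)).mul_right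
    ((τ.im ^ ((w : ℝ) / 2) : ℝ) : ℂ)
  simp only [innerL_poincareTerm u hL hf] at h
  rw [h.tsum_eq, peterssonIntegrand]
  ring

/-- A sum of functions which are dominated on the fundamental domain by a power `y ^ s` with `s < 1`
times a summable sequence is absolutely integrable. -/
lemma lintegral_fd_tsum_ne_top {ι : Type*} {F : ℍ → ι → ℂ} {U : ι → ℝ} (hU0 : ∀ c, 0 ≤ U c)
    (hU : Summable U) {s : ℝ} (hs : s < 1) (hF : ∀ τ ∈ 𝒟, ∀ c, ‖F τ c‖ ≤ U c * τ.im ^ s) :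
    ∫⁻ τ in 𝒟, ∑' c, ‖F τ c‖ₑ ≠ ⊤ := by
  have hle : ∀ τ ∈ 𝒟, ∑' c, ‖F τ c‖ₑ ≤ ENNReal.ofReal (∑' c, U c) * ENNReal.ofReal (τ.im ^ s) := by
    intro τ hτ
    have hy := τ.im_pos
    calc ∑' c, ‖F τ c‖ₑ ≤ ∑' c, ENNReal.ofReal (U c * τ.im ^ s) := by
          refine ENNReal.tsum_le_tsum fun c => ?_
          rw [← ofReal_norm]
          exact ENNReal.ofReal_le_ofReal (hF τ hτ c)
      _ = ENNReal.ofReal (∑' c, U c * τ.im ^ s) :=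
          (ENNReal.ofReal_tsum_of_nonneg (fun c => mul_nonneg (hU0 c) (by positivity))
            (hU.mul_right _)).symm
      _ = _ := by rw [tsum_mul_right, ← ENNReal.ofReal_mul (tsum_nonneg hU0)]
  refine ne_top_of_le_ne_top ?_ (setLIntegral_mono (ENNReal.measurable_ofReal.comp
      (UpperHalfPlane.continuous_im.measurable.pow_const _) |>.const_mul _) hle)
  change ∫⁻ τ in 𝒟, ENNReal.ofReal (∑' c, U c) * ENNReal.ofReal (τ.im ^ s) ≠ ⊤
  rw [lintegral_const_mul' _ _ ENNReal.ofReal_ne_top]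
  exact (ENNReal.mul_lt_top ENNReal.ofReal_lt_top (lintegral_fd_rpow_lt_top hs)).ne

/-- The coset sum of the norms is integrable when the Gaussian series decays at the cusp. -/
lemma lintegral_unfolded_ne_top (u : q.IsometryEquiv (stdForm bp bm)) (hL : IsEvenLattice q L)
    {m : ℝ} (hm : 0 < m) (β : Discr q L) {w : ℤ} (hw : 4 < w) {κ : ℝ → V bp bm → ℂ}
    (hκ : ModerateGrowth κ) (h0 : ∀ y, 0 < y → κ y 0 = 0)
    (hf : IsModular q L ((bp : ℤ) - bm) w (kernelVec u L κ)) :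
    ∫⁻ τ in 𝒟, ∑' c : CuspCosets,
      ‖unfolded u L κ m β ((w : ℝ) / 2) ((Quotient.out c).mat • τ)‖ₑ ≠ ⊤ := by
  have := finite_discr u hL
  have := Fintype.ofFinite (Discr q L)
  have hw' : (4 : ℝ) < w := by exact_mod_cast hw
  obtain ⟨s, U, hs, hU, hUle⟩ := exists_poincareTerm_bound u hL hm β hw (1 / 2)
    (one_half_pos (α := ℝ))
  obtain ⟨D, hD, hDle⟩ := hκ.exists_decay u hL h0 (r := (w : ℝ) / 2) (by positivity)
  set N : ℝ := (Fintype.card (Discr q L) : ℝ)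
  refine lintegral_fd_tsum_ne_top (U := fun c => |U c| * (N * D)) (fun c => by positivity)
    (hU.abs.mul_right _) (s := -s) (by linarith) fun τ hτ c => ?_
  have hy := τ.im_pos
  have h1 := abs_re_le_of_mem_fd hτ
  have h2 := half_le_im_of_mem_fd hτ
  rw [← innerL_poincareTerm u hL hf, norm_mul, Complex.norm_real,
    Real.norm_of_nonneg (by positivity), innerL_eq]
  have h4 : ‖∑ γ, poincareTerm q L ((bp : ℤ) - bm) w m β τ c γ *
      conj (kernelVec u L κ τ γ)‖ ≤ ∑ _γ : Discr q L,
        (|U c| * τ.im ^ (-s)) * (D * τ.im ^ (-((w : ℝ) / 2))) := by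
    refine norm_sum_le_of_le _ fun γ _ => ?_
    rw [norm_mul, Complex.norm_conj]
    exact mul_le_mul ((hUle τ c γ h1 h2).trans (mul_le_mul_of_nonneg_right (le_abs_self _)
      (by positivity))) (hDle τ γ (by simpa using h2)) (norm_nonneg _) (by positivity)
  refine (mul_le_mul_of_nonneg_right h4 (by positivity)).trans (le_of_eq ?_)
  rw [Finset.sum_const, nsmul_eq_mul, Finset.card_univ, Real.rpow_neg hy.le ((w : ℝ) / 2)]
  have : τ.im ^ ((w : ℝ) / 2) ≠ 0 := by positivity
  field_simp
  change _ = |U c| * D * (Fintype.card (Discr q L) : ℝ)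
  ring

/-- The Petersson product of the Poincaré series with a modular Gaussian series without constant
term is a sum over the lattice vectors of norm `m`. The factor two is the order four of the center of
`Mp₂(ℤ)` times the factor `1 / 2` of the Poincaré series. -/
theorem petersson_poincare_eq (u : q.IsometryEquiv (stdForm bp bm)) (hL : IsEvenLattice q L)
    {m : ℝ} (hm : 0 < m) {β : Discr q L} (hmβ : e (m : ℂ) = e (q (rep β) : ℝ)) {w : ℤ}
    (hw : 4 < w) {κ κ' : ℝ → V bp bm → ℂ} (hκ : KernelHasDeriv κ κ')
    (h0 : ∀ y, 0 < y → κ y 0 = 0) (hf : IsModular q L ((bp : ℤ) - bm) w (kernelVec u L κ))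
    (hI : ∀ x : CosetOfNorm q L β m, IntegrableOn (fun y : ℝ => κ y (u (x.1 : W)) *
      ((Real.exp (-(2 * Real.pi * sqPlus (u (x.1 : W)) * y)) * y ^ ((w : ℝ) / 2 - 2) : ℝ) : ℂ))
      (Set.Ioi 0))
    (hS : Summable fun x : CosetOfNorm q L β m => ∫ y in Set.Ioi (0 : ℝ), ‖κ y (u (x.1 : W)) *
      ((Real.exp (-(2 * Real.pi * sqPlus (u (x.1 : W)) * y)) * y ^ ((w : ℝ) / 2 - 2) : ℝ) : ℂ)‖) :
    petersson w (poincare q L ((bp : ℤ) - bm) w m β) (kernelVec u L κ) =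
      2 * ∑' x : CosetOfNorm q L β m, conj (∫ y in Set.Ioi (0 : ℝ), κ y (u (x.1 : W)) *
        ((Real.exp (-(2 * Real.pi * sqPlus (u (x.1 : W)) * y)) *
          y ^ ((w : ℝ) / 2 - 2) : ℝ) : ℂ)) := by
  have := countable_dual u hL
  have h1 := integral_unfold (continuous_unfolded u hL hκ m β ((w : ℝ) / 2)).stronglyMeasurable
    (hf.unfolded_T_smul u hL hmβ _) (lintegral_unfolded_ne_top u hL hm β hw hκ.1 h0 hf)
  have h2 := (integral_strip_unfolded u hL hκ hmβ h1.1).2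
  have h3 : ∀ y, ∀ x : CosetOfNorm q L β m, conj (κ y (u (x.1 : W))) *
      ((Real.exp (-(2 * Real.pi * sqPlus (u (x.1 : W)) * y)) * y ^ ((w : ℝ) / 2 - 2) : ℝ) : ℂ) =
      conj (κ y (u (x.1 : W)) * ((Real.exp (-(2 * Real.pi * sqPlus (u (x.1 : W)) * y)) *
          y ^ ((w : ℝ) / 2 - 2) : ℝ) : ℂ)) := by
    intro y x
    rw [map_mul, Complex.conj_ofReal]
  simp only [h3] at h2
  have h4 := integral_tsum_of_summable_integral_norm (μ := volume.restrict (Set.Ioi (0 : ℝ)))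
    (F := fun (x : CosetOfNorm q L β m) (y : ℝ) => conj (κ y (u (x.1 : W)) *
      ((Real.exp (-(2 * Real.pi * sqPlus (u (x.1 : W)) * y)) *
          y ^ ((w : ℝ) / 2 - 2) : ℝ) : ℂ)))
    (fun x => (LinearIsometryEquiv.integrable_comp_iff Complex.conjLIE).mpr (hI x))
    (by simpa only [Complex.norm_conj] using hS)
  simp only [integral_conj] at h4
  rw [petersson]
  simp only [peterssonIntegrand_poincare u hL hm β hw hf]
  rw [integral_const_mul, h1.2, h2, ← h4]
  ring

end Unfold

/-! ### Stokes' theorem on the fundamental domain -/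

/-- The height of the unit circle above the point `x`. -/
def arc (x : ℝ) : ℝ := Real.sqrt (1 - x ^ 2)

lemma arc_neg (x : ℝ) : arc (-x) = arc x := by rw [arc, arc, neg_sq]

lemma arc_sq {x : ℝ} (hx : |x| ≤ 1) : arc x ^ 2 = 1 - x ^ 2 := by
  rw [arc, Real.sq_sqrt]
  nlinarith [(sq_le_one_iff_abs_le_one x).mpr hx]

lemma arc_pos {x : ℝ} (hx : |x| < 1) : 0 < arc x := by
  rw [arc, Real.sqrt_pos]
  nlinarith [(sq_lt_one_iff_abs_lt_one x).mpr hx]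

lemma half_le_arc {x : ℝ} (hx : |x| ≤ 1 / 2) : 1 / 2 ≤ arc x := by
  rw [arc]
  refine Real.le_sqrt_of_sq_le ?_
  have := sq_abs x
  nlinarith [abs_nonneg x]

lemma hasDerivAt_arc {x : ℝ} (hx : |x| < 1) : HasDerivAt arc (-x / arc x) x := by
  have h0 : 1 - x ^ 2 ≠ 0 := by
    nlinarith [(sq_lt_one_iff_abs_lt_one x).mpr hx]
  have h1 : HasDerivAt (fun x : ℝ => 1 - x ^ 2) (-(2 * x)) x := by
    simpa using ((hasDerivAt_pow 2 x).const_sub 1)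
  refine (h1.sqrt h0).congr_deriv ?_
  rw [arc]
  ring

lemma continuous_arc : Continuous arc := by unfold arc; fun_prop

/-- Coordinates on the plane in which the unit circle is a horizontal line. -/
def shear (p : ℝ × ℝ) : ℝ × ℝ := (p.1, arc p.1 + p.2)

lemma measurePreserving_shear : MeasurePreserving shear volume volume := by
  rw [Measure.volume_eq_prod]
  refine (MeasurePreserving.id (volume : Measure ℝ)).skew_product
    (g := fun x t => arc x + t) ?_ (Filter.Eventually.of_forall fun x => ?_)
  · exact (continuous_arc.measurable.comp measurable_fst).add measurable_snd
  · exact map_add_left_eq_self volume (arc x)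

lemma shear_preimage_fd : shear ⁻¹' (pt ⁻¹' 𝒟 ∩ halfPlane) =
    Set.Icc (-1 / 2 : ℝ) (1 / 2) ×ˢ Set.Ici (0 : ℝ) := by
  ext p
  have key : ∀ {y : ℝ}, 0 < y → (pt (p.1, y) ∈ 𝒟 ↔ 1 ≤ p.1 ^ 2 + y ^ 2 ∧ |p.1| ≤ 1 / 2) := by
    intro y hy
    have h1 : pt (p.1, y) ∈ 𝒟 ↔ 1 ≤ Complex.normSq (pt (p.1, y)) ∧ |(pt (p.1, y)).re| ≤ 1 / 2 :=
      Iff.rfl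
    rw [h1, coe_pt (p := (p.1, y)) hy, pt_re (p := (p.1, y)) hy, Complex.normSq_mk]
    simp only [← pow_two]
  constructor
  · rintro ⟨h, hp⟩
    have hp : 0 < arc p.1 + p.2 := hp
    obtain ⟨h1, h2⟩ := (key hp).mp h
    have h3 := arc_sq (x := p.1) (by linarith)
    have h4 := half_le_arc h2
    refine ⟨⟨by linarith [(abs_le.mp h2).1], (abs_le.mp h2).2⟩, ?_⟩
    change 0 ≤ p.2
    nlinarith
  · rintro ⟨⟨h1, h2⟩, h3⟩
    have h3 : 0 ≤ p.2 := h3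
    have h4 : |p.1| ≤ 1 / 2 := abs_le.mpr ⟨by linarith, h2⟩
    have h5 := half_le_arc h4
    have h6 := arc_sq (x := p.1) (by linarith)
    have hp : 0 < arc p.1 + p.2 := by linarith
    exact ⟨(key hp).mpr ⟨by nlinarith, h4⟩, hp⟩

/-- The slope factor of the boundary form along the translates of the unit circle. -/
def slope (x : ℝ) : ℂ := Complex.I + (x / arc x : ℝ)

lemma norm_slope_le {x : ℝ} (hx : |x| ≤ 1 / 2) : ‖slope x‖ ≤ 2 := by
  have h1 := half_le_arc hx
  refine (norm_add_le _ _).trans ?_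
  rw [Complex.norm_I, Complex.norm_real, Real.norm_eq_abs, abs_div, abs_of_pos (by linarith : 0 < arc x)]
  have : |x| / arc x ≤ 1 := (div_le_one (by linarith)).mpr (by linarith)
  linarith

lemma differentiableAt_slope {x : ℝ} (hx : |x| < 1) : DifferentiableAt ℝ slope x := by
  unfold slope
  have h1 : DifferentiableAt ℝ (fun x : ℝ => x / arc x) x :=
    differentiableAt_id.div (hasDerivAt_arc hx).differentiableAt (arc_pos hx).ne'
  exact (differentiableAt_const _).add h1.hasDerivAt.ofReal_comp.differentiableAt

lemma hasFDerivAt_shear {p : ℝ × ℝ} (hp : |p.1| < 1) : HasFDerivAt shear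
    ((ContinuousLinearMap.fst ℝ ℝ ℝ).prod
      ((-p.1 / arc p.1) • ContinuousLinearMap.fst ℝ ℝ ℝ + ContinuousLinearMap.snd ℝ ℝ ℝ)) p := by
  have h1 : HasFDerivAt (fun p : ℝ × ℝ => arc p.1)
      ((-p.1 / arc p.1) • ContinuousLinearMap.fst ℝ ℝ ℝ) p :=
    (hasDerivAt_arc hp).comp_hasFDerivAt p (ContinuousLinearMap.fst ℝ ℝ ℝ).hasFDerivAt
  exact HasFDerivAt.prodMk (ContinuousLinearMap.fst ℝ ℝ ℝ).hasFDerivAt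
    (h1.add (ContinuousLinearMap.snd ℝ ℝ ℝ).hasFDerivAt)

section Stokes

variable {F a b : ℝ × ℝ → ℂ}

lemma hasFDerivAt_comp_shear (hF : ∀ p : ℝ × ℝ, 0 < p.2 → HasFDerivAt F (planeForm (a p) (b p)) p)
    {p : ℝ × ℝ} (hp : |p.1| < 1) (hp' : 0 ≤ p.2) : HasFDerivAt (fun p => F (shear p))
      (planeForm (a (shear p) - ((p.1 / arc p.1 : ℝ) : ℂ) * b (shear p)) (b (shear p))) p := by
  have h0 : 0 < (shear p).2 := add_pos_of_pos_of_nonneg (arc_pos hp) hp'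
  refine ((hF _ h0).comp p (hasFDerivAt_shear hp)).congr_fderiv ?_
  ext <;> simp [planeForm_apply, neg_div]
  ring

lemma hasFDerivAt_slope_mul
    (hF : ∀ p : ℝ × ℝ, 0 < p.2 → HasFDerivAt F (planeForm (a p) (b p)) p)
    {p : ℝ × ℝ} (hp : |p.1| < 1) (hp' : 0 ≤ p.2) :
    HasFDerivAt (fun p : ℝ × ℝ => slope p.1 * F (shear p))
      (planeForm (deriv slope p.1 * F (shear p) +
        slope p.1 * (a (shear p) - ((p.1 / arc p.1 : ℝ) : ℂ) * b (shear p)))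
        (slope p.1 * b (shear p))) p := by
  have h1 : HasFDerivAt (fun p : ℝ × ℝ => slope p.1)
      ((ContinuousLinearMap.fst ℝ ℝ ℝ).smulRight (deriv slope p.1)) p := by
    have := (differentiableAt_slope hp).hasDerivAt.hasFDerivAt.comp p
      (ContinuousLinearMap.fst ℝ ℝ ℝ).hasFDerivAt
    refine this.congr_fderiv ?_
    ext <;> simp
  refine (h1.mul (hasFDerivAt_comp_shear hF hp hp')).congr_fderiv ?_
  ext <;> simp [planeForm_apply]
  ring

/-- Stokes' theorem on the part of the fundamental domain of height at most `T` over the unit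
circle. The vertical sides cancel by periodicity, and the boundary form is odd along the circle. -/
lemma integral_truncated (hF : ∀ p : ℝ × ℝ, 0 < p.2 → HasFDerivAt F (planeForm (a p) (b p)) p)
    (hT : ∀ x y, 0 < y → F (x + 1, y) = F (x, y))
    (hS : ∀ x y : ℝ, 0 < y → x ^ 2 + y ^ 2 = 1 → F (-x, y) = (x + y * Complex.I) ^ 2 * F (x, y))
    {T : ℝ} (h0 : 0 ≤ T) (hint : IntegrableOn (fun p => a (shear p) + Complex.I * b (shear p))
      (Set.Icc (-1 / 2 : ℝ) (1 / 2) ×ˢ Set.Icc 0 T)) :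
    ∫ p in Set.Icc (-1 / 2 : ℝ) (1 / 2) ×ˢ Set.Icc 0 T, a (shear p) + Complex.I * b (shear p) =
      ∫ x in (-1 / 2 : ℝ)..(1 / 2), slope x * F (x, arc x + T) := by
  set f' : ℝ × ℝ → ℝ × ℝ →L[ℝ] ℂ := fun p =>
    planeForm (a (shear p) - ((p.1 / arc p.1 : ℝ) : ℂ) * b (shear p)) (b (shear p))
  set g' : ℝ × ℝ → ℝ × ℝ →L[ℝ] ℂ := fun p =>
    planeForm (deriv slope p.1 * F (shear p) +
        slope p.1 * (a (shear p) - ((p.1 / arc p.1 : ℝ) : ℂ) * b (shear p)))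
        (slope p.1 * b (shear p))
  have hdiv : ∀ p, f' p (1, 0) + g' p (0, 1) = a (shear p) + Complex.I * b (shear p) := by
    intro p
    simp only [f', g', planeForm_apply, slope]
    push_cast
    ring
  have hIcc : Set.Icc ((-1 / 2, 0) : ℝ × ℝ) (1 / 2, T) =
      Set.Icc (-1 / 2 : ℝ) (1 / 2) ×ˢ Set.Icc 0 T := (Set.Icc_prod_eq _ _)
  have habs : ∀ {x : ℝ}, x ∈ Set.Icc (-1 / 2 : ℝ) (1 / 2) → |x| < 1 := fun hx =>
    abs_lt.mpr ⟨by linarith [hx.1], by linarith [hx.2]⟩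
  have key := integral_divergence_prod_Icc_of_hasFDerivAt_of_le
    (fun p => F (shear p)) (fun p => slope p.1 * F (shear p)) f' g' (-1 / 2, 0) (1 / 2, T)
    (by exact ⟨by norm_num, h0⟩)
    (by
      rw [hIcc]
      exact fun p hp => (hasFDerivAt_comp_shear hF (habs hp.1)
        hp.2.1).continuousAt.continuousWithinAt)
    (by
      rw [hIcc]
      exact fun p hp => (hasFDerivAt_slope_mul hF (habs hp.1)
        hp.2.1).continuousAt.continuousWithinAt)
    (fun p hp => hasFDerivAt_comp_shear hF (habs ⟨hp.1.1.le, hp.1.2.le⟩) hp.2.1.le)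
    (fun p hp => hasFDerivAt_slope_mul hF (habs ⟨hp.1.1.le, hp.1.2.le⟩) hp.2.1.le)
    (by
      rw [hIcc]
      simpa only [hdiv] using hint)
  rw [hIcc] at key
  simp only [hdiv] at key
  rw [key]
  -- the two vertical sides cancel
  have hper : ∫ y in (0 : ℝ)..T, F (shear (1 / 2, y)) = ∫ y in (0 : ℝ)..T, F (shear (-1 / 2, y)) := by
    refine intervalIntegral.integral_congr fun y hy => ?_
    rw [Set.uIcc_of_le h0] at hy
    have h1 : arc (1 / 2) = arc (-1 / 2) := by rw [← arc_neg]; norm_num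
    have h2 := hT (-1 / 2) (arc (-1 / 2) + y)
      (add_pos_of_pos_of_nonneg (arc_pos (by norm_num [abs_lt])) hy.1)
    simp only [shear, h1]
    rw [← h2]
    norm_num
  rw [hper]
  -- the integral along the circle changes sign under `x ↦ -x`, the action of `S` on the circle
  have hodd : ∫ x in (-1 / 2 : ℝ)..(1 / 2), slope x * F (shear (x, 0)) = 0 := by
    set G : ℝ → ℂ := fun x => slope x * F (shear (x, 0))
    have h1 : ∫ x in (-1 / 2 : ℝ)..(1 / 2), G (-x) = ∫ x in (-1 / 2 : ℝ)..(1 / 2), G x := by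
      rw [intervalIntegral.integral_comp_neg]
      norm_num
    have h2 : ∫ x in (-1 / 2 : ℝ)..(1 / 2), G (-x) = ∫ x in (-1 / 2 : ℝ)..(1 / 2), -G x := by
      refine intervalIntegral.integral_congr fun x hx => ?_
      rw [Set.uIcc_of_le (by norm_num)] at hx
      have h3 := arc_pos (habs hx)
      have h4 := arc_sq (habs hx).le
      have h5 := hS x (arc x) h3 (by linarith)
      have h6 : (arc x : ℂ) ≠ 0 := by exact_mod_cast h3.ne'
      have h7 : (arc x : ℂ) ^ 2 = 1 - (x : ℂ) ^ 2 := by exact_mod_cast h4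
      have h8 : (x + arc x * Complex.I) ^ 2 * (Complex.I * arc x - x) =
          -(Complex.I * arc x + x) := by
        have hI := Complex.I_sq
        have : (x + arc x * Complex.I) * (Complex.I * arc x - x) = -1 := by
          linear_combination (arc x : ℂ) ^ 2 * hI - h7
        rw [pow_two, mul_assoc, this]
        ring
      simp only [G, shear, add_zero, arc_neg, h5, slope]
      push_cast
      field_simp
      linear_combination (F (x, arc x)) * h8
    rw [h1, intervalIntegral.integral_neg] at h2
    have h9 : (2 : ℂ) * ∫ x in (-1 / 2 : ℝ)..(1 / 2), G x = 0 := by linear_combination h2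
    exact (mul_eq_zero.mp h9).resolve_left two_ne_zero
  rw [hodd]
  simp only [shear]
  ring

/-- **Stokes' theorem** for a form `F dz` of weight two on the fundamental domain. The hypotheses `hT`
and `hS` are the transformation laws under the generators of `SL₂(ℤ)`, the second one on the unit circle
only, and the contribution of the cusp vanishes by the bound `hC`. -/
theorem integral_fd_eq_zero
    (hF : ∀ p : ℝ × ℝ, 0 < p.2 → HasFDerivAt F (planeForm (a p) (b p)) p)
    (hT : ∀ x y, 0 < y → F (x + 1, y) = F (x, y))
    (hS : ∀ x y : ℝ, 0 < y → x ^ 2 + y ^ 2 = 1 → F (-x, y) = (x + y * Complex.I) ^ 2 * F (x, y))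
    {C : ℝ} (hC : ∀ x y : ℝ, |x| ≤ 1 / 2 → 1 / 2 ≤ y → ‖F (x, y)‖ ≤ C / y)
    (hint : IntegrableOn (fun p => a p + Complex.I * b p) (pt ⁻¹' 𝒟 ∩ halfPlane)) :
    ∫ p in pt ⁻¹' 𝒟 ∩ halfPlane, (a p + Complex.I * b p) = 0 := by
  have hD : MeasurableSet (pt ⁻¹' 𝒟 ∩ halfPlane) :=
    (measurable_pt measurableSet_fd).inter measurableSet_halfPlane
  have hmp := measurePreserving_shear.restrict_preimage hD
  rw [shear_preimage_fd] at hmp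
  have hint' : IntegrableOn (fun p => a (shear p) + Complex.I * b (shear p))
      (Set.Icc (-1 / 2 : ℝ) (1 / 2) ×ˢ Set.Ici 0) := hmp.integrable_comp_of_integrable hint
  have hU : ⋃ n : ℕ, Set.Icc (-1 / 2 : ℝ) (1 / 2) ×ˢ Set.Icc 0 (n : ℝ) =
      Set.Icc (-1 / 2 : ℝ) (1 / 2) ×ˢ Set.Ici (0 : ℝ) := by
    rw [← Set.prod_iUnion]
    congr 1
    ext t
    simp only [Set.mem_iUnion, Set.mem_Icc, Set.mem_Ici]
    exact ⟨fun ⟨_, h, _⟩ => h, fun h => (exists_nat_ge t).imp fun _ hn => ⟨h, hn⟩⟩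
  have h1 : ∫ p in pt ⁻¹' 𝒟 ∩ halfPlane, (a p + Complex.I * b p) =
      ∫ p in Set.Icc (-1 / 2 : ℝ) (1 / 2) ×ˢ Set.Ici 0, (a (shear p) + Complex.I * b (shear p)) := by
    rw [← hmp.map_eq, integral_map hmp.measurable.aemeasurable]
    rw [hmp.map_eq]
    exact hint.aestronglyMeasurable
  rw [h1, ← hU]
  rw [← hU] at hint'
  have h2 := tendsto_setIntegral_of_monotone
    (fun n : ℕ => (measurableSet_Icc.prod measurableSet_Icc :
      MeasurableSet (Set.Icc (-1 / 2 : ℝ) (1 / 2) ×ˢ Set.Icc 0 (n : ℝ))))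
    (fun i j hij => Set.prod_mono_right (Set.Icc_subset_Icc_right (by exact_mod_cast hij))) hint'
  refine tendsto_nhds_unique h2 ?_
  have h3 : ∀ n : ℕ, ∫ p in Set.Icc (-1 / 2 : ℝ) (1 / 2) ×ˢ Set.Icc 0 (n : ℝ),
      (a (shear p) + Complex.I * b (shear p)) =
      ∫ x in (-1 / 2 : ℝ)..(1 / 2), slope x * F (x, arc x + n) := fun n =>
    integral_truncated hF hT hS n.cast_nonneg (hint'.mono_set
      (Set.subset_iUnion (fun n : ℕ => Set.Icc (-1 / 2 : ℝ) (1 / 2) ×ˢ Set.Icc 0 (n : ℝ)) n))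
  simp only [h3]
  rw [tendsto_zero_iff_norm_tendsto_zero]
  have h4 : Filter.Tendsto (fun n : ℕ => 2 * |C| / (n : ℝ)) Filter.atTop (nhds 0) :=
    tendsto_const_div_atTop_nhds_zero_nat _
  refine squeeze_zero' (Filter.Eventually.of_forall fun _ => norm_nonneg _) ?_ h4
  filter_upwards [Filter.eventually_gt_atTop 0] with n hn
  have hn' : (0 : ℝ) < n := by exact_mod_cast hn
  have h5 : ∀ x ∈ Set.uIoc (-1 / 2 : ℝ) (1 / 2),
      ‖slope x * F (x, arc x + n)‖ ≤ 2 * |C| / (n : ℝ) := by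
    intro x hx
    rw [Set.uIoc_of_le (by norm_num)] at hx
    have hx' : |x| ≤ 1 / 2 := abs_le.mpr ⟨by linarith [hx.1], hx.2⟩
    have h6 := half_le_arc hx'
    rw [norm_mul, mul_div_assoc]
    refine mul_le_mul (norm_slope_le hx') ((hC x _ hx' (by linarith)).trans ?_)
      (norm_nonneg _) (by norm_num)
    exact (div_le_div_of_nonneg_right (le_abs_self C) (by linarith)).trans
      (div_le_div_of_nonneg_left (abs_nonneg _) hn' (by linarith))
  have h7 := intervalIntegral.norm_integral_le_of_norm_le_const h5
  norm_num at h7 ⊢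
  exact h7

end Stokes

/-! ### Raising operators and the Poincaré series -/

section Raise

variable {W : Type*} [AddCommGroup W] [Module ℝ W] {q : QuadraticForm ℝ W} {L : AddSubgroup W}

lemma innerL_smul_right (u : q.IsometryEquiv (stdForm bp bm)) (hL : IsEvenLattice q L) (a : ℂ)
    (f g : GroupRing q L) : innerL f (a • g) = conj a * innerL f g := by
  have := finite_discr u hL
  have := Fintype.ofFinite (Discr q L)
  simp only [innerL_eq, Pi.smul_apply, smul_eq_mul, map_mul, Finset.mul_sum]
  exact Finset.sum_congr rfl fun γ _ => by ring

lemma isModular_poincare (u : q.IsometryEquiv (stdForm bp bm)) (hL : IsEvenLattice q L)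
    {m : ℝ} (hm : 0 < m) {β : Discr q L} (hmβ : e (m : ℂ) = e (q (rep β) : ℝ)) {w : ℤ}
    (hw : 4 < w) :
    IsModular q L ((bp : ℤ) - bm) w (poincare q L ((bp : ℤ) - bm) w m β) :=
  fun M τ => poincare_smul u hL hm hmβ hw M τ

/-- The product of modular forms of weights `ν` and `ν - 2`, times `y^{ν-2}`, has weight two. -/
lemma innerL_smul_mul_im (u : q.IsometryEquiv (stdForm bp bm)) (hL : IsEvenLattice q L) {w : ℤ}
    {f g : ℍ → GroupRing q L} (hf : IsModular q L ((bp : ℤ) - bm) w f)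
    (hg : IsModular q L ((bp : ℤ) - bm) (w - 4) g) (M : Mp2Z) (τ : ℍ) :
    innerL (f (M.mat • τ)) (g (M.mat • τ)) * (((M.mat • τ).im ^ ((w : ℝ) / 2 - 2) : ℝ) : ℂ) =
      M.phi τ ^ 4 * (innerL (f τ) (g τ) * ((τ.im ^ ((w : ℝ) / 2 - 2) : ℝ) : ℂ)) := by
  have h1 := zpow_mul_rpow_im M τ (w - 4)
  have h2 : (((w - 4 : ℤ) : ℝ) / 2) = (w : ℝ) / 2 - 2 := by push_cast; ring
  have h3 : M.phi τ ^ w * M.phi τ ^ (-(w - 4)) = M.phi τ ^ 4 := by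
    rw [← zpow_add₀ (M.phi_ne_zero τ), ← zpow_natCast]
    congr 1
    push_cast
    ring
  rw [h2] at h1
  rw [hf M τ, hg M τ, innerL_smul_left, innerL_smul_right u hL, innerL_weilRep u hL, map_zpow₀]
  linear_combination (M.phi τ ^ w * innerL (f τ) (g τ)) * h1 +
    (innerL (f τ) (g τ) * ((τ.im ^ ((w : ℝ) / 2 - 2) : ℝ) : ℂ)) * h3

lemma exists_innerL_poincare_bound (u : q.IsometryEquiv (stdForm bp bm)) (hL : IsEvenLattice q L)
    {m : ℝ} (hm : 0 < m) {β : Discr q L} (hmβ : e (m : ℂ) = e (q (rep β) : ℝ)) {w : ℤ}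
    (hw : 4 < w) {κ : ℝ → V bp bm → ℂ} (hκ : ModerateGrowth κ) {A : ℝ} (hA : 0 < A) :
    ∃ C : ℝ, ∀ τ : ℍ, |τ.re| ≤ 1 → 1 / 2 ≤ τ.im →
      ‖innerL (poincare q L ((bp : ℤ) - bm) w m β τ) (kernelVec u L κ τ)‖ ≤ C * τ.im ^ (-A) := by
  have := finite_discr u hL
  have := Fintype.ofFinite (Discr q L)
  choose C c hc hP using fun γ => exists_poincare_decay u hL hm hmβ hw γ
  obtain ⟨C', s, N, hC', hκ'⟩ := hκ
  obtain ⟨D, hD, hK⟩ := ModerateGrowth.exists_bound u hL hC' hκ'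
  refine ⟨∑ γ, |C γ| * D * ((s + A) / c γ) ^ (s + A), fun τ h1 h2 => ?_⟩
  have hy := τ.im_pos
  rw [innerL_eq, Finset.sum_mul]
  refine norm_sum_le_of_le _ fun γ _ => ?_
  rw [norm_mul, Complex.norm_conj]
  have h3 := rpow_mul_exp_neg_le (s := s + A) (by positivity) (hc γ) hy
  rw [Real.rpow_add hy, Real.rpow_natCast] at h3
  have h4 : τ.im ^ s * Real.exp (-(c γ * τ.im)) ≤ ((s + A) / c γ) ^ (s + A) * τ.im ^ (-A) := by
    rw [Real.rpow_neg hy.le, ← div_eq_mul_inv, le_div_iff₀ (by positivity)]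
    linarith
  have h5 := hP γ τ h1 h2
  have h6 : ‖kernelVec u L κ τ γ‖ ≤ D * τ.im ^ s := hK τ γ (by simpa using h2)
  calc _ ≤ (|C γ| * Real.exp (-(c γ * τ.im))) * (D * τ.im ^ s) := by
        refine mul_le_mul (h5.trans ?_) h6 (norm_nonneg _) (by positivity)
        exact mul_le_mul_of_nonneg_right (le_abs_self _) (Real.exp_pos _).le
    _ = |C γ| * D * (τ.im ^ s * Real.exp (-(c γ * τ.im))) := by ring
    _ ≤ |C γ| * D * (((s + A) / c γ) ^ (s + A) * τ.im ^ (-A)) := by gcongr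
    _ = _ := by ring

lemma continuous_poincare (u : q.IsometryEquiv (stdForm bp bm)) (hL : IsEvenLattice q L)
    {m : ℝ} (hm : 0 < m) (β : Discr q L) {w : ℤ} (hw : 4 < w) (γ : Discr q L) :
    Continuous fun τ : ℍ => poincare q L ((bp : ℤ) - bm) w m β τ γ := by
  have h := (differentiableOn_poincare u hL hm β hw γ).continuousOn.comp_continuous
    UpperHalfPlane.continuous_coe (fun τ => τ.im_pos)
  refine h.congr fun τ => ?_
  rw [Function.comp_apply, ofComplex_apply]

/-- The Petersson product of the Poincaré series with a Gaussian series converges absolutely. -/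
theorem integrableOn_peterssonIntegrand (u : q.IsometryEquiv (stdForm bp bm))
    (hL : IsEvenLattice q L) {m : ℝ} (hm : 0 < m) {β : Discr q L}
    (hmβ : e (m : ℂ) = e (q (rep β) : ℝ)) {w : ℤ} (hw : 4 < w) {κ κ' : ℝ → V bp bm → ℂ}
    (hκ : KernelHasDeriv κ κ') :
    Continuous (peterssonIntegrand w (poincare q L ((bp : ℤ) - bm) w m β) (kernelVec u L κ)) ∧
    IntegrableOn (peterssonIntegrand w (poincare q L ((bp : ℤ) - bm) w m β) (kernelVec u L κ))
      𝒟 := by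
  have := finite_discr u hL
  have := Fintype.ofFinite (Discr q L)
  have hw' : (4 : ℝ) < w := by exact_mod_cast hw
  have hcont : Continuous
      (peterssonIntegrand w (poincare q L ((bp : ℤ) - bm) w m β) (kernelVec u L κ)) := by
    unfold peterssonIntegrand
    simp only [innerL_eq]
    refine Continuous.mul (continuous_finsetSum _ fun γ _ => ?_) ?_
    · exact (continuous_poincare u hL hm β hw γ).mul
        (Complex.continuous_conj.comp (hκ.continuous_kernelVec u hL γ))
    · exact Complex.continuous_ofReal.comp
        (UpperHalfPlane.continuous_im.rpow_const fun τ => Or.inl τ.im_pos.ne')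
  refine ⟨hcont, ?_⟩
  obtain ⟨C, hC⟩ := exists_innerL_poincare_bound u hL hm hmβ hw hκ.1 (A := (w : ℝ) / 2)
    (by positivity)
  refine integrableOn_fd_of_le hcont (C := C) zero_lt_one fun τ hτ => ?_
  have h1 := hC τ ((abs_re_le_of_mem_fd hτ).trans (by norm_num)) (half_le_im_of_mem_fd hτ)
  have hy := τ.im_pos
  rw [peterssonIntegrand, norm_mul, Complex.norm_real, Real.norm_of_nonneg (by positivity),
    Real.rpow_zero]
  refine (mul_le_mul_of_nonneg_right h1 (by positivity)).trans (le_of_eq ?_)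
  rw [mul_assoc, ← Real.rpow_add hy, neg_add_cancel, Real.rpow_zero]

/-- The kernel of `(2i ∂/∂τ + s / y) K`, where `κ` is the kernel of `K` and `κ'` its derivative with
respect to `y`. -/
def raiseKernel (s : ℝ) (κ κ' : ℝ → V bp bm → ℂ) (y : ℝ) (v : V bp bm) : ℂ :=
  κ' y v - 2 * Real.pi * sqPlus v * κ y v + (s / y : ℝ) * κ y v

lemma hasFDerivAt_holomorphic {f : ℂ → ℂ} {p : ℝ × ℝ} {d : ℂ}
    (h : HasDerivAt f d (⟨p.1, p.2⟩ : ℂ)) :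
    HasFDerivAt (fun p : ℝ × ℝ => f ⟨p.1, p.2⟩) (planeForm d (Complex.I * d)) p := by
  have h1 := (h.hasFDerivAt.restrictScalars ℝ).comp p
    (Complex.equivRealProdCLM.symm : ℝ × ℝ →L[ℝ] ℂ).hasFDerivAt
  refine h1.congr_fderiv ?_
  ext <;> simp [planeForm_apply, Complex.equivRealProdCLM_symm_apply]

lemma kernelSeries_raise (u : q.IsometryEquiv (stdForm bp bm)) (hL : IsEvenLattice q L)
    {κ κ' : ℝ → V bp bm → ℂ} (hκ : KernelHasDeriv κ κ') (s : ℝ) (γ : Discr q L) {z : ℂ}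
    (hz : 0 < z.im) : Complex.I * kernelSeries u L (kernelDX κ) γ z +
      kernelSeries u L (kernelDY κ κ') γ z + (s / z.im : ℝ) * kernelSeries u L κ γ z =
      kernelSeries u L (raiseKernel s κ κ') γ z := by
  have h1 := (hκ.1.kernelDX.summable_coset u hL hz γ).hasSum.mul_left Complex.I
  have h2 := ((hκ.1.kernelDY hκ.2).summable_coset u hL hz γ).hasSum
  have h3 := (hκ.1.summable_coset u hL hz γ).hasSum.mul_left ((s / z.im : ℝ) : ℂ)
  rw [kernelSeries, kernelSeries, kernelSeries, kernelSeries, ← ((h1.add h2).add h3).tsum_eq]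
  refine tsum_congr fun x => ?_
  rw [kernelDX, kernelDY, raiseKernel, stdForm_eq]
  push_cast
  linear_combination (Real.pi * (sqPlus (u (x.1 : W)) - sqMinus (u (x.1 : W))) *
    κ z.im (u (x.1 : W)) * gaussV z (u (x.1 : W))) * Complex.I_sq

/-- The image of a raising operator is orthogonal to the Poincaré series: the integrand is the exterior
derivative of the invariant form `⟨P, K⟩ y^{w/2-2} dz`, because `P` is holomorphic. -/
theorem petersson_raise_eq_zero (u : q.IsometryEquiv (stdForm bp bm))
    (hL : IsEvenLattice q L) {m : ℝ} (hm : 0 < m) {β : Discr q L}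
    (hmβ : e (m : ℂ) = e (q (rep β) : ℝ)) {w : ℤ} (hw : 4 < w) {κ κ' R' : ℝ → V bp bm → ℂ}
    (hκ : KernelHasDeriv κ κ') (hR : KernelHasDeriv (raiseKernel ((w : ℝ) / 2 - 2) κ κ') R')
    (hmod : IsModular q L ((bp : ℤ) - bm) (w - 4) (kernelVec u L κ)) :
    petersson w (poincare q L ((bp : ℤ) - bm) w m β)
      (kernelVec u L (raiseKernel ((w : ℝ) / 2 - 2) κ κ')) = 0 := by
  have := finite_discr u hL
  have := Fintype.ofFinite (Discr q L)
  have hw' : (4 : ℝ) < w := by exact_mod_cast hw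
  set s : ℝ := (w : ℝ) / 2 - 2 with hs
  set P := poincare q L ((bp : ℤ) - bm) w m β with hP
  have hPd := fun γ => differentiableOn_poincare u hL hm β hw γ
  set F : ℝ × ℝ → ℂ := fun p => ∑ γ, P (ofComplex ⟨p.1, p.2⟩) γ *
    conj (kernelSeries u L κ γ ⟨p.1, p.2⟩) * ((p.2 ^ s : ℝ) : ℂ) with hFdef
  set d : Discr q L → ℝ × ℝ → ℂ := fun γ p =>
    deriv (fun z : ℂ => P (ofComplex z) γ) ⟨p.1, p.2⟩
  set a : ℝ × ℝ → ℂ := fun p => ∑ γ, (d γ p * conj (kernelSeries u L κ γ ⟨p.1, p.2⟩) +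
    P (ofComplex ⟨p.1, p.2⟩) γ * conj (kernelSeries u L (kernelDX κ) γ ⟨p.1, p.2⟩)) *
      ((p.2 ^ s : ℝ) : ℂ)
  set b : ℝ × ℝ → ℂ := fun p => ∑ γ, ((Complex.I * d γ p *
    conj (kernelSeries u L κ γ ⟨p.1, p.2⟩) +
    P (ofComplex ⟨p.1, p.2⟩) γ * conj (kernelSeries u L (kernelDY κ κ') γ ⟨p.1, p.2⟩)) *
      ((p.2 ^ s : ℝ) : ℂ) + P (ofComplex ⟨p.1, p.2⟩) γ *
      conj (kernelSeries u L κ γ ⟨p.1, p.2⟩) * ((s * p.2 ^ (s - 1) : ℝ) : ℂ))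
  have hF : ∀ p : ℝ × ℝ, 0 < p.2 → HasFDerivAt F (planeForm (a p) (b p)) p := by
    intro p hp
    have hz : (⟨p.1, p.2⟩ : ℂ) ∈ {z : ℂ | 0 < z.im} := hp
    have h1 : ∀ γ, HasFDerivAt (fun p : ℝ × ℝ => P (ofComplex ⟨p.1, p.2⟩) γ)
        (planeForm (d γ p) (Complex.I * d γ p)) p := fun γ =>
      hasFDerivAt_holomorphic ((hPd γ).differentiableAt
        ((isOpen_lt continuous_const Complex.continuous_im).mem_nhds hz)).hasDerivAt
    have h2 : ∀ γ, HasFDerivAt (fun p : ℝ × ℝ => conj (kernelSeries u L κ γ ⟨p.1, p.2⟩))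
        (planeForm (conj (kernelSeries u L (kernelDX κ) γ ⟨p.1, p.2⟩))
          (conj (kernelSeries u L (kernelDY κ κ') γ ⟨p.1, p.2⟩))) p := by
      intro γ
      have := (Complex.conjCLE : ℂ →L[ℝ] ℂ).hasFDerivAt.comp p
        (hasFDerivAt_kernelSeries u hL hκ.1 hκ.2 hκ.3 γ hp)
      refine this.congr_fderiv ?_
      ext <;> simp [planeForm_apply]
    have h3 : HasFDerivAt (fun p : ℝ × ℝ => ((p.2 ^ s : ℝ) : ℂ))
        (planeForm 0 ((s * p.2 ^ (s - 1) : ℝ) : ℂ)) p := by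
      have := ((Real.hasDerivAt_rpow_const (p := s) (Or.inl hp.ne')).ofReal_comp).hasFDerivAt.comp p
        (ContinuousLinearMap.snd ℝ ℝ ℝ).hasFDerivAt
      refine this.congr_fderiv ?_
      ext <;> simp [planeForm_apply]
    have h4 := HasFDerivAt.fun_sum (u := Finset.univ) fun γ _ => ((h1 γ).mul (h2 γ)).mul h3
    refine h4.congr_fderiv (ContinuousLinearMap.ext fun r => ?_)
    simp only [sum_apply, add_apply, smul_apply, planeForm_apply,
      Pi.mul_apply, smul_eq_mul, a, b, Finset.mul_sum, ← Finset.sum_add_distrib]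
    exact Finset.sum_congr rfl fun γ _ => by ring
  have hFpt : ∀ p : ℝ × ℝ, 0 < p.2 → F p = innerL (P (pt p)) (kernelVec u L κ (pt p)) *
      (((pt p).im ^ s : ℝ) : ℂ) := by
    intro p hp
    rw [innerL_eq, Finset.sum_mul, pt_im hp]
    simp only [kernelVec, coe_pt hp]
    rfl
  have hlaw := fun M τ => innerL_smul_mul_im u hL (isModular_poincare u hL hm hmβ hw) hmod M τ
  have hT : ∀ x y, 0 < y → F (x + 1, y) = F (x, y) := by
    intro x y hy
    have h1 : pt (x + 1, y) = Mp2Z.T.mat • pt (x, y) := by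
      apply UpperHalfPlane.ext
      change ((pt (x + 1, y) : ℍ) : ℂ) = ((ModularGroup.T • pt (x, y) : ℍ) : ℂ)
      rw [coe_T_smul, coe_pt (p := (x + 1, y)) hy, coe_pt (p := (x, y)) hy]
      apply Complex.ext <;> simp
    have hphi : Mp2Z.T.phi (pt (x, y)) = 1 := rfl
    rw [hFpt _ hy, hFpt _ hy, h1, hlaw, hphi, one_pow, one_mul]
  have hS : ∀ x y : ℝ, 0 < y → x ^ 2 + y ^ 2 = 1 →
      F (-x, y) = (x + y * Complex.I) ^ 2 * F (x, y) := by
    intro x y hy hxy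
    have hτ : ((pt (x, y) : ℍ) : ℂ) = x + y * Complex.I := by
      rw [coe_pt (p := (x, y)) hy, Complex.mk_eq_add_mul_I]
    have h1 : pt (-x, y) = Mp2Z.S.mat • pt (x, y) := by
      apply UpperHalfPlane.ext
      change ((pt (-x, y) : ℍ) : ℂ) = ((ModularGroup.S • pt (x, y) : ℍ) : ℂ)
      rw [UpperHalfPlane.modular_S_smul]
      change _ = (-((pt (x, y) : ℍ) : ℂ))⁻¹
      rw [hτ, coe_pt (p := (-x, y)) hy, Complex.mk_eq_add_mul_I]
      have hxy' : (x : ℂ) ^ 2 + (y : ℂ) ^ 2 = 1 := by exact_mod_cast hxy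
      refine (inv_eq_of_mul_eq_one_left ?_).symm
      push_cast
      linear_combination hxy' - (y : ℂ) ^ 2 * Complex.I_sq
    have hphi : Mp2Z.S.phi (pt (x, y)) ^ 4 = (x + y * Complex.I) ^ 2 := by
      have h2 := Mp2Z.S.sq (pt (x, y))
      have h3 : Mp2Z.S.mat = ModularGroup.S := rfl
      rw [h3, hτ] at h2
      simp only [ModularGroup.S] at h2
      norm_num at h2
      rw [show Mp2Z.S.phi (pt (x, y)) ^ 4 = (Mp2Z.S.phi (pt (x, y)) ^ 2) ^ 2 by ring, h2]
    rw [hFpt _ hy, hFpt _ hy, h1, hlaw, hphi]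
  -- the exterior derivative of `F dz` is the Petersson integrand against the raised form
  have hab : ∀ p : ℝ × ℝ, 0 < p.2 → a p + Complex.I * b p = Complex.I * (((1 / p.2 ^ 2 : ℝ) : ℂ) *
      peterssonIntegrand w P (kernelVec u L (raiseKernel s κ κ')) (pt p)) := by
    intro p hp
    have hpow : p.2 ^ ((w : ℝ) / 2) = p.2 ^ s * p.2 ^ 2 := by
      rw [← Real.rpow_natCast, ← Real.rpow_add hp, hs]
      congr 1
      push_cast
      ring
    have hpow' : p.2 ^ (s - 1) = p.2 ^ s / p.2 := by
      rw [Real.rpow_sub hp, Real.rpow_one]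
    have hp0 : (p.2 : ℂ) ≠ 0 := by exact_mod_cast hp.ne'
    rw [peterssonIntegrand, innerL_eq, pt_im hp, hpow]
    simp only [kernelVec, coe_pt hp, a, b, hpow', Finset.mul_sum, Finset.sum_mul,
      ← Finset.sum_add_distrib]
    refine Finset.sum_congr rfl fun γ _ => ?_
    rw [← kernelSeries_raise u hL hκ s γ (z := ⟨p.1, p.2⟩) hp]
    simp only [map_add, map_mul, Complex.conj_I, Complex.conj_ofReal]
    rw [show pt p = ofComplex ⟨p.1, p.2⟩ from rfl]
    push_cast
    field_simp
    linear_combination ((p.2 ^ s : ℝ) : ℂ) * (p.2 * d γ p * conj (kernelSeries u L κ γ ⟨p.1, p.2⟩) +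
      p.2 * P (ofComplex ⟨p.1, p.2⟩) γ *
        conj (kernelSeries u L (kernelDX κ) γ ⟨p.1, p.2⟩)) * Complex.I_sq
  obtain ⟨hcont, hint⟩ := integrableOn_peterssonIntegrand u hL hm hmβ hw hR
  rw [integrableOn_iff_real hcont.stronglyMeasurable measurableSet_fd] at hint
  have hD : MeasurableSet (pt ⁻¹' 𝒟 ∩ halfPlane) :=
    (measurable_pt measurableSet_fd).inter measurableSet_halfPlane
  obtain ⟨C, hC⟩ := exists_innerL_poincare_bound u hL hm hmβ hw hκ.1 (A := s + 1)
    (by rw [hs]; linarith)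
  have key := integral_fd_eq_zero hF hT hS (C := C) (fun x y hx hy => ?_) ?_
  · rw [setIntegral_congr_fun hD fun p hp => hab p hp.2, integral_const_mul,
      ← setIntegral_eq_real hcont.stronglyMeasurable measurableSet_fd] at key
    exact (mul_eq_zero.mp key).resolve_left Complex.I_ne_zero
  · have hy0 : 0 < y := by linarith
    have h1 := hC (pt (x, y)) (by rw [pt_re (p := (x, y)) hy0]; linarith)
      (by rw [pt_im (p := (x, y)) hy0]; exact hy)
    rw [pt_im (p := (x, y)) hy0] at h1
    rw [hFpt _ hy0, norm_mul, Complex.norm_real, pt_im (p := (x, y)) hy0,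
      Real.norm_of_nonneg (by positivity)]
    refine (mul_le_mul_of_nonneg_right h1 (by positivity)).trans (le_of_eq ?_)
    rw [mul_assoc, ← Real.rpow_add hy0, show -(s + 1) + s = -1 by ring, Real.rpow_neg_one,
      div_eq_mul_inv]
  · exact (hint.const_mul Complex.I).congr ((ae_restrict_mem hD).mono fun p hp =>
      (hab p hp.2).symm)

end Raise

/-! ### The harmonic projection -/

section Harmonic

open MvPolynomial

variable {bp bm : ℕ}

lemma mul_mem_bihomogeneous {k l k' l' : ℕ} {p r : Poly bp bm} (hp : p ∈ bihomogeneous bp bm k l)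
    (hr : r ∈ bihomogeneous bp bm k' l') : p * r ∈ bihomogeneous bp bm (k + k') (l + l') :=
  IsWeightedHomogeneous.mul hp hr

lemma normSqPlus_mem : normSqPlus bp bm ∈ bihomogeneous bp bm 2 0 := by
  refine Submodule.sum_mem _ fun i _ => ?_
  have h := isWeightedHomogeneous_X ℂ
    (Sum.elim (fun _ : Fin bp => ((1, 0) : ℕ × ℕ)) (fun _ : Fin bm => ((0, 1) : ℕ × ℕ))) (Sum.inl i)
  exact h.pow 2

lemma normSqPlus_pow_mem (j : ℕ) : normSqPlus bp bm ^ j ∈ bihomogeneous bp bm (2 * j) 0 := by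
  induction j with
  | zero => simpa using one_mem_bihomogeneous
  | succ j ih => rw [pow_succ]; exact mul_mem_bihomogeneous ih normSqPlus_mem

lemma laplacianPlus_mem {k l : ℕ} {p : Poly bp bm} (hp : p ∈ bihomogeneous bp bm (k + 2) l) :
    laplacianPlus p ∈ bihomogeneous bp bm k l := by
  refine Submodule.sum_mem _ fun i _ => ?_
  have h1 : IsWeightedHomogeneous _ (pderiv (Sum.inl i) p) ((k + 1, l) : ℕ × ℕ) :=
    IsWeightedHomogeneous.pderiv hp (by simp)
  exact IsWeightedHomogeneous.pderiv h1 (by simp)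

lemma laplacianPlus_iterate_mem {k l : ℕ} (j : ℕ) :
    ∀ {p : Poly bp bm}, p ∈ bihomogeneous bp bm (k + 2 * j) l →
      laplacianPlus^[j] p ∈ bihomogeneous bp bm k l := by
  induction j with
  | zero => exact fun hp => hp
  | succ j ih => exact fun hp => ih (laplacianPlus_mem hp)

lemma laplacianPlus_eq_zero {k l : ℕ} (hk : k < 2) {p : Poly bp bm}
    (hp : p ∈ bihomogeneous bp bm k l) : laplacianPlus p = 0 := by
  rw [mem_bihomogeneous_iff] at hp
  refine Finset.sum_eq_zero fun i _ => ?_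
  ext d
  rw [coeff_pderiv, coeff_pderiv, coeff_zero]
  have h : coeff (d + Finsupp.single (Sum.inl i) 1 + Finsupp.single (Sum.inl i) 1) p = 0 := by
    by_contra h
    have h1 := (hp _ (mem_support_iff.mpr h)).1
    have h2 := Finset.single_le_sum (f := fun i' : Fin bp =>
      (d + Finsupp.single (Sum.inl i) 1 + Finsupp.single (Sum.inl i) 1 :
        Fin bp ⊕ Fin bm →₀ ℕ) (Sum.inl i'))
      (fun _ _ => Nat.zero_le _) (Finset.mem_univ i)
    rw [h1] at h2
    simp only [Finsupp.add_apply, Finsupp.single_eq_same] at h2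
    omega
  rw [h]
  ring

lemma pderiv_inr_eq_zero {k : ℕ} {p : Poly bp bm} (hp : p ∈ bihomogeneous bp bm k 0) (j : Fin bm) :
    pderiv (Sum.inr j) p = 0 := by
  rw [mem_bihomogeneous_iff] at hp
  ext d
  rw [coeff_pderiv, coeff_zero]
  have h : coeff (d + Finsupp.single (Sum.inr j) 1) p = 0 := by
    by_contra h
    have h1 := (hp _ (mem_support_iff.mpr h)).2
    have h2 := Finset.single_le_sum (f := fun j' : Fin bm =>
      (d + Finsupp.single (Sum.inr j) 1 : Fin bp ⊕ Fin bm →₀ ℕ) (Sum.inr j'))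
      (fun _ _ => Nat.zero_le _) (Finset.mem_univ j)
    rw [h1] at h2
    simp only [Finsupp.add_apply, Finsupp.single_eq_same] at h2
    omega
  rw [h, zero_mul]

lemma laplacian_eq_laplacianPlus {k : ℕ} {p : Poly bp bm} (hp : p ∈ bihomogeneous bp bm k 0) :
    laplacian p = laplacianPlus p := by
  rw [laplacian, Fintype.sum_sum_type, laplacianPlus]
  simp [pderiv_inr_eq_zero hp]

/-- Euler's identity in the variables of `V⁺`. -/
lemma sum_X_mul_pderiv {k l : ℕ} {p : Poly bp bm} (hp : p ∈ bihomogeneous bp bm k l) :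
    ∑ i : Fin bp, X (Sum.inl i) * pderiv (Sum.inl i) p = (k : ℂ) • p := by
  rw [mem_bihomogeneous_iff] at hp
  have h : IsWeightedHomogeneous
      (Sum.elim (fun _ : Fin bp => (1 : ℕ)) (fun _ : Fin bm => (0 : ℕ))) p k := by
    intro d hd
    rw [← (hp d (mem_support_iff.mpr hd)).1, Finsupp.weight_apply, Finsupp.sum_fintype]
    · simp [Fintype.sum_sum_type]
    · simp
  have h1 := h.sum_weight_X_mul_pderiv
  rw [Fintype.sum_sum_type] at h1
  simp only [Sum.elim_inl, Sum.elim_inr, one_smul, zero_smul, Finset.sum_const_zero, add_zero] at h1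
  rw [h1, Nat.cast_smul_eq_nsmul]

lemma pderiv_normSqPlus (i : Fin bp) :
    pderiv (Sum.inl i) (normSqPlus bp bm) = 2 * X (Sum.inl i) := by
  rw [normSqPlus, map_sum, Finset.sum_eq_single i]
  · rw [Derivation.leibniz_pow, pderiv_X_self]
    simp [nsmul_eq_mul]
  · intro j _ hj
    rw [Derivation.leibniz_pow, pderiv_X_of_ne (by simpa using hj)]
    simp
  · simp

lemma laplacianPlus_normSqPlus_mul {k l : ℕ} {p : Poly bp bm} (hp : p ∈ bihomogeneous bp bm k l) :
    laplacianPlus (normSqPlus bp bm * p) =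
      normSqPlus bp bm * laplacianPlus p + (4 * k + 2 * bp : ℂ) • p := by
  have h1 : ∀ i : Fin bp, pderiv (Sum.inl i) (pderiv (Sum.inl i) (normSqPlus bp bm * p)) =
      normSqPlus bp bm * pderiv (Sum.inl i) (pderiv (Sum.inl i) p) +
        (4 * (X (Sum.inl i) * pderiv (Sum.inl i) p) + 2 * p) := by
    intro i
    have h2 : pderiv (Sum.inl i : Fin bp ⊕ Fin bm) (2 : Poly bp bm) = 0 := by
      rw [← map_ofNat C 2, pderiv_C]
    simp only [pderiv_mul, map_add, pderiv_normSqPlus, pderiv_X_self, h2]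
    ring
  rw [laplacianPlus, Finset.sum_congr rfl fun i _ => h1 i, Finset.sum_add_distrib,
    Finset.sum_add_distrib, ← Finset.mul_sum, ← Finset.mul_sum, sum_X_mul_pderiv hp, laplacianPlus,
    Finset.sum_const, Finset.card_univ, Fintype.card_fin, add_smul, mul_smul, mul_smul]
  congr 1
  rw [show (4 : Poly bp bm) = C 4 from (map_ofNat C 4).symm,
    show (2 : Poly bp bm) = C 2 from (map_ofNat C 2).symm, ← smul_eq_C_mul, ← smul_eq_C_mul,
    smul_comm bp, Nat.cast_smul_eq_nsmul ℂ bp]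

lemma laplacianPlus_normSqPlus_pow_mul {k l : ℕ} {p : Poly bp bm}
    (hp : p ∈ bihomogeneous bp bm k l) (j : ℕ) :
    laplacianPlus (normSqPlus bp bm ^ (j + 1) * p) =
      normSqPlus bp bm ^ (j + 1) * laplacianPlus p +
        (4 * (j + 1) * (k + bp / 2 + j) : ℂ) • (normSqPlus bp bm ^ j * p) := by
  induction j with
  | zero =>
    rw [zero_add, pow_one, laplacianPlus_normSqPlus_mul hp, pow_zero, one_mul]
    congr 2
    push_cast
    ring
  | succ j ih =>
    have hmem : normSqPlus bp bm ^ (j + 1) * p ∈ bihomogeneous bp bm (2 * (j + 1) + k) (0 + l) :=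
      mul_mem_bihomogeneous (normSqPlus_pow_mem _) hp
    rw [pow_succ' _ (j + 1), mul_assoc, laplacianPlus_normSqPlus_mul hmem, ih, mul_add, ← mul_assoc,
      mul_smul_comm, ← mul_assoc, ← pow_succ' _ j, add_assoc, ← add_smul]
    congr 2
    push_cast
    ring

/-- The coefficients of the harmonic projection. -/
def harmonicCoeff (bp k j : ℕ) : ℝ :=
  (-1) ^ j * Real.Gamma (bp / 2 + k - j - 1) / (4 ^ j * j.factorial * Real.Gamma (bp / 2 + k - 1))

lemma harmonicProj_eq (k : ℕ) (p : Poly bp bm) : harmonicProj k p =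
    ∑ j ∈ Finset.range (k / 2 + 1),
      (harmonicCoeff bp k j : ℂ) • (normSqPlus bp bm ^ j * laplacianPlus^[j] p) := by
  refine Finset.sum_congr rfl fun j _ => ?_
  rw [smul_eq_C_mul, mul_assoc]
  rfl

lemma harmonicCoeff_zero {k : ℕ} (h : 0 < (bp : ℝ) / 2 + k - 1) : harmonicCoeff bp k 0 = 1 := by
  have : Real.Gamma (bp / 2 + k - 1) ≠ 0 := (Real.Gamma_pos_of_pos h).ne'
  simp [harmonicCoeff, this]

lemma harmonicCoeff_succ {k j : ℕ} (hb : 0 < bp) (hj : 2 * j + 2 ≤ k) :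
    harmonicCoeff bp k (j + 1) * (4 * (j + 1) * (bp / 2 + k - j - 2)) = -harmonicCoeff bp k j := by
  have hj' : 2 * (j : ℝ) + 2 ≤ k := by exact_mod_cast hj
  have hb' : (0 : ℝ) < bp := by exact_mod_cast hb
  have h0 : (0 : ℝ) ≤ j := j.cast_nonneg
  have hx : (0 : ℝ) < bp / 2 + k - j - 2 := by linarith
  have h1 := Real.Gamma_add_one hx.ne'
  rw [show (bp / 2 + k - j - 2 + 1 : ℝ) = bp / 2 + k - j - 1 by ring] at h1
  have h2 : Real.Gamma (bp / 2 + k - 1) ≠ 0 := (Real.Gamma_pos_of_pos (by linarith)).ne'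
  rw [harmonicCoeff, harmonicCoeff, h1]
  have h3 : (bp / 2 + k - (j + 1 : ℕ) - 1 : ℝ) = bp / 2 + k - j - 2 := by push_cast; ring
  rw [h3, Nat.factorial_succ]
  have h4 : (j.factorial : ℝ) ≠ 0 := by exact_mod_cast j.factorial_ne_zero
  have h5 : (j + 1 : ℝ) ≠ 0 := by positivity
  push_cast
  field_simp
  ring

lemma harmonicProj_summand_mem {k j : ℕ} {p : Poly bp bm} (hp : p ∈ bihomogeneous bp bm k 0)
    (hj : 2 * j ≤ k) : laplacianPlus^[j] p ∈ bihomogeneous bp bm (k - 2 * j) 0 :=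
  laplacianPlus_iterate_mem j (by rwa [Nat.sub_add_cancel hj])

lemma harmonicProj_mem {k : ℕ} {p : Poly bp bm} (hp : p ∈ bihomogeneous bp bm k 0) :
    harmonicProj k p ∈ bihomogeneous bp bm k 0 := by
  rw [harmonicProj_eq]
  refine Submodule.sum_mem _ fun j hj => Submodule.smul_mem _ _ ?_
  rw [Finset.mem_range] at hj
  have h := mul_mem_bihomogeneous (normSqPlus_pow_mem j)
    (harmonicProj_summand_mem (j := j) hp (by omega))
  rwa [show 2 * j + (k - 2 * j) = k by omega] at h

/-- The harmonic projection is harmonic: consecutive terms cancel. -/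
theorem laplacianPlus_harmonicProj {k : ℕ} (hb : 0 < bp) {p : Poly bp bm}
    (hp : p ∈ bihomogeneous bp bm k 0) : laplacianPlus (harmonicProj k p) = 0 := by
  have hadd : ∀ (s : Finset ℕ) (c : ℕ → ℂ) (f : ℕ → Poly bp bm),
      laplacianPlus (∑ j ∈ s, c j • f j) = ∑ j ∈ s, c j • laplacianPlus (f j) := by
    intro s c f
    simp only [laplacianPlus, map_sum, Derivation.map_smul, Finset.smul_sum]
    exact Finset.sum_comm
  rw [harmonicProj_eq, hadd, Finset.sum_range_succ']
  have h1 : ∀ j ∈ Finset.range (k / 2), (harmonicCoeff bp k (j + 1) : ℂ) •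
      laplacianPlus (normSqPlus bp bm ^ (j + 1) * laplacianPlus^[j + 1] p) =
      (harmonicCoeff bp k (j + 1) : ℂ) •
        (normSqPlus bp bm ^ (j + 1) * laplacianPlus^[j + 2] p) -
      (harmonicCoeff bp k j : ℂ) • (normSqPlus bp bm ^ j * laplacianPlus^[j + 1] p) := by
    intro j hj
    rw [Finset.mem_range] at hj
    have hmem := harmonicProj_summand_mem (j := j + 1) hp (by omega)
    rw [laplacianPlus_normSqPlus_pow_mul hmem, smul_add, smul_smul,
      ← Function.iterate_succ_apply' laplacianPlus]
    have h2 := harmonicCoeff_succ (bp := bp) (k := k) (j := j) hb (by omega)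
    have h3 : ((k - 2 * (j + 1) : ℕ) : ℝ) = k - 2 * (j + 1) := by
      rw [Nat.cast_sub (by omega)]
      push_cast
      ring
    have h4 : (harmonicCoeff bp k (j + 1) : ℂ) *
        (4 * (j + 1) * (((k - 2 * (j + 1) : ℕ) : ℂ) + bp / 2 + j)) = -(harmonicCoeff bp k j : ℂ) := by
      rw [← Complex.ofReal_neg, ← h2]
      rw [show ((k - 2 * (j + 1) : ℕ) : ℂ) = ((k - 2 * (j + 1) : ℕ) : ℝ) by norm_cast, h3]
      push_cast
      ring
    rw [h4, _root_.neg_smul, sub_eq_add_neg]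
  rw [Finset.sum_congr rfl h1, pow_zero, one_mul, Function.iterate_zero, id,
    Finset.sum_range_sub (fun j => (harmonicCoeff bp k j : ℂ) •
      (normSqPlus bp bm ^ j * laplacianPlus^[j + 1] p))]
  have h5 : laplacianPlus^[k / 2 + 1] p = 0 := by
    rw [Function.iterate_succ_apply']
    exact laplacianPlus_eq_zero (k := k - 2 * (k / 2)) (by omega)
      (harmonicProj_summand_mem hp (by omega))
  rw [h5]
  simp

/-- A homogeneous polynomial differs from its harmonic projection by a multiple of `‖x⁺‖²`. -/
lemma exists_sub_harmonicProj {k : ℕ} (h : 0 < (bp : ℝ) / 2 + k - 1) {p : Poly bp bm}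
    (hp : p ∈ bihomogeneous bp bm k 0) :
    p = harmonicProj k p ∨ ∃ k', k = k' + 2 ∧ ∃ r ∈ bihomogeneous bp bm k' 0,
      p = harmonicProj k p + normSqPlus bp bm * r := by
  rcases Nat.lt_or_ge k 2 with hk | hk
  · left
    have h0 : k / 2 = 0 := by omega
    rw [harmonicProj_eq, h0, zero_add, Finset.sum_range_one, harmonicCoeff_zero h]
    simp
  · right
    refine ⟨k - 2, by omega, -∑ j ∈ Finset.range (k / 2), (harmonicCoeff bp k (j + 1) : ℂ) •
      (normSqPlus bp bm ^ j * laplacianPlus^[j + 1] p), ?_, ?_⟩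
    · refine Submodule.neg_mem _ (Submodule.sum_mem _ fun j hj => Submodule.smul_mem _ _ ?_)
      rw [Finset.mem_range] at hj
      have h := mul_mem_bihomogeneous (normSqPlus_pow_mem j)
        (harmonicProj_summand_mem (j := j + 1) hp (by omega))
      rwa [show 2 * j + (k - 2 * (j + 1)) = k - 2 by omega] at h
    · rw [harmonicProj_eq, Finset.sum_range_succ', harmonicCoeff_zero h, mul_neg, Finset.mul_sum]
      simp only [mul_smul_comm, ← mul_assoc, ← pow_succ']
      simp

end Harmonic

/-! ### Raising theta functions -/

section Heat

open MvPolynomial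

variable {bp bm : ℕ}

lemma evalAt_add (p r : Poly bp bm) (v : V bp bm) : evalAt (p + r) v = evalAt p v + evalAt r v :=
  map_add _ _ _

lemma evalAt_mul (p r : Poly bp bm) (v : V bp bm) : evalAt (p * r) v = evalAt p v * evalAt r v :=
  map_mul _ _ _

lemma evalAt_smul (a : ℂ) (p : Poly bp bm) (v : V bp bm) : evalAt (a • p) v = a * evalAt p v :=
  MvPolynomial.smul_eval _ _ _

lemma evalAt_normSqPlus (v : V bp bm) : evalAt (normSqPlus bp bm) v = sqPlus v := by
  simp [evalAt, normSqPlus, sqPlus]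

lemma pderiv_laplacianLin_pow (i : Fin bp ⊕ Fin bm) (j : ℕ) (p : Poly bp bm) :
    pderiv i ((laplacianLin bp bm ^ j) p) = (laplacianLin bp bm ^ j) (pderiv i p) := by
  induction j with
  | zero => simp
  | succ j ih =>
    rw [pow_succ', Module.End.mul_apply, Module.End.mul_apply, pderiv_laplacianLin, ih]

lemma pderiv_expLaplacian (t : ℝ) (i : Fin bp ⊕ Fin bm) (p : Poly bp bm) :
    pderiv i (expLaplacian t p) = expLaplacian t (pderiv i p) := by
  set N := p.totalDegree + (pderiv i p).totalDegree + 1 with hN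
  rw [expLaplacian_eq (N := N) (by omega), expLaplacian_eq (N := N) (by omega)]
  simp only [heatTrunc, map_sum, Derivation.map_smul, pderiv_laplacianLin_pow]

/-- The commutator of the heat operator with multiplication by `‖x⁺‖²`. -/
lemma expLaplacian_normSqPlus_mul (t : ℝ) {k l : ℕ} {r : Poly bp bm}
    (hr : r ∈ bihomogeneous bp bm k l) : expLaplacian t (normSqPlus bp bm * r) =
      normSqPlus bp bm * expLaplacian t r + (4 * t * k + 2 * t * bp : ℂ) • expLaplacian t r -
        (4 * t ^ 2 : ℂ) • expLaplacian t (laplacianPlus r) := by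
  set u := expLaplacian t r with hu
  have hD : expLaplacian t (laplacianPlus r) =
      ∑ i : Fin bp, pderiv (Sum.inl i) (pderiv (Sum.inl i) u) := by
    rw [laplacianPlus, expLaplacian_sum]
    simp only [hu, pderiv_expLaplacian]
  have hE : (k : ℂ) • u = ∑ i : Fin bp, X (Sum.inl i) * pderiv (Sum.inl i) u +
      (2 * t : ℂ) • ∑ i : Fin bp, pderiv (Sum.inl i) (pderiv (Sum.inl i) u) := by
    rw [hu, ← expLaplacian_smul, ← sum_X_mul_pderiv hr, expLaplacian_sum, Finset.smul_sum,
      ← Finset.sum_add_distrib]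
    refine Finset.sum_congr rfl fun i _ => ?_
    rw [expLaplacian_X_mul, pderiv_expLaplacian, pderiv_expLaplacian, pderiv_expLaplacian]
  have hX : ∀ i : Fin bp, expLaplacian t (X (Sum.inl i) ^ 2 * r) =
      X (Sum.inl i) ^ 2 * u + ((4 * t : ℂ) • (X (Sum.inl i) * pderiv (Sum.inl i) u) +
        ((2 * t : ℂ) • u + (4 * t ^ 2 : ℂ) • pderiv (Sum.inl i) (pderiv (Sum.inl i) u))) := by
    intro i
    rw [pow_two, mul_assoc, expLaplacian_X_mul, expLaplacian_X_mul, map_add, Derivation.map_smul,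
      pderiv_mul, pderiv_X_self, ← hu]
    simp only [smul_eq_C_mul, map_mul, map_pow, map_ofNat]
    ring
  rw [normSqPlus, Finset.sum_mul, expLaplacian_sum, Finset.sum_congr rfl fun i _ => hX i]
  simp only [Finset.sum_add_distrib, ← Finset.smul_sum]
  have hE' : ∑ i : Fin bp, X (Sum.inl i) * pderiv (Sum.inl i) u = (k : ℂ) • u -
      (2 * t : ℂ) • ∑ i : Fin bp, pderiv (Sum.inl i) (pderiv (Sum.inl i) u) := by
    rw [hE, add_sub_cancel_right]
  rw [hD, hE', ← Finset.sum_mul, Finset.sum_const, Finset.card_univ, Fintype.card_fin,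
    ← Nat.cast_smul_eq_nsmul ℂ bp]
  simp only [smul_eq_C_mul, map_mul, map_add, map_pow, map_ofNat]
  ring

lemma hasDerivAt_evalAt_expLaplacian (p : Poly bp bm) (v : V bp bm) (t : ℝ) :
    HasDerivAt (fun t : ℝ => evalAt (expLaplacian t p) v)
      (evalAt (expLaplacian t (laplacian p)) v) t := by
  set N := p.totalDegree + (laplacian p).totalDegree + 1 with hN
  have h1 : ∀ t : ℝ, evalAt (expLaplacian t p) v = ∑ j ∈ Finset.range (N + 1),
      (t ^ j / j.factorial : ℂ) * evalAt ((laplacianLin bp bm ^ j) p) v := by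
    intro t
    rw [expLaplacian_eq (N := N + 1) (by omega), heatTrunc, evalAt, map_sum]
    exact Finset.sum_congr rfl fun j _ => evalAt_smul _ _ _
  have h2 : evalAt (expLaplacian t (laplacian p)) v = ∑ j ∈ Finset.range N,
      (t ^ j / j.factorial : ℂ) * evalAt ((laplacianLin bp bm ^ (j + 1)) p) v := by
    rw [expLaplacian_eq (N := N) (by omega), heatTrunc, evalAt, map_sum]
    refine Finset.sum_congr rfl fun j _ => ?_
    rw [pow_succ, Module.End.mul_apply, laplacianLin_apply]
    exact evalAt_smul _ _ _
  simp only [h1]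
  rw [h2]
  have h3 : ∀ j ∈ Finset.range (N + 1), HasDerivAt (fun t : ℝ =>
      ((t : ℂ) ^ j / j.factorial : ℂ) * evalAt ((laplacianLin bp bm ^ j) p) v)
      ((j * (t : ℂ) ^ (j - 1) / j.factorial : ℂ) * evalAt ((laplacianLin bp bm ^ j) p) v) t := by
    intro j _
    exact (((hasDerivAt_pow j (t : ℂ)).comp_ofReal).div_const _).mul_const _
  refine (HasDerivAt.fun_sum h3).congr_deriv ?_
  rw [Finset.sum_range_succ']
  simp only [Nat.cast_zero, zero_mul, zero_div, add_zero, Nat.add_sub_cancel]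
  refine Finset.sum_congr rfl fun j _ => ?_
  rw [Nat.factorial_succ]
  have h4 : (j.factorial : ℂ) ≠ 0 := by exact_mod_cast j.factorial_ne_zero
  have h5 : ((j + 1 : ℕ) : ℂ) ≠ 0 := by exact_mod_cast j.succ_ne_zero
  push_cast at h5 ⊢
  field_simp

/-- The kernel `exp(-Δ / 8πy) p`. -/
def polyKernel (p : Poly bp bm) (y : ℝ) (v : V bp bm) : ℂ :=
  evalAt (expLaplacian (-1 / (8 * Real.pi * y)) p) v

/-- The kernel of the theta function of a polynomial. -/
def thetaK (p : Poly bp bm) (y : ℝ) (v : V bp bm) : ℂ :=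
  ((y ^ ((bm : ℝ) / 2) : ℝ) : ℂ) * polyKernel p y v

/-- The derivative of `thetaK p` with respect to `y`. -/
def thetaKDeriv (p : Poly bp bm) (y : ℝ) (v : V bp bm) : ℂ :=
  (((bm : ℝ) / 2 * y ^ ((bm : ℝ) / 2 - 1) : ℝ) : ℂ) * polyKernel p y v +
    ((y ^ ((bm : ℝ) / 2) : ℝ) : ℂ) *
      (((1 / (8 * Real.pi * y ^ 2) : ℝ) : ℂ) * polyKernel (laplacian p) y v)

lemma moderateGrowth_polyKernel (p : Poly bp bm) : ModerateGrowth (polyKernel p) := by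
  have h : ModerateGrowth fun (y : ℝ) (v : V bp bm) =>
      ∑ j ∈ Finset.range (p.totalDegree + 1),
        (((-1 / (8 * Real.pi)) ^ j / j.factorial : ℝ) : ℂ) * ((y ^ (-(j : ℝ)) : ℝ) : ℂ) *
          evalAt (laplacian^[j] p) v :=
    .sum fun j _ => ((ModerateGrowth.const _).mul (.rpow _)).mul
      (.of_polyGrowth (PolyGrowth.evalAt _))
  refine h.congr fun y hy v => ?_
  rw [polyKernel, expLaplacian, evalAt, map_sum]
  refine Finset.sum_congr rfl fun j _ => ?_
  rw [map_mul, eval_C, Real.rpow_neg hy.le, Real.rpow_natCast, ← Complex.ofReal_mul]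
  congr 2
  have := hy.ne'
  have := Real.pi_ne_zero
  rw [div_pow, div_pow, mul_pow (8 * Real.pi)]
  field_simp

lemma kernelHasDeriv_polyKernel (p : Poly bp bm) : KernelHasDeriv (polyKernel p)
    (fun y v => ((1 / (8 * Real.pi * y ^ 2) : ℝ) : ℂ) * polyKernel (laplacian p) y v) := by
  refine ⟨moderateGrowth_polyKernel p, ?_, fun y hy v => ?_⟩
  · refine (((ModerateGrowth.const ((1 / (8 * Real.pi) : ℝ) : ℂ)).mul (.rpow (-2))).mul
      (moderateGrowth_polyKernel (laplacian p))).congr fun y hy v => ?_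
    rw [Real.rpow_neg hy.le, Real.rpow_two, ← Complex.ofReal_mul]
    congr 2
    have := hy.ne'
    have := Real.pi_ne_zero
    field_simp
  · have h1 : HasDerivAt (fun y : ℝ => -1 / (8 * Real.pi * y)) (1 / (8 * Real.pi * y ^ 2)) y := by
      have h2 := ((hasDerivAt_inv hy.ne').const_mul (-1 / (8 * Real.pi)))
      have h3 : (fun y : ℝ => -1 / (8 * Real.pi * y)) = fun y => -1 / (8 * Real.pi) * y⁻¹ := by
        funext y
        rw [div_mul_eq_div_div, div_eq_mul_inv _ y]
      rw [h3]
      refine h2.congr_deriv ?_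
      have := hy.ne'
      have := Real.pi_ne_zero
      field_simp
    have h4 := (hasDerivAt_evalAt_expLaplacian p v (-1 / (8 * Real.pi * y))).scomp y h1
    refine h4.congr_deriv ?_
    rw [Complex.real_smul]
    rfl

lemma kernelHasDeriv_thetaK (p : Poly bp bm) : KernelHasDeriv (thetaK p) (thetaKDeriv p) :=
  (KernelHasDeriv.rpow _).mul (kernelHasDeriv_polyKernel p)

lemma polyKernel_add (p r : Poly bp bm) (y : ℝ) (v : V bp bm) :
    polyKernel (p + r) y v = polyKernel p y v + polyKernel r y v := by
  rw [polyKernel, expLaplacian_add, evalAt_add]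
  rfl

lemma polyKernel_smul (a : ℂ) (p : Poly bp bm) (y : ℝ) (v : V bp bm) :
    polyKernel (a • p) y v = a * polyKernel p y v := by
  rw [polyKernel, expLaplacian_smul, evalAt_smul]
  rfl

lemma polyKernel_normSqPlus_mul {k l : ℕ} {r : Poly bp bm} (hr : r ∈ bihomogeneous bp bm k l)
    {y : ℝ} (hy : 0 < y) (v : V bp bm) : polyKernel (normSqPlus bp bm * r) y v =
      (sqPlus v - ((k + bp / 2) / (2 * Real.pi * y) : ℝ)) * polyKernel r y v -
        ((1 / (16 * Real.pi ^ 2 * y ^ 2) : ℝ) : ℂ) * polyKernel (laplacianPlus r) y v := by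
  rw [polyKernel, expLaplacian_normSqPlus_mul _ hr, sub_eq_add_neg, evalAt_add, evalAt_add,
    evalAt_mul, evalAt_normSqPlus, evalAt_smul, ← _root_.neg_smul, evalAt_smul]
  have h1 : (y : ℂ) ≠ 0 := by exact_mod_cast hy.ne'
  have h2 : (Real.pi : ℂ) ≠ 0 := by exact_mod_cast Real.pi_ne_zero
  rw [polyKernel, polyKernel]
  push_cast
  field_simp
  ring

/-- The raising operator maps the theta function of `r` to that of `-2π ‖x⁺‖² r`. -/
lemma raiseKernel_thetaK {k : ℕ} {r : Poly bp bm} (hr : r ∈ bihomogeneous bp bm k 0) {y : ℝ}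
    (hy : 0 < y) (v : V bp bm) :
    raiseKernel (((twoWeight bp bm (k + 2) : ℤ) : ℝ) / 2 - 2) (thetaK r) (thetaKDeriv r) y v =
      (-2 * Real.pi : ℂ) * thetaK (normSqPlus bp bm * r) y v := by
  rw [raiseKernel, thetaK, thetaK, thetaKDeriv, polyKernel_normSqPlus_mul hr hy,
    laplacian_eq_laplacianPlus hr, Real.rpow_sub_one hy.ne', twoWeight]
  have h1 : (y : ℂ) ≠ 0 := by exact_mod_cast hy.ne'
  have h2 : (Real.pi : ℂ) ≠ 0 := by exact_mod_cast Real.pi_ne_zero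
  push_cast
  field_simp
  ring

end Heat

section Theta

variable {W : Type*} [AddCommGroup W] [Module ℝ W] {q : QuadraticForm ℝ W} {L : AddSubgroup W}

lemma kernelVec_congr (u : q.IsometryEquiv (stdForm bp bm)) {κ μ : ℝ → V bp bm → ℂ}
    (h : ∀ y, 0 < y → ∀ v, κ y v = μ y v) : kernelVec u L κ = kernelVec u L μ := by
  funext τ γ
  exact tsum_congr fun x => by rw [h _ (show 0 < (τ : ℂ).im from τ.im_pos)]

lemma kernelVec_add (u : q.IsometryEquiv (stdForm bp bm)) (hL : IsEvenLattice q L)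
    {κ μ : ℝ → V bp bm → ℂ} (hκ : ModerateGrowth κ) (hμ : ModerateGrowth μ) :
    kernelVec u L (fun y v => κ y v + μ y v) = kernelVec u L κ + kernelVec u L μ := by
  funext τ γ
  simp only [kernelVec, kernelSeries, Pi.add_apply, add_mul]
  exact (hκ.summable_coset u hL τ.im_pos γ).tsum_add (hμ.summable_coset u hL τ.im_pos γ)

lemma kernelVec_const_mul (u : q.IsometryEquiv (stdForm bp bm)) (a : ℂ) (κ : ℝ → V bp bm → ℂ) :
    kernelVec u L (fun y v => a * κ y v) = fun τ => a • kernelVec u L κ τ := by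
  funext τ γ
  simp only [kernelVec, kernelSeries, Pi.smul_apply, smul_eq_mul, mul_assoc, tsum_mul_left]

lemma kernelVec_im_mul (u : q.IsometryEquiv (stdForm bp bm)) (f : ℝ → ℂ) (κ : ℝ → V bp bm → ℂ) :
    kernelVec u L (fun y v => f y * κ y v) = fun τ : ℍ => f τ.im • kernelVec u L κ τ := by
  funext τ γ
  simp only [kernelVec, kernelSeries, Pi.smul_apply, smul_eq_mul, mul_assoc, tsum_mul_left, coe_im]

lemma thetaVec_eq_kernelVec (u : q.IsometryEquiv (stdForm bp bm)) (p : Poly bp bm) :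
    thetaVec u L p = kernelVec u L (thetaK p) := by
  funext τ γ
  simp only [thetaVec, thetaSeries, kernelVec, kernelSeries, thetaKernel, thetaK, polyKernel,
    mul_assoc, tsum_mul_left, coe_im]

lemma isModular_thetaK (u : q.IsometryEquiv (stdForm bp bm)) (hL : IsEvenLattice q L)
    {k : ℕ} {p : Poly bp bm} (hp : p ∈ bihomogeneous bp bm k 0) :
    IsModular q L ((bp : ℤ) - bm) (twoWeight bp bm k) (kernelVec u L (thetaK p)) := by
  intro M τ
  have h := thetaVec_smul u hL hp M τ
  rw [← thetaVec_eq_kernelVec]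
  simpa using h

lemma petersson_kernelVec_add (u : q.IsometryEquiv (stdForm bp bm)) (hL : IsEvenLattice q L)
    {m : ℝ} (hm : 0 < m) {β : Discr q L} (hmβ : e (m : ℂ) = e (q (rep β) : ℝ)) {w : ℤ}
    (hw : 4 < w) {κ κ' μ μ' : ℝ → V bp bm → ℂ} (hκ : KernelHasDeriv κ κ')
    (hμ : KernelHasDeriv μ μ') :
    petersson w (poincare q L ((bp : ℤ) - bm) w m β) (kernelVec u L fun y v => κ y v + μ y v) =
      petersson w (poincare q L ((bp : ℤ) - bm) w m β) (kernelVec u L κ) +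
        petersson w (poincare q L ((bp : ℤ) - bm) w m β) (kernelVec u L μ) := by
  have := finite_discr u hL
  have := Fintype.ofFinite (Discr q L)
  rw [petersson, petersson, petersson,
    ← integral_add (integrableOn_peterssonIntegrand u hL hm hmβ hw hκ).2
      (integrableOn_peterssonIntegrand u hL hm hmβ hw hμ).2, kernelVec_add u hL hκ.1 hμ.1]
  congr 1
  funext τ
  simp only [peterssonIntegrand, innerL_eq, Pi.add_apply, map_add, mul_add, Finset.sum_add_distrib,
    add_mul]

lemma petersson_kernelVec_const_mul (u : q.IsometryEquiv (stdForm bp bm)) (hL : IsEvenLattice q L)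
    (w : ℤ) (P : ℍ → GroupRing q L) (a : ℂ) (κ : ℝ → V bp bm → ℂ) :
    petersson w P (kernelVec u L fun y v => a * κ y v) = conj a * petersson w P (kernelVec u L κ) := by
  rw [petersson, petersson, ← integral_const_mul, kernelVec_const_mul]
  congr 1
  funext τ
  rw [peterssonIntegrand, peterssonIntegrand, innerL_smul_right u hL, mul_assoc]

/-- The theta lift of `‖x⁺‖² r` vanishes, because its theta function lies in the image of the raising
operator. -/
theorem petersson_normSqPlus_mul (u : q.IsometryEquiv (stdForm bp bm)) (hL : IsEvenLattice q L)
    {m : ℝ} (hm : 0 < m) {β : Discr q L} (hmβ : e (m : ℂ) = e (q (rep β) : ℝ)) {k : ℕ}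
    (hw : 4 < twoWeight bp bm (k + 2)) {r : Poly bp bm} (hr : r ∈ bihomogeneous bp bm k 0) :
    petersson (twoWeight bp bm (k + 2))
      (poincare q L ((bp : ℤ) - bm) (twoWeight bp bm (k + 2)) m β)
      (kernelVec u L (thetaK (normSqPlus bp bm * r))) = 0 := by
  have hw4 : twoWeight bp bm (k + 2) - 4 = twoWeight bp bm k := by
    simp only [twoWeight]
    push_cast
    ring
  have hR := ((KernelHasDeriv.const (bp := bp) (bm := bm) (-2 * Real.pi : ℂ)).mul
    (kernelHasDeriv_thetaK (normSqPlus bp bm * r))).congr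
    (fun y hy v => raiseKernel_thetaK hr hy v) (fun _ _ _ => rfl)
  have h := petersson_raise_eq_zero u hL hm hmβ hw (kernelHasDeriv_thetaK r) hR
    (by rw [hw4]; exact isModular_thetaK u hL hr)
  rw [kernelVec_congr u fun y hy v => raiseKernel_thetaK hr hy v,
    petersson_kernelVec_const_mul u hL] at h
  refine (mul_eq_zero.mp h).resolve_left ?_
  rw [map_eq_zero]
  simp [Real.pi_ne_zero]

/-- The theta lift depends only on the harmonic projection. -/
theorem petersson_harmonicProj (u : q.IsometryEquiv (stdForm bp bm)) (hL : IsEvenLattice q L)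
    {m : ℝ} (hm : 0 < m) {β : Discr q L} (hmβ : e (m : ℂ) = e (q (rep β) : ℝ)) {k : ℕ}
    (hw : 4 < twoWeight bp bm k) (hk : 0 < (bp : ℝ) / 2 + k - 1) {p : Poly bp bm}
    (hp : p ∈ bihomogeneous bp bm k 0) :
    petersson (twoWeight bp bm k) (poincare q L ((bp : ℤ) - bm) (twoWeight bp bm k) m β)
      (kernelVec u L (thetaK p)) =
    petersson (twoWeight bp bm k) (poincare q L ((bp : ℤ) - bm) (twoWeight bp bm k) m β)
      (kernelVec u L (thetaK (harmonicProj k p))) := by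
  rcases exists_sub_harmonicProj hk hp with h | ⟨k', rfl, r, hr, h⟩
  · rw [← h]
  · have h1 : kernelVec u L (thetaK p) = kernelVec u L fun y v =>
        thetaK (harmonicProj (k' + 2) p) y v + thetaK (normSqPlus bp bm * r) y v := by
      refine kernelVec_congr u fun y _ v => ?_
      conv_lhs => rw [h]
      simp only [thetaK, polyKernel_add, mul_add]
    rw [h1, petersson_kernelVec_add u hL hm hmβ hw (kernelHasDeriv_thetaK _)
      (kernelHasDeriv_thetaK _), petersson_normSqPlus_mul u hL hm hmβ hw hr, add_zero]

end Theta

/-! ### The lift in positive degree -/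

section Evaluate

lemma integral_exp_mul_rpow {a c : ℝ} (ha : 0 < a) (hc : 0 < c) :
    IntegrableOn (fun y : ℝ => Real.exp (-(c * y)) * y ^ (a - 1)) (Set.Ioi 0) ∧
      ∫ y in Set.Ioi (0 : ℝ), Real.exp (-(c * y)) * y ^ (a - 1) = Real.Gamma a / c ^ a := by
  constructor
  · refine (integrableOn_rpow_mul_exp_neg_mul_rpow (p := 1) (s := a - 1) (b := c) (by linarith)
      one_pos hc).congr_fun (fun y _ => ?_) measurableSet_Ioi
    simp only [Real.rpow_one, neg_mul]
    rw [mul_comm]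
  · have h := Real.integral_rpow_mul_exp_neg_mul_Ioi ha hc
    simp only [mul_comm (Real.exp _)]
    rw [h, one_div, Real.inv_rpow hc.le]
    ring

lemma evalAt_eq_sum (p : Poly bp bm) (v : V bp bm) : evalAt p v =
    ∑ d ∈ p.support, p.coeff d * ∏ i, (v i : ℂ) ^ d i := by
  rw [evalAt, MvPolynomial.eval_eq']

lemma evalAt_plusPart {k : ℕ} {p : Poly bp bm} (hp : p ∈ bihomogeneous bp bm k 0) (v : V bp bm) :
    evalAt p (plusPart v) = evalAt p v := by
  rw [mem_bihomogeneous_iff] at hp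
  rw [evalAt_eq_sum, evalAt_eq_sum]
  refine Finset.sum_congr rfl fun d hd => ?_
  congr 1
  refine Finset.prod_congr rfl fun i _ => ?_
  rcases i with i | j
  · rfl
  · have h := (Finset.sum_eq_zero_iff.mp (hp d hd).2) j (Finset.mem_univ j)
    rw [h, pow_zero, pow_zero]

lemma evalAt_zero_of_pos {k : ℕ} (hk : 0 < k) {p : Poly bp bm}
    (hp : p ∈ bihomogeneous bp bm k 0) : evalAt p 0 = 0 := by
  rw [mem_bihomogeneous_iff] at hp
  rw [evalAt_eq_sum]
  refine Finset.sum_eq_zero fun d hd => ?_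
  obtain ⟨i, -, hi⟩ := Finset.exists_ne_zero_of_sum_ne_zero (by rw [(hp d hd).1]; exact hk.ne')
  rw [Finset.prod_eq_zero (Finset.mem_univ (Sum.inl i)), mul_zero]
  rw [Pi.zero_apply, Complex.ofReal_zero, zero_pow hi]

lemma expLaplacian_of_harmonic {p : Poly bp bm} (h : laplacian p = 0) (t : ℝ) :
    expLaplacian t p = p := by
  have h0 : laplacian (0 : Poly bp bm) = 0 := by simp [laplacian]
  have h1 : ∀ j, laplacian^[j + 1] p = 0 := by
    intro j
    induction j with
    | zero => exact h
    | succ j ih => rw [Function.iterate_succ_apply', ih, h0]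
  rw [expLaplacian, Finset.sum_range_succ']
  simp [h1]

lemma thetaK_of_harmonic {p : Poly bp bm} (h : laplacian p = 0) (y : ℝ) (v : V bp bm) :
    thetaK p y v = ((y ^ ((bm : ℝ) / 2) : ℝ) : ℂ) * evalAt p v := by
  rw [thetaK, polyKernel, expLaplacian_of_harmonic h]

variable {W : Type*} [AddCommGroup W] [Module ℝ W] {q : QuadraticForm ℝ W} {L : AddSubgroup W}

lemma sqPlus_sub_sqMinus (u : q.IsometryEquiv (stdForm bp bm)) {β : Discr q L} {m : ℝ}
    (x : CosetOfNorm q L β m) : sqPlus (u (x.1 : W)) - sqMinus (u (x.1 : W)) = 2 * m := by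
  have h1 := stdForm_eq (u (x.1 : W))
  rw [u.map_app, x.2.2] at h1
  linarith

lemma sqPlus_pos (u : q.IsometryEquiv (stdForm bp bm)) {β : Discr q L} {m : ℝ} (hm : 0 < m)
    (x : CosetOfNorm q L β m) : 0 < sqPlus (u (x.1 : W)) := by
  have h1 := sqPlus_sub_sqMinus u x
  have h2 := sqMinus_nonneg (u (x.1 : W))
  linarith

/-- The exponent `k + bp / 2 - 1`. -/
def liftExp (bp k : ℕ) : ℝ := k + (bp : ℝ) / 2 - 1

lemma liftTerm_eq (k : ℕ) (v₀ : q.IsometryEquiv (stdForm bp bm)) {p : Poly bp bm}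
    (hp : p ∈ bihomogeneous bp bm k 0) (g : q.IsometryEquiv q) (x : W) :
    liftTerm k q v₀ p g x = conj (evalAt p ((g.symm.trans v₀) x)) /
      ((sqPlus ((g.symm.trans v₀) x) ^ liftExp bp k : ℝ) : ℂ) := by
  change conj (evalAt p (plusPart ((g.symm.trans v₀) x))) /
    (vnorm (plusPart ((g.symm.trans v₀) x)) : ℂ) ^ (2 * (k : ℤ) + bp - 2) = _
  rw [evalAt_plusPart hp, vnorm_plusPart, ← Complex.ofReal_zpow, ← Real.rpow_intCast,
    Real.sqrt_eq_rpow, ← Real.rpow_mul (sqPlus_nonneg _), liftExp]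
  congr 4
  push_cast
  ring

/-- The lift of a harmonic polynomial of positive degree. -/
theorem petersson_of_harmonic (u : q.IsometryEquiv (stdForm bp bm)) (hL : IsEvenLattice q L)
    {m : ℝ} (hm : 0 < m) {β : Discr q L} (hmβ : e (m : ℂ) = e (q (rep β) : ℝ)) {k : ℕ}
    (hk : 0 < k) (hw : 4 < twoWeight bp bm k) {p : Poly bp bm} (hp : p ∈ bihomogeneous bp bm k 0)
    (hharm : laplacian p = 0) (ha : 0 < liftExp bp k)
    (hS : Summable fun x : CosetOfNorm q L β m => conj (evalAt p (u (x.1 : W))) /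
      ((sqPlus (u (x.1 : W)) ^ liftExp bp k : ℝ) : ℂ)) :
    petersson (twoWeight bp bm k) (poincare q L ((bp : ℤ) - bm) (twoWeight bp bm k) m β)
      (kernelVec u L (thetaK p)) =
      ((2 * Real.Gamma (liftExp bp k) / (2 * Real.pi) ^ liftExp bp k : ℝ) : ℂ) *
        ∑' x : CosetOfNorm q L β m, conj (evalAt p (u (x.1 : W))) /
          ((sqPlus (u (x.1 : W)) ^ liftExp bp k : ℝ) : ℂ) := by
  set a := liftExp bp k with ha_def
  have hX := fun x : CosetOfNorm q L β m => sqPlus_pos u hm x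
  have hc : ∀ x : CosetOfNorm q L β m, 0 < 2 * Real.pi * sqPlus (u (x.1 : W)) := fun x =>
    mul_pos (by positivity) (hX x)
  have hker : ∀ x : CosetOfNorm q L β m, ∀ y ∈ Set.Ioi (0 : ℝ), thetaK p y (u (x.1 : W)) *
      ((Real.exp (-(2 * Real.pi * sqPlus (u (x.1 : W)) * y)) *
        y ^ (((twoWeight bp bm k : ℤ) : ℝ) / 2 - 2) : ℝ) : ℂ) =
      evalAt p (u (x.1 : W)) *
        ((Real.exp (-(2 * Real.pi * sqPlus (u (x.1 : W)) * y)) * y ^ (a - 1) : ℝ) : ℂ) := by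
    intro x y hy
    have h1 : y ^ (a - 1) = y ^ ((bm : ℝ) / 2) *
        y ^ (((twoWeight bp bm k : ℤ) : ℝ) / 2 - 2) := by
      rw [← Real.rpow_add hy, ha_def, liftExp, twoWeight]
      congr 1
      push_cast
      ring
    rw [thetaK_of_harmonic hharm, h1]
    push_cast
    ring
  have hint : ∀ x : CosetOfNorm q L β m, ∀ c : ℂ, ∫ y in Set.Ioi (0 : ℝ), c *
      ((Real.exp (-(2 * Real.pi * sqPlus (u (x.1 : W)) * y)) * y ^ (a - 1) : ℝ) : ℂ) =
      c * ((Real.Gamma a / (2 * Real.pi * sqPlus (u (x.1 : W))) ^ a : ℝ) : ℂ) := by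
    intro x c
    rw [integral_const_mul, integral_complex_ofReal, (integral_exp_mul_rpow ha (hc x)).2]
  have hval : ∀ x : CosetOfNorm q L β m, conj (evalAt p (u (x.1 : W)) *
      ((Real.Gamma a / (2 * Real.pi * sqPlus (u (x.1 : W))) ^ a : ℝ) : ℂ)) =
      ((Real.Gamma a / (2 * Real.pi) ^ a : ℝ) : ℂ) * (conj (evalAt p (u (x.1 : W))) /
        ((sqPlus (u (x.1 : W)) ^ a : ℝ) : ℂ)) := by
    intro x
    rw [map_mul, Complex.conj_ofReal, Real.mul_rpow (by positivity) (hX x).le]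
    push_cast
    ring
  rw [petersson_poincare_eq u hL hm hmβ hw (kernelHasDeriv_thetaK p)
    (fun y hy => by rw [thetaK_of_harmonic hharm, evalAt_zero_of_pos hk hp, mul_zero])
    (isModular_thetaK u hL hp)]
  · simp only [setIntegral_congr_fun measurableSet_Ioi (hker _), hint, hval]
    rw [tsum_mul_left]
    push_cast
    ring
  · intro x
    refine IntegrableOn.congr_fun ?_ (fun y hy => (hker x y hy).symm) measurableSet_Ioi
    exact (integral_exp_mul_rpow ha (hc x)).1.ofReal.const_mul _
  · refine (hS.norm.mul_left (Real.Gamma a / (2 * Real.pi) ^ a)).congr fun x => ?_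
    rw [setIntegral_congr_fun (g := fun y : ℝ => ‖evalAt p (u (x.1 : W))‖ *
      (Real.exp (-(2 * Real.pi * sqPlus (u (x.1 : W)) * y)) * y ^ (a - 1))) measurableSet_Ioi,
      integral_const_mul, (integral_exp_mul_rpow ha (hc x)).2,
      Real.mul_rpow (by positivity) (hX x).le, norm_div, Complex.norm_conj, Complex.norm_real,
      Real.norm_of_nonneg (Real.rpow_nonneg (hX x).le _)]
    · field_simp
    · intro y hy
      have hy : 0 < y := hy
      simp only [hker x y hy]
      rw [norm_mul, Complex.norm_real, Real.norm_of_nonneg (by positivity)]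

end Evaluate

/-! ### The lift in degree zero -/

section NormSqMinus

open MvPolynomial

variable {bp bm : ℕ}

/-- The polynomial `‖x⁻‖²`. -/
def normSqMinus (bp bm : ℕ) : Poly bp bm := ∑ j : Fin bm, X (Sum.inr j) ^ 2

lemma normSqMinus_mem : normSqMinus bp bm ∈ bihomogeneous bp bm 0 2 := by
  refine Submodule.sum_mem _ fun i _ => ?_
  have h := isWeightedHomogeneous_X ℂ
    (Sum.elim (fun _ : Fin bp => ((1, 0) : ℕ × ℕ)) (fun _ : Fin bm => ((0, 1) : ℕ × ℕ))) (Sum.inr i)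
  exact h.pow 2

lemma evalAt_normSqMinus (v : V bp bm) : evalAt (normSqMinus bp bm) v = sqMinus v := by
  simp [evalAt, normSqMinus, sqMinus]

lemma evalAt_one (v : V bp bm) : evalAt (1 : Poly bp bm) v = 1 := map_one _

lemma expLaplacian_normSqMinus (t : ℝ) : expLaplacian t (normSqMinus bp bm) =
    normSqMinus bp bm + (2 * t * bm : ℂ) • (1 : Poly bp bm) := by
  have hX : ∀ j : Fin bm, expLaplacian t (X (Sum.inr j) ^ 2 : Poly bp bm) =
      X (Sum.inr j) ^ 2 + (2 * t : ℂ) • 1 := by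
    intro j
    have h := expLaplacian_X_mul t (Sum.inr j : Fin bp ⊕ Fin bm) 1
    rw [expLaplacian_one, ← C_1, pderiv_C, smul_zero, add_zero, C_1, mul_one] at h
    rw [pow_two, expLaplacian_X_mul, h, pderiv_X_self]
  rw [normSqMinus, expLaplacian_sum, Finset.sum_congr rfl fun j _ => hX j, Finset.sum_add_distrib,
    Finset.sum_const, Finset.card_univ, Fintype.card_fin, ← Nat.cast_smul_eq_nsmul ℂ bm, smul_smul]
  congr 2
  ring

lemma laplacian_normSqMinus : laplacian (normSqMinus bp bm) = (2 * bm : ℂ) • (1 : Poly bp bm) := by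
  have h1 : ∀ j j' : Fin bm, pderiv (Sum.inr j) (pderiv (Sum.inr j)
      (X (Sum.inr j') ^ 2 : Poly bp bm)) = if j = j' then (2 : ℂ) • 1 else 0 := by
    intro j j'
    rw [Derivation.leibniz_pow]
    split_ifs with h
    · subst h
      have h2 : pderiv (Sum.inr j) (2 : Poly bp bm) = 0 := by rw [← map_ofNat C 2, pderiv_C]
      rw [pderiv_X_self]
      simp [Derivation.leibniz, nsmul_eq_mul, smul_eq_C_mul, h2]
      exact (map_ofNat C 2).symm
    · rw [pderiv_X_of_ne (by simpa using Ne.symm h)]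
      simp
  have h2 : ∀ (i : Fin bp) (j' : Fin bm), pderiv (Sum.inl i) (X (Sum.inr j') ^ 2 : Poly bp bm) =
      0 := by
    intro i j'
    rw [Derivation.leibniz_pow, pderiv_X_of_ne (by simp)]
    simp
  rw [laplacian, Fintype.sum_sum_type]
  simp only [normSqMinus, map_sum, h1, h2, map_zero, Finset.sum_const_zero, zero_add,
    Finset.sum_ite_eq, Finset.mem_univ, if_true]
  rw [Finset.sum_const, Finset.card_univ, Fintype.card_fin, ← Nat.cast_smul_eq_nsmul ℂ bm,
    smul_smul]
  congr 1
  ring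

lemma polyKernel_one (y : ℝ) (v : V bp bm) : polyKernel 1 y v = 1 := by
  rw [polyKernel, expLaplacian_one, evalAt_one]

lemma polyKernel_normSqMinus {y : ℝ} (hy : 0 < y) (v : V bp bm) :
    polyKernel (normSqMinus bp bm) y v = sqMinus v - ((bm / (4 * Real.pi * y) : ℝ) : ℂ) := by
  rw [polyKernel, expLaplacian_normSqMinus, evalAt_add, evalAt_smul, evalAt_one, evalAt_normSqMinus]
  have h1 : (y : ℂ) ≠ 0 := by exact_mod_cast hy.ne'
  have h2 : (Real.pi : ℂ) ≠ 0 := by exact_mod_cast Real.pi_ne_zero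
  push_cast
  field_simp
  ring

lemma polyKernel_normSqPlus_mul_normSqMinus {y : ℝ} (hy : 0 < y) (v : V bp bm) :
    polyKernel (normSqPlus bp bm * normSqMinus bp bm) y v =
      (sqPlus v - ((bp / (4 * Real.pi * y) : ℝ) : ℂ)) *
        (sqMinus v - ((bm / (4 * Real.pi * y) : ℝ) : ℂ)) := by
  have h0 : polyKernel (0 : Poly bp bm) y v = 0 := by
    rw [polyKernel, expLaplacian_zero]
    exact map_zero _
  rw [polyKernel_normSqPlus_mul normSqMinus_mem hy,
    laplacianPlus_eq_zero (by norm_num) normSqMinus_mem, h0, mul_zero, sub_zero,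
    polyKernel_normSqMinus hy]
  congr 3
  push_cast
  field_simp
  ring

/-- The kernel of `y² Θ(‖x⁻‖²)`, a form whose weight is lower by two than that of `Θ(1)`. -/
def minusKernel (y : ℝ) (v : V bp bm) : ℂ :=
  ((y ^ (2 : ℝ) : ℝ) : ℂ) * thetaK (normSqMinus bp bm) y v

/-- The derivative of `minusKernel` with respect to `y`. -/
def minusKernelDeriv (y : ℝ) (v : V bp bm) : ℂ :=
  ((2 * y ^ ((2 : ℝ) - 1) : ℝ) : ℂ) * thetaK (normSqMinus bp bm) y v +
    ((y ^ (2 : ℝ) : ℝ) : ℂ) * thetaKDeriv (normSqMinus bp bm) y v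

lemma kernelHasDeriv_minusKernel :
    KernelHasDeriv (minusKernel (bp := bp) (bm := bm)) minusKernelDeriv :=
  (KernelHasDeriv.rpow 2).mul (kernelHasDeriv_thetaK _)

/-- The kernel of the image of `y² Θ(‖x⁻‖²)` under the raising operator. -/
def raisedKernel (y : ℝ) (v : V bp bm) : ℂ :=
  (-2 * Real.pi : ℂ) * (((y ^ (2 : ℝ) : ℝ) : ℂ) *
    thetaK (normSqPlus bp bm * normSqMinus bp bm) y v) +
    ((bm / (4 * Real.pi) : ℝ) : ℂ) * thetaK 1 y v

lemma raisedKernel_eq {y : ℝ} (hy : 0 < y) (v : V bp bm) : raisedKernel y v =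
    ((y ^ ((bm : ℝ) / 2) : ℝ) : ℂ) * (-2 * Real.pi * y ^ 2 * sqPlus v * sqMinus v +
      bm / 2 * y * sqPlus v + bp / 2 * y * sqMinus v -
      bm / (4 * Real.pi) * (bp / 2 - 1)) := by
  rw [raisedKernel, thetaK, thetaK, polyKernel_one, polyKernel_normSqPlus_mul_normSqMinus hy,
    Real.rpow_two]
  have h1 : (y : ℂ) ≠ 0 := by exact_mod_cast hy.ne'
  have h2 : (Real.pi : ℂ) ≠ 0 := by exact_mod_cast Real.pi_ne_zero
  push_cast
  field_simp
  ring

lemma raiseKernel_minusKernel {y : ℝ} (hy : 0 < y) (v : V bp bm) :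
    raiseKernel (((twoWeight bp bm 0 : ℤ) : ℝ) / 2 - 2) minusKernel minusKernelDeriv y v =
      raisedKernel y v := by
  rw [raisedKernel_eq hy, raiseKernel, minusKernel, minusKernelDeriv, thetaKDeriv, thetaK,
    laplacian_normSqMinus, polyKernel_smul, polyKernel_one, polyKernel_normSqMinus hy,
    Real.rpow_sub_one hy.ne', Real.rpow_sub_one hy.ne', Real.rpow_two, twoWeight]
  have h1 : (y : ℂ) ≠ 0 := by exact_mod_cast hy.ne'
  have h2 : (Real.pi : ℂ) ≠ 0 := by exact_mod_cast Real.pi_ne_zero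
  push_cast
  field_simp
  ring

lemma kernelHasDeriv_raisedKernel : ∃ R', KernelHasDeriv (raisedKernel (bp := bp) (bm := bm)) R' :=
  ⟨_, ((KernelHasDeriv.const (-2 * Real.pi : ℂ)).mul
    ((KernelHasDeriv.rpow 2).mul (kernelHasDeriv_thetaK _))).add
    ((KernelHasDeriv.const ((bm / (4 * Real.pi) : ℝ) : ℂ)).mul (kernelHasDeriv_thetaK 1))⟩

lemma eq_smul_one {p : Poly bp bm} (hp : p ∈ bihomogeneous bp bm 0 0) :
    p = (p.coeff 0) • (1 : Poly bp bm) := by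
  rw [mem_bihomogeneous_iff] at hp
  ext d
  rw [coeff_smul, coeff_one, smul_eq_mul]
  split_ifs with h
  · rw [h, mul_one]
  · rw [mul_zero]
    by_contra hd
    have h1 := hp d (mem_support_iff.mpr hd)
    refine h (Finsupp.ext fun i => ?_).symm
    rcases i with i | j
    · exact (Finset.sum_eq_zero_iff.mp h1.1) i (Finset.mem_univ i)
    · exact (Finset.sum_eq_zero_iff.mp h1.2) j (Finset.mem_univ j)

end NormSqMinus

section DegreeZero

variable {bp bm : ℕ}

variable {W : Type*} [AddCommGroup W] [Module ℝ W] {q : QuadraticForm ℝ W} {L : AddSubgroup W}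

lemma IsModular.add {sig w : ℤ} {f g : ℍ → GroupRing q L} (hf : IsModular q L sig w f)
    (hg : IsModular q L sig w g) : IsModular q L sig w (f + g) := fun M τ => by
  rw [Pi.add_apply, Pi.add_apply, hf M τ, hg M τ, map_add, smul_add]

lemma IsModular.const_smul {sig w : ℤ} {f : ℍ → GroupRing q L} (hf : IsModular q L sig w f)
    (a : ℂ) : IsModular q L sig w fun τ => a • f τ := fun M τ => by
  simp only [hf M τ, map_smul]
  rw [smul_comm]

lemma isModular_sq_mul_thetaK (u : q.IsometryEquiv (stdForm bp bm)) (hL : IsEvenLattice q L)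
    {k : ℕ} {p : Poly bp bm} (hp : p ∈ bihomogeneous bp bm k 2) :
    IsModular q L ((bp : ℤ) - bm) (twoWeight bp bm k - 4)
      (kernelVec u L fun y v => ((y ^ (2 : ℝ) : ℝ) : ℂ) * thetaK p y v) := by
  intro M τ
  have h := thetaVec_smul u hL hp M τ
  rw [thetaVec_eq_kernelVec] at h
  rw [kernelVec_im_mul u (fun y => ((y ^ (2 : ℝ) : ℝ) : ℂ))]
  simp only [Real.rpow_two, Complex.ofReal_pow]
  exact h

lemma isModular_raisedKernel (u : q.IsometryEquiv (stdForm bp bm)) (hL : IsEvenLattice q L) :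
    IsModular q L ((bp : ℤ) - bm) (twoWeight bp bm 0) (kernelVec u L raisedKernel) := by
  have h1 := isModular_sq_mul_thetaK u hL (k := 2)
    (mul_mem_bihomogeneous (normSqPlus_mem (bp := bp) (bm := bm)) normSqMinus_mem)
  have hw : twoWeight bp bm 2 - 4 = twoWeight bp bm 0 := by
    simp only [twoWeight]
    push_cast
    ring
  rw [hw] at h1
  have h2 := (h1.const_smul (-2 * Real.pi)).add
    ((isModular_thetaK u hL one_mem_bihomogeneous).const_smul ((bm / (4 * Real.pi) : ℝ) : ℂ))
  rw [← kernelVec_const_mul, ← kernelVec_const_mul, ← kernelVec_add u hL] at h2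
  · exact h2
  · exact (ModerateGrowth.const _).mul ((ModerateGrowth.rpow 2).mul (kernelHasDeriv_thetaK _).1)
  · exact (ModerateGrowth.const _).mul (kernelHasDeriv_thetaK _).1

/-- The kernel of the theta function minus a multiple of a raised form, which removes the constant
term. -/
def reducedKernel (y : ℝ) (v : V bp bm) : ℂ :=
  thetaK 1 y v + ((4 * Real.pi / (bm * (bp / 2 - 1)) : ℝ) : ℂ) * raisedKernel y v

lemma reducedKernel_eq (hbm : 0 < bm) (ha : 0 < (bp : ℝ) / 2 - 1) {y : ℝ} (hy : 0 < y)
    (v : V bp bm) : reducedKernel y v =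
      ((4 * Real.pi / (bm * (bp / 2 - 1)) * (y ^ ((bm : ℝ) / 2) *
        (-(2 * Real.pi * sqPlus v * sqMinus v) * y ^ 2 +
          (bm / 2 * sqPlus v + bp / 2 * sqMinus v) * y)) : ℝ) : ℂ) := by
  rw [reducedKernel, raisedKernel_eq hy, thetaK, polyKernel_one]
  have h1 : (bm : ℂ) ≠ 0 := by exact_mod_cast hbm.ne'
  have h2 : (Real.pi : ℂ) ≠ 0 := by exact_mod_cast Real.pi_ne_zero
  have h3 : ((bp : ℂ) - 2) ≠ 0 := by
    have : ((bp : ℝ) - 2) ≠ 0 := by linarith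
    exact_mod_cast this
  push_cast
  field_simp
  ring

/-- The lift in degree zero. The theta function has a constant term, but it can be removed by adding
a form in the image of the raising operator, which is orthogonal to the Poincaré series. -/
theorem petersson_of_degree_zero (u : q.IsometryEquiv (stdForm bp bm)) (hL : IsEvenLattice q L)
    {m : ℝ} (hm : 0 < m) {β : Discr q L} (hmβ : e (m : ℂ) = e (q (rep β) : ℝ))
    (hw : 4 < twoWeight bp bm 0) (hbm : 0 < bm) {p : Poly bp bm}
    (hp : p ∈ bihomogeneous bp bm 0 0) (ha : 0 < liftExp bp 0)
    (hS : Summable fun x : CosetOfNorm q L β m => conj (evalAt p (u (x.1 : W))) /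
      ((sqPlus (u (x.1 : W)) ^ liftExp bp 0 : ℝ) : ℂ)) :
    petersson (twoWeight bp bm 0) (poincare q L ((bp : ℤ) - bm) (twoWeight bp bm 0) m β)
      (kernelVec u L (thetaK p)) =
      ((2 * Real.Gamma (liftExp bp 0) / (2 * Real.pi) ^ liftExp bp 0 : ℝ) : ℂ) *
        ∑' x : CosetOfNorm q L β m, conj (evalAt p (u (x.1 : W))) /
          ((sqPlus (u (x.1 : W)) ^ liftExp bp 0 : ℝ) : ℂ) := by
  set a := liftExp bp 0 with ha_def
  have haeq : a = (bp : ℝ) / 2 - 1 := by rw [ha_def, liftExp]; push_cast; ring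
  have ha2 : 0 < (bp : ℝ) / 2 - 1 := haeq ▸ ha
  have hbm' : (0 : ℝ) < bm := by exact_mod_cast hbm
  set a₀ : ℂ := p.coeff 0 with ha₀
  have hev : ∀ v : V bp bm, evalAt p v = a₀ := fun v => by
    conv_lhs => rw [eq_smul_one hp, evalAt_smul, evalAt_one, mul_one]
  obtain ⟨R', hR'⟩ := kernelHasDeriv_raisedKernel (bp := bp) (bm := bm)
  set c₀ : ℝ := 4 * Real.pi / (bm * (bp / 2 - 1)) with hc₀
  have hc₀pos : 0 < c₀ := by
    have := Real.pi_pos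
    positivity
  have hred : KernelHasDeriv (reducedKernel (bp := bp) (bm := bm)) _ :=
    (kernelHasDeriv_thetaK 1).add ((KernelHasDeriv.const (c₀ : ℂ)).mul hR')
  have hκ : KernelHasDeriv (fun y (v : V bp bm) => a₀ * reducedKernel y v) _ :=
    (KernelHasDeriv.const a₀).mul hred
  -- adding the raised form does not change the Petersson product
  have horth : petersson (twoWeight bp bm 0)
      (poincare q L ((bp : ℤ) - bm) (twoWeight bp bm 0) m β) (kernelVec u L raisedKernel) = 0 := by
    have hR'' := hR'.congr (fun y hy v => raiseKernel_minusKernel hy v) (fun _ _ _ => rfl)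
    have h := petersson_raise_eq_zero u hL hm hmβ hw kernelHasDeriv_minusKernel hR''
      (isModular_sq_mul_thetaK u hL normSqMinus_mem)
    rwa [kernelVec_congr u fun y hy v => raiseKernel_minusKernel hy v] at h
  have hP : petersson (twoWeight bp bm 0)
      (poincare q L ((bp : ℤ) - bm) (twoWeight bp bm 0) m β) (kernelVec u L (thetaK p)) =
      petersson (twoWeight bp bm 0) (poincare q L ((bp : ℤ) - bm) (twoWeight bp bm 0) m β)
        (kernelVec u L fun y v => a₀ * reducedKernel y v) := by
    have h1 : kernelVec u L (thetaK p) = kernelVec u L fun y v => a₀ * thetaK 1 y v := by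
      refine kernelVec_congr u fun y _ v => ?_
      conv_lhs => rw [eq_smul_one hp]
      rw [thetaK, thetaK, polyKernel_smul]
      ring
    have h2 : petersson (twoWeight bp bm 0)
        (poincare q L ((bp : ℤ) - bm) (twoWeight bp bm 0) m β) (kernelVec u L reducedKernel) =
        petersson (twoWeight bp bm 0)
        (poincare q L ((bp : ℤ) - bm) (twoWeight bp bm 0) m β) (kernelVec u L (thetaK 1)) := by
      have h3 := petersson_kernelVec_add u hL hm hmβ hw (kernelHasDeriv_thetaK 1)
        ((KernelHasDeriv.const (c₀ : ℂ)).mul hR')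
      rw [petersson_kernelVec_const_mul u hL, horth, mul_zero, add_zero] at h3
      exact h3
    rw [h1, petersson_kernelVec_const_mul u hL, petersson_kernelVec_const_mul u hL, h2]
  have hmod : IsModular q L ((bp : ℤ) - bm) (twoWeight bp bm 0)
      (kernelVec u L fun y (v : V bp bm) => a₀ * reducedKernel y v) := by
    rw [kernelVec_const_mul]
    refine IsModular.const_smul ?_ a₀
    have h := (isModular_thetaK u hL one_mem_bihomogeneous).add
      ((isModular_raisedKernel u hL).const_smul (c₀ : ℂ))
    rw [← kernelVec_const_mul, ← kernelVec_add u hL (kernelHasDeriv_thetaK 1).1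
      ((ModerateGrowth.const _).mul hR'.1)] at h
    exact h
  have hX := fun x : CosetOfNorm q L β m => sqPlus_pos u hm x
  have hc : ∀ x : CosetOfNorm q L β m, 0 < 2 * Real.pi * sqPlus (u (x.1 : W)) := fun x =>
    mul_pos (by positivity) (hX x)
  -- the integrand over `y` at a lattice vector, in terms of the integrands of Gamma integrals
  have hker : ∀ x : CosetOfNorm q L β m, ∀ y ∈ Set.Ioi (0 : ℝ), a₀ * reducedKernel y (u (x.1 : W)) *
      ((Real.exp (-(2 * Real.pi * sqPlus (u (x.1 : W)) * y)) *
        y ^ (((twoWeight bp bm 0 : ℤ) : ℝ) / 2 - 2) : ℝ) : ℂ) =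
      a₀ * ((c₀ * (-(2 * Real.pi * sqPlus (u (x.1 : W)) * sqMinus (u (x.1 : W))) *
        (Real.exp (-(2 * Real.pi * sqPlus (u (x.1 : W)) * y)) * y ^ ((a + 2) - 1)) +
        (bm / 2 * sqPlus (u (x.1 : W)) + bp / 2 * sqMinus (u (x.1 : W))) *
        (Real.exp (-(2 * Real.pi * sqPlus (u (x.1 : W)) * y)) * y ^ ((a + 1) - 1))) : ℝ) : ℂ) := by
    intro x y hy
    have hy : 0 < y := hy
    have h1 : y ^ ((a + 2) - 1) = y ^ ((bm : ℝ) / 2) *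
        y ^ (((twoWeight bp bm 0 : ℤ) : ℝ) / 2 - 2) * y ^ 2 := by
      rw [← Real.rpow_add hy, ← Real.rpow_two, ← Real.rpow_add hy, haeq, twoWeight]
      congr 1
      push_cast
      ring
    have h2 : y ^ ((a + 1) - 1) = y ^ ((bm : ℝ) / 2) *
        y ^ (((twoWeight bp bm 0 : ℤ) : ℝ) / 2 - 2) * y := by
      nth_rewrite 4 [← Real.rpow_one y]
      rw [← Real.rpow_add hy, ← Real.rpow_add hy, haeq, twoWeight]
      congr 1
      push_cast
      ring
    rw [reducedKernel_eq hbm ha2 hy, mul_assoc, ← Complex.ofReal_mul, h1, h2]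
    congr 2
    ring
  have hG1 := fun x => integral_exp_mul_rpow (a := a + 1) (by positivity) (hc x)
  have hG2 := fun x => integral_exp_mul_rpow (a := a + 2) (by positivity) (hc x)
  have hΓ1 : Real.Gamma (a + 1) = a * Real.Gamma a := Real.Gamma_add_one ha.ne'
  have hΓ2 : Real.Gamma (a + 2) = (a + 1) * (a * Real.Gamma a) := by
    rw [show a + 2 = (a + 1) + 1 by ring, Real.Gamma_add_one (by positivity), hΓ1]
  have hval : ∀ x : CosetOfNorm q L β m,
      conj (∫ y in Set.Ioi (0 : ℝ), a₀ * reducedKernel y (u (x.1 : W)) *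
        ((Real.exp (-(2 * Real.pi * sqPlus (u (x.1 : W)) * y)) *
          y ^ (((twoWeight bp bm 0 : ℤ) : ℝ) / 2 - 2) : ℝ) : ℂ)) =
      ((Real.Gamma a / (2 * Real.pi) ^ a : ℝ) : ℂ) * (conj (evalAt p (u (x.1 : W))) /
        ((sqPlus (u (x.1 : W)) ^ a : ℝ) : ℂ)) := by
    intro x
    rw [setIntegral_congr_fun measurableSet_Ioi (hker x), integral_const_mul,
      integral_complex_ofReal, integral_const_mul,
      integral_add ((hG2 x).1.const_mul _) ((hG1 x).1.const_mul _), integral_const_mul,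
      integral_const_mul, (hG1 x).2, (hG2 x).2, hΓ1, hΓ2, map_mul, Complex.conj_ofReal, hev]
    have h3 : c₀ * (-(2 * Real.pi * sqPlus (u (x.1 : W)) * sqMinus (u (x.1 : W))) *
        ((a + 1) * (a * Real.Gamma a) / (2 * Real.pi * sqPlus (u (x.1 : W))) ^ (a + 2)) +
        (bm / 2 * sqPlus (u (x.1 : W)) + bp / 2 * sqMinus (u (x.1 : W))) *
        (a * Real.Gamma a / (2 * Real.pi * sqPlus (u (x.1 : W))) ^ (a + 1))) =
        Real.Gamma a / (2 * Real.pi) ^ a / sqPlus (u (x.1 : W)) ^ a := by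
      have h4 : 0 < sqPlus (u (x.1 : W)) := hX x
      have h5 : (bp : ℝ) = 2 * (a + 1) := by rw [haeq]; ring
      have h6 : ((bp : ℝ) / 2 - 1) = a := haeq.symm
      rw [Real.rpow_add (hc x), Real.rpow_add (hc x), Real.rpow_one, Real.rpow_two,
        Real.mul_rpow (by positivity) h4.le, hc₀, h6, h5]
      have h7 : (2 * Real.pi) ^ a ≠ 0 := by positivity
      have h8 : sqPlus (u (x.1 : W)) ^ a ≠ 0 := by positivity
      field_simp
      ring
    rw [h3]
    push_cast
    ring
  have h0 : ∀ y, 0 < y → a₀ * reducedKernel y (0 : V bp bm) = 0 := by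
    intro y hy
    have h0 : sqPlus (0 : V bp bm) = 0 := by simp [sqPlus]
    rw [reducedKernel_eq hbm ha2 hy, h0]
    simp [sqMinus]
  have hI : ∀ x : CosetOfNorm q L β m, IntegrableOn (fun y : ℝ => a₀ * reducedKernel y (u (x.1 : W)) *
      ((Real.exp (-(2 * Real.pi * sqPlus (u (x.1 : W)) * y)) *
        y ^ (((twoWeight bp bm 0 : ℤ) : ℝ) / 2 - 2) : ℝ) : ℂ)) (Set.Ioi 0) := by
    intro x
    refine IntegrableOn.congr_fun ?_ (fun y hy => (hker x y hy).symm) measurableSet_Ioi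
    exact ((((hG2 x).1.const_mul _).add ((hG1 x).1.const_mul _)).const_mul _).ofReal.const_mul _
  have hS' : Summable fun x : CosetOfNorm q L β m => ∫ y in Set.Ioi (0 : ℝ),
      ‖a₀ * reducedKernel y (u (x.1 : W)) *
      ((Real.exp (-(2 * Real.pi * sqPlus (u (x.1 : W)) * y)) *
        y ^ (((twoWeight bp bm 0 : ℤ) : ℝ) / 2 - 2) : ℝ) : ℂ)‖ := by
    refine Summable.of_nonneg_of_le (fun x => integral_nonneg fun y => norm_nonneg _) (fun x => ?_)
      (hS.norm.mul_left (c₀ * (2 * Real.pi * (Real.Gamma (a + 2) / (2 * Real.pi) ^ (a + 2)) +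
        (bm / 2 + bp / 2) * (Real.Gamma (a + 1) / (2 * Real.pi) ^ (a + 1)))))
    have hXx := hX x
    have hYX : sqMinus (u (x.1 : W)) ≤ sqPlus (u (x.1 : W)) := by
      linarith [sqPlus_sub_sqMinus u x]
    have hY0 := sqMinus_nonneg (u (x.1 : W))
    have hle : ∀ y ∈ Set.Ioi (0 : ℝ), ‖a₀ * reducedKernel y (u (x.1 : W)) *
      ((Real.exp (-(2 * Real.pi * sqPlus (u (x.1 : W)) * y)) *
        y ^ (((twoWeight bp bm 0 : ℤ) : ℝ) / 2 - 2) : ℝ) : ℂ)‖ ≤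
      ‖a₀‖ * (c₀ * ((2 * Real.pi * sqPlus (u (x.1 : W)) ^ 2) *
        (Real.exp (-(2 * Real.pi * sqPlus (u (x.1 : W)) * y)) * y ^ ((a + 2) - 1)) +
        ((bm / 2 + bp / 2) * sqPlus (u (x.1 : W))) *
        (Real.exp (-(2 * Real.pi * sqPlus (u (x.1 : W)) * y)) * y ^ ((a + 1) - 1)))) := by
      intro y hy
      have hy : 0 < y := hy
      rw [hker x y hy, norm_mul, Complex.norm_real, norm_mul, Real.norm_of_nonneg hc₀pos.le]
      refine mul_le_mul_of_nonneg_left (mul_le_mul_of_nonneg_left ((norm_add_le _ _).trans ?_)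
        hc₀pos.le) (norm_nonneg _)
      rw [norm_mul, norm_mul, norm_neg, Real.norm_of_nonneg (by positivity),
        Real.norm_of_nonneg (by positivity), Real.norm_of_nonneg (by positivity),
        Real.norm_of_nonneg (by positivity)]
      have hb0 : (0 : ℝ) ≤ bp := bp.cast_nonneg
      refine add_le_add (mul_le_mul_of_nonneg_right ?_ (by positivity))
        (mul_le_mul_of_nonneg_right ?_ (by positivity))
      · have := mul_le_mul_of_nonneg_left hYX (show 0 ≤ 2 * Real.pi * sqPlus (u (x.1 : W)) by
          positivity)
        linarith
      · nlinarith
    have hint := ((((hG2 x).1.const_mul (2 * Real.pi * sqPlus (u (x.1 : W)) ^ 2)).add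
      ((hG1 x).1.const_mul ((bm / 2 + bp / 2) * sqPlus (u (x.1 : W))))).const_mul c₀).const_mul ‖a₀‖
    refine (integral_mono_of_nonneg (Filter.Eventually.of_forall fun y => norm_nonneg _) hint
      ((ae_restrict_mem measurableSet_Ioi).mono hle)).trans (le_of_eq ?_)
    simp only [Pi.add_apply]
    rw [integral_const_mul, integral_const_mul,
      integral_add ((hG2 x).1.const_mul _) ((hG1 x).1.const_mul _), integral_const_mul,
      integral_const_mul, (hG1 x).2, (hG2 x).2, hev, norm_div, Complex.norm_conj, Complex.norm_real,
      Real.norm_of_nonneg (by positivity), Real.rpow_add (hc x), Real.rpow_add (hc x),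
      Real.rpow_one, Real.rpow_two, Real.mul_rpow (by positivity) hXx.le,
      Real.rpow_add (by positivity), Real.rpow_add (by positivity), Real.rpow_one, Real.rpow_two]
    have h8 : sqPlus (u (x.1 : W)) ^ a ≠ 0 := by positivity
    field_simp
  rw [hP, petersson_poincare_eq u hL hm hmβ hw hκ h0 hmod hI hS']
  simp only [hval]
  rw [tsum_mul_left]
  push_cast
  ring

end DegreeZero

/-! ### Convergence of the sum over lattice vectors -/

section Convergence

variable {bp bm : ℕ}

/-- A polynomial of degree `k` in the variables of `V⁺` is bounded by a multiple of `‖v⁺‖ ^ k`. -/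
lemma exists_norm_evalAt_le {k : ℕ} {p : Poly bp bm} (hp : p ∈ bihomogeneous bp bm k 0) :
    ∃ C : ℝ, 0 ≤ C ∧ ∀ v : V bp bm, ‖evalAt p v‖ ≤ C * sqPlus v ^ ((k : ℝ) / 2) := by
  rw [mem_bihomogeneous_iff] at hp
  refine ⟨∑ d ∈ p.support, ‖p.coeff d‖, Finset.sum_nonneg fun _ _ => norm_nonneg _, fun v => ?_⟩
  rw [evalAt_eq_sum, Finset.sum_mul]
  refine norm_sum_le_of_le _ fun d hd => ?_
  rw [norm_mul]
  refine mul_le_mul_of_nonneg_left ?_ (norm_nonneg _)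
  obtain ⟨h1, h2⟩ := hp d hd
  have hv : ∀ i : Fin bp, |v (Sum.inl i)| ≤ Real.sqrt (sqPlus v) := fun i =>
    Real.abs_le_sqrt (Finset.single_le_sum (f := fun i : Fin bp => v (Sum.inl i) ^ 2)
      (fun _ _ => sq_nonneg _) (Finset.mem_univ i))
  have h3 : ∀ j : Fin bm, d (Sum.inr j) = 0 := fun j =>
    (Finset.sum_eq_zero_iff.mp h2) j (Finset.mem_univ j)
  rw [Fintype.prod_sum_type]
  simp only [h3, pow_zero, Finset.prod_const_one, mul_one]
  rw [norm_prod]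
  calc ∏ i : Fin bp, ‖(v (Sum.inl i) : ℂ) ^ d (Sum.inl i)‖
      ≤ ∏ i : Fin bp, Real.sqrt (sqPlus v) ^ d (Sum.inl i) := by
        refine Finset.prod_le_prod (fun _ _ => norm_nonneg _) fun i _ => ?_
        rw [norm_pow, Complex.norm_real, Real.norm_eq_abs]
        exact pow_le_pow_left₀ (abs_nonneg _) (hv i) _
    _ = sqPlus v ^ ((k : ℝ) / 2) := by
        rw [Finset.prod_pow_eq_pow_sum, h1, Real.sqrt_eq_rpow, ← Real.rpow_natCast,
          ← Real.rpow_mul (sqPlus_nonneg v)]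
        congr 1
        ring

variable {W : Type*} [AddCommGroup W] [Module ℝ W] {q : QuadraticForm ℝ W} {L : AddSubgroup W}

/-- The theta function of the constant polynomial `1` grows at most like `y ^ (bm / 2)`. -/
lemma exists_norm_theta_one_le (u : q.IsometryEquiv (stdForm bp bm)) (hL : IsEvenLattice q L) :
    ∃ D : ℝ, 0 ≤ D ∧ ∀ (τ : ℍ) (γ : Discr q L), 1 / 2 ≤ τ.im →
      ‖kernelVec u L (thetaK 1) τ γ‖ ≤ D * τ.im ^ ((bm : ℝ) / 2) := by
  obtain ⟨D, hD, h⟩ := ModerateGrowth.exists_bound u hL (κ := fun _ _ => 1) (C := 1) (s := 0)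
    (N := 0) zero_le_one (fun y _ x => by simp)
  refine ⟨D, hD, fun τ γ hτ => ?_⟩
  have h1 : kernelVec u L (thetaK 1) =
      kernelVec u L fun y (_ : V bp bm) => ((y ^ ((bm : ℝ) / 2) : ℝ) : ℂ) * 1 :=
    kernelVec_congr u fun y _ v => by rw [thetaK, polyKernel_one]
  rw [h1, kernelVec_im_mul u fun y => ((y ^ ((bm : ℝ) / 2) : ℝ) : ℂ)]
  beta_reduce
  rw [Pi.smul_apply, smul_eq_mul, norm_mul, Complex.norm_real, Real.norm_of_nonneg (by have := τ.im_pos; positivity), mul_comm]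
  refine mul_le_mul_of_nonneg_right ?_ (by have := τ.im_pos; positivity)
  have h2 := h τ γ (by simpa using hτ)
  rwa [pow_zero, mul_one] at h2

/-- For `k > bm` the function `e(mτ) conj(Θ_β(τ; 1)) y ^ ((k + bp - bm) / 2)`, although its exponent
does not match the weight of `Θ(·; 1)` unless `k = 0`, is absolutely integrable over the strip. -/
lemma integrableOn_strip_unfolded_one (u : q.IsometryEquiv (stdForm bp bm))
    (hL : IsEvenLattice q L) {m : ℝ} (hm : 0 < m) {β : Discr q L}
    (hmβ : e (m : ℂ) = e (q (rep β) : ℝ)) {k : ℕ} (hw : 4 < twoWeight bp bm k) (hk : bm < k) :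
    IntegrableOn (unfolded u L (thetaK 1) m β (((k : ℝ) + bp - bm) / 2)) strip := by
  have := finite_discr u hL
  have := Fintype.ofFinite (Discr q L)
  set t : ℝ := ((k : ℝ) + bp - bm) / 2 with ht
  -- the majorant with `b = 5 / 8` leaves the power `y ^ ((bm - k) / 2 + 5 / 4)`
  set a : ℝ := ((twoWeight bp bm k : ℤ) : ℝ) / 4 - 5 / 8 with ha
  have hw' : (5 : ℝ) ≤ ((twoWeight bp bm k : ℤ) : ℝ) := by exact_mod_cast hw
  have hk' : (bm : ℝ) + 1 ≤ k := by exact_mod_cast hk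
  have hmod := isModular_thetaK u hL (one_mem_bihomogeneous (bp := bp) (bm := bm))
  have hcont := continuous_unfolded u hL (kernelHasDeriv_thetaK 1) m β t
  obtain ⟨K, hK, hKle⟩ := exists_majorant_bound (a := a) (b := 5 / 8) (A := 1 / 2) (m := m)
    (by linarith) (by norm_num) (one_half_pos (α := ℝ)) hm
  obtain ⟨D, hD, hDle⟩ := exists_norm_theta_one_le u hL
  set N : ℝ := (Fintype.card (Discr q L) : ℝ)
  have key := lintegral_fd_tsum_ne_top
    (F := fun τ (c : CuspCosets) => unfolded u L (thetaK 1) m β t ((Quotient.out c).mat • τ))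
    (U := fun c => K * majorant a (5 / 8) (Quotient.out c) * (N * D))
    (fun c => by have := majorant_pos a (5 / 8) (Quotient.out c); positivity)
    (((summable_majorant (by linarith) (by norm_num)).mul_left K).mul_right _)
    (s := t + (bm : ℝ) / 2 - 2 * a)
    (by rw [ht, ha, twoWeight]; push_cast; linarith) fun τ hτ c => ?_
  · rw [lintegral_unfold hcont.measurable.enorm fun τ => by
      rw [hmod.unfolded_T_smul u hL hmβ]] at key
    refine ⟨hcont.aestronglyMeasurable, lt_top_iff_ne_top.mpr fun h => key ?_⟩
    rw [h]
    exact ENNReal.mul_top (by norm_num)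
  · have hy := τ.im_pos
    have h1 := abs_re_le_of_mem_fd hτ
    have h2 := half_le_im_of_mem_fd hτ
    set M := Quotient.out c
    have hφ := M.norm_phi_pos τ
    have h3 : ‖innerL ((weilRep q L ((bp : ℤ) - bm) M)⁻¹ (basisVec β))
        (kernelVec u L (thetaK 1) τ)‖ ≤ N * D * τ.im ^ ((bm : ℝ) / 2) := by
      rw [innerL_eq]
      have h : ∑ _γ : Discr q L, D * τ.im ^ ((bm : ℝ) / 2) = N * D * τ.im ^ ((bm : ℝ) / 2) := by
        rw [Finset.sum_const, nsmul_eq_mul, Finset.card_univ, mul_assoc]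
      rw [← h]
      refine norm_sum_le_of_le _ fun γ _ => ?_
      rw [norm_mul, Complex.norm_conj]
      exact (mul_le_of_le_one_left (norm_nonneg _)
        (norm_weilRep_inv_basisVec_le u hL M β γ)).trans (hDle τ γ h2)
    have h4 : ‖e (m * ((M.mat • τ : ℍ) : ℂ))‖ = Real.exp (-(2 * Real.pi * m * (M.mat • τ).im)) := by
      rw [e, Complex.norm_exp]
      congr 1
      simp [mul_assoc]
    -- the exponent is chosen such that the powers of `|φ|` combine to the weight `w / 2`
    have h5 : ‖M.phi τ‖ ^ twoWeight bp bm 0 * (M.mat • τ).im ^ t =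
        (‖M.phi τ‖ ^ 4) ^ (-(a + 5 / 8)) * τ.im ^ t := by
      have hpow : ‖M.phi τ‖ ^ twoWeight bp bm 0 =
          (‖M.phi τ‖ ^ 4) ^ (((twoWeight bp bm 0 : ℤ) : ℝ) / 4) := by
        rw [← Real.rpow_natCast, ← Real.rpow_mul hφ.le, ← Real.rpow_intCast]
        congr 1
        push_cast
        ring
      rw [M.im_smul_eq, Real.div_rpow hy.le (by positivity), hpow, mul_div_left_comm,
        ← Real.rpow_sub (by positivity), mul_comm]
      congr 2
      rw [ht, ha, twoWeight, twoWeight]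
      push_cast
      ring
    have h6 := hKle M τ h1 h2
    rw [hmod.unfolded_smul u hL, norm_mul, norm_mul, norm_mul, norm_zpow, Complex.norm_conj,
      Complex.norm_real, Real.norm_of_nonneg (Real.rpow_nonneg (M.mat • τ).im_pos.le _), h4]
    calc Real.exp (-(2 * Real.pi * m * (M.mat • τ).im)) * (‖M.phi τ‖ ^ twoWeight bp bm 0 *
          ‖innerL ((weilRep q L ((bp : ℤ) - bm) M)⁻¹ (basisVec β)) (kernelVec u L (thetaK 1) τ)‖) *
          (M.mat • τ).im ^ t
        = ((‖M.phi τ‖ ^ twoWeight bp bm 0 * (M.mat • τ).im ^ t) *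
          Real.exp (-(2 * Real.pi * m * (M.mat • τ).im))) *
          ‖innerL ((weilRep q L ((bp : ℤ) - bm) M)⁻¹ (basisVec β))
            (kernelVec u L (thetaK 1) τ)‖ := by ring
      _ ≤ (K * majorant a (5 / 8) M * τ.im ^ (-(2 * a)) * τ.im ^ t) *
          (N * D * τ.im ^ ((bm : ℝ) / 2)) := by
        rw [h5]
        refine mul_le_mul ?_ h3 (norm_nonneg _) ?_
        · have := mul_le_mul_of_nonneg_right h6 (Real.rpow_nonneg hy.le t)
          linarith
        · have := majorant_pos a (5 / 8) M
          positivity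
      _ = _ := by
        rw [show t + (bm : ℝ) / 2 - 2 * a = -(2 * a) + t + (bm : ℝ) / 2 by ring,
          Real.rpow_add hy, Real.rpow_add hy]
        ring

/-- For `k > bm` the sum of `‖v⁺‖ ^ (-(k + bp - 2))` over the lattice vectors of norm `m`
converges: its terms are Gamma integrals, and their sum is the integral over the strip of a function
which is integrable by unfolding backwards. -/
lemma summable_sqPlus_rpow (u : q.IsometryEquiv (stdForm bp bm)) (hL : IsEvenLattice q L)
    {m : ℝ} (hm : 0 < m) {β : Discr q L} (hmβ : e (m : ℂ) = e (q (rep β) : ℝ)) {k : ℕ}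
    (hw : 4 < twoWeight bp bm k) (hk : bm < k) (hpos : 0 < ((k : ℝ) + bp) / 2 - 1) :
    Summable fun x : CosetOfNorm q L β m =>
      1 / sqPlus (u (x.1 : W)) ^ (((k : ℝ) + bp) / 2 - 1) := by
  have hX := fun x : CosetOfNorm q L β m => sqPlus_pos u hm x
  set c : ℝ := ((k : ℝ) + bp) / 2 - 1 with hc
  have hint := (integral_strip_unfolded u hL (kernelHasDeriv_thetaK 1) hmβ
    (integrableOn_strip_unfolded_one u hL hm hmβ hw hk)).1
  set F : CosetOfNorm q L β m → ℝ → ℝ := fun x y =>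
    Real.exp (-(2 * Real.pi * sqPlus (u (x.1 : W)) * y)) * y ^ (c - 1) with hF
  -- only the vectors of norm `m` contribute to the integral over a horizontal segment
  have hterm : ∀ y ∈ Set.Ioi (0 : ℝ), (∑' x : CosetOfNorm q L β m,
      conj (thetaK 1 y (u (x.1 : W))) * ((Real.exp (-(2 * Real.pi * sqPlus (u (x.1 : W)) * y)) *
        y ^ (((k : ℝ) + bp - bm) / 2 - 2) : ℝ) : ℂ)) = ((∑' x, F x y : ℝ) : ℂ) := by
    intro y hy
    have hy : 0 < y := hy
    rw [Complex.ofReal_tsum]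
    refine tsum_congr fun x => ?_
    rw [thetaK, polyKernel_one, mul_one, Complex.conj_ofReal, ← Complex.ofReal_mul]
    congr 1
    rw [hF, mul_left_comm, ← Real.rpow_add hy]
    congr 2
    rw [hc]
    ring
  have hint' : IntegrableOn (fun y => ∑' x, F x y) (Set.Ioi 0) := by
    have h := (hint.congr_fun hterm measurableSet_Ioi).re
    simp only [RCLike.re_to_complex, Complex.ofReal_re] at h
    exact h
  have hsum : ∀ y ∈ Set.Ioi (0 : ℝ), Summable fun x => F x y := by
    intro y hy
    have h := (((ModerateGrowth.const (bp := bp) (bm := bm) 1).summable u hL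
      (z := ⟨0, y⟩) hy).norm.comp_injective (Subtype.val_injective :
        Function.Injective fun x : CosetOfNorm q L β m => x.1)).mul_left
        (Real.exp (-(2 * Real.pi * m * y)) * y ^ (c - 1))
    refine h.congr fun x => ?_
    have h1 := sqPlus_sub_sqMinus u x
    simp only [Function.comp_apply, one_mul, norm_gaussV]
    rw [mul_right_comm, ← Real.exp_add, hF]
    congr 2
    linear_combination (Real.pi * y) * h1
  have hG := fun x : CosetOfNorm q L β m =>
    integral_exp_mul_rpow (a := c) hpos (mul_pos Real.two_pi_pos (hX x))
  have hF0 : ∀ y ∈ Set.Ioi (0 : ℝ), ∀ x, 0 ≤ F x y := fun y hy x =>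
    mul_nonneg (Real.exp_pos _).le (Real.rpow_nonneg (le_of_lt hy) _)
  have hsumG : Summable fun x : CosetOfNorm q L β m =>
      Real.Gamma c / (2 * Real.pi * sqPlus (u (x.1 : W))) ^ c := by
    refine summable_of_sum_le (c := ∫ y in Set.Ioi (0 : ℝ), ∑' x, F x y)
      (fun x => div_nonneg (Real.Gamma_pos_of_pos hpos).le (Real.rpow_nonneg
        (mul_pos Real.two_pi_pos (hX x)).le _)) fun s => ?_
    calc ∑ x ∈ s, Real.Gamma c / (2 * Real.pi * sqPlus (u (x.1 : W))) ^ c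
        = ∫ y in Set.Ioi (0 : ℝ), ∑ x ∈ s, F x y := by
          rw [integral_finsetSum _ fun x _ => (hG x).1]
          exact Finset.sum_congr rfl fun x _ => (hG x).2.symm
      _ ≤ ∫ y in Set.Ioi (0 : ℝ), ∑' x, F x y :=
          setIntegral_mono_on (integrable_finsetSum _ fun x _ => (hG x).1) hint' measurableSet_Ioi
            fun y hy => (hsum y hy).sum_le_tsum _ fun x _ => hF0 y hy x
  refine (hsumG.mul_left ((2 * Real.pi) ^ c / Real.Gamma c)).congr fun x => ?_
  have h1 := (Real.Gamma_pos_of_pos hpos).ne'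
  have h2 : (2 * Real.pi) ^ c ≠ 0 := by positivity
  rw [Real.mul_rpow Real.two_pi_pos.le (hX x).le]
  field_simp

lemma summable_liftTerm (v₀ : q.IsometryEquiv (stdForm bp bm)) (g : q.IsometryEquiv q)
    (hL : IsEvenLattice q L) {m : ℝ} (hm : 0 < m) {β : Discr q L}
    (hmβ : e (m : ℂ) = e (q (rep β) : ℝ)) {k : ℕ} (hw : 4 < twoWeight bp bm k) (hk : bm < k)
    (hpos : 0 < ((k : ℝ) + bp) / 2 - 1) {p : Poly bp bm} (hp : p ∈ bihomogeneous bp bm k 0) :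
    Summable fun x : CosetOfNorm q L β m => liftTerm k q v₀ p g (x.1 : W) := by
  obtain ⟨C, hC, hle⟩ := exists_norm_evalAt_le hp
  set u := g.symm.trans v₀
  refine Summable.of_norm_bounded
    ((summable_sqPlus_rpow u hL hm hmβ hw hk hpos).mul_left C) fun x => ?_
  have hX := sqPlus_pos u hm x
  rw [liftTerm_eq k v₀ hp, norm_div, Complex.norm_conj, Complex.norm_real,
    Real.norm_of_nonneg (by positivity), div_le_iff₀ (by positivity)]
  refine (hle _).trans (le_of_eq ?_)
  rw [mul_assoc, one_div, ← Real.rpow_neg hX.le, ← Real.rpow_add hX, liftExp]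
  congr 2
  ring

end Convergence

end ThetaLift

end

open ThetaLift

theorem theorem4 {bp bm : ℕ} (hb : 1 < bp * bm)
    {W : Type*} [AddCommGroup W] [Module ℝ W] (q : QuadraticForm ℝ W)
    (v₀ : q.IsometryEquiv (ThetaLift.stdForm bp bm))
    (L : AddSubgroup W) (hL : ThetaLift.IsEvenLattice q L)
    (k : ℕ) (hν : (2 : ℝ) < k + ((bp : ℝ) - bm) / 2)
    (β : ThetaLift.Discr q L) (m : ℝ) (hm : 0 < m)
    (hmβ : ∃ x : ThetaLift.dual q L, (QuotientAddGroup.mk x : ThetaLift.Discr q L) = β ∧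
      ∃ n : ℤ, m = q (x : W) + n)
    (p : ThetaLift.Poly bp bm) (hp : p ∈ ThetaLift.bihomogeneous bp bm k 0)
    (g : q.IsometryEquiv q) :
    let sig : ℤ := (bp : ℤ) - bm
    let w : ℤ := ThetaLift.twoWeight bp bm k
    let P : ℍ → ThetaLift.GroupRing q L := ThetaLift.poincare q L sig w m β
    let Hp : ThetaLift.Poly bp bm := ThetaLift.harmonicProj k p
    let a : ThetaLift.CosetOfNorm q L β m → ℂ :=
      fun x => ThetaLift.liftTerm k q v₀ Hp g (x.1 : W)
    -- the Poincaré series and the integral defining the lift converge absolutely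
    (∀ τ : ℍ, Summable (ThetaLift.poincareTerm q L sig w m β τ)) ∧
    IntegrableOn (ThetaLift.peterssonIntegrand w P (ThetaLift.theta q v₀ L g p)) 𝒟 ∧
    -- the sum on the right converges absolutely for `k > bm`
    (bm < k → Summable a) ∧
    -- whenever the sum converges absolutely, the lift is given by the formula
    (Summable a → ThetaLift.thetaLift k q v₀ L P p g =
      ((2 * Real.Gamma (k + (bp : ℝ) / 2 - 1) /
        (2 * Real.pi) ^ ((k : ℝ) + (bp : ℝ) / 2 - 1) : ℝ) : ℂ) * ∑' x, a x) ∧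
    -- the lift depends on the harmonic projection only
    ThetaLift.thetaLift k q v₀ L P p g = ThetaLift.thetaLift k q v₀ L P Hp g := by
  intro sig w P Hp a
  set u := g.symm.trans v₀
  obtain ⟨hbp, hbm⟩ : 0 < bp ∧ 0 < bm := by
    constructor <;> exact Nat.pos_of_ne_zero fun h => by simp [h] at hb
  have hw : 4 < twoWeight bp bm k := by
    have h : (4 : ℝ) < ((twoWeight bp bm k : ℤ) : ℝ) := by
      rw [twoWeight]; push_cast; linarith
    exact_mod_cast h
  have hbp' : (1 : ℝ) ≤ bp := by exact_mod_cast hbp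
  have hbm' : (1 : ℝ) ≤ bm := by exact_mod_cast hbm
  have hexp : 0 < (bp : ℝ) / 2 + k - 1 := by linarith
  have hm' := e_m_eq hL hmβ
  have hθ : ∀ r : Poly bp bm, theta q v₀ L g r = kernelVec u L (thetaK r) := fun r => by
    rw [← thetaVec_eq_kernelVec]
    funext τ
    exact theta_eq v₀ g r τ
  have hHp : Hp ∈ bihomogeneous bp bm k 0 := harmonicProj_mem hp
  have hproj := petersson_harmonicProj u hL hm hm' hw hexp hp
  refine ⟨summable_poincareTerm u hL hm β hw, ?_, fun hk => ?_, fun hS => ?_, ?_⟩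
  · rw [hθ]
    exact (integrableOn_peterssonIntegrand u hL hm hm' hw (kernelHasDeriv_thetaK p)).2
  · have hk' : (1 : ℝ) ≤ k := by exact_mod_cast (Nat.zero_le bm).trans_lt hk
    exact summable_liftTerm v₀ g hL hm hm' hw hk (by linarith) hHp
  · have ha : a = fun x : CosetOfNorm q L β m => conj (evalAt Hp (u (x.1 : W))) /
        ((sqPlus (u (x.1 : W)) ^ liftExp bp k : ℝ) : ℂ) :=
      funext fun x => liftTerm_eq k v₀ hHp g (x.1 : W)
    have hexp' : (k : ℝ) + (bp : ℝ) / 2 - 1 = liftExp bp k := rfl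
    have hpos : 0 < liftExp bp k := by rw [← hexp']; linarith
    have hharm : laplacian Hp = 0 := by
      rw [laplacian_eq_laplacianPlus hHp]
      exact laplacianPlus_harmonicProj hbp hp
    rw [thetaLift, hθ, hproj, hexp', ha]
    rw [ha] at hS
    rcases Nat.eq_zero_or_pos k with rfl | hk
    · exact petersson_of_degree_zero u hL hm hm' hw hbm hHp hpos hS
    · exact petersson_of_harmonic u hL hm hm' hk hw hHp hharm hpos hS
  · rw [thetaLift, thetaLift, hθ, hθ]
    exact hproj
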